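/- **Setting.** Let $\mathfrak h$ be a $d$-dimensional complex vector space with a nondegenerate symmetric bilinear form $\langle\cdot,\cdot\rangle$ and an orthonormal basis $\alpha^{(1)},\dots,\alpha^{(d)}$. Let $\mathfrak h=\mathfrak a^-\oplus\mathfrak a^+\oplus\mathfrak e$ be a polarization: $\mathfrak a^\pm$ are isotropic of dimension $\lfloor d/2\rfloor$, and $\mathfrak e\perp\mathfrak a^\pm$ has dimension $0$ ($d$ even) or $1$ ($d$ odd). All modes $\alpha(n)=\alpha\otimes t^n$ below are linear in $\alpha\in\mathfrak h$. *Free fields.* $V_{bos}=S(\mathfrak h\otimes t^{-1}\mathbb C[t^{-1}])$ carries $\alpha(n)$, $n\in\mathbb Z$, with $[\alpha(m),\beta(n)]=m\langle\alpha,\beta\rangle\delta_{m+n,0}$, where $\alpha(n)$ is multiplication for $n<0$, a derivation for $n>0$, and $\alpha(0)=0$. $V_{fer}=\bigwedge(\mathfrak h\otimes t^{-1/2}\mathbb C[t^{-1}])$ carries $\alpha(n)$, $n\in\mathbb Z+\frac12$, with $\alpha(m)\beta(n)+\beta(n)\alpha(m)=\langle\alpha,\beta\rangle\delta_{m+n,0}$,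 where $\alpha(n)$ is multiplication for $n<0$ and an odd derivation for $n>0$. The vertex operators $Y(\cdot,x)$ are the normal ordered products of the fields $\alpha(x)=\sum_{n\in\mathbb Z}\alpha(n)x^{-n-1}$ (bosons), $\alpha(x)=\sum_{n\in\mathbb Z+1/2}\alpha(n)x^{-n-1/2}$ (fermions) and their divided derivatives, $\omega_{bos}=\frac12\sum_j\alpha^{(j)}(-1)^2\mathbf 1$ and $\omega_{fer}=\frac12\sum_j\alpha^{(j)}(-\frac32)\alpha^{(j)}(-\frac12)\mathbf 1$. Let $V=V_{bos}\otimes V_{fer}$. On $V\otimes V$ put $$\tau^{(1)}=\tau\otimes\mathbf 1+\mathbf 1\otimes\tau,\quad \tau=\sum_j\alpha^{(j)}(-1)\alpha^{(j)}(-\tfrac12)\mathbf 1,$$ $$\tau^{(2)}=\sum_j\bigl(\alpha^{(j)}(-1)\mathbf 1\otimes\alpha^{(j)}(-\tfrac12)\mathbf 1-\alpha^{(j)}(-\tfrac12)\mathbf 1\otimes\alpha^{(j)}(-1)\mathbf 1\bigr),\quad \mu=i\sum_j\alpha^{(j)}(-\tfrac12)\mathbf 1\otimes\alpha^{(j)}(-\tfrac12)\mathbf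 1.$$ *The map $\kappa$.* On $V_{bos}$, $\kappa$ is the algebra automorphism of the symmetric algebra that is $-1$ on the generators $\alpha(-n)$. On $V\otimes V=V\otimes(V_{bos}\otimes V_{fer})$, $\kappa$ is the identity on the first factor $V$, the map $\kappa$ on the second $V_{bos}$, and the parity map $\sigma$ on the second $V_{fer}$. *The spaces $M_\kappa$ and $M_\sigma$.* $M_\kappa=S(\mathfrak h\otimes t^{-1/2}\mathbb C[t^{-1}])$ carries $\overline{\alpha(n)}$, $n\in\mathbb Z+\frac12$, with $[\overline{\alpha(m)},\overline{\beta(n)}]=m\langle\alpha,\beta\rangle\delta_{m+n,0}$ (multiplication for $n<0$, derivation for $n>0$); put $\alpha(x)^\kappa=\sum_{n\in\mathbb Z+1/2}\overline{\alpha(n)}x^{-n-1}$. $M_\sigma$ is the Clifford algebra of $\mathfrak h\otimes t^{-1}\mathbb C[t^{-1}]\oplus\mathfrak a^+\oplus\mathfrak e$ with relations $xy+yx=\langle x,y\rangle$, where the form vanishes except that it is $\langle\cdot,\cdot\rangle$ on the zero modes $\mathfrak a^+\oplus\mathfrak e$ (an exterior algebra for $d$ even); it carries $\overline{\alpha(n)}$,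 $n\in\mathbb Z$, with $\overline{\alpha(m)}\,\overline{\beta(n)}+\overline{\beta(n)}\,\overline{\alpha(m)}=\langle\alpha,\beta\rangle\delta_{m+n,0}$, where the creation modes act by left multiplication and $\overline{\alpha(n)}$ ($n>0$) and $\overline{\alpha(0)}$ ($\alpha\in\mathfrak a^-$) act by odd derivations, so annihilate $1$; put $\alpha(x)^\sigma=\sum_{n\in\mathbb Z}\overline{\alpha(n)}x^{-n-1/2}$. *Twisted vertex operators.* $Y^\kappa:V_{bos}\to(\mathrm{End}\,M_\kappa)[[x^{\pm1/2}]]$ and $Y^\sigma:V_{fer}\to(\mathrm{End}\,M_\sigma)[[x^{\pm1/2}]]$ are linear with $Y^\kappa(\mathbf 1,x)=1$, $Y^\sigma(\mathbf 1,x)=1$ and have values truncated below on each vector. For $n\ge1$ and all $u$ (of homogeneous sign in the case of $Y^\sigma$), with $g=\kappa,\sigma$ and $\epsilon=0,1$ respectively, $$Y^g(\alpha_{-n}u,x)=\mathrm{Res}_{x_1}\mathrm{Res}_{x_0}\Bigl(\tfrac{x_1-x_0}{x}\Bigr)^{1/2}x_0^{-n}\Bigl(x_0^{-1}\delta\bigl(\tfrac{x_1-x}{x_0}\bigr)\alpha(x_1)^gY^g(u,x)-(-1)^{\epsilon|u|}x_0^{-1}\delta\bigl(\tfrac{x-x_1}{-x_0}\bigr)Y^g(u,x)\alpha(x_1)^g\Bigr),$$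 where $\alpha_{-n}=\alpha(-n)$ on $V_{bos}$ and $\alpha_{-n}=\alpha(-n+\frac12)$ on $V_{fer}$. On $V\otimes M_\kappa\otimes M_\sigma$ put $Y^\kappa(u\otimes v\otimes w,x)=Y(u,x)\otimes Y^\kappa(v,x)\otimes Y^\sigma(w,x)$ for $u\in V$, $v\in V_{bos}$, $w\in V_{fer}$, with the usual sign: on $a\otimes m\otimes m'$ this is $(-1)^{|w||a|}Y(u,x)a\otimes Y^\kappa(v,x)m\otimes Y^\sigma(w,x)m'$. *Notions.* For an automorphism $g$ of a vertex operator superalgebra (VOSA) with $g^2=1$, a weak $g$-twisted module $M$ has operators $Y^g(v,x)=\sum_{n\in\frac12\mathbb Z}v^g_nx^{-n-1}$, truncated below on each vector, with $n\in\mathbb Z+\frac j2$ when $gv=(-1)^jv$, with $Y^g(\mathbf 1,x)=1$, and satisfying the twisted Jacobi identity. It is ordinary if $M=\coprod_{\lambda\in\mathbb C}M_\lambda$ with $L^g(0)=\omega^g_1$ acting as $\lambda$ on $M_\lambda$, $\dim M_\lambda<\infty$, and, for each $\lambda$, $M_{\lambda+n/2}=0$ for all sufficiently negative integers $n$. If the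 VOSA has central charge $c$, the $q$-dimension is $\dim_qM=q^{-c/24}\sum_\lambda(\dim M_\lambda)q^\lambda$. **Theorem.** 1. The map $Y$ on $V_{bos}$ and on $V_{fer}$, the map $Y^\kappa$ and the map $Y^\sigma$ are well defined: each is the unique linear map satisfying its recursion (for $Y$, that of the normal ordered product). 2. $(V_{bos},Y,\mathbf 1,\omega_{bos})$ is a VOSA of central charge $d$, $\kappa$ is an automorphism of it with $\kappa^2=1$, and $(M_\kappa,Y^\kappa)$ is an ordinary $\kappa$-twisted $V_{bos}$-module, with $\dim_qM_\kappa=\bigl(\eta(q)/\eta(q^{1/2})\bigr)^d$. 3. $V\otimes V$ is an N=2 VOSA of central charge $3d$ with the elements $\tau^{(1)},\tau^{(2)},\mu$; $\kappa$ is an automorphism of it with $\kappa^2=1$, $\kappa(\mu)=-\mu$, $\kappa(\tau^{(1)})=\tau^{(1)}$ and $\kappa(\tau^{(2)})=-\tau^{(2)}$; and $V\otimes M_\kappa\otimes M_\sigma$ is an ordinary $\kappa$-twisted $V\otimes V$-module, with $$\dim_q(V\otimes M_\kappa\otimes M_\sigma)=C_d\,\sqrt2^{\,d}\left(\frac{\eta(q)}{\eta(q^{1/2})^2}\right)^d,\qquad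 C_d=\begin{cases}1&d\text{ even},\\ \sqrt2&d\text{ odd}.\end{cases}$$ Here $\eta(q)=q^{1/24}\prod_{n\ge1}(1-q^n)$, and the $q$-dimensions are convergent series for $q=e^{2\pi iz}$ with $z$ in the upper half plane, $q^\lambda=e^{2\pi i\lambda z}$. -/

import Mathlib

open scoped TensorProduct

noncomputable section

/-!
Vertex operators on `M` in the formal variable `x^{1/k}` are elements of Mathlib's
`VertexOperator ℂ M`: linear maps from `M` to Laurent series in `x^{1/k}` with coefficients in `M`,
so that the lower truncation condition is built in.
-/

section Modes

variable {M : Type*} [AddCommGroup M] [Module ℂ M]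

/-- For `A(x) = ∑_{n ∈ (1/k)ℤ} A_n x^{-n-1}` in the variable `x^{1/k}`, this is the mode
`A_{N/k}`, the coefficient of `x^{-N/k-1}`. -/
def vmode (k : ℕ) (A : VertexOperator ℂ M) (N : ℤ) : Module.End ℂ M :=
  HVertexOperator.coeff A (-N - k)

/-- Let `A`, `B` be the families of modes of `A(x)` and `B(x)`, indexed so that `A N` is the mode
`A_{N/k}`.  This is the coefficient of `x₀^{-l-1} x₁^{-m/k-1} x₂^{-n/k-1}` in
`x₀⁻¹ δ((x₁-x₂)/x₀) A(x₁) B(x₂) w - ε x₀⁻¹ δ((x₂-x₁)/(-x₀)) B(x₂) A(x₁) w`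
(binomials being expanded in nonnegative powers of their second variable). -/
def jacobiLHS (k : ℕ) (ε : ℂ) (A B : ℤ → Module.End ℂ M) (l m n : ℤ) (w : M) : M :=
  ∑ᶠ i : ℕ, ((-1) ^ i * (Ring.choose l i : ℂ)) •
    (A (m + k * (l - i)) (B (n + k * i) w) -
      (ε * (-1) ^ l) • B (n + k * (l - i)) (A (m + k * i) w))

/-- The multiplicity space of the value `lam` for an operator `L`. -/
abbrev wtSpace (L : Module.End ℂ M) (lam : ℂ) : Submodule ℂ M := Module.End.eigenspace L lam

end Modes

/-! ### Vertex operator superalgebras and twisted modules -/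

/-- The data `(V, Y, 1, ω)` of a vertex operator superalgebra; the `ℤ/2`-grading by sign is
recorded by the parity map `v ↦ (-1)^{|v|} v`.  The axioms are in `VertexData.IsVOSA`. -/
structure VertexData (V : Type*) [AddCommGroup V] [Module ℂ V] where
  parity : Module.End ℂ V
  Y : V →ₗ[ℂ] VertexOperator ℂ V
  vac : V
  omega : V

namespace VertexData

variable {V : Type*} [AddCommGroup V] [Module ℂ V] (D : VertexData V)

/-- The mode `v_n`. -/
def md (v : V) (n : ℤ) : Module.End ℂ V := vmode 1 (D.Y v) n

/-- `L(n) = ω_{n+1}`. -/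
def L (n : ℤ) : Module.End ℂ V := D.md D.omega (n + 1)

/-- `v` is homogeneous of sign `a` (mod 2). -/
def HasSign (a : ℕ) (v : V) : Prop := D.parity v = (-1 : ℂ) ^ a • v

/-- The axioms of a vertex operator superalgebra of central charge `c`.  The condition
`u_n v = 0` for `n` sufficiently large is part of the type of `Y`. -/
structure IsVOSA (c : ℂ) : Prop where
  /-- `V` is the direct sum of its even and odd parts -/
  parity_parity : ∀ v, D.parity (D.parity v) = v
  parity_vac : D.parity D.vac = D.vac
  parity_omega : D.parity D.omega = D.omega
  parity_md : ∀ u v n, D.parity (D.md u n v) = D.md (D.parity u) n (D.parity v)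
  /-- `V = ∐_{n ∈ ½ℤ} V_n`, where `L(0)` acts on `V_n` as `n` -/
  grading : DirectSum.IsInternal (fun n : ℤ => wtSpace (D.L 0) ((n : ℂ) / 2))
  finite_dim : ∀ n : ℤ, FiniteDimensional ℂ (wtSpace (D.L 0) ((n : ℂ) / 2))
  lower_bound : ∃ N : ℤ, ∀ n < N, wtSpace (D.L 0) ((n : ℂ) / 2) = ⊥
  vac_mem : D.vac ∈ wtSpace (D.L 0) 0
  omega_mem : D.omega ∈ wtSpace (D.L 0) 2
  /-- `Y(1, x) = 1` -/
  md_vac : ∀ n : ℤ, D.md D.vac n = if n = -1 then 1 else 0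
  /-- `Y(v, x)1 ∈ V[[x]]` with constant term `v` -/
  creation : ∀ v, ∀ n : ℤ, 0 ≤ n → D.md v n D.vac = 0
  creation_neg_one : ∀ v, D.md v (-1) D.vac = v
  /-- the Jacobi identity -/
  jacobi : ∀ (a b : ℕ) (u v : V), D.HasSign a u → D.HasSign b v → ∀ (l m n : ℤ) (w : V),
    jacobiLHS 1 ((-1) ^ (a * b)) (D.md u) (D.md v) l m n w =
      ∑ᶠ i : ℕ, (Ring.choose m i : ℂ) • D.md (D.md u (l + i) v) (m + n - i) w
  /-- the Virasoro relations -/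
  virasoro : ∀ m n : ℤ, D.L m * D.L n - D.L n * D.L m =
    ((m : ℂ) - n) • D.L (m + n) +
      (if m + n = 0 then ((m : ℂ) ^ 3 - m) / 12 * c else 0) • (1 : Module.End ℂ V)
  /-- the `L(-1)`-derivative property -/
  derivative : ∀ v, ∀ n : ℤ, D.md (D.L (-1) v) n = (-n : ℂ) • D.md v (n - 1)

/-- `g` is an automorphism of the vertex operator superalgebra. -/
structure IsAutomorphism (g : Module.End ℂ V) : Prop where
  bijective : Function.Bijective g
  map_vac : g D.vac = D.vac
  map_omega : g D.omega = D.omega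
  map_parity : ∀ v, g (D.parity v) = D.parity (g v)
  map_md : ∀ u v n, g (D.md u n v) = D.md (g u) n (g v)

/-- `(V, Y, 1, ω)` is a VOSA of central charge `c`, and the modes
`τ⁽ʲ⁾_{n+1} = G⁽ʲ⁾(n+1/2)`, `L(n)` and `J(n) = μ_n` satisfy the relations of the N=2
Neveu-Schwarz algebra. -/
structure IsN2VOSA (c : ℂ) (τ : Fin 2 → V) (μ : V) : Prop extends D.IsVOSA c where
  tau_mem : ∀ j, τ j ∈ wtSpace (D.L 0) (3 / 2)
  tau_odd : ∀ j, D.HasSign 1 (τ j)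
  /-- `½ G⁽ʲ⁾(-1/2) τ⁽ʲ⁾ = ω` -/
  omega_eq : ∀ j, (1 / 2 : ℂ) • D.md (τ j) 0 (τ j) = D.omega
  /-- `μ = (i/2) G⁽¹⁾(1/2) τ⁽²⁾` -/
  mu_eq : μ = (Complex.I / 2) • D.md (τ 0) 1 (τ 1)
  L_G : ∀ j, ∀ m n : ℤ, D.L m * D.md (τ j) (n + 1) - D.md (τ j) (n + 1) * D.L m =
    ((m : ℂ) / 2 - (n + 1 / 2)) • D.md (τ j) (m + n + 1)
  G_G : ∀ j, ∀ m n : ℤ,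
    D.md (τ j) (m + 1) * D.md (τ j) (n + 1) + D.md (τ j) (n + 1) * D.md (τ j) (m + 1) =
      (2 : ℂ) • D.L (m + n + 1) +
        (if m + n + 1 = 0 then (((m : ℂ) + 1 / 2) ^ 2 - 1 / 4) / 3 * c else 0) •
          (1 : Module.End ℂ V)
  L_J : ∀ m n : ℤ, D.L m * D.md μ n - D.md μ n * D.L m = (-n : ℂ) • D.md μ (m + n)
  J_J : ∀ m n : ℤ, D.md μ m * D.md μ n - D.md μ n * D.md μ m =
    (if m + n = 0 then (m : ℂ) / 3 * c else 0) • (1 : Module.End ℂ V)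
  J_G1 : ∀ m n : ℤ, D.md μ m * D.md (τ 0) (n + 1) - D.md (τ 0) (n + 1) * D.md μ m =
    (-Complex.I) • D.md (τ 1) (m + n + 1)
  J_G2 : ∀ m n : ℤ, D.md μ m * D.md (τ 1) (n + 1) - D.md (τ 1) (n + 1) * D.md μ m =
    Complex.I • D.md (τ 0) (m + n + 1)
  G1_G2 : ∀ m n : ℤ,
    D.md (τ 0) (m + 1) * D.md (τ 1) (n + 1) + D.md (τ 1) (n + 1) * D.md (τ 0) (m + 1) =
      (-Complex.I * ((m : ℂ) - n)) • D.md μ (m + n + 1)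

variable {M : Type*} [AddCommGroup M] [Module ℂ M]

/-- `(M, Yg)` is a weak `g`-twisted module, where `g` has period `k`, `η` is a primitive `k`-th
root of unity and `Yg(v, x) = ∑_{n ∈ (1/k)ℤ} v^g_n x^{-n-1}`.  The condition `v^g_n w = 0` for `n`
sufficiently large is part of the type of `Yg`. -/
structure IsWeakTwistedModule (g : Module.End ℂ V) (k : ℕ) (η : ℂ)
    (Yg : V →ₗ[ℂ] VertexOperator ℂ M) : Prop where
  /-- only modes in `ℤ + j/k` occur in `Yg(v, x)` if `g v = η ^ j v` -/
  support : ∀ (j : ℕ) (v : V), g v = η ^ j • v → ∀ N : ℤ, ¬ N ≡ j [ZMOD k] →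
    vmode k (Yg v) N = 0
  /-- `Yg(1, x) = 1` -/
  vac : ∀ N : ℤ, vmode k (Yg D.vac) N = if N = -k then 1 else 0
  /-- the twisted Jacobi identity: the coefficient of `x₀^{-l-1} x₁^{-m/k-1} x₂^{-n/k-1}`, the
  right-hand side being
  `x₂⁻¹ (1/k) ∑_{r mod k} δ(η^r (x₁-x₀)^{1/k} / x₂^{1/k}) Yg(Y(g^r u, x₀)v, x₂) w` -/
  jacobi : ∀ (a b : ℕ) (u v : V), D.HasSign a u → D.HasSign b v → ∀ (l m n : ℤ) (w : M),
    jacobiLHS k ((-1) ^ (a * b)) (vmode k (Yg u)) (vmode k (Yg v)) l m n w =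
      (1 / k : ℂ) • ∑ r ∈ Finset.range k, (η ^ (-(r * m) : ℤ)) • ∑ᶠ i : ℕ,
        (Ring.choose ((m : ℂ) / k) i) •
          vmode k (Yg (D.md ((g ^ r) u) (l + i) v)) (m + n - k * i) w

/-- `L^g(0) = ω^g_1`. -/
def twistedL0 (k : ℕ) (Yg : V →ₗ[ℂ] VertexOperator ℂ M) : Module.End ℂ M :=
  vmode k (Yg D.omega) k

/-- `(M, Yg)` is an ordinary `g`-twisted module. -/
structure IsOrdinaryTwistedModule (g : Module.End ℂ V) (k : ℕ) (η : ℂ)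
    (Yg : V →ₗ[ℂ] VertexOperator ℂ M) : Prop extends D.IsWeakTwistedModule g k η Yg where
  /-- `M = ∐_{λ ∈ ℂ} M_λ`, where `L^g(0)` acts on `M_λ` as `λ` -/
  grading : DirectSum.IsInternal (fun lam : ℂ => wtSpace (D.twistedL0 k Yg) lam)
  finite_dim : ∀ lam : ℂ, FiniteDimensional ℂ (wtSpace (D.twistedL0 k Yg) lam)
  lower_bound : ∀ lam : ℂ, ∃ N : ℤ, ∀ n < N, wtSpace (D.twistedL0 k Yg) ((n : ℂ) / k + lam) = ⊥

/-- The graded dimension `q^{-c/24} ∑_{λ ∈ ℂ} (dim M_λ) q^λ` with `q = e^{2πiz}` converges for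
every `z` in the upper half plane, and its sum there is `F z`. -/
def HasQDim (c : ℂ) (k : ℕ) (Yg : V →ₗ[ℂ] VertexOperator ℂ M) (F : ℂ → ℂ) : Prop :=
  ∀ z : ℂ, 0 < z.im → HasSum
    (fun lam : ℂ => (Module.finrank ℂ (wtSpace (D.twistedL0 k Yg) lam) : ℂ) *
      Complex.exp (2 * Real.pi * Complex.I * z * (lam - c / 24))) (F z)

end VertexData

/-! ### Tensor products of vertex operators -/

section Tensor

variable {M N : Type*} [AddCommGroup M] [Module ℂ M] [AddCommGroup N] [Module ℂ N]

/-- The coefficients of a vertex operator applied to a fixed vector are bounded below. -/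
theorem VertexOperator.exists_bound (A : VertexOperator ℂ M) (a : M) :
    ∃ K : ℤ, ∀ p < K, HVertexOperator.coeff A p a = 0 := by
  have h := HVertexOperator.coeff_isPWOsupport A a
  rcases Set.eq_empty_or_nonempty (((HahnModule.of ℂ).symm (A a)).coeff.support) with he | hne
  · refine ⟨0, fun p _ => ?_⟩
    have : p ∉ ((HahnModule.of ℂ).symm (A a)).coeff.support := by simp [he]
    exact not_not.mp this
  · refine ⟨h.isWF.min hne, fun p hp => ?_⟩
    by_contra hp'
    exact h.isWF.not_lt_min hne (a := p) hp' hp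

theorem tensorCoeff_finite (A : VertexOperator ℂ M) (B : VertexOperator ℂ N) (e : ℤ) (a : M)
    (b : N) : (Function.support fun p : ℤ =>
      HVertexOperator.coeff A p a ⊗ₜ[ℂ] HVertexOperator.coeff B (e - p) b).Finite := by
  obtain ⟨K, hK⟩ := A.exists_bound a
  obtain ⟨K', hK'⟩ := B.exists_bound b
  refine (Set.finite_Icc K (e - K')).subset fun p hp => ?_
  rw [Function.mem_support] at hp
  constructor
  · by_contra h
    exact hp (by rw [hK p (by lia), TensorProduct.zero_tmul])
  · by_contra h
    exact hp (by rw [hK' (e - p) (by lia), TensorProduct.tmul_zero])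

/-- The coefficient of `x^e` in `A(x)a ⊗ B(x)b`. -/
def tensorCoeff (A : VertexOperator ℂ M) (B : VertexOperator ℂ N) (e : ℤ) :
    Module.End ℂ (M ⊗[ℂ] N) :=
  TensorProduct.lift (LinearMap.mk₂ ℂ
    (fun a b => ∑ᶠ p : ℤ, HVertexOperator.coeff A p a ⊗ₜ[ℂ] HVertexOperator.coeff B (e - p) b)
    (fun a a' b => by
      rw [← finsum_add_distrib (tensorCoeff_finite A B e a b) (tensorCoeff_finite A B e a' b)]
      simp only [map_add, TensorProduct.add_tmul])
    (fun c a b => by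
      rw [smul_finsum' c (tensorCoeff_finite A B e a b)]
      simp only [map_smul, TensorProduct.smul_tmul'])
    (fun a b b' => by
      rw [← finsum_add_distrib (tensorCoeff_finite A B e a b) (tensorCoeff_finite A B e a b')]
      simp only [map_add, TensorProduct.tmul_add])
    (fun c a b => by
      rw [smul_finsum' c (tensorCoeff_finite A B e a b)]
      simp only [map_smul, TensorProduct.tmul_smul]))

theorem tensorCoeff_tmul (A : VertexOperator ℂ M) (B : VertexOperator ℂ N) (e : ℤ) (a : M)
    (b : N) : tensorCoeff A B e (a ⊗ₜ b) =
      ∑ᶠ p : ℤ, HVertexOperator.coeff A p a ⊗ₜ[ℂ] HVertexOperator.coeff B (e - p) b := rfl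

theorem tensorCoeff_bddBelow (A : VertexOperator ℂ M) (B : VertexOperator ℂ N) (w : M ⊗[ℂ] N) :
    BddBelow (Function.support fun e : ℤ => tensorCoeff A B e w) := by
  suffices h : ∃ K : ℤ, ∀ e < K, tensorCoeff A B e w = 0 by
    obtain ⟨K, hK⟩ := h
    refine ⟨K, fun e he => ?_⟩
    by_contra hlt
    exact he (hK e (by lia))
  induction w with
  | zero => exact ⟨0, fun e _ => map_zero _⟩
  | add x y hx hy =>
    obtain ⟨K, hK⟩ := hx
    obtain ⟨K', hK'⟩ := hy
    exact ⟨min K K', fun e he => by rw [map_add, hK e (by lia), hK' e (by lia), add_zero]⟩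
  | tmul a b =>
    obtain ⟨K, hK⟩ := A.exists_bound a
    obtain ⟨K', hK'⟩ := B.exists_bound b
    refine ⟨K + K', fun e he => ?_⟩
    rw [tensorCoeff_tmul]
    refine finsum_eq_zero_of_forall_eq_zero fun p => ?_
    rcases lt_or_ge p K with h | h
    · rw [hK p h, TensorProduct.zero_tmul]
    · rw [hK' (e - p) (by lia), TensorProduct.tmul_zero]

theorem VertexOperator.ext_coeff {A B : VertexOperator ℂ M}
    (h : ∀ e w, HVertexOperator.coeff A e w = HVertexOperator.coeff B e w) : A = B :=
  HVertexOperator.coeff_inj (funext fun e => LinearMap.ext (h e))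

/-- The product `A(x) ⊗ B(x)` of two vertex operators in the same formal variable. -/
def fieldTensor :
    VertexOperator ℂ M →ₗ[ℂ] VertexOperator ℂ N →ₗ[ℂ] VertexOperator ℂ (M ⊗[ℂ] N) :=
  LinearMap.mk₂ ℂ
    (fun A B => VertexOperator.of_coeff (tensorCoeff A B) (tensorCoeff_bddBelow A B))
    (fun A A' B => by
      refine VertexOperator.ext_coeff fun e w => ?_
      induction w with
      | zero => simp only [map_zero]
      | add x y hx hy => rw [map_add, map_add, hx, hy]
      | tmul a b =>
        simp only [map_add, Pi.add_apply, LinearMap.add_apply]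
        change tensorCoeff (A + A') B e (a ⊗ₜ b) =
          tensorCoeff A B e (a ⊗ₜ b) + tensorCoeff A' B e (a ⊗ₜ b)
        rw [tensorCoeff_tmul, tensorCoeff_tmul, tensorCoeff_tmul,
          ← finsum_add_distrib (tensorCoeff_finite A B e a b) (tensorCoeff_finite A' B e a b)]
        simp only [map_add, Pi.add_apply, LinearMap.add_apply, TensorProduct.add_tmul])
    (fun c A B => by
      refine VertexOperator.ext_coeff fun e w => ?_
      induction w with
      | zero => simp only [map_zero]
      | add x y hx hy => rw [map_add, map_add, hx, hy]
      | tmul a b =>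
        simp only [map_smul, Pi.smul_apply, LinearMap.smul_apply]
        change tensorCoeff (c • A) B e (a ⊗ₜ b) = c • tensorCoeff A B e (a ⊗ₜ b)
        rw [tensorCoeff_tmul, tensorCoeff_tmul, smul_finsum' c (tensorCoeff_finite A B e a b)]
        simp only [map_smul, Pi.smul_apply, LinearMap.smul_apply, TensorProduct.smul_tmul'])
    (fun A B B' => by
      refine VertexOperator.ext_coeff fun e w => ?_
      induction w with
      | zero => simp only [map_zero]
      | add x y hx hy => rw [map_add, map_add, hx, hy]
      | tmul a b =>
        simp only [map_add, Pi.add_apply, LinearMap.add_apply]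
        change tensorCoeff A (B + B') e (a ⊗ₜ b) =
          tensorCoeff A B e (a ⊗ₜ b) + tensorCoeff A B' e (a ⊗ₜ b)
        rw [tensorCoeff_tmul, tensorCoeff_tmul, tensorCoeff_tmul,
          ← finsum_add_distrib (tensorCoeff_finite A B e a b) (tensorCoeff_finite A B' e a b)]
        simp only [map_add, Pi.add_apply, LinearMap.add_apply, TensorProduct.tmul_add])
    (fun c A B => by
      refine VertexOperator.ext_coeff fun e w => ?_
      induction w with
      | zero => simp only [map_zero]
      | add x y hx hy => rw [map_add, map_add, hx, hy]
      | tmul a b =>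
        simp only [map_smul, Pi.smul_apply, LinearMap.smul_apply]
        change tensorCoeff A (c • B) e (a ⊗ₜ b) = c • tensorCoeff A B e (a ⊗ₜ b)
        rw [tensorCoeff_tmul, tensorCoeff_tmul, smul_finsum' c (tensorCoeff_finite A B e a b)]
        simp only [map_smul, Pi.smul_apply, LinearMap.smul_apply, TensorProduct.tmul_smul])

/-- Given `Y₁(u, x)` on `M` and `Y₂(v, x)` on `N`, the vertex operators
`Y(u ⊗ v, x)(a ⊗ b) = (-1)^{|v||a|} Y₁(u, x)a ⊗ Y₂(v, x)b` on `M ⊗ N`.  Here `P` is the parity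
map on `M` and `Q` is the parity map on `V₂`, with respect to which `v` is decomposed into its even
part `(v + Q v)/2` and its odd part `(v - Q v)/2`. -/
def tensorY {V₁ V₂ : Type*} [AddCommGroup V₁] [Module ℂ V₁] [AddCommGroup V₂] [Module ℂ V₂]
    (P : Module.End ℂ M) (Q : Module.End ℂ V₂)
    (Y₁ : V₁ →ₗ[ℂ] VertexOperator ℂ M) (Y₂ : V₂ →ₗ[ℂ] VertexOperator ℂ N) :
    V₁ ⊗[ℂ] V₂ →ₗ[ℂ] VertexOperator ℂ (M ⊗[ℂ] N) :=
  TensorProduct.lift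
    (fieldTensor.compl₁₂ Y₁ (Y₂ ∘ₗ ((1 / 2 : ℂ) • (1 + Q))) +
      fieldTensor.compl₁₂ (LinearMap.lcomp ℂ _ P ∘ₗ Y₁) (Y₂ ∘ₗ ((1 / 2 : ℂ) • (1 - Q))))

/-- A vertex operator in the variable `x`, regarded as one in the variable `x^{1/k}`. -/
def refineVar (k : ℕ) [NeZero k] : VertexOperator ℂ M →ₗ[ℂ] VertexOperator ℂ M where
  toFun A := VertexOperator.of_coeff
    (fun e => if (k : ℤ) ∣ e then HVertexOperator.coeff A (e / k) else 0)
    (fun w => by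
      obtain ⟨K, hK⟩ := A.exists_bound w
      refine ⟨k * K, fun e he => ?_⟩
      by_contra hlt
      refine he ?_
      by_cases hd : (k : ℤ) ∣ e
      · obtain ⟨f, rfl⟩ := hd
        have hk : (0 : ℤ) < k := by exact_mod_cast NeZero.pos k
        simp only [dvd_mul_right, if_true]
        rw [Int.mul_ediv_cancel_left _ hk.ne']
        exact hK f (lt_of_mul_lt_mul_left (not_le.mp hlt) hk.le)
      · simp [hd])
  map_add' A B := by
    refine VertexOperator.ext_coeff fun e w => ?_
    simp only [map_add, Pi.add_apply, VertexOperator.of_coeff, HVertexOperator.coeff_of_coeff]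
    split_ifs <;> simp
  map_smul' c A := by
    refine VertexOperator.ext_coeff fun e w => ?_
    simp only [map_smul, Pi.smul_apply, VertexOperator.of_coeff, HVertexOperator.coeff_of_coeff]
    split_ifs <;> simp

/-- The tensor product of two vertex operator superalgebras. -/
def VertexData.tensor (D : VertexData M) (E : VertexData N) : VertexData (M ⊗[ℂ] N) where
  parity := TensorProduct.map D.parity E.parity
  Y := tensorY D.parity E.parity D.Y E.Y
  vac := D.vac ⊗ₜ E.vac
  omega := D.omega ⊗ₜ E.vac + D.vac ⊗ₜ E.omega

end Tensor

/-! ### Free bosons and free fermions -/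

section Free

variable {h : Type*} [AddCommGroup h] [Module ℂ h]

/-- For `f : W → ℂ` linear, the derivation of `S(W)` extending `f`. -/
def symDeriv {W : Type*} [AddCommGroup W] [Module ℂ W] (f : Module.Dual ℂ W) :
    Module.End ℂ (SymmetricAlgebra ℂ W) :=
  (TrivSqZeroExt.sndHom (SymmetricAlgebra ℂ W) (SymmetricAlgebra ℂ W)).restrictScalars ℂ ∘ₗ
    (SymmetricAlgebra.lift
      ((TrivSqZeroExt.inlAlgHom ℂ (SymmetricAlgebra ℂ W) (SymmetricAlgebra ℂ W)).toLinearMap ∘ₗ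
          SymmetricAlgebra.ι ℂ W +
        (TrivSqZeroExt.inrHom (SymmetricAlgebra ℂ W) (SymmetricAlgebra ℂ W)).restrictScalars ℂ ∘ₗ
          (Algebra.linearMap ℂ (SymmetricAlgebra ℂ W)) ∘ₗ f)).toLinearMap

variable (h) in
/-- The span of the creation modes: `Finsupp.single q α` stands for `α ⊗ t^{-(q+1)}` or
`α ⊗ t^{-(q+1/2)}`, where `q = 0, 1, 2, …`. -/
abbrev CreationModes := ℕ →₀ h

/-- The functional `∑_q β_q ⊗ t^{-…} ↦ ⟨α, β_p⟩`. -/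
def modePairing (B : LinearMap.BilinForm ℂ h) (α : h) (p : ℕ) :
    Module.Dual ℂ (CreationModes h) :=
  B α ∘ₗ Finsupp.lapply p

variable (h) in
/-- `V_bos = S(ĥ_+)`, where `ĥ_+ = h ⊗ t⁻¹ℂ[t⁻¹]` and `Finsupp.single q α` is `α(-(q+1))`. -/
abbrev Vbos := SymmetricAlgebra ℂ (CreationModes h)

variable (h) in
/-- `V_fer = ⋀(ĥ^f_+)`, where `ĥ^f_+ = h ⊗ t^{-1/2}ℂ[t⁻¹]` and `Finsupp.single q α` is
`α(-(q+1/2))`. -/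
abbrev Vfer := ExteriorAlgebra ℂ (CreationModes h)

variable (h) in
/-- `M_κ = S(ĥ^b[κ]_+)`, where `ĥ^b[κ]_+ = h ⊗ t^{-1/2}ℂ[t⁻¹]` and `Finsupp.single q α` is
`α(-(q+1/2))`. -/
abbrev Mkappa := SymmetricAlgebra ℂ (CreationModes h)

/-- `α(n)` on `V_bos`, `n ∈ ℤ`: multiplication by `α(n)` for `n < 0`, the derivation with
`β(-m) ↦ n⟨α, β⟩δ_{m,n}` for `n > 0`, and `α(0) = 0`. -/
def bosMode (B : LinearMap.BilinForm ℂ h) (α : h) (n : ℤ) : Module.End ℂ (Vbos h) :=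
  if n < 0 then
    LinearMap.mulLeft ℂ (SymmetricAlgebra.ι ℂ (CreationModes h)
      (Finsupp.single (-n - 1).toNat α))
  else (n : ℂ) • symDeriv (modePairing B α (n - 1).toNat)

/-- The mode `α(n + 1/2)` on `V_fer`, `n ∈ ℤ`, i.e. the coefficient of `x^{-n-1}` in
`α(x)^f = ∑_{m ∈ ℤ+1/2} α(m) x^{-m-1/2}`: multiplication by `α(n + 1/2)` for `n < 0`, and the
odd derivation with `β(-m) ↦ ⟨α, β⟩δ_{m,n+1/2}` for `n ≥ 0`. -/
def ferMode (B : LinearMap.BilinForm ℂ h) (α : h) (n : ℤ) : Module.End ℂ (Vfer h) :=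
  if n < 0 then
    LinearMap.mulLeft ℂ (ExteriorAlgebra.ι ℂ (Finsupp.single (-n - 1).toNat α))
  else CliffordAlgebra.contractLeft (modePairing B α n.toNat)

/-- The mode `α(N/2)` on `M_κ` for `N` odd, `0` for `N` even, i.e. the coefficient of
`x^{-N/2-1}` in `α(x)^κ = ∑_{m ∈ ℤ+1/2} α(m) x^{-m-1}`: multiplication by `α(N/2)` for `N < 0`,
and the derivation with `β(-m) ↦ (N/2)⟨α, β⟩δ_{m,N/2}` for `N > 0`. -/
def kappaMode (B : LinearMap.BilinForm ℂ h) (α : h) (N : ℤ) : Module.End ℂ (Mkappa h) :=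
  if Even N then 0
  else if N < 0 then
    LinearMap.mulLeft ℂ (SymmetricAlgebra.ι ℂ (CreationModes h)
      (Finsupp.single ((-N - 1) / 2).toNat α))
  else ((N : ℂ) / 2) • symDeriv (modePairing B α ((N - 1) / 2).toNat)

/-- A polarization `h = a⁻ ⊕ a⁺ ⊕ e` of a `d`-dimensional space with a bilinear form: `a^±` are
isotropic of dimension `⌊d/2⌋`, and `e` is orthogonal to `a^±`, of dimension `0` for `d` even and
`1` for `d` odd. -/
structure Polarization (B : LinearMap.BilinForm ℂ h) (d : ℕ) where
  aminus : Submodule ℂ h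
  aplus : Submodule ℂ h
  e : Submodule ℂ h
  finrank_aminus : Module.finrank ℂ aminus = d / 2
  finrank_aplus : Module.finrank ℂ aplus = d / 2
  finrank_e : Module.finrank ℂ e = d % 2
  isotropic_aminus : ∀ x ∈ aminus, ∀ y ∈ aminus, B x y = 0
  isotropic_aplus : ∀ x ∈ aplus, ∀ y ∈ aplus, B x y = 0
  orth_aminus : ∀ x ∈ aminus, ∀ y ∈ e, B x y = 0
  orth_aplus : ∀ x ∈ aplus, ∀ y ∈ e, B x y = 0
  disjoint : Disjoint aplus e
  isCompl : IsCompl aminus (aplus ⊔ e)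

variable {B : LinearMap.BilinForm ℂ h} {d : ℕ}

/-- The space `ĥ^f[σ]_+ ⊕ a⁺ ⊕ e` of creation modes of `M_σ`; in the first factor
`Finsupp.single q α` is `α(-(q+1))`, in the second factor `α` is the zero mode `α(0)`. -/
abbrev SigmaModes (P : Polarization B d) := CreationModes h × ↥(P.aplus ⊔ P.e)

/-- The quadratic form `½⟨x, x⟩` on `ĥ^f[σ]_+ ⊕ a⁺ ⊕ e`, where `⟨α(m), β(n)⟩ = ⟨α, β⟩δ_{m+n,0}`. -/
def sigmaForm (P : Polarization B d) : QuadraticForm ℂ (SigmaModes P) :=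
  ((1 / 2 : ℂ) • LinearMap.BilinMap.toQuadraticMap B).comp
    ((P.aplus ⊔ P.e).subtype ∘ₗ LinearMap.snd ℂ _ _)

/-- `M_σ`, the Clifford algebra of `ĥ^f[σ]_+ ⊕ a⁺ ⊕ e` with `x y + y x = ⟨x, y⟩`.  For `d` even
this is the exterior algebra `⋀(ĥ^f[σ]_+ ⊕ a⁺)`. -/
abbrev Msigma (P : Polarization B d) := CliffordAlgebra (sigmaForm P)

/-- The coefficient of `x^{-N/2-1}` in `α(x)^σ = ∑_{m ∈ ℤ} α(m) x^{-m-1/2}` on `M_σ`.  It is `0` for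
`N` even, and `α(m)` with `m = (N+1)/2` for `N` odd: multiplication by `α(m)` for `m < 0`, the odd
derivation with `β(-m') ↦ ⟨α, β⟩δ_{m,m'}` for `m > 0`.  For `m = 0` and `α = α₋ + α₊` with
`α₋ ∈ a⁻`, `α₊ ∈ a⁺ ⊕ e`, it is the sum of the odd derivation with `β(-m') ↦ ⟨α₋, β⟩δ_{0,m'}`
and of the multiplication by `α₊(0)`. -/
def sigmaMode (P : Polarization B d) (α : h) (N : ℤ) : Module.End ℂ (Msigma P) :=
  if Even N then 0
  else if N < -1 then
    LinearMap.mulLeft ℂ (CliffordAlgebra.ι (sigmaForm P)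
      (Finsupp.single (-(N + 1) / 2 - 1).toNat α, 0))
  else if N = -1 then
    CliffordAlgebra.contractLeft
        (B (P.aminus.projectionOnto _ P.isCompl α : h) ∘ₗ
          (P.aplus ⊔ P.e).subtype ∘ₗ LinearMap.snd ℂ _ _) +
      LinearMap.mulLeft ℂ (CliffordAlgebra.ι (sigmaForm P)
        (0, (P.aplus ⊔ P.e).projectionOnto _ P.isCompl.symm α))
  else CliffordAlgebra.contractLeft
    (modePairing B α ((N + 1) / 2 - 1).toNat ∘ₗ LinearMap.fst ℂ _ _)

/-- Let `V` be generated by fields `α(x)`, `α ∈ h`, all of sign `s`, with modes `α_n` on `V`, and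
let `α(x)^M = ∑_{n ∈ ℤ + j/k} α^M_n x^{-n-1}` be fields on `M`, with `modeM α N = α^M_{N/k}`.  This
says that `Y(1, x) = 1` and that, for `n < 0` and `u` of sign `b`,
`Y(α_n u, x) = Res_{x₁} Res_{x₀} ((x₁-x₀)/x)^{j/k} x₀^n (x₀⁻¹ δ((x₁-x)/x₀) α(x₁)^M Y(u, x)
  - (-1)^{s b} x₀⁻¹ δ((x-x₁)/(-x₀)) Y(u, x) α(x₁)^M)`,
where the bracket has only finitely many negative powers of `x₀`, and is multiplied by
`((x₁-x₀)/x)^{j/k} = ∑_i (-1)^i binom(j/k, i) x₁^{j/k-i} x₀^i x^{-j/k}`.  For `k = 1` and `j = 0`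
the right-hand side is the normal ordered product of `(1/(-n-1)!) (d/dx)^{-n-1} α(x)` and
`Y(u, x)`. -/
structure IsIterated {V M : Type*} [AddCommGroup V] [Module ℂ V] [AddCommGroup M] [Module ℂ M]
    (k : ℕ) (j : ℤ) (s : ℕ) (vac : V) (parity : Module.End ℂ V)
    (modeV : h → ℤ → Module.End ℂ V) (modeM : h → ℤ → Module.End ℂ M)
    (Y : V →ₗ[ℂ] VertexOperator ℂ M) : Prop where
  vac : ∀ N : ℤ, vmode k (Y vac) N = if N = -k then 1 else 0
  iterate : ∀ (α : h) (n : ℤ), n < 0 → ∀ (b : ℕ) (u : V), parity u = (-1 : ℂ) ^ b • u →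
    ∀ (N : ℤ) (w : M), vmode k (Y (modeV α n u)) N w =
      ∑ᶠ i : ℕ, ((-1) ^ i * Ring.choose ((j : ℂ) / k) i) •
        jacobiLHS k ((-1) ^ (s * b)) (modeM α) (vmode k (Y u)) (n + i) (j - k * i) (N - j) w

/-- The vertex operators of `V_bos`, on `V_bos`. -/
abbrev IsBosY (B : LinearMap.BilinForm ℂ h) (Y : Vbos h →ₗ[ℂ] VertexOperator ℂ (Vbos h)) : Prop :=
  IsIterated 1 0 0 1 1 (bosMode B) (bosMode B) Y

/-- The vertex operators of `V_fer`, on `V_fer`. -/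
abbrev IsFerY (B : LinearMap.BilinForm ℂ h) (Y : Vfer h →ₗ[ℂ] VertexOperator ℂ (Vfer h)) : Prop :=
  IsIterated 1 0 1 1 CliffordAlgebra.involute.toLinearMap (ferMode B) (ferMode B) Y

/-- The `κ`-twisted vertex operators of `V_bos`, on `M_κ`. -/
abbrev IsKappaY (B : LinearMap.BilinForm ℂ h)
    (Y : Vbos h →ₗ[ℂ] VertexOperator ℂ (Mkappa h)) : Prop :=
  IsIterated 2 1 0 1 1 (bosMode B) (kappaMode B) Y

/-- The `σ`-twisted vertex operators of `V_fer`, on `M_σ`. -/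
abbrev IsSigmaY (P : Polarization B d)
    (Y : Vfer h →ₗ[ℂ] VertexOperator ℂ (Msigma P)) : Prop :=
  IsIterated 2 1 1 1 CliffordAlgebra.involute.toLinearMap (ferMode B) (sigmaMode P) Y

/-- `Y` on `V_bos`: the linear map determined by the recursion `IsBosY`. -/
def bosY (B : LinearMap.BilinForm ℂ h) : Vbos h →ₗ[ℂ] VertexOperator ℂ (Vbos h) :=
  Classical.epsilon (IsBosY B)

/-- `Y` on `V_fer`: the linear map determined by the recursion `IsFerY`. -/
def ferY (B : LinearMap.BilinForm ℂ h) : Vfer h →ₗ[ℂ] VertexOperator ℂ (Vfer h) :=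
  Classical.epsilon (IsFerY B)

/-- `Y^κ`: the linear map determined by the recursion `IsKappaY`. -/
def kappaY (B : LinearMap.BilinForm ℂ h) : Vbos h →ₗ[ℂ] VertexOperator ℂ (Mkappa h) :=
  Classical.epsilon (IsKappaY B)

/-- `Y^σ`: the linear map determined by the recursion `IsSigmaY`. -/
def sigmaY (P : Polarization B d) : Vfer h →ₗ[ℂ] VertexOperator ℂ (Msigma P) :=
  Classical.epsilon (IsSigmaY P)

/-- `α(-1)1 ∈ V_bos`. -/
def bosGen (α : h) : Vbos h := SymmetricAlgebra.ι ℂ _ (Finsupp.single 0 α)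

/-- `α(-(q+1/2))1 ∈ V_fer`. -/
def ferGen (q : ℕ) (α : h) : Vfer h := ExteriorAlgebra.ι ℂ (Finsupp.single q α)

/-- The `d` free boson VOA, for an orthonormal basis `e` of `h`. -/
def bosVOA (B : LinearMap.BilinForm ℂ h) (e : Fin d → h) : VertexData (Vbos h) where
  parity := 1
  Y := bosY B
  vac := 1
  omega := (1 / 2 : ℂ) • ∑ j, bosGen (e j) * bosGen (e j)

/-- The `d` free fermion VOSA, for an orthonormal basis `e` of `h`. -/
def ferVOSA (B : LinearMap.BilinForm ℂ h) (e : Fin d → h) : VertexData (Vfer h) where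
  parity := CliffordAlgebra.involute.toLinearMap
  Y := ferY B
  vac := 1
  omega := (1 / 2 : ℂ) • ∑ j, ferGen 1 (e j) * ferGen 0 (e j)

variable (h) in
/-- The underlying space of `V = V_bos ⊗ V_fer`. -/
abbrev Vfree := Vbos h ⊗[ℂ] Vfer h

/-- The free boson-fermion VOSA `V = V_bos ⊗ V_fer`. -/
def freeVOSA (B : LinearMap.BilinForm ℂ h) (e : Fin d → h) : VertexData (Vfree h) :=
  (bosVOA B e).tensor (ferVOSA B e)

/-- The free N=2 VOSA `V ⊗ V`. -/
def freeN2VOSA (B : LinearMap.BilinForm ℂ h) (e : Fin d → h) :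
    VertexData (Vfree h ⊗[ℂ] Vfree h) :=
  (freeVOSA B e).tensor (freeVOSA B e)

/-- `α(-1)1 ∈ V = V_bos ⊗ V_fer`. -/
def bosVec (α : h) : Vfree h := bosGen α ⊗ₜ 1

/-- `α(-1/2)1 ∈ V = V_bos ⊗ V_fer`. -/
def ferVec (α : h) : Vfree h := 1 ⊗ₜ ferGen 0 α

/-- `τ = ∑_j α⁽ʲ⁾(-1) α⁽ʲ⁾(-1/2) 1 ∈ V`. -/
def tauN1 (e : Fin d → h) : Vfree h := ∑ j, bosGen (e j) ⊗ₜ[ℂ] ferGen 0 (e j)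

/-- The N=1 superconformal elements `τ⁽¹⁾`, `τ⁽²⁾` of `V ⊗ V`. -/
def tauN2 (e : Fin d → h) : Fin 2 → Vfree h ⊗[ℂ] Vfree h :=
  ![tauN1 e ⊗ₜ (1 ⊗ₜ 1) + (1 ⊗ₜ 1) ⊗ₜ tauN1 e,
    ∑ j, (bosVec (e j) ⊗ₜ[ℂ] ferVec (e j) - ferVec (e j) ⊗ₜ[ℂ] bosVec (e j))]

/-- The element `μ = i ∑_j α⁽ʲ⁾(-1/2)1 ⊗ α⁽ʲ⁾(-1/2)1` of `V ⊗ V`. -/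
def muN2 (e : Fin d → h) : Vfree h ⊗[ℂ] Vfree h :=
  Complex.I • ∑ j, ferVec (e j) ⊗ₜ[ℂ] ferVec (e j)

variable (h) in
/-- `κ` on `V_bos`, the algebra automorphism with `α(-n)1 ↦ -α(-n)1`. -/
def kappaBos : Module.End ℂ (Vbos h) :=
  (SymmetricAlgebra.lift (-SymmetricAlgebra.ι ℂ (CreationModes h))).toLinearMap

variable (h) in
/-- The mirror map `κ` on `V ⊗ V`: the identity on the first factor, and on the second factor
`V_bos ⊗ V_fer` the tensor product of `κ` on `V_bos` and of the parity map on `V_fer`. -/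
def mirrorMap : Module.End ℂ (Vfree h ⊗[ℂ] Vfree h) :=
  TensorProduct.map LinearMap.id
    (TensorProduct.map (kappaBos h) CliffordAlgebra.involute.toLinearMap)

/-- The vertex operators `Y ⊗ Y^κ ⊗ Y^σ` of `V ⊗ V = V ⊗ (V_bos ⊗ V_fer)` on
`V ⊗ M_κ ⊗ M_σ`, in the variable `x^{1/2}`. -/
def mirrorY (P : Polarization B d) (e : Fin d → h) :
    Vfree h ⊗[ℂ] Vfree h →ₗ[ℂ] VertexOperator ℂ (Vfree h ⊗[ℂ] (Mkappa h ⊗[ℂ] Msigma P)) :=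
  tensorY (freeVOSA B e).parity (freeVOSA B e).parity (refineVar 2 ∘ₗ (freeVOSA B e).Y)
    (tensorY 1 (ferVOSA B e).parity (kappaY B) (sigmaY P))

/-- `C_d = 1` for `d` even and `√2` for `d` odd. -/
def Cd (d : ℕ) : ℂ := if Even d then 1 else (Real.sqrt 2 : ℂ)

end Free

end

/-!
All the vertex operators of the theorem are generated by free fields `α(x)`, and all its Jacobi
identities follow from one principle about such fields.

The Jacobi identity of two fields is treated coefficient by coefficient, as the identity `OPE`
between the modes of `A(x₁)`, `B(x₂)` and of their products `P l`.  The modes are indexed by integers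
`N` standing for `N / k`, with `k = 1` for modules and `k = 2` for twisted modules, so that both cases
are one.  Two facts are needed about it.  Fields that are local have products satisfying it
(`OPE.exists_of_local`): a function of the three exponents that obeys the recursion "multiply by
`x₁ - x₂`", is zero for large powers of `x₁ - x₂`, and is zero for one exponent of `x₁`, is zero.  And
it is inherited by products (`OPE.assoc`): the identity for the products of `A` and `B` with `C`
follows, by descending induction on the order of the product, from those of `A` and of `B` with the
other fields.

For free fields on a space `M` consider the fields on `M` that are local with respect to all of them.
Taking the `n`-th product with `α(x)` acts on this space of fields, and these operators satisfy the
commutation relations of the modes of untwisted free fields (`FreeField.fieldMode_commutator`),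
whether the free fields of `M` are twisted or not.  As `V_bos` and `V_fer` are freely generated by
creation modes (`FreeModel`), they map to the local fields, the vacuum going to the field `1`
(`FreeModel.exists_fields`).  This map is `Y`, `Y^κ` or `Y^σ`: it satisfies the recursion because the
recursion is the Jacobi identity with one free field, solved for the products (`OPE.product_eq`), and
it is unique because the creation modes generate.  By `OPE.assoc`, the vectors satisfying the Jacobi
identity with all vectors are closed under all products; as they contain the generators, they are
everything (`FreeModel.isVertex`, `FreeModel.isTwistedSystem`).

Tensor products preserve these structures (`IsVertex.tensor`, `IsTwistedSystem.tensor`): the vectors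
`u ⊗ 1` and `1 ⊗ v` satisfy the Jacobi identity by that of one factor, and their products span.  The
conformal vectors are controlled by their commutators with the free fields, the Virasoro relations
being the commutator formula applied to the singular products `ω_i ω` (`IsVertex.virasoro`).

In the same way the N=2 relations are commutator formulas.  Both vectors `τ` are of the form
`∑_c ∑_j ε_c b^c_j f^{σ(c)}_j` for two families of free bosons `b` and fermions `f` (`superVec`), so
their products are computed together, and `ω` need not be treated separately, since it is half the
anticommutator of the modes of `τ^{(1)}` (`IsFreePair.omega_eq_anticommutator`).

The lowest weights `d/16` of `M_κ` and `M_σ` come from the binomial coefficient of `(1 + x)^{1/2}` of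
order two in the Jacobi identity.  Monomials in the creation modes form a basis of eigenvectors of
`L(0)`, so the graded dimensions are products of factors `(1 - p^k)⁻¹` and `1 + p^k`, with
`p = q^{1/2}` (`HasCharacter.symmetricAlgebra`, `HasCharacter.cliffordAlgebra`); for `M_σ` the basis is
transported from the exterior algebra of the same space.  Euler's product identities turn them into
quotients of eta functions.
-/

open LinearMap (comp_apply id_apply)
open TensorProduct (map_tmul zero_tmul tmul_zero tmul_smul smul_tmul' tmul_neg tmul_add neg_tmul add_tmul map_smul_left map_smul_right map_id map)
open Finset (sum_congr range sum_eq_zero smul_sum sum_range_succ sum_range_one sum_smul sum_add_distrib mul_sum mem_range sum_sub_distrib sum_range_zero sum_comm)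
open Module (End Dual Basis)
open CliffordAlgebra (involute contractLeft involute_ι contractLeft_ι_mul contractLeft_one)
open Finset.HasAntidiagonal (antidiagonal mem_antidiagonal)
noncomputable section

set_option linter.unusedSectionVars false
universe u

/-- The complex binomial coefficient. -/
notation "binom(" r ", " i ")" => Ring.choose (r : ℂ) i

section

variable {M N : Type*} [AddCommGroup M] [Module ℂ M] [AddCommGroup N] [Module ℂ N]

-- linear maps are evaluated by the general lemmas `zero_apply`, `add_apply`, `sub_apply`, `smul_apply`
instance : IsZeroApply (M →ₗ[ℂ] N) M N := ⟨fun _ => rfl⟩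
instance : IsAddApply (M →ₗ[ℂ] N) M N := ⟨fun _ _ _ => rfl⟩
instance : IsSubApply (M →ₗ[ℂ] N) M N := ⟨fun _ _ _ => rfl⟩
instance : IsSMulApply ℂ (M →ₗ[ℂ] N) M N := ⟨fun _ _ _ => rfl⟩

end

/-! ### Finite double sums -/

section Sums

variable {M : Type*} [AddCommGroup M] [Module ℂ M]

lemma hasFiniteSupport_of_ge {f : ℕ → M} {N : ℕ} (h : ∀ i, N ≤ i → f i = 0) :
    Function.HasFiniteSupport f :=
  (range N).finite_toSet.subset fun i hi => by
    by_contra hn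
    exact hi (h i (by simpa using hn))

lemma finsum_eq_sum_range {f : ℕ → M} {N : ℕ} (h : ∀ i, N ≤ i → f i = 0) :
    ∑ᶠ i, f i = ∑ i ∈ range N, f i :=
  finsum_eq_sum_of_support_subset f fun i hi => by
    by_contra hn
    exact hi (h i (by simpa using hn))

lemma finsum_finsum_eq_sum_range {f : ℕ → ℕ → M} {N : ℕ}
    (h : ∀ i p, N ≤ i ∨ N ≤ p → f i p = 0) :
    ∑ᶠ i, ∑ᶠ p, f i p = ∑ i ∈ range N, ∑ p ∈ range N, f i p := by
  rw [finsum_eq_sum_range (N := N)]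
  · exact sum_congr rfl fun i _ => finsum_eq_sum_range fun p hp => h i p (Or.inr hp)
  · intro i hi
    exact finsum_eq_zero_of_forall_eq_zero fun p => h i p (Or.inl hi)

/-- A doubly indexed family with support in a square. -/
def Boxed (f : ℕ → ℕ → M) : Prop := ∃ N, ∀ i p, N ≤ i ∨ N ≤ p → f i p = 0

lemma Boxed.of_left {f : ℕ → ℕ → M} {N : ℕ} (h : ∀ i p, N ≤ i → f i p = 0)
    (h' : ∀ i, ∃ K, ∀ p, K ≤ p → f i p = 0) : Boxed f := by
  choose K hK using h'
  refine ⟨max N ((range N).sup K), fun i p hip => ?_⟩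
  by_cases hi : N ≤ i
  · exact h i p hi
  · rcases hip with h1 | h1
    · exact h i p (le_trans (le_max_left _ _) h1)
    · exact hK i p ((Finset.le_sup (f := K) (by simpa using hi)).trans
        ((le_max_right _ _).trans h1))

lemma Boxed.swap {f : ℕ → ℕ → M} (h : Boxed f) : Boxed fun i p => f p i :=
  h.imp fun _ hN i p hip => hN p i hip.symm

lemma Boxed.finsum_comm {f : ℕ → ℕ → M} (h : Boxed f) :
    ∑ᶠ i, ∑ᶠ p, f i p = ∑ᶠ p, ∑ᶠ i, f i p := by
  obtain ⟨N, hN⟩ := h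
  rw [finsum_finsum_eq_sum_range hN, finsum_finsum_eq_sum_range (fun i p hip => hN p i hip.symm),
    sum_comm]

lemma Boxed.smul {f : ℕ → ℕ → M} (hf : Boxed f) (c : ℕ → ℕ → ℂ) :
    Boxed fun i p => c i p • f i p :=
  hf.imp fun _ hN i p hip => by simp [hN i p hip]

lemma Boxed.finsum_add {f g : ℕ → ℕ → M} (hf : Boxed f) (hg : Boxed g) :
    ∑ᶠ i, ∑ᶠ p, (f i p + g i p) = ∑ᶠ i, ∑ᶠ p, f i p + ∑ᶠ i, ∑ᶠ p, g i p := by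
  obtain ⟨N, hN⟩ := hf
  obtain ⟨K, hK⟩ := hg
  rw [finsum_finsum_eq_sum_range (N := max N K) fun i p hip => by
      rw [hN i p (by omega), hK i p (by omega), add_zero],
    finsum_finsum_eq_sum_range (N := max N K) fun i p hip => hN i p (by omega),
    finsum_finsum_eq_sum_range (N := max N K) fun i p hip => hK i p (by omega)]
  simp only [sum_add_distrib]

lemma Boxed.finsum_smul {f : ℕ → ℕ → M} (hf : Boxed f) (c : ℂ) :
    ∑ᶠ i, ∑ᶠ p, c • f i p = c • ∑ᶠ i, ∑ᶠ p, f i p := by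
  obtain ⟨N, hN⟩ := hf
  rw [finsum_finsum_eq_sum_range (N := N) fun i p hip => by rw [hN i p hip, smul_zero],
    finsum_finsum_eq_sum_range (N := N) hN]
  simp only [smul_sum]

/-- Summation of a finitely supported family over the antidiagonals. -/
lemma Boxed.finsum_antidiagonal {f : ℕ → ℕ → M} (h : Boxed f) :
    ∑ᶠ i, ∑ᶠ p, f i p = ∑ᶠ n, ∑ ij ∈ antidiagonal n, f ij.1 ij.2 := by
  obtain ⟨N, hN⟩ := h
  rw [finsum_finsum_eq_sum_range hN, finsum_eq_sum_range (N := 2 * N), ← Finset.sum_product',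
    Finset.sum_sigma']
  · symm
    refine Finset.sum_bij_ne_zero (fun x _ _ => x.2) ?_ ?_ ?_ ?_
    · rintro ⟨n, i, p⟩ hx hne
      by_contra hcon
      refine hne (hN i p ?_)
      simp only [Finset.mem_product, mem_range] at hcon
      omega
    · rintro ⟨n, i, p⟩ hx hne ⟨n', i', p'⟩ hx' hne' heq
      simp only [Finset.mem_sigma, mem_antidiagonal, Prod.mk.injEq] at hx hx' heq
      obtain ⟨rfl, rfl⟩ := heq
      obtain rfl : n = n' := by rw [← hx.2, ← hx'.2]
      rfl
    · rintro ⟨i, p⟩ hx hne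
      simp only [Finset.mem_product, mem_range] at hx
      exact ⟨⟨i + p, i, p⟩, by simp; omega, hne, rfl⟩
    · intros; rfl
  · intro n hn
    refine sum_eq_zero fun ij hij => hN _ _ ?_
    rw [mem_antidiagonal] at hij
    omega

lemma finsum_smul_eq {f : ℕ → M} (hf : Function.HasFiniteSupport f) (c : ℂ) :
    c • ∑ᶠ i, f i = ∑ᶠ i, c • f i := smul_finsum' c hf

lemma smul_finsum_ge {f : ℕ → M} {N : ℕ} (h : ∀ i, N ≤ i → f i = 0) (c : ℂ) :
    c • ∑ᶠ i, f i = ∑ᶠ i, c • f i := finsum_smul_eq (hasFiniteSupport_of_ge h) c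

lemma finsum_sub_smul {f g : ℕ → M} {N K : ℕ} (hf : ∀ i, N ≤ i → f i = 0)
    (hg : ∀ i, K ≤ i → g i = 0) (c : ℂ) :
    ∑ᶠ i, f i - c • ∑ᶠ i, g i = ∑ᶠ i, (f i - c • g i) := by
  rw [smul_finsum_ge hg, ← finsum_sub_distrib (hasFiniteSupport_of_ge hf)
    (hasFiniteSupport_of_ge (N := K) fun i hi => by rw [hg i hi, smul_zero])]

lemma map_finsum_ge (T : M →ₗ[ℂ] M) {f : ℕ → M} {N : ℕ} (h : ∀ i, N ≤ i → f i = 0) :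
    T (∑ᶠ i, f i) = ∑ᶠ i, T (f i) := by
  rw [finsum_eq_sum_range h, finsum_eq_sum_range (N := N) (fun i hi => by rw [h i hi, map_zero]),
    map_sum]

/-- Shifting the summation index, the terms before the shift being zero. -/
lemma finsum_shift {f : ℕ → M} (t : ℕ) (h0 : ∀ i, i < t → f i = 0) :
    ∑ᶠ q, f (t + q) = ∑ᶠ i, f i := by
  have hinj : Function.Injective fun q : ℕ => t + q := add_right_injective t
  rw [← finsum_mem_range (f := f) hinj, ← finsum_mem_univ f]
  refine finsum_mem_inter_support_eq' f _ _ fun i hi => ?_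
  simp only [Set.mem_range, Set.mem_univ, iff_true]
  have : t ≤ i := by
    by_contra hlt
    exact hi (h0 i (by omega))
  exact ⟨i - t, by omega⟩

end Sums

/-! ### Binomial identities -/

section Binomial

lemma choose_add_antidiagonal (x y : ℂ) (n : ℕ) :
    ∑ ij ∈ antidiagonal n, binom(x, ij.1) * binom(y, ij.2) = binom(x + y, n) :=
  (Ring.add_choose_eq n (Commute.all x y)).symm

lemma choose_mul_choose_sub (x : ℂ) (i t : ℕ) :
    binom(x, i) * binom(x - i, t) = binom(x, t) * binom(x - t, i) := by
  have h1 := Ring.choose_smul_choose x (n := i + t) (k := i) (by omega)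
  have h2 := Ring.choose_smul_choose x (n := i + t) (k := t) (by omega)
  rw [Nat.add_sub_cancel_left] at h1
  rw [Nat.add_sub_cancel] at h2
  rw [← h1, ← h2, Nat.choose_symm_add]

lemma choose_mul_natChoose (x : ℂ) {i t : ℕ} (h : t ≤ i) :
    binom(x, i) * (i.choose t : ℂ) = binom(x, t) * binom(x - t, i - t) := by
  rw [← Ring.choose_smul_choose x h, nsmul_eq_mul, mul_comm]

/-- A weighted Vandermonde convolution. -/
lemma sum_natChoose_mul (r l : ℂ) (n t : ℕ) :
    ∑ ij ∈ antidiagonal n, (ij.1.choose t : ℂ) * (binom(r, ij.1) * binom(l, ij.2)) =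
      if t ≤ n then binom(r, t) * binom(r + l - t, n - t) else 0 := by
  split_ifs with h
  · obtain ⟨q, rfl⟩ := Nat.exists_eq_add_of_le h
    have h1 : r + l - t = (r - t) + l := by ring
    rw [Nat.add_sub_cancel_left, h1, ← choose_add_antidiagonal, mul_sum]
    symm
    refine Finset.sum_bij_ne_zero (fun x _ _ => (t + x.1, x.2)) ?_ ?_ ?_ ?_
    · rintro ⟨i, p⟩ hx _
      simp only [mem_antidiagonal] at hx ⊢
      omega
    · rintro ⟨i, p⟩ _ _ ⟨i', p'⟩ _ _ heq
      simp only [Prod.mk.injEq, Nat.add_left_cancel_iff] at heq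
      rw [heq.1, heq.2]
    · rintro ⟨i, p⟩ hx hne
      have hti : t ≤ i := by
        by_contra hlt
        exact hne (by simp [Nat.choose_eq_zero_of_lt (not_le.mp hlt)])
      simp only [mem_antidiagonal] at hx
      have h3 := choose_mul_natChoose r hti
      refine ⟨(i - t, p), ?_, ?_, ?_⟩
      · simp only [mem_antidiagonal]; omega
      · intro h4
        apply hne
        dsimp only at h4 ⊢
        linear_combination h4 + (binom(l, p)) * h3
      · simp [hti]
    · rintro ⟨i, p⟩ hx hne
      have h3 := choose_mul_natChoose r (i := t + i) (t := t) (by omega)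
      rw [Nat.add_sub_cancel_left] at h3
      dsimp only
      linear_combination -(binom(l, p)) * h3
  · refine sum_eq_zero fun ij hij => ?_
    rw [mem_antidiagonal] at hij
    rw [Nat.choose_eq_zero_of_lt (by omega)]
    simp

lemma sum_choose_choose_add (r l a : ℂ) (n s : ℕ) :
    ∑ ij ∈ antidiagonal n, binom(r, ij.1) * binom(l, ij.2) * binom(a + ij.1, s) =
      ∑ t ∈ range (s + 1), binom(r, t) * binom(a, s - t) *
        (if t ≤ n then binom(r + l - t, n - t) else 0) := by
  have h1 : ∀ i : ℕ, binom(a + i, s) =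
      ∑ t ∈ range (s + 1), (i.choose t : ℂ) * binom(a, s - t) := fun i => by
    rw [add_comm, ← choose_add_antidiagonal, Finset.Nat.sum_antidiagonal_eq_sum_range_succ
      (fun x y => binom(i, x) * binom(a, y))]
    simp only [Ring.choose_natCast]
  simp only [h1, mul_sum]
  rw [sum_comm]
  refine sum_congr rfl fun t _ => ?_
  have h2 := sum_natChoose_mul r l n t
  calc _ = binom(a, s - t) * ∑ ij ∈ antidiagonal n,
        (ij.1.choose t : ℂ) * (binom(r, ij.1) * binom(l, ij.2)) := by
        rw [mul_sum]
        exact sum_congr rfl fun ij _ => by ring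
    _ = _ := by
      rw [h2]
      split_ifs <;> ring

lemma sum_choose_choose_sub (r l a : ℂ) (n s : ℕ) :
    ∑ ij ∈ antidiagonal n, binom(r, ij.1) * binom(l, ij.2) *
        binom(a + r - ij.1, s) =
      ∑ t ∈ range (s + 1), binom(r, t) * binom(a, s - t) *
        binom(r + l - t, n) := by
  have h1 : ∀ i : ℕ, binom(r, i) * binom(a + r - i, s) =
      ∑ t ∈ range (s + 1), binom(r, t) * binom(r - t, i) * binom(a, s - t) :=
    fun i => by
    have h0 : a + r - i = (r - i) + a := by ring
    rw [h0, ← choose_add_antidiagonal, Finset.Nat.sum_antidiagonal_eq_sum_range_succ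
      (fun x y => binom(r - i, x) * binom(a, y)), mul_sum]
    exact sum_congr rfl fun t _ => by rw [← choose_mul_choose_sub, mul_assoc]
  calc _ = ∑ ij ∈ antidiagonal n, ∑ t ∈ range (s + 1),
        binom(l, ij.2) * (binom(r, t) * binom(r - t, ij.1) *
          binom(a, s - t)) := by
        refine sum_congr rfl fun ij _ => ?_
        rw [← mul_sum, ← h1]
        ring
    _ = _ := by
        rw [sum_comm]
        refine sum_congr rfl fun t _ => ?_
        have h2 : r + l - t = (r - t) + l := by ring
        rw [h2, ← choose_add_antidiagonal, mul_sum]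
        exact sum_congr rfl fun ij _ => by ring

lemma choose_add_one (x : ℂ) (i : ℕ) :
    binom(x + 1, i + 1) = binom(x, i) + binom(x, i + 1) :=
  Ring.choose_succ_succ x i

lemma sum_neg_one_pow_choose (x : ℂ) (n : ℕ) :
    ∑ ij ∈ antidiagonal n, (-1 : ℂ) ^ ij.1 * binom(x, ij.1) * binom(x - ij.1, ij.2) =
      if n = 0 then 1 else 0 := by
  have h1 : ∀ ij ∈ antidiagonal n, (-1 : ℂ) ^ ij.1 * binom(x, ij.1) *
      binom(x - ij.1, ij.2) = binom(x, n) * ((-1) ^ ij.1 * n.choose ij.1) := by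
    intro ij hij
    rw [mem_antidiagonal] at hij
    have := choose_mul_natChoose x (i := n) (t := ij.1) (by omega)
    rw [show n - ij.1 = ij.2 by omega] at this
    rw [mul_assoc, ← this]
    ring
  rw [sum_congr rfl h1, ← mul_sum,
    Finset.Nat.sum_antidiagonal_eq_sum_range_succ (fun x _ => (-1 : ℂ) ^ x * (n.choose x : ℂ))]
  have h2 := Int.alternating_sum_range_choose (n := n)
  have h3 : ∑ m ∈ range (n + 1), (-1 : ℂ) ^ m * (n.choose m : ℂ) = if n = 0 then 1 else 0 := by
    exact_mod_cast h2
  rw [h3]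
  split_ifs with h
  · simp [h]
  · simp

lemma neg_one_zpow_sub_nat (r : ℤ) (t : ℕ) : (-1 : ℂ) ^ (r - t) = (-1) ^ r * (-1) ^ t := by
  rw [zpow_sub₀ (by norm_num), zpow_natCast]
  rcases Nat.even_or_odd t with h | h <;> simp [h.neg_one_pow, div_neg]

lemma neg_one_zpow_mul_self (r : ℤ) : (-1 : ℂ) ^ r * (-1) ^ r = 1 := by
  rw [← mul_zpow]; norm_num

end Binomial
/-! ### Operator product expansions -/

section OPE

variable {M : Type*} [AddCommGroup M] [Module ℂ M]

/-- The family of modes of a field: each vector is annihilated by `A n` for `n` large. -/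
def TruncField (A : ℤ → End ℂ M) : Prop := ∀ w, ∃ N : ℤ, ∀ n, N ≤ n → A n w = 0

/-- For families `A`, `B` of modes indexed by `(1/k)ℤ`, the coefficient of `x₁^{-m/k-1} x₂^{-n/k-1}`
in `(x₁ - x₂)^l A(x₁) B(x₂) w`, the binomial being expanded in nonnegative powers of `x₂`.  The
sum has finitely many nonzero terms if `B` is truncated. -/
def ordProd (k : ℕ) (A B : ℤ → End ℂ M) (l m n : ℤ) (w : M) : M :=
  ∑ᶠ i : ℕ, ((-1) ^ i * binom(l, i)) • A (m + k * (l - i)) (B (n + k * i) w)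

variable {k : ℕ} {A A' B B' C : ℤ → End ℂ M}

lemma TruncField.add (hA : TruncField A) (hB : TruncField B) : TruncField (A + B) := fun w => by
  obtain ⟨N, hN⟩ := hA w
  obtain ⟨K, hK⟩ := hB w
  exact ⟨max N K, fun n hn => by
    simp [hN n (le_trans (le_max_left _ _) hn), hK n (le_trans (le_max_right _ _) hn)]⟩

lemma TruncField.smul (hA : TruncField A) (c : ℂ) : TruncField (c • A) := fun w =>
  (hA w).imp fun N hN n hn => by simp [hN n hn]

lemma TruncField.zero : TruncField (0 : ℤ → End ℂ M) := fun _ => ⟨0, fun _ _ => rfl⟩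

lemma TruncField.exists_nat [NeZero k] (hB : TruncField B) (n : ℤ) (w : M) :
    ∃ N : ℕ, ∀ i : ℕ, N ≤ i → B (n + k * i) w = 0 := by
  obtain ⟨N, hN⟩ := hB w
  refine ⟨(N - n).toNat, fun i hi => hN _ ?_⟩
  have hk : (1 : ℤ) ≤ k := by exact_mod_cast NeZero.one_le
  have : (i : ℤ) ≤ k * i := le_mul_of_one_le_left (by positivity) hk
  omega

lemma ordProd_eq_sum_range {l m n : ℤ} {w : M} {N : ℕ}
    (h : ∀ i : ℕ, N ≤ i → B (n + k * i) w = 0) :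
    ordProd k A B l m n w = ∑ i ∈ range N,
      ((-1) ^ i * binom(l, i)) • A (m + k * (l - i)) (B (n + k * i) w) :=
  finsum_eq_sum_range fun i hi => by rw [h i hi, map_zero, smul_zero]

lemma ordProd_hasFiniteSupport [NeZero k] (hB : TruncField B) (l m n : ℤ) (w : M) :
    Function.HasFiniteSupport fun i : ℕ =>
      ((-1) ^ i * binom(l, i)) • A (m + k * (l - i)) (B (n + k * i) w) := by
  obtain ⟨N, hN⟩ := hB.exists_nat (k := k) n w
  exact hasFiniteSupport_of_ge (N := N) fun i hi => by rw [hN i hi, map_zero, smul_zero]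

lemma ordProd_map_add [NeZero k] (hB : TruncField B) (l m n : ℤ) (w w' : M) :
    ordProd k A B l m n (w + w') = ordProd k A B l m n w + ordProd k A B l m n w' := by
  rw [ordProd, ordProd, ordProd, ← finsum_add_distrib (ordProd_hasFiniteSupport hB l m n w)
    (ordProd_hasFiniteSupport hB l m n w')]
  simp only [map_add, smul_add]

lemma ordProd_map_smul [NeZero k] (hB : TruncField B) (l m n : ℤ) (c : ℂ) (w : M) :
    ordProd k A B l m n (c • w) = c • ordProd k A B l m n w := by
  rw [ordProd, ordProd, finsum_smul_eq (ordProd_hasFiniteSupport hB l m n w)]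
  simp only [map_smul]
  exact finsum_congr fun i => smul_comm _ _ _

/-- `ordProd` as a linear operator. -/
def ordProdEnd (k : ℕ) [NeZero k] (A : ℤ → End ℂ M) {B : ℤ → End ℂ M}
    (hB : TruncField B) (l m n : ℤ) : End ℂ M where
  toFun := ordProd k A B l m n
  map_add' := ordProd_map_add hB l m n
  map_smul' := ordProd_map_smul hB l m n

lemma ordProd_map_zero (l m n : ℤ) : ordProd k A B l m n 0 = 0 :=
  finsum_eq_zero_of_forall_eq_zero fun i => by simp

lemma ordProd_add_left [NeZero k] (hB : TruncField B) (l m n : ℤ) (w : M) :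
    ordProd k (A + A') B l m n w = ordProd k A B l m n w + ordProd k A' B l m n w := by
  rw [ordProd, ordProd, ordProd, ← finsum_add_distrib (ordProd_hasFiniteSupport hB l m n w)
    (ordProd_hasFiniteSupport hB l m n w)]
  simp

lemma ordProd_add_right [NeZero k] (hB : TruncField B) (hB' : TruncField B') (l m n : ℤ) (w : M) :
    ordProd k A (B + B') l m n w = ordProd k A B l m n w + ordProd k A B' l m n w := by
  rw [ordProd, ordProd, ordProd, ← finsum_add_distrib (ordProd_hasFiniteSupport hB l m n w)
    (ordProd_hasFiniteSupport hB' l m n w)]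
  simp

lemma ordProd_smul_left [NeZero k] (hB : TruncField B) (c : ℂ) (l m n : ℤ) (w : M) :
    ordProd k (c • A) B l m n w = c • ordProd k A B l m n w := by
  rw [ordProd, ordProd, finsum_smul_eq (ordProd_hasFiniteSupport hB l m n w)]
  exact finsum_congr fun i => smul_comm _ _ _

lemma ordProd_smul_right [NeZero k] (hB : TruncField B) (c : ℂ) (l m n : ℤ) (w : M) :
    ordProd k A (c • B) l m n w = c • ordProd k A B l m n w := by
  rw [ordProd, ordProd, finsum_smul_eq (ordProd_hasFiniteSupport hB l m n w)]
  refine finsum_congr fun i => ?_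
  simp only [Pi.smul_apply, smul_apply, map_smul]
  exact smul_comm _ _ _

lemma ordProd_zero_left (l m n : ℤ) (w : M) :
    ordProd k (0 : ℤ → End ℂ M) B l m n w = 0 :=
  finsum_eq_zero_of_forall_eq_zero fun i => by simp

lemma ordProd_zero_right (l m n : ℤ) (w : M) :
    ordProd k A (0 : ℤ → End ℂ M) l m n w = 0 :=
  finsum_eq_zero_of_forall_eq_zero fun i => by simp

/-- Multiplication by `x₁ - x₂`. -/
lemma ordProd_succ [NeZero k] (hB : TruncField B) (l m n : ℤ) (w : M) :
    ordProd k A B (l + 1) m n w = ordProd k A B l (m + k) n w - ordProd k A B l m (n + k) w := by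
  obtain ⟨N, hN⟩ := hB.exists_nat (k := k) n w
  have hN' : ∀ i : ℕ, N ≤ i → B (n + k + k * i) w = 0 := fun i hi => by
    have := hN (i + 1) (by omega)
    rwa [show n + k * ((i + 1 : ℕ) : ℤ) = n + k + k * i by push_cast; ring] at this
  rw [ordProd_eq_sum_range (N := N + 1) fun i hi => hN i (by omega),
    ordProd_eq_sum_range (N := N + 1) fun i hi => hN i (by omega), ordProd_eq_sum_range hN',
    Finset.sum_range_succ', Finset.sum_range_succ']
  refine Eq.trans ?_ (add_sub_right_comm _ _ _).symm
  rw [← sum_sub_distrib]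
  refine congrArg₂ (· + ·) ?_ ?_
  · refine sum_congr rfl fun i _ => ?_
    rw [show m + (k : ℤ) * (l + 1 - ((i + 1 : ℕ) : ℤ)) = m + k * (l - i) by push_cast; ring,
      show m + (k : ℤ) + (k : ℤ) * (l - ((i + 1 : ℕ) : ℤ)) = m + k * (l - i) by push_cast; ring,
      show n + k * ((i + 1 : ℕ) : ℤ) = n + k + k * i by push_cast; ring, ← sub_smul]
    congr 1
    push_cast
    rw [choose_add_one]
    ring
  · simp only [pow_zero, Ring.choose_zero_right, Nat.cast_zero, sub_zero, mul_zero, add_zero]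
    congr 2
    ring_nf

lemma jacobiLHS_eq [NeZero k] (hA : TruncField A) (hB : TruncField B) (ε : ℂ) (l m n : ℤ) (w : M) :
    jacobiLHS k ε A B l m n w =
      ordProd k A B l m n w - (-1 : ℂ) ^ l • ordProd k (ε • B) A l n m w := by
  rw [ordProd_smul_left hA, smul_smul, mul_comm, ordProd, ordProd,
    finsum_smul_eq (ordProd_hasFiniteSupport hA l n m w), ← finsum_sub_distrib
    (ordProd_hasFiniteSupport hB l m n w)]
  · refine finsum_congr fun i => ?_
    rw [smul_sub, smul_comm]
  · obtain ⟨N, hN⟩ := hA.exists_nat (k := k) m w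
    exact hasFiniteSupport_of_ge (N := N) fun i hi => by simp [hN i hi]

/-- The operator product expansion of a field `A`, whose modes are indexed by `ℤ + j/k`, and a
field `B`: the products `P l` of the two fields satisfy
`x₀⁻¹ δ((x₁-x₂)/x₀) A(x₁) B(x₂) - x₀⁻¹ δ((x₂-x₁)/(-x₀)) B'(x₂) A(x₁) =
  ∑_l x₀^{-l-1} x₂⁻¹ δ((x₁-x₀)/x₂) ((x₁-x₀)/x₂)^{-j/k} (P l)(x₂)`.
Here `B'` is `B` up to a sign. -/
structure OPE (k : ℕ) (j : ℤ) (A B B' : ℤ → End ℂ M) (P : ℤ → ℤ → End ℂ M) :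
    Prop where
  bdd : ∃ L : ℤ, ∀ l, L ≤ l → P l = 0
  eq : ∀ (l m n : ℤ) (w : M), m ≡ j [ZMOD k] →
    ordProd k A B l m n w - (-1 : ℂ) ^ l • ordProd k B' A l n m w =
      ∑ᶠ i : ℕ, binom((m : ℂ) / k, i) • P (l + i) (m + n - k * i) w

lemma exists_nat_of_bdd {X : Type*} [Zero X] {P : ℤ → X} (h : ∃ L : ℤ, ∀ l, L ≤ l → P l = 0)
    (l : ℤ) :
    ∃ N : ℕ, ∀ i : ℕ, N ≤ i → P (l + i) = 0 := by
  obtain ⟨L, hL⟩ := h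
  exact ⟨(L - l).toNat, fun i hi => hL _ (by omega)⟩

/-- A triangular system: its only solution is zero. -/
lemma eq_zero_of_triangular {P : ℤ → ℤ → End ℂ M} (hP : ∃ L : ℤ, ∀ l, L ≤ l → P l = 0)
    (x : ℂ) (h : ∀ (l n : ℤ) (w : M), ∑ᶠ i : ℕ, binom(x, i) • P (l + i) (n - k * i) w = 0) :
    P = 0 := by
  obtain ⟨L, hL⟩ := hP
  suffices H : ∀ t : ℕ, ∀ l, L - t ≤ l → P l = 0 by
    funext l
    exact H (L - l).toNat l (by omega)
  intro t
  induction t with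
  | zero => intro l hl; exact hL l (by omega)
  | succ t ih =>
    intro l hl
    funext n
    ext w
    have h1 := h l n w
    rw [finsum_eq_sum_range (N := 1)] at h1
    · simpa using h1
    · intro i hi
      rw [ih (l + i) (by push_cast at hl; omega)]
      simp

/-- The products are determined by the fields. -/
lemma OPE.unique {j : ℤ} {P Q : ℤ → ℤ → End ℂ M} (hP : OPE k j A B B' P)
    (hQ : OPE k j A B B' Q) : P = Q := by
  rw [← sub_eq_zero]
  refine eq_zero_of_triangular (k := k) ?_ ((j : ℂ) / k) fun l n w => ?_
  · obtain ⟨L, hL⟩ := hP.bdd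
    obtain ⟨K, hK⟩ := hQ.bdd
    exact ⟨max L K, fun l hl => by
      simp [hL l (le_trans (le_max_left _ _) hl), hK l (le_trans (le_max_right _ _) hl)]⟩
  · have h1 := hP.eq l j (n - j) w rfl
    have h2 := hQ.eq l j (n - j) w rfl
    rw [h1] at h2
    obtain ⟨N, hN⟩ := exists_nat_of_bdd hP.bdd l
    obtain ⟨K, hK⟩ := exists_nat_of_bdd hQ.bdd l
    rw [← sub_eq_zero, ← finsum_sub_distrib
      (hasFiniteSupport_of_ge (N := N) fun i hi => by simp [hN i hi])
      (hasFiniteSupport_of_ge (N := K) fun i hi => by simp [hK i hi])] at h2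
    rw [← h2]
    refine finsum_congr fun i => ?_
    rw [show j + (n - j) = n by ring, ← smul_sub]
    rfl

/-- The right-hand side of the Jacobi identity satisfies the same recursion as the left-hand
side. -/
lemma ope_rhs_succ [NeZero k] {P : ℤ → ℤ → End ℂ M}
    (hP : ∃ L : ℤ, ∀ l, L ≤ l → P l = 0) (l m n : ℤ) (w : M) :
    ∑ᶠ i : ℕ, binom((m : ℂ) / k, i) • P (l + 1 + i) (m + n - k * i) w =
      ∑ᶠ i : ℕ, binom(((m + k : ℤ) : ℂ) / k, i) • P (l + i) (m + k + n - k * i) w -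
      ∑ᶠ i : ℕ, binom((m : ℂ) / k, i) • P (l + i) (m + (n + k) - k * i) w := by
  obtain ⟨N, hN⟩ := exists_nat_of_bdd hP l
  have hk : (k : ℂ) ≠ 0 := by exact_mod_cast NeZero.ne k
  rw [finsum_eq_sum_range (N := N) fun i hi => by
      rw [show l + 1 + (i : ℤ) = l + ((i + 1 : ℕ) : ℤ) by push_cast; ring,
        hN (i + 1) (by omega)]; simp,
    finsum_eq_sum_range (N := N + 1) fun i hi => by rw [hN i (by omega)]; simp,
    finsum_eq_sum_range (N := N + 1) fun i hi => by rw [hN i (by omega)]; simp,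
    ← sum_sub_distrib, Finset.sum_range_succ']
  simp only [Nat.cast_zero, mul_zero, sub_zero, Ring.choose_zero_right, one_smul,
    show m + k + n = m + (n + k) by ring, sub_self, add_zero]
  refine sum_congr rfl fun i _ => ?_
  rw [← sub_smul, show l + 1 + (i : ℤ) = l + ((i + 1 : ℕ) : ℤ) by push_cast; ring,
    show m + (n + k) - (k : ℤ) * ((i + 1 : ℕ) : ℤ) = m + n - k * i by push_cast; ring]
  congr 1
  push_cast
  rw [add_div, div_self hk, choose_add_one]
  ring

/-- The left-hand side of the Jacobi identity under multiplication by `x₁ - x₂`. -/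
lemma jac_succ [NeZero k] (hA : TruncField A) (hB : TruncField B) (l m n : ℤ) (w : M) :
    ordProd k A B (l + 1) m n w - (-1 : ℂ) ^ (l + 1) • ordProd k B' A (l + 1) n m w =
      (ordProd k A B l (m + k) n w - (-1 : ℂ) ^ l • ordProd k B' A l n (m + k) w) -
      (ordProd k A B l m (n + k) w - (-1 : ℂ) ^ l • ordProd k B' A l (n + k) m w) := by
  rw [ordProd_succ hB, ordProd_succ hA, zpow_add_one₀ (by norm_num)]
  module

/-- A function of the three exponents satisfying the recursion of the Jacobi identity vanishes if
it vanishes for large powers of `x₁ - x₂` (locality), and for one exponent of `x₁`. -/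
lemma eq_zero_of_recursion {D : ℤ → ℤ → ℤ → M} {k : ℕ} [NeZero k] (j : ℤ)
    (hrec : ∀ l m n, m ≡ j [ZMOD k] → D (l + 1) m n = D l (m + k) n - D l m (n + k))
    (hloc : ∃ L : ℤ, ∀ l, L ≤ l → ∀ m n, m ≡ j [ZMOD k] → D l m n = 0)
    (hone : ∀ l n, D l j n = 0) (l m n : ℤ) (hm : m ≡ j [ZMOD k]) : D l m n = 0 := by
  obtain ⟨L, hL⟩ := hloc
  suffices H : ∀ t : ℕ, ∀ l, L - t ≤ l → ∀ m n, m ≡ j [ZMOD k] → D l m n = 0 from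
    H (L - l).toNat l (by omega) m n hm
  intro t
  induction t with
  | zero => intro l hl; exact hL l (by omega)
  | succ t ih =>
    intro l hl m n hm
    have hstep : ∀ m n, m ≡ j [ZMOD k] → D l (m + k) n = D l m (n + k) := fun m n hm => by
      rw [← sub_eq_zero, ← hrec l m n hm]
      exact ih (l + 1) (by push_cast at hl; omega) m n hm
    -- the recursion moves `k` from one exponent to the other, so the exponent `j` suffices
    obtain ⟨q, hq⟩ := hm.symm.dvd
    obtain rfl : m = j + k * q := by linarith
    clear hq hm
    have hmod : ∀ q : ℤ, j + k * q ≡ j [ZMOD k] := fun q => by simp [Int.ModEq]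
    induction q using Int.induction_on generalizing n with
    | zero => simpa using hone l n
    | succ i h =>
      rw [show j + (k : ℤ) * (i + 1) = j + k * i + k by ring, hstep _ _ (hmod _)]
      exact h _
    | pred i h =>
      have := hstep (j + k * (-i - 1)) (n - k) (hmod _)
      rw [show j + (k : ℤ) * (-i - 1) + k = j + k * (-i) by ring, sub_add_cancel] at this
      rw [← this]
      exact h _

/-- Given locality, the Jacobi identity needs checking for one exponent of `x₁` only. -/
lemma OPE.of_recursion [NeZero k] {j : ℤ} {P : ℤ → ℤ → End ℂ M} (hA : TruncField A)
    (hB : TruncField B) (hP : ∃ L : ℤ, ∀ l, L ≤ l → P l = 0)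
    (hloc : ∃ L : ℤ, ∀ l, L ≤ l → ∀ m n w, m ≡ j [ZMOD k] →
      ordProd k A B l m n w - (-1 : ℂ) ^ l • ordProd k B' A l n m w = 0)
    (hone : ∀ l n w, ordProd k A B l j n w - (-1 : ℂ) ^ l • ordProd k B' A l n j w =
      ∑ᶠ i : ℕ, binom((j : ℂ) / k, i) • P (l + i) (j + n - k * i) w) :
    OPE k j A B B' P := by
  refine ⟨hP, fun l m n w hm => ?_⟩
  rw [← sub_eq_zero]
  refine eq_zero_of_recursion (k := k) (D := fun l m n =>
    (ordProd k A B l m n w - (-1 : ℂ) ^ l • ordProd k B' A l n m w) -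
      ∑ᶠ i : ℕ, binom((m : ℂ) / k, i) • P (l + i) (m + n - k * i) w) j ?_ ?_ ?_ l m n hm
  · intro l m n _
    simp only [jac_succ hA hB, ope_rhs_succ hP]
    abel
  · obtain ⟨L, hL⟩ := hloc
    obtain ⟨K, hK⟩ := hP
    refine ⟨max L K, fun l hl m n hm => ?_⟩
    rw [hL l (le_trans (le_max_left _ _) hl) m n w hm, zero_sub, neg_eq_zero]
    refine finsum_eq_zero_of_forall_eq_zero fun i => ?_
    rw [hK (l + i) (by have := le_trans (le_max_right _ _) hl; omega)]
    simp
  · intro l n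
    rw [hone, sub_self]

/-- Local fields have an operator product expansion. -/
lemma OPE.exists_of_local [NeZero k] {j : ℤ} (hA : TruncField A) (hB : TruncField B)
    (hloc : ∃ L : ℤ, ∀ l, L ≤ l → ∀ m n w, m ≡ j [ZMOD k] →
      ordProd k A B l m n w - (-1 : ℂ) ^ l • ordProd k B' A l n m w = 0) :
    ∃ P, OPE k j A B B' P := by
  obtain ⟨L, hL⟩ := hloc
  let J : ℤ → ℤ → End ℂ M := fun l n =>
    ordProdEnd k A hB l j n - (-1 : ℂ) ^ l • ordProdEnd k B' hA l n j
  have hJ : ∀ l, L ≤ l → J l = 0 := fun l hl => by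
    funext n
    ext w
    exact hL l hl j n w rfl
  -- inverting `(1 + x₀/x₂)^{j/k}` solves the identity with exponent `j` for the products
  let P : ℤ → ℤ → End ℂ M := fun l n =>
    ∑ i ∈ range (L - l).toNat, binom(-((j : ℂ) / k), i) • J (l + i) (n - j - k * i)
  have hPN : ∀ l n (N : ℕ), (L - l).toNat ≤ N → P l n = ∑ i ∈ range N,
      binom(-((j : ℂ) / k), i) • J (l + i) (n - j - k * i) := by
    intro l n N hN
    refine Finset.sum_subset (Finset.range_mono hN) fun i _ hi => ?_
    rw [hJ (l + i) (by simp at hi; omega)]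
    simp
  have hP0 : ∀ l, L ≤ l → P l = 0 := fun l hl => by
    funext n
    simp [P, show (L - l).toNat = 0 by omega]
  refine ⟨P, OPE.of_recursion hA hB ⟨L, hP0⟩ ⟨L, hL⟩ fun l n w => ?_⟩
  let N := (L - l).toNat
  have hbox : Boxed fun i p => (binom((j : ℂ) / k, i) * binom(-((j : ℂ) / k), p)) •
      J (l + i + p) (n - k * i - k * p) w := by
    refine ⟨N, fun i p hip => ?_⟩
    dsimp only
    rw [hJ (l + i + p) (by omega)]
    simp
  have h1 : ∀ i : ℕ, binom((j : ℂ) / k, i) • P (l + i) (j + n - k * i) w =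
      ∑ᶠ p : ℕ, (binom((j : ℂ) / k, i) * binom(-((j : ℂ) / k), p)) •
        J (l + i + p) (n - k * i - k * p) w := by
    intro i
    rw [hPN (l + i) _ N (by omega), finsum_eq_sum_range (N := N)]
    · simp only [sum_apply, smul_apply, smul_sum, smul_smul]
      refine sum_congr rfl fun p _ => ?_
      congr 3
      ring
    · intro p hp
      rw [hJ (l + i + p) (by omega)]
      simp
  rw [finsum_congr h1, hbox.finsum_antidiagonal, finsum_eq_sum_range (N := 1)]
  · simp
    rfl
  · intro u hu
    have h2 : ∀ ij ∈ antidiagonal u,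
        (binom((j : ℂ) / k, ij.1) * binom(-((j : ℂ) / k), ij.2)) •
        J (l + ij.1 + ij.2) (n - k * ij.1 - k * ij.2) w =
        (binom((j : ℂ) / k, ij.1) * binom(-((j : ℂ) / k), ij.2)) •
          J (l + u) (n - k * u) w := by
      intro ij hij
      rw [mem_antidiagonal] at hij
      rw [← hij]
      push_cast
      congr 3 <;> ring
    rw [sum_congr rfl h2, ← sum_smul, choose_add_antidiagonal, add_neg_cancel,
      Ring.choose_zero_pos ℂ (by omega), zero_smul]

/-- The products of two fields in terms of their modes. -/
lemma OPE.product_eq [NeZero k] {j : ℤ} {P : ℤ → ℤ → End ℂ M} (hP : OPE k j A B B' P)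
    (l n : ℤ) (w : M) :
    P l n w = ∑ᶠ i : ℕ, ((-1) ^ i * binom((j : ℂ) / k, i)) •
      (ordProd k A B (l + i) (j - k * i) (n - j) w -
        (-1 : ℂ) ^ (l + i) • ordProd k B' A (l + i) (n - j) (j - k * i) w) := by
  have hk : (k : ℂ) ≠ 0 := by exact_mod_cast NeZero.ne k
  obtain ⟨N, hN⟩ := exists_nat_of_bdd hP.bdd l
  have hbox : Boxed fun i p => ((-1) ^ i * binom((j : ℂ) / k, i) *
      binom((j : ℂ) / k - i, p)) • P (l + (i + p : ℕ)) (n - k * (i + p : ℕ)) w := by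
    refine ⟨N, fun i p hip => ?_⟩
    dsimp only
    rw [hN (i + p) (by omega)]
    simp
  have h1 : ∀ i : ℕ, ((-1) ^ i * binom((j : ℂ) / k, i)) •
      (ordProd k A B (l + i) (j - k * i) (n - j) w -
        (-1 : ℂ) ^ (l + i) • ordProd k B' A (l + i) (n - j) (j - k * i) w) =
      ∑ᶠ p : ℕ, ((-1) ^ i * binom((j : ℂ) / k, i) *
        binom((j : ℂ) / k - i, p)) • P (l + (i + p : ℕ)) (n - k * (i + p : ℕ)) w := by
    intro i
    rw [hP.eq _ _ _ _ (by simp [Int.ModEq]), finsum_smul_eq]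
    · refine finsum_congr fun p => ?_
      rw [smul_smul]
      push_cast
      rw [sub_div, mul_div_cancel_left₀ _ hk]
      congr 3 <;> ring
    · refine hasFiniteSupport_of_ge (N := N) fun p hp => ?_
      have := hN (i + p) (by omega)
      push_cast at this
      rw [← add_assoc] at this
      rw [this]
      simp
  rw [finsum_congr h1, hbox.finsum_antidiagonal, finsum_eq_sum_range (N := 1)]
  · simp
  · intro u hu
    have h2 : ∀ ij ∈ antidiagonal u,
        ((-1) ^ ij.1 * binom((j : ℂ) / k, ij.1) * binom((j : ℂ) / k - ij.1, ij.2)) •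
          P (l + (ij.1 + ij.2 : ℕ)) (n - k * (ij.1 + ij.2 : ℕ)) w =
        ((-1) ^ ij.1 * binom((j : ℂ) / k, ij.1) * binom((j : ℂ) / k - ij.1, ij.2)) •
          P (l + u) (n - k * u) w := by
      intro ij hij
      rw [mem_antidiagonal] at hij
      rw [hij]
    rw [sum_congr rfl h2, ← sum_smul, sum_neg_one_pow_choose, if_neg (by omega),
      zero_smul]

end OPE
/-! ### Associativity of operator products -/

section Assoc

variable {M : Type*} [AddCommGroup M] [Module ℂ M]

lemma Boxed.of_add {f : ℕ → ℕ → M} {N : ℕ} (h : ∀ i p, N ≤ i + p → f i p = 0) : Boxed f :=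
  ⟨N, fun i p hip => h i p (by omega)⟩

lemma Boxed.of_right {f : ℕ → ℕ → M} {N : ℕ} (h : ∀ i p, N ≤ p → f i p = 0)
    (h' : ∀ p, ∃ K, ∀ i, K ≤ i → f i p = 0) : Boxed f :=
  (Boxed.of_left (f := fun p i => f i p) (fun p i hp => h i p hp) h').swap

/-- The coefficient extraction for `(x₁ - x₂)^r (x₂ - x₃)^l`, where `F i p` is the
term obtained from the `i`-th and `p`-th terms of the two binomial expansions. -/
def binomSum (r l : ℤ) (F : ℕ → ℕ → M) : M :=
  ∑ᶠ i : ℕ, ∑ᶠ p : ℕ, ((-1) ^ (i + p) * binom(r, i) * binom(l, p)) • F i p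

lemma binomSum_eq_left {r l : ℤ} {F : ℕ → ℕ → M} (hF : Boxed F) :
    binomSum r l F = ∑ᶠ i : ℕ, ((-1) ^ i * binom(r, i)) •
      ∑ᶠ p : ℕ, ((-1) ^ p * binom(l, p)) • F i p := by
  obtain ⟨N, hN⟩ := hF
  refine finsum_congr fun i => ?_
  rw [smul_finsum_ge (N := N) (fun p hp => by simp [hN i p (Or.inr hp)])]
  refine finsum_congr fun p => ?_
  rw [smul_smul]
  congr 1
  ring

lemma binomSum_eq_right {r l : ℤ} {F : ℕ → ℕ → M} (hF : Boxed F) :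
    binomSum r l F = ∑ᶠ p : ℕ, ((-1) ^ p * binom(l, p)) •
      ∑ᶠ i : ℕ, ((-1) ^ i * binom(r, i)) • F i p := by
  rw [binomSum, Boxed.finsum_comm (hF.smul _)]
  obtain ⟨N, hN⟩ := hF
  refine finsum_congr fun p => ?_
  rw [smul_finsum_ge (N := N) (fun i hi => by simp [hN i p (Or.inl hi)])]
  refine finsum_congr fun i => ?_
  rw [smul_smul]
  congr 1
  ring

lemma binomSum_sub {r l : ℤ} {F G : ℕ → ℕ → M} (hF : Boxed F) (hG : Boxed G) (c : ℂ) :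
    binomSum r l (fun i p => F i p - c • G i p) = binomSum r l F - c • binomSum r l G := by
  have h1 := (hF.smul fun i p =>
    (-1) ^ (i + p) * binom(r, i) * binom(l, p))
  have h2 := (hG.smul fun i p =>
    (-1) ^ (i + p) * binom(r, i) * binom(l, p))
  rw [binomSum, binomSum, binomSum, sub_eq_add_neg, ← neg_smul, ← h2.finsum_smul,
    ← h1.finsum_add (h2.smul fun _ _ => -c)]
  refine finsum_congr fun i => finsum_congr fun p => ?_
  module

lemma binomSum_swap {r l : ℤ} {G : ℕ → ℕ → M} (h : Boxed G) :
    binomSum r l G = binomSum l r fun i p => G p i := by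
  rw [binomSum_eq_left h, binomSum_eq_right h.swap]

variable {k : ℕ} [NeZero k] {A B C G : ℤ → End ℂ M}

lemma Boxed.sub {f g : ℕ → ℕ → M} (hf : Boxed f) (hg : Boxed g) :
    Boxed fun i p => f i p - g i p := by
  obtain ⟨N, hN⟩ := hf
  obtain ⟨K, hK⟩ := hg
  refine ⟨max N K, fun i p hip => ?_⟩
  simp only [hN i p (by omega), hK i p (by omega), sub_zero]

lemma Boxed.finsum_sub {f g : ℕ → ℕ → M} (hf : Boxed f) (hg : Boxed g) :
    ∑ᶠ i, ∑ᶠ p, (f i p - g i p) = ∑ᶠ i, ∑ᶠ p, f i p - ∑ᶠ i, ∑ᶠ p, g i p := by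
  have h := hf.finsum_add (hg.smul fun _ _ => (-1 : ℂ))
  rw [hg.finsum_smul, neg_one_smul, ← sub_eq_add_neg] at h
  rw [← h]
  exact finsum_congr fun i => finsum_congr fun p => by rw [neg_one_smul, sub_eq_add_neg]

lemma finsum_finsum_sum_comm (S : Finset ℕ) {f : ℕ → ℕ → ℕ → M}
    (h : ∀ s, Boxed fun i p => f s i p) :
    ∑ᶠ i, ∑ᶠ p, ∑ s ∈ S, f s i p = ∑ s ∈ S, ∑ᶠ i, ∑ᶠ p, f s i p := by
  choose N hN using h
  have hle : ∀ s ∈ S, N s ≤ S.sup N := fun s hs => Finset.le_sup hs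
  rw [finsum_finsum_eq_sum_range (N := S.sup N) fun i p hip => sum_eq_zero fun s hs =>
    hN s i p (by have := hle s hs; omega)]
  rw [sum_congr rfl fun i _ => sum_comm, sum_comm]
  refine sum_congr rfl fun s hs => ?_
  rw [finsum_finsum_eq_sum_range (N := S.sup N) fun i p hip =>
    hN s i p (by have := hle s hs; omega)]

/-- Expansion of a polynomial weight in the summation index: the first factor is the leftmost. -/
lemma finsum_choose_add_smul (hG : TruncField G) (r l : ℤ) (x : ℂ) (s : ℕ) (b d : ℤ) (w : M) :
    ∑ᶠ i : ℕ, ∑ᶠ p : ℕ, ((-1) ^ (i + p) * binom(r, i) * binom(l, p) *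
        binom(x + i, s)) • B (b + k * (r + l - (i + p : ℕ))) (G (d + k * (i + p : ℕ)) w) =
      ∑ t ∈ range (s + 1), ((-1) ^ t * binom(r, t) * binom(x, s - t)) •
        ordProd k B G (r + l - t) b (d + k * t) w := by
  obtain ⟨N, hN⟩ := hG.exists_nat (k := k) d w
  let X : ℕ → M := fun n => B (b + k * (r + l - n)) (G (d + k * n) w)
  have hX : ∀ n, N ≤ n → X n = 0 := fun n hn => by simp only [X, hN n hn, map_zero]
  have hbox : Boxed fun i p => ((-1) ^ (i + p) * binom(r, i) *
      binom(l, p) * binom(x + i, s)) • X (i + p) :=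
    Boxed.of_add (N := N) fun i p h => by simp only [hX _ h, smul_zero]
  rw [hbox.finsum_antidiagonal, finsum_eq_sum_range (N := N)]
  · have h1 : ∀ t : ℕ, ordProd k B G (r + l - t) b (d + k * t) w = ∑ n ∈ range N,
        (if t ≤ n then (-1) ^ (n - t) * binom((r : ℂ) + l - t, n - t) else 0) • X n := by
      intro t
      rw [← finsum_eq_sum_range (fun n hn => by rw [hX n hn, smul_zero]),
        ← finsum_shift t (fun i hi => by rw [if_neg (by omega), zero_smul])]
      refine finsum_congr fun q => ?_
      rw [if_pos (by omega), Nat.add_sub_cancel_left]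
      rw [show d + k * t + k * q = d + k * ((t + q : ℕ) : ℤ) by push_cast; ring,
        show b + k * (r + l - t - q) = b + k * (r + l - ((t + q : ℕ) : ℤ)) by push_cast; ring]
      congr 2
      push_cast
      ring_nf
    simp only [h1, smul_sum]
    rw [sum_comm]
    refine sum_congr rfl fun n _ => ?_
    have h2 : ∀ ij ∈ antidiagonal n, ((-1) ^ (ij.1 + ij.2) *
        binom(r, ij.1) * binom(l, ij.2) * binom(x + ij.1, s)) •
          X (ij.1 + ij.2) = ((-1) ^ n * (binom(r, ij.1) * binom(l, ij.2) *
        binom(x + ij.1, s))) • X n := by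
      intro ij hij
      rw [mem_antidiagonal] at hij
      rw [hij]
      congr 1
      ring
    rw [sum_congr rfl h2, ← sum_smul, ← mul_sum, sum_choose_choose_add,
      mul_sum, sum_smul]
    refine sum_congr rfl fun t _ => ?_
    rw [smul_smul]
    congr 1
    split_ifs with h
    · obtain ⟨q, rfl⟩ := Nat.exists_eq_add_of_le h
      rw [Nat.add_sub_cancel_left, pow_add]
      ring
    · ring
  · intro n hn
    refine sum_eq_zero fun ij hij => ?_
    rw [mem_antidiagonal] at hij
    rw [hij, hX n hn, smul_zero]

/-- Expansion of a polynomial weight in the summation index: the first factor is the rightmost. -/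
lemma finsum_choose_sub_smul (hB : TruncField B) (r l : ℤ) (x : ℂ) (s : ℕ) (b d : ℤ) (w : M) :
    ∑ᶠ i : ℕ, ∑ᶠ p : ℕ, ((-1) ^ (i + p) * binom(r, i) * binom(l, p) *
        binom(x + r - i, s)) •
          G (d + k * (r + l - (i + p : ℕ))) (B (b + k * (i + p : ℕ)) w) =
      ∑ t ∈ range (s + 1), (binom(r, t) * binom(x, s - t)) •
        ordProd k G B (r + l - t) (d + k * t) b w := by
  obtain ⟨N, hN⟩ := hB.exists_nat (k := k) b w
  let X : ℕ → M := fun n => G (d + k * (r + l - n)) (B (b + k * n) w)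
  have hX : ∀ n, N ≤ n → X n = 0 := fun n hn => by simp only [X, hN n hn, map_zero]
  have hbox : Boxed fun i p => ((-1) ^ (i + p) * binom(r, i) *
      binom(l, p) * binom(x + r - i, s)) • X (i + p) :=
    Boxed.of_add (N := N) fun i p h => by simp only [hX _ h, smul_zero]
  rw [hbox.finsum_antidiagonal, finsum_eq_sum_range (N := N)]
  · have h1 : ∀ t : ℕ, ordProd k G B (r + l - t) (d + k * t) b w = ∑ n ∈ range N,
        ((-1) ^ n * binom((r : ℂ) + l - t, n)) • X n := by
      intro t
      rw [ordProd_eq_sum_range hN]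
      refine sum_congr rfl fun n _ => ?_
      push_cast
      congr 2
      ring_nf
    simp only [h1, smul_sum]
    rw [sum_comm]
    refine sum_congr rfl fun n _ => ?_
    have h2 : ∀ ij ∈ antidiagonal n, ((-1) ^ (ij.1 + ij.2) *
        binom(r, ij.1) * binom(l, ij.2) * binom(x + r - ij.1, s)) •
          X (ij.1 + ij.2) = ((-1) ^ n * (binom(r, ij.1) * binom(l, ij.2) *
        binom(x + r - ij.1, s))) • X n := by
      intro ij hij
      rw [mem_antidiagonal] at hij
      rw [hij]
      congr 1
      ring
    rw [sum_congr rfl h2, ← sum_smul, ← mul_sum, sum_choose_choose_sub,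
      mul_sum, sum_smul]
    refine sum_congr rfl fun t _ => ?_
    rw [smul_smul]
    congr 1
    ring
  · intro n hn
    refine sum_eq_zero fun ij hij => ?_
    rw [mem_antidiagonal] at hij
    rw [hij, hX n hn, smul_zero]

lemma finsum_choose_zero_smul (f : ℕ → ℂ) (F : ℕ → M) :
    ∑ᶠ p : ℕ, (f p * binom(((0 : ℤ) : ℂ), p)) • F p = f 0 • F 0 := by
  rw [finsum_eq_sum_range (N := 1)]
  · simp
  · intro p hp
    rw [Int.cast_zero, Ring.choose_zero_pos ℂ (by omega), mul_zero, zero_smul]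

lemma finsum_choose_add_smul' (hG : TruncField G) (r : ℤ) (x : ℂ) (s : ℕ) (b d : ℤ) (w : M) :
    ∑ᶠ i : ℕ, ((-1) ^ i * binom(r, i) * binom(x + i, s)) •
        B (b + k * (r - i)) (G (d + k * i) w) =
      ∑ t ∈ range (s + 1), ((-1) ^ t * binom(r, t) * binom(x, s - t)) •
        ordProd k B G (r - t) b (d + k * t) w := by
  have h := finsum_choose_add_smul (k := k) (B := B) hG r 0 x s b d w
  rw [add_zero] at h
  rw [← h]
  refine finsum_congr fun i => ?_
  have h1 := finsum_choose_zero_smul (fun p => (-1) ^ (i + p) * binom(r, i) *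
    binom(x + i, s)) fun p => B (b + k * (r - (i + p : ℕ))) (G (d + k * (i + p : ℕ)) w)
  simp only [add_zero] at h1
  rw [← h1]
  refine finsum_congr fun p => ?_
  congr 1
  ring

lemma finsum_choose_sub_smul' (hB : TruncField B) (r : ℤ) (x : ℂ) (s : ℕ) (b d : ℤ) (w : M) :
    ∑ᶠ i : ℕ, ((-1) ^ i * binom(r, i) * binom(x + r - i, s)) •
          G (d + k * (r - i)) (B (b + k * i) w) =
      ∑ t ∈ range (s + 1), (binom(r, t) * binom(x, s - t)) •
        ordProd k G B (r - t) (d + k * t) b w := by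
  have h := finsum_choose_sub_smul (k := k) (G := G) hB r 0 x s b d w
  rw [add_zero] at h
  rw [← h]
  refine finsum_congr fun i => ?_
  have h1 := finsum_choose_zero_smul (fun p => (-1) ^ (i + p) * binom(r, i) *
    binom(x + r - i, s)) fun p => G (d + k * (r - (i + p : ℕ))) (B (b + k * (i + p : ℕ)) w)
  simp only [add_zero] at h1
  rw [← h1]
  refine finsum_congr fun p => ?_
  congr 1
  ring

lemma boxed_nested (hB : TruncField B) (hC : TruncField C) {Φ : ℕ → ℕ → End ℂ M} {g : ℕ → ℤ}
    (c : ℤ) (w : M) : Boxed fun i p : ℕ => Φ i p (B (g p + k * i) (C (c + k * p) w)) := by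
  obtain ⟨N, hN⟩ := hC.exists_nat (k := k) c w
  refine Boxed.of_right (N := N) (fun i p hp => by simp only [hN p hp, map_zero]) fun p => ?_
  obtain ⟨K, hK⟩ := hB.exists_nat (k := k) (g p) (C (c + k * p) w)
  exact ⟨K, fun i hi => by simp only [hK i hi, map_zero]⟩

lemma boxed_diagonal (hC : TruncField C) {Φ Ψ : ℕ → ℕ → End ℂ M} (c : ℤ) (w : M) :
    Boxed fun i p : ℕ => Φ i p (Ψ i p (C (c + k * i + k * p) w)) := by
  obtain ⟨N, hN⟩ := hC.exists_nat (k := k) c w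
  refine Boxed.of_add (N := N) fun i p h => ?_
  rw [add_assoc, ← mul_add, ← Nat.cast_add, hN _ h, map_zero, map_zero]

lemma div_add_natCast_mul {k : ℕ} [NeZero k] (x : ℤ) (i : ℕ) :
    ((x + k * i : ℤ) : ℂ) / k = x / k + i := by
  have hk : (k : ℂ) ≠ 0 := by exact_mod_cast NeZero.ne k
  push_cast
  rw [add_div, mul_div_cancel_left₀ _ hk]

lemma sub_div_natCast {k : ℕ} [NeZero k] (x r : ℤ) (i : ℕ) :
    ((x + k * (r - i) : ℤ) : ℂ) / k = x / k + r - i := by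
  have hk : (k : ℂ) ≠ 0 := by exact_mod_cast NeZero.ne k
  push_cast
  rw [add_div, mul_div_cancel_left₀ _ hk, add_sub_assoc]

lemma smul_ordProd (hB : TruncField B) (x : ℂ) (l m n : ℤ) (w : M) :
    x • ordProd k A B l m n w = ∑ᶠ i : ℕ, ((-1) ^ i * binom(l, i) * x) •
      A (m + k * (l - i)) (B (n + k * i) w) := by
  rw [ordProd, finsum_smul_eq (ordProd_hasFiniteSupport hB _ _ _ _)]
  exact finsum_congr fun i => by rw [smul_smul, mul_comm]

/-- The operator product expansion of two fields, multiplied by a third field whose modes enter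
through the operators `Φ i` on the left or through the vectors `v i` on the right. -/
lemma OPE.binomSum_eq_finsum {j : ℤ} {ε : ℂ} {C₁ : ℤ → End ℂ M} {T : ℤ → ℤ → End ℂ M}
    {Φ : ℕ → End ℂ M} {b c : ℕ → ℤ} {v : ℕ → M} (hB : TruncField B) (hC : TruncField C)
    (h : OPE k j B C (ε • C₁) T) (r l : ℤ) (hb : ∀ i, b i ≡ j [ZMOD k])
    (h1 : Boxed fun i p : ℕ => Φ i (B (b i + k * (l - p)) (C (c i + k * p) (v i))))
    (h2 : Boxed fun i p : ℕ => Φ i (C₁ (c i + k * (l - p)) (B (b i + k * p) (v i))))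
    (hK : ∀ s : ℕ, ∃ K : ℕ, ∀ i, K ≤ i → Φ i (T (l + s) (b i + c i - k * s) (v i)) = 0) :
    binomSum r l (fun i p => Φ i (B (b i + k * (l - p)) (C (c i + k * p) (v i)))) -
      (ε * (-1) ^ l) •
        binomSum r l (fun i p => Φ i (C₁ (c i + k * (l - p)) (B (b i + k * p) (v i)))) =
      ∑ᶠ s : ℕ, ∑ᶠ i : ℕ, ((-1) ^ i * binom(r, i) * binom((b i : ℂ) / k, s)) •
        Φ i (T (l + s) (b i + c i - k * s) (v i)) := by
  obtain ⟨N, hN⟩ := exists_nat_of_bdd h.bdd l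
  have hbox : Boxed fun i s : ℕ => ((-1) ^ i * binom(r, i) * binom((b i : ℂ) / k, s)) •
      Φ i (T (l + s) (b i + c i - k * s) (v i)) :=
    Boxed.of_right (N := N) (fun i s hs => by simp [hN s hs]) fun s =>
      (hK s).imp fun K hK i hi => by rw [hK i hi, smul_zero]
  rw [← hbox.finsum_comm, ← binomSum_sub h1 h2, binomSum_eq_left (h1.sub (h2.smul _))]
  refine finsum_congr fun i => ?_
  have e := congrArg (Φ i) (h.eq l (b i) (c i) (v i) (hb i))
  obtain ⟨K1, hK1⟩ := hC.exists_nat (k := k) (c i) (v i)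
  obtain ⟨K2, hK2⟩ := hB.exists_nat (k := k) (b i) (v i)
  rw [map_finsum_ge (N := N) _ (fun s hs => by simp [hN s hs]), ordProd_smul_left hB, ordProd,
    ordProd, smul_smul, finsum_sub_smul (N := K1) (K := K2) (fun p hp => by simp [hK1 p hp])
      (fun p hp => by simp [hK2 p hp]), map_finsum_ge (N := max K1 K2) _
      (fun p hp => by simp [hK1 p (by omega), hK2 p (by omega)])] at e
  simp only [map_smul] at e
  simp only [mul_smul ((-1) ^ i * binom(r, i))]
  rw [← smul_finsum_ge (N := N) (fun s hs => by simp [hN s hs]), ← e]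
  congr 1
  refine finsum_congr fun p => ?_
  simp only [map_sub, map_smul]
  module

lemma ordProd_zero (m n : ℤ) (w : M) : ordProd k A B 0 m n w = A m (B n w) := by
  rw [ordProd, finsum_choose_zero_smul (fun i => (-1) ^ i)
    fun i => A (m + k * (((0 : ℤ) : ℤ) - i)) (B (n + k * i) w)]
  simp

/-- The Jacobi identity for exponent zero of `x₁ - x₂`. -/
lemma OPE.commutator {j : ℤ} {c₀ : ℂ} {AC : ℤ → ℤ → End ℂ M}
    (h : OPE k j A C (c₀ • C) AC) (a c : ℤ) (ha : a ≡ j [ZMOD k]) (w : M) :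
    A a (C c w) - c₀ • C c (A a w) =
      ∑ᶠ s : ℕ, binom((a : ℂ) / k, s) • AC s (a + c - k * s) w := by
  have := h.eq 0 a c w ha
  simpa only [ordProd_zero, zpow_zero, one_smul, zero_add, Pi.smul_apply,
    smul_apply] using this

lemma OPE.binomSum_left {j : ℤ} {c₀ : ℂ} {AC : ℤ → ℤ → End ℂ M}
    (hAC : ∀ l, TruncField (AC l)) (h : OPE k j A C (c₀ • C) AC) (r l a b c : ℤ)
    (ha : a ≡ j [ZMOD k]) (w : M) :
    binomSum r l (fun i p : ℕ => B (b + k * (r + l - (i + p : ℕ)))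
      (A (a + k * i) (C (c + k * p) w) - c₀ • C (c + k * p) (A (a + k * i) w))) =
    ∑ᶠ s : ℕ, ∑ t ∈ range (s + 1),
      ((-1) ^ t * binom(r, t) * binom((a : ℂ) / k, s - t)) •
        ordProd k B (AC s) (r + l - t) b (a + c - k * s + k * t) w := by
  obtain ⟨N, hN⟩ := exists_nat_of_bdd h.bdd 0
  simp only [zero_add] at hN
  have e : ∀ i p : ℕ, A (a + k * i) (C (c + k * p) w) - c₀ • C (c + k * p) (A (a + k * i) w) =
      ∑ s ∈ range N, binom((a : ℂ) / k + i, s) •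
        AC s (a + c - k * s + k * (i + p : ℕ)) w := by
    intro i p
    rw [h.commutator _ _ (by simpa [Int.ModEq] using ha),
      finsum_eq_sum_range (N := N) (fun i hi => by simp [hN i hi])]
    refine sum_congr rfl fun s _ => ?_
    rw [div_add_natCast_mul]
    congr 2
    push_cast
    ring
  rw [finsum_eq_sum_range (N := N) fun s hs => sum_eq_zero fun t _ => by
    rw [hN s hs]; simp [ordProd_zero_right]]
  simp only [e, map_sum, map_smul, binomSum, smul_sum, smul_smul]
  have hbox : ∀ s : ℕ, Boxed fun i p : ℕ => ((-1) ^ (i + p) * binom(r, i) *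
      binom(l, p) * binom((a : ℂ) / k + i, s)) •
        B (b + k * (r + l - (i + p : ℕ))) (AC s (a + c - k * s + k * (i + p : ℕ)) w) := fun s => by
    obtain ⟨K, hK⟩ := (hAC s).exists_nat (k := k) (a + c - k * s) w
    exact Boxed.of_add (N := K) fun i p hip => by rw [hK _ hip]; simp
  rw [finsum_finsum_sum_comm _ hbox]
  exact sum_congr rfl fun s _ => finsum_choose_add_smul (hAC s) _ _ _ _ _ _ _

lemma OPE.binomSum_right {j : ℤ} {c₀ : ℂ} {AC : ℤ → ℤ → End ℂ M}
    (hB : TruncField B) (h : OPE k j A C (c₀ • C) AC) (r l a b c : ℤ)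
    (ha : a ≡ j [ZMOD k]) (w : M) :
    binomSum r l (fun i p : ℕ => A (a + k * (r - i)) (C (c + k * (l - p))
        (B (b + k * (i + p : ℕ)) w)) - c₀ • C (c + k * (l - p)) (A (a + k * (r - i))
        (B (b + k * (i + p : ℕ)) w))) =
    ∑ᶠ s : ℕ, ∑ t ∈ range (s + 1),
      (binom(r, t) * binom((a : ℂ) / k, s - t)) •
        ordProd k (AC s) B (r + l - t) (a + c - k * s + k * t) b w := by
  obtain ⟨N, hN⟩ := exists_nat_of_bdd h.bdd 0
  simp only [zero_add] at hN
  have e : ∀ (i p : ℕ) (v : M), A (a + k * (r - i)) (C (c + k * (l - p)) v) -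
      c₀ • C (c + k * (l - p)) (A (a + k * (r - i)) v) =
      ∑ s ∈ range N, binom((a : ℂ) / k + r - i, s) •
        AC s (a + c - k * s + k * (r + l - (i + p : ℕ))) v := by
    intro i p v
    rw [h.commutator _ _ (by simpa [Int.ModEq] using ha),
      finsum_eq_sum_range (N := N) (fun i hi => by simp [hN i hi])]
    refine sum_congr rfl fun s _ => ?_
    rw [sub_div_natCast]
    congr 2
    push_cast
    ring
  rw [finsum_eq_sum_range (N := N) fun s hs => sum_eq_zero fun t _ => by
    rw [hN s hs]; simp [ordProd_zero_left]]
  simp only [e, binomSum, smul_sum, smul_smul]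
  have hbox : ∀ s : ℕ, Boxed fun i p : ℕ => ((-1) ^ (i + p) * binom(r, i) *
      binom(l, p) * binom((a : ℂ) / k + r - i, s)) •
        AC s (a + c - k * s + k * (r + l - (i + p : ℕ))) (B (b + k * (i + p : ℕ)) w) := fun s => by
    obtain ⟨K, hK⟩ := hB.exists_nat (k := k) b w
    exact Boxed.of_add (N := K) fun i p hip => by rw [hK _ hip]; simp
  rw [finsum_finsum_sum_comm _ hbox]
  exact sum_congr rfl fun s _ => finsum_choose_sub_smul hB _ _ _ _ _ _ _

lemma finsum_sum_range_sub {P Q : ℕ → ℕ → M} {N : ℕ} (hP : ∀ s t, N ≤ s → P s t = 0)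
    (hQ : ∀ s t, N ≤ s → Q s t = 0) (r l : ℤ) (y c : ℂ) :
    ∑ᶠ s : ℕ, ∑ t ∈ range (s + 1), ((-1) ^ t * binom(r, t) * binom(y, s - t)) •
        (P s t - (-1 : ℂ) ^ (l - t) • c • Q s t) =
      ∑ᶠ s : ℕ, ∑ t ∈ range (s + 1), ((-1) ^ t * binom(r, t) * binom(y, s - t)) • P s t -
        ((-1) ^ l * c) •
          ∑ᶠ s : ℕ, ∑ t ∈ range (s + 1), (binom(r, t) * binom(y, s - t)) • Q s t := by
  rw [finsum_sub_smul (N := N) (K := N)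
    (fun s hs => sum_eq_zero fun t _ => by rw [hP s t hs, smul_zero])
    (fun s hs => sum_eq_zero fun t _ => by rw [hQ s t hs, smul_zero])]
  refine finsum_congr fun s => ?_
  rw [smul_sum, ← sum_sub_distrib]
  refine sum_congr rfl fun t _ => ?_
  have hs : (-1 : ℂ) ^ t * (-1) ^ t = 1 := by rw [← mul_pow]; norm_num
  rw [neg_one_zpow_sub_nat, smul_sub, smul_smul, smul_smul, smul_smul]
  congr 2
  linear_combination ((-1) ^ l * c * binom(r, t) * binom(y, s - t)) * hs

/-- The Jacobi identity for the products of `A` and `B` with `C`, summed with binomial weights, in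
terms of the products of `A` with those of `B` and `C`, and of `B` with those of `A` and `C`.  Both
sides are combinations of the six orderings of `A`, `B` and `C`. -/
lemma OPE.finsum_assoc {jA jB : ℤ} {εAB εBC εAC : ℂ} {AB BC AC : ℤ → ℤ → End ℂ M}
    (hA : TruncField A) (hB : TruncField B) (hC : TruncField C) (hε : εAB * εAB = 1)
    (hAB : ∀ l, TruncField (AB l)) (hBC : ∀ l, TruncField (BC l)) (hAC : ∀ l, TruncField (AC l))
    (h1 : OPE k jA A B (εAB • B) AB) (h2 : OPE k jB B C (εBC • C) BC)
    (h3 : OPE k jA A C (εAC • C) AC) (r l a b c : ℤ) (ha : a ≡ jA [ZMOD k])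
    (hb : b ≡ jB [ZMOD k]) (w : M) :
    ∑ᶠ t : ℕ, binom((a : ℂ) / k, t) • (ordProd k (AB (r + t)) C l (a + b - k * t) c w -
        (-1 : ℂ) ^ l • ordProd k ((εAC * εBC) • C) (AB (r + t)) l c (a + b - k * t) w) =
      ∑ᶠ s : ℕ, ∑ t ∈ range (s + 1),
        ((-1) ^ t * binom(r, t) * binom((b : ℂ) / k, s - t)) •
          (ordProd k A (BC (l + s)) (r - t) a (b + c - k * s + k * t) w -
            (-1 : ℂ) ^ (r - t) •
              ordProd k ((εAB * εAC) • BC (l + s)) A (r - t) (b + c - k * s + k * t) a w) -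
      (εAB * (-1) ^ r) • ∑ᶠ s : ℕ, ∑ t ∈ range (s + 1),
        ((-1) ^ t * binom(r, t) * binom((a : ℂ) / k, s - t)) •
          (ordProd k B (AC s) (r + l - t) b (a + c - k * s + k * t) w -
            (-1 : ℂ) ^ (r + l - t) •
              ordProd k ((εAB * εBC) • AC s) B (r + l - t) (a + c - k * s + k * t) b w) := by
  have hmod : ∀ (y x z : ℤ), x ≡ z [ZMOD k] → x + k * y ≡ z [ZMOD k] := fun x y z h => by
    simpa [Int.ModEq] using h
  have b1 : Boxed fun i p : ℕ =>
      A (a + k * (r - i)) (B (b + k * (l - p) + k * i) (C (c + k * p) w)) := boxed_nested hB hC _ _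
  have b2 : Boxed fun i p : ℕ =>
      B (b + k * (l - p) + k * (r - i)) (A (a + k * i) (C (c + k * p) w)) := boxed_nested hA hC _ _
  have b3 : Boxed fun i p : ℕ =>
      A (a + k * (r - i)) (C (c + k * (l - p)) (B (b + k * i + k * p) w)) := boxed_diagonal hB _ _
  have b4 : Boxed fun i p : ℕ =>
      B (b + k * (r - i) + k * (l - p)) (C (c + k * p) (A (a + k * i) w)) :=
    (boxed_nested hC hA _ _).swap
  have b5 : Boxed fun i p : ℕ =>
      C (c + k * (l - p)) (A (a + k * (r - i)) (B (b + k * p + k * i) w)) :=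
    (boxed_diagonal hB _ _).swap
  have b6 : Boxed fun i p : ℕ =>
      C (c + k * (l - p)) (B (b + k * (r - i) + k * p) (A (a + k * i) w)) :=
    (boxed_nested hB hA _ _).swap
  obtain ⟨N1, hN1⟩ := exists_nat_of_bdd h1.bdd r
  obtain ⟨N2, hN2⟩ := exists_nat_of_bdd h2.bdd l
  obtain ⟨N3, hN3⟩ := exists_nat_of_bdd h3.bdd 0
  simp only [zero_add] at hN3
  -- the products of `A` and `B`, to the left and to the right of `C`
  have S1 := h1.binomSum_eq_finsum (Φ := 1) (v := fun p => C (c + k * p) w) hA hB l r (fun _ => ha)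
    b1.swap b2.swap fun s => (hC.exists_nat (k := k) c w).imp fun K hK p hp => by
      rw [hK p hp, map_zero, map_zero]
  have S2 := h1.binomSum_eq_finsum (Φ := fun p => C (c + k * (l - p))) (v := fun _ => w)
    (c := fun p => b + k * p) hA hB l r (fun _ => ha)
    b5.swap
    (by simpa only [add_right_comm b] using b6.swap) fun s => by
      obtain ⟨K, hK⟩ := (hAB (r + s)).exists_nat (k := k) (a + b - k * s) w
      exact ⟨K, fun p hp => by
        rw [show a + (b + k * p) - k * s = a + b - (k : ℤ) * s + k * p by ring, hK p hp, map_zero]⟩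
  -- the products of `B` and `C`, to the right and to the left of `A`
  have S3 := h2.binomSum_eq_finsum (Φ := fun i => A (a + k * (r - i))) (v := fun _ => w)
    (b := fun i => b + k * i) (c := fun _ => c) hB hC r l (fun i => hmod _ _ _ hb)
    (by simpa only [add_right_comm b] using b1) b3 fun s => by
      obtain ⟨K, hK⟩ := (hBC (l + s)).exists_nat (k := k) (b + c - k * s) w
      exact ⟨K, fun i hi => by
        rw [show b + k * i + c - k * s = b + c - (k : ℤ) * s + k * i by ring, hK i hi, map_zero]⟩
  have S4 := h2.binomSum_eq_finsum (Φ := 1) (v := fun i => A (a + k * i) w)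
    (b := fun i => b + k * (r - i)) (c := fun _ => c) hB hC r l (fun i => hmod _ _ _ hb) b4 b6
    fun s => (hA.exists_nat (k := k) a w).imp fun K hK i hi => by rw [hK i hi, map_zero, map_zero]
  have S5 : binomSum r l _ - εAC • binomSum r l _ = _ := (binomSum_sub b2 b4 εAC).symm.trans
    (Eq.trans (by
      congr 1
      funext i p
      rw [map_sub, map_smul, show b + (k : ℤ) * (r - i) + k * (l - p) =
        b + k * (r + l - ((i + p : ℕ) : ℤ)) by push_cast; ring, show b + (k : ℤ) * (l - p) +
        k * (r - i) = b + k * (r + l - ((i + p : ℕ) : ℤ)) by push_cast; ring])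
    (h3.binomSum_left (B := B) hAC r l a b c ha w))
  have S6 : binomSum r l _ - εAC • binomSum r l _ = _ := (binomSum_sub b3 b5 εAC).symm.trans
    (Eq.trans (by
      congr 1
      funext i p
      rw [Nat.cast_add, mul_add, ← add_assoc, add_right_comm b (k * (p : ℤ))])
    (h3.binomSum_right hB r l a b c ha w))
  simp only [Pi.one_apply, Module.End.one_apply,
    fun p s : ℕ => show a + (b + k * (l - p)) - k * s = a + b - (k : ℤ) * s + k * (l - p) by ring,
    fun p s : ℕ => show a + (b + k * p) - k * s = a + b - (k : ℤ) * s + k * p by ring,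
    fun i s : ℕ => show b + k * i + c - k * s = b + c - (k : ℤ) * s + k * i by ring,
    fun i s : ℕ => show b + k * (r - i) + c - k * s = b + c - (k : ℤ) * s + k * (r - i) by ring,
    ← smul_ordProd hC, ← smul_ordProd (hAB _), div_add_natCast_mul, sub_div_natCast,
    finsum_choose_add_smul' (hBC _), finsum_choose_sub_smul' hA] at S1 S2 S3 S4
  rw [finsum_congr fun t : ℕ => show _ = binom((a : ℂ) / k, t) •
      ordProd k (AB (r + t)) C l (a + b - k * t) c w - ((-1) ^ l * (εAC * εBC)) •
        binom((a : ℂ) / k, t) • ordProd k C (AB (r + t)) l c (a + b - k * t) w by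
      rw [ordProd_smul_left (hAB _)]; module,
    ← finsum_sub_smul (N := N1) (K := N1)
      (fun t ht => by rw [hN1 t ht, ordProd_zero_left, smul_zero])
      (fun t ht => by rw [hN1 t ht, ordProd_zero_right, smul_zero])]
  simp only [ordProd_smul_left hA, ordProd_smul_left hB]
  rw [finsum_sum_range_sub (N := N2) (fun s t hs => by rw [hN2 s hs, ordProd_zero_right])
      (fun s t hs => by rw [hN2 s hs, ordProd_zero_left]),
    finsum_sum_range_sub (N := N3) (fun s t hs => by rw [hN3 s hs, ordProd_zero_right])
      (fun s t hs => by rw [hN3 s hs, ordProd_zero_left]),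
    ← S1, ← S2, ← S3, ← S4, ← S5, ← S6, binomSum_swap b1.swap, binomSum_swap b2.swap,
    binomSum_swap b5.swap, zpow_add₀ (by norm_num)]
  simp only [fun (x : ℤ) (p : ℕ) => add_right_comm b (k * x) (k * (l - p)),
    fun i p : ℕ => add_right_comm b (k * (r - i)) (k * p)] at b6 ⊢
  rw [binomSum_swap b6.swap]
  have hr := neg_one_zpow_mul_self r
  generalize (-1 : ℂ) ^ r = u at *
  generalize (-1 : ℂ) ^ l = v at *
  have c3 : εBC * v = (εAB * u) * (u * v * (εAB * εBC)) := by
    linear_combination (-εBC * v) * (εAB * εAB * hr + hε)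
  match_scalars
  · ring
  · ring
  · linear_combination (v * (εAC * εBC)) * (εAB * εAB * hr + hε)
  · ring
  · linear_combination c3
  · ring

lemma finsum_range_succ_sub {f : ℕ → ℕ → M} (h : Boxed f) :
    ∑ᶠ s : ℕ, ∑ t ∈ range (s + 1), f t (s - t) = ∑ᶠ t : ℕ, ∑ᶠ s : ℕ, f t s := by
  rw [h.finsum_antidiagonal]
  exact finsum_congr fun s => (Finset.Nat.sum_antidiagonal_eq_sum_range_succ f s).symm

lemma exists_nat_of_forall_bdd {X : Type*} [Zero X] {F : ℤ → ℤ → X}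
    (h : ∃ L : ℤ, ∀ l, L ≤ l → F l = 0) (h' : ∀ l, ∃ K : ℤ, ∀ n, K ≤ n → F l n = 0) (l₀ n₀ : ℤ) :
    ∃ N : ℕ, ∀ l n : ℤ, l₀ ≤ l → n₀ + N ≤ n → F l n = 0 := by
  obtain ⟨L, hL⟩ := h
  choose K hK using h'
  obtain ⟨N, hN⟩ := ((Finset.Icc l₀ L).image K).bddAbove
  refine ⟨(N - n₀).toNat, fun l n hl hn => ?_⟩
  rcases le_or_gt L l with h1 | h1
  · rw [hL l h1]; rfl
  · exact hK l n (le_trans (hN (by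
      simp only [Finset.coe_image, Finset.coe_Icc, Set.mem_image, Set.mem_Icc]
      exact ⟨l, ⟨hl, h1.le⟩, rfl⟩)) (by omega))

lemma exists_nat_of_add_bdd {F : ℤ → ℤ → ℤ → End ℂ M} (hF : ∃ L : ℤ, ∀ l, L ≤ l → F l = 0)
    (hF' : ∀ l, ∃ K : ℤ, ∀ n, K ≤ n → F l n = 0) (l l' : ℤ) :
    ∃ N : ℕ, ∀ s t q : ℕ, N ≤ s + t ∨ N ≤ q → F (l + s + t) (l' + q - t) = 0 := by
  obtain ⟨N1, hN1⟩ := exists_nat_of_bdd hF l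
  obtain ⟨N2, hN2⟩ := exists_nat_of_forall_bdd hF hF' l (l' - N1)
  refine ⟨max N1 N2, fun s t q h => ?_⟩
  by_cases h1 : N1 ≤ s + t
  · have := hN1 (s + t) h1
    push_cast at this
    rw [add_assoc, this]
    rfl
  · exact hN2 (l + s + t) (l' + q - t) (by omega) (by omega)

/-- Expanding the products of `A` with those of `B` and `C`. -/
lemma finsum_sum_range_choose {x y : ℂ} {F : ℤ → ℤ → ℤ → End ℂ M}
    (hF : ∃ L : ℤ, ∀ l, L ≤ l → F l = 0) (hF' : ∀ l, ∃ K : ℤ, ∀ n, K ≤ n → F l n = 0)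
    (r l l' N : ℤ) (w : M) :
    ∑ᶠ s : ℕ, ∑ t ∈ range (s + 1), ((-1) ^ t * binom(r, t) * binom(y, s - t)) •
        ∑ᶠ q : ℕ, binom(x, q) • F (l + s) (l' - t + q) (N - k * s + k * t - k * q) w =
      ∑ᶠ s : ℕ, ∑ᶠ q : ℕ, (binom(y, s) * binom(x, q)) •
        ∑ᶠ t : ℕ, ((-1) ^ t * binom(r, t)) •
          F (l + s + t) (l' + q - t) (N - k * s - k * q) w := by
  obtain ⟨K, hz⟩ := exists_nat_of_add_bdd hF hF' l l'
  let f : ℕ → ℕ → M := fun t s => ((-1) ^ t * binom(r, t) * binom(y, s)) •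
    ∑ᶠ q : ℕ, binom(x, q) • F (l + s + t) (l' + q - t) (N - k * s - k * q) w
  have hf : Boxed f := Boxed.of_add (N := K) fun t s h => by
    simp only [f]
    rw [finsum_eq_zero_of_forall_eq_zero, smul_zero]
    intro q
    simp [hz s t q (Or.inl (by omega))]
  trans ∑ᶠ s : ℕ, ∑ t ∈ range (s + 1), f t (s - t)
  · refine finsum_congr fun s => sum_congr rfl fun t ht => ?_
    have ht : t ≤ s := by simpa [Nat.lt_succ_iff] using ht
    obtain ⟨p, rfl⟩ := Nat.exists_eq_add_of_le ht
    simp only [f, Nat.add_sub_cancel_left]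
    congr 1
    refine finsum_congr fun q => ?_
    push_cast
    congr 2
    · congr 1 <;> ring_nf
  rw [finsum_range_succ_sub hf, hf.finsum_comm]
  refine finsum_congr fun s => ?_
  have hg : Boxed fun t q : ℕ => ((-1) ^ t * binom(r, t) * binom(y, s) *
      binom(x, q)) • F (l + s + t) (l' + q - t) (N - k * s - k * q) w :=
    ⟨K, fun t q h => by simp [hz s t q (by omega)]⟩
  trans ∑ᶠ t : ℕ, ∑ᶠ q : ℕ, ((-1) ^ t * binom(r, t) * binom(y, s) *
      binom(x, q)) • F (l + s + t) (l' + q - t) (N - k * s - k * q) w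
  · refine finsum_congr fun t => ?_
    simp only [f]
    rw [finsum_smul_eq (hasFiniteSupport_of_ge (N := K) fun q hq => by
      simp [hz s t q (Or.inr hq)])]
    exact finsum_congr fun q => by rw [smul_smul]
  rw [hg.finsum_comm]
  refine finsum_congr fun q => ?_
  rw [finsum_smul_eq (hasFiniteSupport_of_ge (N := K) fun t ht => by
      simp [hz s t q (Or.inl (by omega))])]
  refine finsum_congr fun t => ?_
  rw [smul_smul]
  congr 1
  ring

lemma boxed_choose {x y : ℂ} {F : ℤ → ℤ → ℤ → End ℂ M}
    (hF : ∃ L : ℤ, ∀ l, L ≤ l → F l = 0) (hF' : ∀ l, ∃ K : ℤ, ∀ n, K ≤ n → F l n = 0)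
    (r l l' N : ℤ) (w : M) :
    Boxed fun s q : ℕ => (binom(y, s) * binom(x, q)) •
        ∑ᶠ t : ℕ, ((-1) ^ t * binom(r, t)) •
          F (l + s + t) (l' + q - t) (N - k * s - k * q) w := by
  obtain ⟨K, hz⟩ := exists_nat_of_add_bdd hF hF' l l'
  refine ⟨K, fun s q h => ?_⟩
  dsimp only
  rw [finsum_eq_zero_of_forall_eq_zero fun t => ?_, smul_zero]
  simp [hz s t q (by omega)]

/-- Vandermonde convolution for the iterated products. -/
lemma finsum_finsum_choose_iterate {x y : ℂ} {X : ℤ → ℤ → ℤ → End ℂ M}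
    (hX : ∃ L : ℤ, ∀ l, L ≤ l → X l = 0) (hX' : ∀ l, ∃ K : ℤ, ∀ n, K ≤ n → X l n = 0)
    (r l N : ℤ) (w : M) :
    ∑ᶠ s : ℕ, ∑ᶠ q : ℕ, (binom(y, s) * binom(x, q)) • ∑ᶠ i : ℕ, binom(q, i) •
        X (r + i) (q + (l + s) - i) (N - k * s - k * q) w =
      ∑ᶠ i : ℕ, binom(x, i) • ∑ᶠ u : ℕ, binom(x + y - i, u) •
        X (r + i) (l + u) (N - k * i - k * u) w := by
  obtain ⟨N1, hN1⟩ := exists_nat_of_bdd hX r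
  obtain ⟨N2, hN2⟩ := exists_nat_of_forall_bdd hX hX' r l
  have hz : ∀ (i u : ℕ), N1 ≤ i ∨ N2 ≤ u → ∀ n, X (r + i) (l + u) n w = 0 := by
    intro i u h n
    by_cases h1 : N1 ≤ i
    · rw [hN1 i h1]; rfl
    · rw [hN2 (r + i) (l + u) (by omega) (by omega)]; rfl
  have step : ∀ s : ℕ, ∑ᶠ q : ℕ, (binom(y, s) * binom(x, q)) •
      ∑ᶠ i : ℕ, binom(q, i) • X (r + i) (q + (l + s) - i) (N - k * s - k * q) w =
      ∑ᶠ i : ℕ, ∑ᶠ p : ℕ, (binom(x, i) * (binom(x - i, p) * binom(y, s))) •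
        X (r + i) (l + (p + s : ℕ)) (N - k * i - k * (p + s : ℕ)) w := by
    intro s
    have hb : Boxed fun q i : ℕ => (binom(y, s) * (binom(x, q) * (q.choose i : ℂ))) •
        X (r + i) (q + (l + s) - i) (N - k * s - k * q) w := by
      refine Boxed.of_right (N := N1)
        (fun q i hi => by simp [hN1 i hi]) fun i => ⟨N2 + i, fun q hq => ?_⟩
      have := hz i (q - i + s) (Or.inr (by omega)) (N - k * s - k * q)
      rw [show (q : ℤ) + (l + s) - i =
        l + ((q - i + s : ℕ) : ℤ) by push_cast [Nat.cast_sub (by omega : i ≤ q)]; ring,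
        this, smul_zero]
    trans ∑ᶠ q : ℕ, ∑ᶠ i : ℕ, (binom(y, s) * (binom(x, q) * (q.choose i : ℂ))) •
        X (r + i) (q + (l + s) - i) (N - k * s - k * q) w
    · refine finsum_congr fun q => ?_
      rw [finsum_smul_eq (hasFiniteSupport_of_ge (N := N1) fun i hi => by simp [hN1 i hi])]
      refine finsum_congr fun i => ?_
      rw [smul_smul, Ring.choose_natCast]
      congr 1
      ring
    rw [hb.finsum_comm]
    refine finsum_congr fun i => ?_
    rw [← finsum_shift i fun q hq => by simp [Nat.choose_eq_zero_of_lt hq]]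
    refine finsum_congr fun p => ?_
    rw [choose_mul_natChoose x (by omega), Nat.add_sub_cancel_left]
    congr 1
    · ring
    · rw [show ((i + p : ℕ) : ℤ) + (l + s) - i = l + ((p + s : ℕ) : ℤ) by push_cast; ring,
        show N - k * s - k * ((i + p : ℕ) : ℤ) = N - k * i - k * ((p + s : ℕ) : ℤ) by
          push_cast; ring]
  have hb1 : Boxed fun s i : ℕ => ∑ᶠ p : ℕ,
      (binom(x, i) * (binom(x - i, p) * binom(y, s))) •
        X (r + i) (l + (p + s : ℕ)) (N - k * i - k * (p + s : ℕ)) w :=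
    ⟨max N1 N2, fun s i h => finsum_eq_zero_of_forall_eq_zero fun p => by
      rw [hz i (p + s) (by omega), smul_zero]⟩
  rw [finsum_congr step, hb1.finsum_comm]
  refine finsum_congr fun i => ?_
  have hb2 : Boxed fun p s : ℕ => (binom(x, i) * (binom(x - i, p) * binom(y, s))) •
        X (r + i) (l + (p + s : ℕ)) (N - k * i - k * (p + s : ℕ)) w :=
    Boxed.of_add (N := N2) fun p s h => by rw [hz i (p + s) (by omega), smul_zero]
  rw [hb2.swap.finsum_comm, hb2.finsum_antidiagonal, finsum_smul_eq
    (hasFiniteSupport_of_ge (N := N2) fun u hu => by rw [hz i u (by omega), smul_zero])]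
  refine finsum_congr fun u => ?_
  have : ∀ ij ∈ antidiagonal u,
      (binom(x, i) * (binom(x - i, ij.1) * binom(y, ij.2))) •
        X (r + i) (l + (ij.1 + ij.2 : ℕ)) (N - k * i - k * (ij.1 + ij.2 : ℕ)) w =
      (binom(x, i) * (binom(x - i, ij.1) * binom(y, ij.2))) •
        X (r + i) (l + u) (N - k * i - k * u) w := by
    intro ij hij
    rw [mem_antidiagonal] at hij
    rw [hij]
  rw [sum_congr rfl this, ← sum_smul, ← mul_sum, choose_add_antidiagonal,
    smul_smul, show x - i + y = x + y - i by ring]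

/-- Let the products of `A` and `B`, of `B` and `C`, of `A` and `C`, of `A` with those of `B` and
`C`, and of `B` with those of `A` and `C` satisfy the Jacobi identity.  Then so do the products `X r`
of the `r`-th product of `A` and `B` with `C`, provided that they are related to the given products
by the Jacobi identity `hJ`. -/
lemma OPE.assoc {jA jB : ℤ} {εAB εBC εAC : ℂ} {AB BC AC : ℤ → ℤ → End ℂ M}
    {ABC BAC X : ℤ → ℤ → ℤ → End ℂ M}
    (hA : TruncField A) (hB : TruncField B) (hC : TruncField C) (hε : εAB * εAB = 1)
    (hAB : ∀ l, TruncField (AB l)) (hBC : ∀ l, TruncField (BC l)) (hAC : ∀ l, TruncField (AC l))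
    (h1 : OPE k jA A B (εAB • B) AB) (h2 : OPE k jB B C (εBC • C) BC)
    (h3 : OPE k jA A C (εAC • C) AC)
    (h4 : ∀ l, OPE k jA A (BC l) ((εAB * εAC) • BC l) (ABC l))
    (h5 : ∀ l, OPE k jB B (AC l) ((εAB * εBC) • AC l) (BAC l))
    (hABC : ∃ L : ℤ, ∀ l, L ≤ l → ABC l = 0) (hBAC : ∃ L : ℤ, ∀ l, L ≤ l → BAC l = 0)
    (hX : ∃ L : ℤ, ∀ l, L ≤ l → X l = 0) (hX' : ∀ l, ∃ K : ℤ, ∀ n, K ≤ n → X l n = 0)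
    (hJ : ∀ (r : ℤ) (q : ℕ) (n N : ℤ) (w : M),
      ∑ᶠ i : ℕ, ((-1) ^ i * binom(r, i)) • ABC (n + i) (q + r - i) N w -
        (εAB * (-1) ^ r) • ∑ᶠ i : ℕ, ((-1) ^ i * binom(r, i)) •
          BAC (q + i) (n + r - i) N w =
      ∑ᶠ i : ℕ, binom(q, i) • X (r + i) (q + n - i) N w) (r : ℤ) :
    OPE k (jA + jB) (AB r) C ((εAC * εBC) • C) (X r) := by
  have key : ∀ (r l a b c : ℤ) (w : M), a ≡ jA [ZMOD k] → b ≡ jB [ZMOD k] →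
      ∑ᶠ t : ℕ, binom((a : ℂ) / k, t) • (ordProd k (AB (r + t)) C l (a + b - k * t) c w -
        (-1 : ℂ) ^ l • ordProd k ((εAC * εBC) • C) (AB (r + t)) l c (a + b - k * t) w) =
      ∑ᶠ t : ℕ, binom((a : ℂ) / k, t) • ∑ᶠ u : ℕ, binom((a : ℂ) / k + b / k - t, u) •
        X (r + t) (l + u) (a + b + c - k * t - k * u) w := by
    intro r l a b c w ha hb
    rw [OPE.finsum_assoc hA hB hC hε hAB hBC hAC h1 h2 h3 r l a b c ha hb w,
      ← finsum_finsum_choose_iterate hX hX']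
    have e1 := finsum_sum_range_choose (k := k) (x := (a : ℂ) / k) (y := (b : ℂ) / k) hABC
      (fun l => (h4 l).bdd) r l r (a + b + c) w
    have e2 := finsum_sum_range_choose (k := k) (x := (b : ℂ) / k) (y := (a : ℂ) / k) hBAC
      (fun l => (h5 l).bdd) r 0 (r + l) (a + b + c) w
    have d1 := boxed_choose (k := k) (x := (a : ℂ) / k) (y := (b : ℂ) / k) hABC
      (fun l => (h4 l).bdd) r l r (a + b + c) w
    have d2 := boxed_choose (k := k) (x := (b : ℂ) / k) (y := (a : ℂ) / k) hBAC
      (fun l => (h5 l).bdd) r 0 (r + l) (a + b + c) w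
    have f1 : ∑ᶠ s : ℕ, ∑ t ∈ range (s + 1),
        ((-1) ^ t * binom(r, t) * binom((b : ℂ) / k, s - t)) •
          (ordProd k A (BC (l + s)) (r - t) a (b + c - k * s + k * t) w -
            (-1 : ℂ) ^ (r - t) •
              ordProd k ((εAB * εAC) • BC (l + s)) A (r - t) (b + c - k * s + k * t) a w) = _ :=
      Eq.trans (finsum_congr fun s => sum_congr rfl fun t _ => by
        rw [(h4 (l + s)).eq _ _ _ _ ha]
        congr 1
        refine finsum_congr fun q => ?_
        rw [show a + (b + c - (k : ℤ) * s + k * t) - k * q = a + b + c - k * s + k * t - k * q by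
          ring]) e1
    have f2 : ∑ᶠ s : ℕ, ∑ t ∈ range (s + 1),
        ((-1) ^ t * binom(r, t) * binom((a : ℂ) / k, s - t)) •
          (ordProd k B (AC s) (r + l - t) b (a + c - k * s + k * t) w -
            (-1 : ℂ) ^ (r + l - t) •
              ordProd k ((εAB * εBC) • AC s) B (r + l - t) (a + c - k * s + k * t) b w) = _ :=
      Eq.trans (finsum_congr fun s => sum_congr rfl fun t _ => by
        rw [(h5 s).eq _ _ _ _ hb, zero_add]
        congr 1
        refine finsum_congr fun q => ?_
        rw [show b + (a + c - (k : ℤ) * s + k * t) - k * q = a + b + c - k * s + k * t - k * q by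
          ring]) e2
    rw [f1, f2, d2.finsum_comm, sub_eq_add_neg, ← neg_smul, ← d2.swap.finsum_smul,
      ← d1.finsum_add (d2.swap.smul fun _ _ => -(εAB * (-1) ^ r))]
    refine finsum_congr fun s => finsum_congr fun q => ?_
    have := hJ r q (l + s) (a + b + c - k * s - k * q) w
    have g1 : ∀ t : ℕ, r + (q : ℤ) - t = q + r - t := fun t => by ring
    have g2 : ∀ t : ℕ, r + l + (s : ℤ) - t = l + s + r - t := fun t => by ring
    have g3 : a + b + c - (k : ℤ) * q - k * s = a + b + c - k * s - k * q := by ring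
    simp only [g1, g2, g3, zero_add]
    rw [← this]
    module
  -- `key` is the claim for `r` plus multiples of the claims for larger orders: descending induction
  obtain ⟨L1, hL1⟩ := h1.bdd
  obtain ⟨L2, hL2⟩ := hX
  suffices H : ∀ T : ℕ, ∀ r, max L1 L2 - T ≤ r → ∀ (l m n : ℤ) (w : M), m ≡ jA + jB [ZMOD k] →
      ordProd k (AB r) C l m n w - (-1 : ℂ) ^ l • ordProd k ((εAC * εBC) • C) (AB r) l n m w =
        ∑ᶠ i : ℕ, binom((m : ℂ) / k, i) • X r (l + i) (m + n - k * i) w from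
    ⟨hX' r, H (max L1 L2 - r).toNat r (by omega)⟩
  intro T
  induction T with
  | zero =>
    intro r hr l m n w _
    rw [hL1 r (by push_cast at hr; omega), ordProd_zero_left, ordProd_zero_right, smul_zero,
      sub_zero, finsum_eq_zero_of_forall_eq_zero]
    intro i
    rw [hL2 r (by push_cast at hr; omega)]
    simp
  | succ T ih =>
    intro r hr l m n w hm
    have hk := key r l jA (m - jA) n w rfl (by
      have := hm.sub_right jA
      rwa [add_sub_cancel_left] at this)
    rw [← sub_eq_zero, ← finsum_sub_distrib, finsum_eq_sum_range (N := 1)] at hk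
    · simp only [Finset.range_one, Finset.sum_singleton, Nat.cast_zero, Ring.choose_zero_right,
        one_smul, add_zero, mul_zero, sub_zero, add_sub_cancel] at hk
      rw [sub_eq_zero] at hk
      rw [hk]
      refine finsum_congr fun i => ?_
      rw [← add_div]
      push_cast
      rw [add_sub_cancel]
    · intro t ht
      rw [← smul_sub, ih (r + t) (by push_cast at hr; omega) l _ n w, ← smul_zero
        (binom((jA : ℂ) / k, t))]
      · congr 1
        rw [sub_eq_zero]
        refine finsum_congr fun i => ?_
        have hk : (k : ℂ) ≠ 0 := by exact_mod_cast NeZero.ne k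
        rw [← add_div, show jA + (m - jA) - (k : ℤ) * t + n - k * i =
          jA + (m - jA) + n - k * t - k * i by ring]
        congr 2
        push_cast
        rw [sub_div, mul_div_cancel_left₀ _ hk]
      · rw [add_sub_cancel]
        exact Int.ModEq.trans (by simp [Int.ModEq]) hm
    · exact hasFiniteSupport_of_ge (N := (L1 - r).toNat) fun t ht => by
        rw [hL1 (r + t) (by omega), ordProd_zero_left, ordProd_zero_right]; simp
    · exact hasFiniteSupport_of_ge (N := (L2 - r).toNat) fun t ht => by
        rw [hL2 (r + t) (by omega)]; simp

end Assoc
/-! ### Products with the field `1` -/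

section VacuumFamily

variable {M : Type*} [AddCommGroup M] [Module ℂ M] {k : ℕ} [NeZero k] {A B C : ℤ → End ℂ M}

variable (M) in
/-- The modes of the field `1`, indexed by `(1/k)ℤ`. -/
def vacFamily (k : ℕ) (N : ℤ) : End ℂ M := if N = -k then 1 else 0

lemma truncField_vacFamily : TruncField (vacFamily M k) := fun w => by
  refine ⟨-k + 1, fun n hn => ?_⟩
  rw [vacFamily, if_neg (by omega)]
  rfl

/-- Commuting fields have only products of negative order. -/
lemma jac_eq_zero_of_commute {B' : ℤ → End ℂ M} (hA : TruncField A) (hB : TruncField B)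
    {j : ℤ} (h : ∀ m n w, m ≡ j [ZMOD k] → A m (B n w) = B' n (A m w)) (l : ℕ) (m n : ℤ) (w : M)
    (hm : m ≡ j [ZMOD k]) :
    ordProd k A B l m n w - (-1 : ℂ) ^ (l : ℤ) • ordProd k B' A l n m w = 0 := by
  induction l generalizing m n with
  | zero => simp [ordProd_zero, h m n w hm]
  | succ l ih =>
    push_cast
    rw [jac_succ hA hB, ih _ _ (by simpa [Int.ModEq] using hm), ih _ _ hm, sub_zero]

lemma ordProd_vacFamily_left (l : ℤ) (q : ℕ) (m n : ℤ) (w : M)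
    (hm : m + k * (l - q) = -k) :
    ordProd k (vacFamily M k) B l m n w = ((-1) ^ q * binom(l, q)) • B (n + k * q) w := by
  have hk : (k : ℤ) ≠ 0 := by exact_mod_cast NeZero.ne k
  rw [ordProd, finsum_eq_single _ q]
  · rw [hm, vacFamily, if_pos rfl]; rfl
  · intro i hi
    rw [vacFamily, if_neg, zero_apply, smul_zero]
    intro h
    have : (k : ℤ) * (i - q) = 0 := by linarith
    rcases mul_eq_zero.mp this with h1 | h1
    · exact hk h1
    · omega

lemma ordProd_vacFamily_left_zero (l m n : ℤ) (w : M) (hm : ∀ q : ℕ, m + k * (l - q) ≠ -k) :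
    ordProd k (vacFamily M k) B l m n w = 0 :=
  finsum_eq_zero_of_forall_eq_zero fun i => by
    rw [vacFamily, if_neg (hm i), zero_apply, smul_zero]

lemma ordProd_vacFamily_right (l : ℤ) (q : ℕ) (m n : ℤ) (w : M) (hn : n + k * q = -k) :
    ordProd k A (vacFamily M k) l m n w =
      ((-1) ^ q * binom(l, q)) • A (m + k * (l - q)) w := by
  have hk : (k : ℤ) ≠ 0 := by exact_mod_cast NeZero.ne k
  rw [ordProd, finsum_eq_single _ q]
  · rw [hn, vacFamily, if_pos rfl]; rfl
  · intro i hi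
    rw [vacFamily, if_neg, zero_apply, map_zero, smul_zero]
    intro h
    have : (k : ℤ) * (i - q) = 0 := by linarith
    rcases mul_eq_zero.mp this with h1 | h1
    · exact hk h1
    · omega

lemma ordProd_vacFamily_right_zero (l m n : ℤ) (w : M) (hn : ∀ q : ℕ, n + k * q ≠ -k) :
    ordProd k A (vacFamily M k) l m n w = 0 :=
  finsum_eq_zero_of_forall_eq_zero fun i => by
    rw [vacFamily, if_neg (hn i), zero_apply, map_zero, smul_zero]

lemma neg_one_pow_mul_choose_neg_one (q : ℕ) : (-1 : ℂ) ^ q * binom(-1, q) = 1 := by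
  induction q with
  | zero => simp
  | succ q ih =>
    have := choose_add_one (-1) q
    rw [neg_add_cancel, Ring.choose_zero_pos ℂ (by omega)] at this
    rw [pow_succ]
    linear_combination (-1) ^ q * this + ih

/-- The products of the field `1` with another field. -/
lemma OPE.vac_left (hA : TruncField A) :
    OPE k 0 (vacFamily M k) A A (fun l => if l = -1 then A else 0) := by
  have hcomm : ∀ m n w, m ≡ 0 [ZMOD k] →
      vacFamily M k m (A n w) = A n (vacFamily M k m w) := fun m n w _ => by
    unfold vacFamily; split_ifs <;> simp
  refine OPE.of_recursion truncField_vacFamily hA ⟨0, fun l hl => if_neg (by omega)⟩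
    ⟨0, fun l hl m n w hm => ?_⟩ fun l n w => ?_
  · obtain ⟨q, rfl⟩ := Int.eq_ofNat_of_zero_le hl
    exact jac_eq_zero_of_commute truncField_vacFamily hA hcomm q m n w hm
  · rw [finsum_eq_single _ 0]
    · simp only [Ring.choose_zero_right, Nat.cast_zero, add_zero, mul_zero, sub_zero, one_smul,
        zero_add]
      have hk : (1 : ℤ) ≤ k := by exact_mod_cast NeZero.one_le
      rw [ordProd_vacFamily_right_zero l n 0 w fun q hq => by
        have : (0 : ℤ) ≤ k * q := by positivity
        omega, smul_zero, sub_zero]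
      rcases le_or_gt (-1) l with h1 | h1
      · obtain ⟨q, hq⟩ := Int.eq_ofNat_of_zero_le (show 0 ≤ l + 1 by omega)
        obtain rfl : l = q - 1 := by omega
        rw [ordProd_vacFamily_left _ q 0 n w (by ring)]
        rcases Nat.eq_zero_or_pos q with rfl | hq0
        · simp
        · obtain ⟨t, rfl⟩ := Nat.exists_eq_add_of_lt hq0
          rw [if_neg (by omega), Pi.zero_apply, zero_apply, show (((0 + t + 1 : ℕ) : ℤ) - 1 : ℤ) =
            (t : ℤ) by
            push_cast; ring, Int.cast_natCast, Ring.choose_natCast,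
              Nat.choose_eq_zero_of_lt (by omega)]
          simp
      · rw [if_neg (by omega), Pi.zero_apply, zero_apply]
        refine ordProd_vacFamily_left_zero l 0 n w fun q hq => ?_
        have : (k : ℤ) * (l - q + 1) = 0 := by linarith
        rcases mul_eq_zero.mp this with h2 | h2 <;> omega
    · intro i hi
      rw [Int.cast_zero, zero_div, Ring.choose_zero_pos ℂ (Nat.pos_of_ne_zero hi), zero_smul]

/-- The products of a field with the field `1`. -/
lemma OPE.vac_right {j : ℤ} (hA : TruncField A) (hj : ∀ n, ¬ n ≡ j [ZMOD k] → A n = 0) :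
    ∃ P, OPE k j A (vacFamily M k) (vacFamily M k) P ∧ P (-1) = A ∧ ∀ l : ℕ, P l = 0 := by
  have hcomm : ∀ m n w, m ≡ j [ZMOD k] →
      A m (vacFamily M k n w) = vacFamily M k n (A m w) := fun m n w _ => by
    unfold vacFamily; split_ifs <;> simp
  have h0 := jac_eq_zero_of_commute hA truncField_vacFamily hcomm
  obtain ⟨P, hP⟩ := OPE.exists_of_local (k := k) (j := j) (B' := vacFamily M k) hA
    truncField_vacFamily ⟨0, fun l hl m n w hm => by
      obtain ⟨q, rfl⟩ := Int.eq_ofNat_of_zero_le hl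
      exact h0 q m n w hm⟩
  have hk : (1 : ℤ) ≤ k := by exact_mod_cast NeZero.one_le
  refine ⟨P, hP, ?_, fun l => ?_⟩
  · funext n
    ext w
    rw [hP.product_eq, finsum_eq_single _ 0]
    · simp only [pow_zero, Ring.choose_zero_right, one_mul, Nat.cast_zero, add_zero, mul_zero,
        sub_zero, one_smul]
      by_cases hn : n ≡ j [ZMOD k]
      · obtain ⟨q, hq⟩ := hn.symm.dvd
        obtain rfl : n = j + k * q := by linarith
        rcases le_or_gt 0 q with h | h
        · obtain ⟨t, rfl⟩ := Int.eq_ofNat_of_zero_le h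
          rw [ordProd_vacFamily_right_zero, ordProd_vacFamily_left _ t _ _ _ (by ring)]
          · simp [neg_one_pow_mul_choose_neg_one]
          · intro p hp
            have : (0 : ℤ) ≤ k * p := by positivity
            have : (0 : ℤ) ≤ k * t := by positivity
            have : (k : ℤ) * Int.ofNat t = k * t := rfl
            omega
        · obtain ⟨t, ht⟩ := Int.eq_ofNat_of_zero_le (show 0 ≤ -q - 1 by omega)
          obtain rfl : q = -t - 1 := by omega
          rw [ordProd_vacFamily_left_zero, ordProd_vacFamily_right _ t _ _ _ (by ring)]
          · simp only [Int.cast_neg, Int.cast_one, neg_one_pow_mul_choose_neg_one, smul_zero,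
              sub_zero, one_smul]
            congr 2
            ring
          · intro p hp
            have : (k : ℤ) * (-t - 1 - 1 - p + 1) = 0 := by linarith
            rcases mul_eq_zero.mp this with h2 | h2 <;> omega
      · rw [hj n hn, ordProd_vacFamily_right_zero, ordProd_vacFamily_left_zero]
        · simp
        · intro p hp
          exact hn (Int.modEq_iff_dvd.mpr ⟨-p, by linarith⟩)
        · intro p hp
          exact hn (Int.modEq_iff_dvd.mpr ⟨p + 1, by linarith⟩)
    · intro i hi
      obtain ⟨i, rfl⟩ := Nat.exists_eq_succ_of_ne_zero hi
      have := h0 i (j - k * (i + 1 : ℕ)) (n - j) w (by simp [Int.ModEq])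
      rw [show (-1 : ℤ) + (i.succ : ℕ) = i by push_cast; ring, this, smul_zero]
  · funext n
    ext w
    rw [hP.product_eq]
    simp only [Pi.zero_apply, zero_apply]
    refine finsum_eq_zero_of_forall_eq_zero fun i => ?_
    have := h0 (l + i) (j - k * i) (n - j) w (by simp [Int.ModEq])
    push_cast at this
    rw [this, smul_zero]

end VacuumFamily
/-! ### Products of two fields with a third one -/

section Commutation

variable {M : Type*} [AddCommGroup M] [Module ℂ M] {k : ℕ} [NeZero k]
  {A B F F₁ : ℤ → End ℂ M}

/-- The products of `A` with the products of `B` and `F`, in terms of the orderings of `A`, `B`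
and `F`. -/
lemma OPE.finsum_ordProd_eq_binomSum {j : ℤ} {T T' : ℤ → ℤ → End ℂ M} (ε : ℂ)
    (hA : TruncField A) (hB : TruncField B) (hF : TruncField F) (hF₁ : TruncField F₁)
    (hT : ∀ l, TruncField (T l)) (h : OPE k j B F F₁ T) (h' : OPE k j B F₁ F T') (m n a b c : ℤ)
    (hb : b ≡ j [ZMOD k]) (w : M) :
    ∑ᶠ s : ℕ, binom((b : ℂ) / k, s) • (ordProd k A (T (n + s)) m a (b + c - k * s) w -
        (-1 : ℂ) ^ m • ordProd k (ε • T' (n + s)) A m (b + c - k * s) a w) =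
      binomSum m n (fun i p => A (a + k * (m - i)) (B (b + k * (n - p))
        (F (c + k * i + k * p) w))) -
      (-1 : ℂ) ^ n • binomSum m n (fun i p => A (a + k * (m - i))
        (F₁ (c + k * i + k * (n - p)) (B (b + k * p) w))) -
      (ε * (-1 : ℂ) ^ m) • binomSum n m (fun p i => B (b + k * (n - p))
        (F₁ (c + k * p + k * (m - i)) (A (a + k * i) w))) +
      (ε * (-1 : ℂ) ^ m * (-1) ^ n) • binomSum m n (fun i p =>
        F (c + k * (m - i) + k * (n - p)) (B (b + k * p) (A (a + k * i) w))) := by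
  have h1 := OPE.binomSum_eq_finsum (ε := 1) (Φ := fun i => A (a + k * (m - i))) (v := fun _ => w)
    (b := fun _ => b) (c := fun i => c + k * i) hB hF (by rwa [one_smul]) m n (fun _ => hb)
    (boxed_diagonal hF c w)
    (by
      simpa only [add_right_comm c] using
        boxed_nested (k := k) (g := fun p => c + k * (n - p)) hF₁ hB b w)
    fun s => by
      obtain ⟨K, hK⟩ := (hT (n + s)).exists_nat (k := k) (b + c - k * s) w
      exact ⟨K, fun i hi => by
        rw [show b + (c + k * i) - k * s = b + c - (k : ℤ) * s + k * i by ring, hK i hi, map_zero]⟩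
  have h2 := OPE.binomSum_eq_finsum (ε := 1) (Φ := 1) (v := fun i => A (a + k * i) w)
    (b := fun _ => b) (c := fun i => c + k * (m - i)) hB hF₁ (by rwa [one_smul]) m n (fun _ => hb)
    (boxed_nested hF₁ hA a w).swap (boxed_nested hB hA a w).swap
    fun s => (hA.exists_nat (k := k) a w).imp fun K hK i hi => by rw [hK i hi, map_zero, map_zero]
  obtain ⟨N, hN⟩ := exists_nat_of_bdd h.bdd n
  obtain ⟨N', hN'⟩ := exists_nat_of_bdd h'.bdd n
  simp only [Pi.one_apply, Module.End.one_apply, one_mul,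
    fun i s : ℕ => show b + (c + k * i) - k * s = b + c - (k : ℤ) * s + k * i by ring,
    fun i s : ℕ => show b + (c + k * (m - i)) - k * s = b + c - (k : ℤ) * s + k * (m - i) by ring,
    ← smul_ordProd (hT _), ← smul_ordProd hA] at h1 h2
  rw [finsum_congr fun s : ℕ => show _ = binom((b : ℂ) / k, s) •
      ordProd k A (T (n + s)) m a (b + c - k * s) w - (ε * (-1) ^ m) •
        binom((b : ℂ) / k, s) • ordProd k (T' (n + s)) A m (b + c - k * s) a w by
      rw [ordProd_smul_left hA]; module,
    ← finsum_sub_smul (N := N) (K := N')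
      (fun s hs => by rw [hN s hs, ordProd_zero_right, smul_zero])
      (fun s hs => by rw [hN' s hs, ordProd_zero_left, smul_zero]), ← h1, ← h2,
    binomSum_swap (r := m) (l := n) (boxed_nested (g := fun i => c + k * (m - i)) hF₁ hA a w).swap]
  simp only [add_right_comm c (k * (m - _))]
  module

/-- The products of `A` with those of `B` and `F`, and of `B` with those of `A` and `F`, when the
commutator of `A` and `B` is a multiple of the field `1`. -/
lemma OPE.finsum_ordProd_sub {j : ℤ} {TA TA' TB TB' : ℤ → ℤ → End ℂ M} {ε γ : ℂ}
    {p₀ : ℕ} (hε : ε * ε = 1) (hj : (k : ℤ) ∣ 2 * j)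
    (hA : TruncField A) (hB : TruncField B) (hF : TruncField F) (hF₁ : TruncField F₁)
    (hTA : ∀ l, TruncField (TA l)) (hTB : ∀ l, TruncField (TB l))
    (hAB : ∀ a b w, a ≡ j [ZMOD k] → b ≡ j [ZMOD k] → A a (B b w) - ε • B b (A a w) =
      (γ * binom((a : ℂ) / k, p₀)) • vacFamily M k (a + b - k * p₀) w)
    (h1 : OPE k j A F F₁ TA) (h1' : OPE k j A F₁ F TA')
    (h2 : OPE k j B F F₁ TB) (h2' : OPE k j B F₁ F TB') (m n a b c : ℤ)
    (ha : a ≡ j [ZMOD k]) (hb : b ≡ j [ZMOD k]) (w : M) :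
    ∑ᶠ s : ℕ, binom((b : ℂ) / k, s) • (ordProd k A (TB (n + s)) m a (b + c - k * s) w -
        (-1 : ℂ) ^ m • ordProd k (ε • TB' (n + s)) A m (b + c - k * s) a w) -
      ε • ∑ᶠ s : ℕ, binom((a : ℂ) / k, s) •
        (ordProd k B (TA (m + s)) n b (a + c - k * s) w -
          (-1 : ℂ) ^ n • ordProd k (ε • TA' (m + s)) B n (a + c - k * s) b w) =
      γ • ∑ t ∈ range (p₀ + 1),
        (binom(m, t) * binom((a : ℂ) / k, p₀ - t)) •
          ∑ᶠ i : ℕ, binom(((a : ℂ) + b) / k - p₀ + t, i) •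
            (if m + n - t + i = -1 then F (a + b + c - k * p₀ + k * t - k * i) w else 0) := by
  have hk : (k : ℂ) ≠ 0 := by exact_mod_cast NeZero.ne k
  rw [OPE.finsum_ordProd_eq_binomSum ε hA hB hF hF₁ hTB h2 h2' m n a b c hb w,
    OPE.finsum_ordProd_eq_binomSum ε hB hA hF hF₁ hTA h1 h1' n m b a c ha w]
  have b1 : Boxed fun i p : ℕ =>
      A (a + k * (m - i)) (B (b + k * (n - p)) (F (c + k * i + k * p) w)) := boxed_diagonal hF c w
  have b1' : Boxed fun i p : ℕ =>
      B (b + k * (n - i)) (A (a + k * (m - p)) (F (c + k * i + k * p) w)) := boxed_diagonal hF c w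
  have b4 : Boxed fun i p : ℕ =>
      F (c + k * (m - i) + k * (n - p)) (B (b + k * p) (A (a + k * i) w)) :=
    (boxed_nested hB hA a w).swap
  have b4' : Boxed fun i p : ℕ =>
      F (c + k * (n - i) + k * (m - p)) (A (a + k * p) (B (b + k * i) w)) :=
    (boxed_nested hA hB b w).swap
  have hmod : ∀ (x y z : ℤ), x ≡ z [ZMOD k] → x + k * y ≡ z [ZMOD k] := fun x y z h => by
    simpa [Int.ModEq] using h
  -- the terms with `F` on the right
  have e1 : binomSum m n (fun i p => A (a + k * (m - i)) (B (b + k * (n - p))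
        (F (c + k * i + k * p) w))) -
      ε • binomSum n m (fun i p => B (b + k * (n - i)) (A (a + k * (m - p))
        (F (c + k * i + k * p) w))) =
      γ • ∑ t ∈ range (p₀ + 1), (binom(m, t) * binom((a : ℂ) / k, p₀ - t)) •
        ordProd k (vacFamily M k) F (m + n - t) (a + b - k * p₀ + k * t) c w := by
    rw [binomSum_swap b1', ← binomSum_sub b1 b1'.swap, ← finsum_choose_sub_smul hF, binomSum,
      ← Boxed.finsum_smul]
    · refine finsum_congr fun i => finsum_congr fun p => ?_
      rw [show c + k * i + k * p = c + (k : ℤ) * ((i + p : ℕ) : ℤ) by push_cast; ring,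
        show c + k * p + k * i = c + (k : ℤ) * ((i + p : ℕ) : ℤ) by push_cast; ring,
          hAB _ _ _ (hmod _ _ _ ha) (hmod _ _ _ hb), smul_smul, smul_smul,
        sub_div_natCast,
        show a + k * (m - i) + (b + k * (n - p)) - k * p₀ =
          a + b - k * p₀ + k * (m + n - ((i + p : ℕ) : ℤ)) by push_cast; ring]
      congr 1
      ring
    · obtain ⟨N, hN⟩ := hF.exists_nat (k := k) c w
      exact Boxed.of_add (N := N) fun i p h => by rw [hN _ h, map_zero, smul_zero]
  -- the terms with `F` on the left
  have e2 : binomSum n m (fun i p =>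
        F (c + k * (n - i) + k * (m - p)) (A (a + k * p) (B (b + k * i) w))) -
      ε • binomSum m n (fun i p =>
        F (c + k * (m - i) + k * (n - p)) (B (b + k * p) (A (a + k * i) w))) =
      γ • ∑ t ∈ range (p₀ + 1),
        ((-1) ^ t * binom(m, t) * binom((a : ℂ) / k, p₀ - t)) •
          ordProd k F (vacFamily M k) (m + n - t) c (a + b - k * p₀ + k * t) w := by
    rw [binomSum_swap b4', ← binomSum_sub b4'.swap b4,
      ← finsum_choose_add_smul truncField_vacFamily, binomSum, ← Boxed.finsum_smul]
    · refine finsum_congr fun i => finsum_congr fun p => ?_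
      rw [show c + k * (n - p) + k * (m - i) = c + k * (m + n - ((i + p : ℕ) : ℤ)) by
          push_cast; ring,
        show c + k * (m - i) + k * (n - p) = c + k * (m + n - ((i + p : ℕ) : ℤ)) by
          push_cast; ring, ← map_smul, ← map_sub,
        hAB _ _ _ (hmod _ _ _ ha) (hmod _ _ _ hb), map_smul, smul_smul, smul_smul,
        div_add_natCast_mul,
        show a + k * i + (b + k * p) - k * p₀ =
          a + b - k * p₀ + k * ((i + p : ℕ) : ℤ) by push_cast; ring]
      congr 1
      ring
    · obtain ⟨N, hN⟩ := (truncField_vacFamily (M := M) (k := k)).exists_nat (k := k)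
        (a + b - k * p₀) w
      exact Boxed.of_add (N := N) fun i p h => by rw [hN _ h, map_zero, smul_zero]
  have hvac := OPE.vac_left (k := k) hF
  have e3 : ∀ t : ℕ, ∑ᶠ i : ℕ, binom(((a : ℂ) + b) / k - p₀ + t, i) •
            (if m + n - t + i = -1 then F (a + b + c - k * p₀ + k * t - k * i) w else 0) =
      ordProd k (vacFamily M k) F (m + n - t) (a + b - k * p₀ + k * t) c w -
        (-1 : ℂ) ^ (m + n - t) • ordProd k F (vacFamily M k) (m + n - t) c
          (a + b - k * p₀ + k * t) w := by
    intro t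
    rw [hvac.eq]
    · refine finsum_congr fun i => ?_
      rw [show ((a + b - k * p₀ + k * t : ℤ) : ℂ) / k = ((a : ℂ) + b) / k - p₀ + t by
        push_cast; field_simp,
        show a + b + c - (k : ℤ) * p₀ + k * t - k * i = a + b - k * p₀ + k * t + c - k * i by ring]
      split_ifs <;> rfl
    · have h3 : a + b ≡ j + j [ZMOD k] := ha.add hb
      have h4 : j + j ≡ 0 [ZMOD k] := by
        rw [← two_mul]; exact (Int.modEq_zero_iff_dvd).mpr hj
      have h5 := h3.trans h4
      rw [Int.modEq_zero_iff_dvd] at h5 ⊢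
      exact dvd_add (dvd_sub h5 (dvd_mul_right _ _)) (dvd_mul_right _ _)
  simp only [e3, neg_one_zpow_sub_nat, zpow_add₀ (show (-1 : ℂ) ≠ 0 by norm_num)]
  have e4 : γ • ∑ t ∈ range (p₀ + 1),
        (binom(m, t) * binom((a : ℂ) / k, p₀ - t)) •
          (ordProd k (vacFamily M k) F (m + n - t) (a + b - k * p₀ + k * t) c w -
            ((-1 : ℂ) ^ m * (-1) ^ n * (-1) ^ t) •
              ordProd k F (vacFamily M k) (m + n - t) c (a + b - k * p₀ + k * t) w) =
      γ • ∑ t ∈ range (p₀ + 1), (binom(m, t) * binom((a : ℂ) / k, p₀ - t)) •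
        ordProd k (vacFamily M k) F (m + n - t) (a + b - k * p₀ + k * t) c w -
      ((-1 : ℂ) ^ m * (-1) ^ n) • γ • ∑ t ∈ range (p₀ + 1),
        ((-1) ^ t * binom(m, t) * binom((a : ℂ) / k, p₀ - t)) •
          ordProd k F (vacFamily M k) (m + n - t) c (a + b - k * p₀ + k * t) w := by
    rw [smul_comm _ γ, ← smul_sub,
      smul_sum (r := (-1 : ℂ) ^ m * (-1) ^ n), ← sum_sub_distrib]
    congr 1
    refine sum_congr rfl fun t _ => ?_
    module
  rw [e4, ← e1, ← e2]
  match_scalars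
  all_goals first
    | ring1
    | linear_combination ((-1 : ℂ) ^ n) * hε
    | linear_combination (-((-1 : ℂ) ^ n)) * hε
    | linear_combination ((-1 : ℂ) ^ m * (-1) ^ n) * hε
    | linear_combination (-((-1 : ℂ) ^ m * (-1) ^ n)) * hε

end Commutation
/-! ### Conjugation and linearity of operator product expansions -/

section Conjugation

variable {M : Type*} [AddCommGroup M] [Module ℂ M] {k : ℕ} [NeZero k]
  {A B B' F F₁ : ℤ → End ℂ M}

/-- Conjugation of a field by an involution. -/
def conjFamily (π : End ℂ M) : (ℤ → End ℂ M) →ₗ[ℂ] (ℤ → End ℂ M) where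
  toFun F N := π * F N * π
  map_add' F G := by funext N; simp [mul_add, add_mul]
  map_smul' c F := by funext N; simp

variable {π : End ℂ M}

lemma conjFamily_apply (N : ℤ) (w : M) : conjFamily π F N w = π (F N (π w)) := rfl

lemma conjFamily_conjFamily (hπ : π * π = 1) (F : ℤ → End ℂ M) :
    conjFamily π (conjFamily π F) = F := by
  funext N
  change π * (π * F N * π) * π = F N
  rw [mul_assoc, mul_assoc, hπ, mul_one, ← mul_assoc, hπ, one_mul]

lemma TruncField.conj (hF : TruncField F) : TruncField (conjFamily π F) := fun w =>
  (hF (π w)).imp fun N hN n hn => by rw [conjFamily_apply, hN n hn, map_zero]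

lemma ordProd_conj (hπ : π * π = 1) (hB : TruncField B) (l m n : ℤ) (w : M) :
    ordProd k (conjFamily π A) (conjFamily π B) l m n w = π (ordProd k A B l m n (π w)) := by
  obtain ⟨N, hN⟩ := hB.exists_nat (k := k) n (π w)
  rw [ordProd, ordProd, map_finsum_ge (N := N) _ fun i hi => by simp [hN i hi]]
  refine finsum_congr fun i => ?_
  have h : ∀ v, π (π v) = v := fun v => by
    rw [← Module.End.mul_apply, hπ]; rfl
  rw [conjFamily_apply, conjFamily_apply, h, map_smul]

lemma OPE.conj {j : ℤ} {ε : ℂ} {T : ℤ → ℤ → End ℂ M} (hπ : π * π = 1) (hε : ε * ε = 1)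
    (hA : TruncField A) (hF : TruncField F) (hAπ : conjFamily π A = ε • A) (h : OPE k j A F F₁ T) :
    OPE k j A (conjFamily π F) (conjFamily π F₁) (fun l => ε • conjFamily π (T l)) := by
  refine ⟨h.bdd.imp fun L hL l hl => by simp [hL l hl], fun l m n w hm => ?_⟩
  have hA' : A = ε • conjFamily π A := by rw [hAπ, smul_smul, hε, one_smul]
  have h1 : ∀ m n w, ordProd k A (conjFamily π F) l m n w =
      ε • π (ordProd k A F l m n (π w)) := fun m n w => by
    conv_lhs => rw [hA']
    rw [ordProd_smul_left hF.conj, ordProd_conj hπ hF]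
  have h2 : ∀ m n w, ordProd k (conjFamily π F₁) A l m n w =
      ε • π (ordProd k F₁ A l m n (π w)) := fun m n w => by
    conv_lhs => rw [hA']
    rw [ordProd_smul_right hA.conj, ordProd_conj hπ hA]
  obtain ⟨N, hN⟩ := exists_nat_of_bdd h.bdd l
  rw [h1, h2, smul_comm, ← smul_sub, ← map_smul, ← map_sub, h.eq _ _ _ _ hm,
    map_finsum_ge (N := N) _ fun i hi => by simp [hN i hi],
    finsum_smul_eq (hasFiniteSupport_of_ge (N := N) fun i hi => by simp [hN i hi])]
  refine finsum_congr fun i => ?_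
  rw [map_smul, smul_comm]
  rfl

lemma OPE.truncField {j : ℤ} {T : ℤ → ℤ → End ℂ M} (hA : TruncField A)
    (hF : TruncField F) (hF₁ : TruncField F₁) (h : OPE k j A F F₁ T) (l : ℤ) :
    TruncField (T l) := fun w => by
  obtain ⟨N, hN⟩ := exists_nat_of_bdd h.bdd l
  obtain ⟨K, hK⟩ := hF w
  have h1 : ∀ i : ℕ, ∃ R : ℤ, ∀ n, R ≤ n →
      ordProd k F₁ A (l + i) (n - j) (j - k * i) w = 0 := by
    intro i
    obtain ⟨N', hN'⟩ := hA.exists_nat (k := k) (j - k * i) w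
    choose R hR using fun i' : ℕ => hF₁ (A (j - k * i + k * i') w)
    obtain ⟨R', hR'⟩ := ((range N').image fun i' : ℕ =>
      R i' + j - k * (l + i - i')).bddAbove
    refine ⟨R', fun n hn => ?_⟩
    rw [ordProd_eq_sum_range hN']
    refine sum_eq_zero fun i' hi' => ?_
    have := hR' (by
      simp only [Finset.coe_image, Set.mem_image, Finset.mem_coe]
      exact ⟨i', hi', rfl⟩)
    rw [hR i' _ (by linarith), smul_zero]
  choose R hR using h1
  obtain ⟨R', hR'⟩ := ((range N).image R).bddAbove
  refine ⟨max R' (K + j), fun n hn => ?_⟩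
  rw [h.product_eq, finsum_eq_sum_range (N := N)]
  · refine sum_eq_zero fun i hi => ?_
    have h2 := hR' (by
      simp only [Finset.coe_image, Set.mem_image, Finset.mem_coe]
      exact ⟨i, hi, rfl⟩)
    rw [hR i n (by omega), smul_zero, sub_zero, ordProd_eq_sum_range (N := 0) fun i _ => ?_]
    · simp
    · have : (0 : ℤ) ≤ k * i := by positivity
      exact hK _ (by omega)
  · intro i hi
    rw [h.eq _ _ _ _ (by simp [Int.ModEq]), finsum_eq_zero_of_forall_eq_zero, smul_zero]
    intro p
    have := hN (i + p) (by omega)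
    push_cast at this
    rw [add_assoc, this]
    simp

lemma OPE.add {j : ℤ} {G G₁ : ℤ → End ℂ M} {S T : ℤ → ℤ → End ℂ M}
    (hA : TruncField A) (hF : TruncField F) (hG : TruncField G) (h : OPE k j A F F₁ S)
    (h' : OPE k j A G G₁ T) : OPE k j A (F + G) (F₁ + G₁) (S + T) := by
  obtain ⟨L, hL⟩ := h.bdd
  obtain ⟨K, hK⟩ := h'.bdd
  refine ⟨⟨max L K, fun l hl => ?_⟩, fun l m n w hm => ?_⟩
  · rw [Pi.add_apply, hL l (by omega), hK l (by omega), add_zero]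
  · obtain ⟨N, hN⟩ := exists_nat_of_bdd h.bdd l
    obtain ⟨N', hN'⟩ := exists_nat_of_bdd h'.bdd l
    rw [ordProd_add_right hF hG, ordProd_add_left hA, smul_add, add_sub_add_comm, h.eq _ _ _ _ hm,
      h'.eq _ _ _ _ hm, ← finsum_add_distrib
        (hasFiniteSupport_of_ge (N := N) fun i hi => by simp [hN i hi])
        (hasFiniteSupport_of_ge (N := N') fun i hi => by simp [hN' i hi])]
    refine finsum_congr fun i => ?_
    rw [← smul_add]
    rfl

lemma OPE.smul {j : ℤ} {S : ℤ → ℤ → End ℂ M} (hA : TruncField A) (hF : TruncField F)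
    (h : OPE k j A F F₁ S) (c : ℂ) : OPE k j A (c • F) (c • F₁) (c • S) := by
  refine ⟨h.bdd.imp fun L hL l hl => by simp [hL l hl], fun l m n w hm => ?_⟩
  obtain ⟨N, hN⟩ := exists_nat_of_bdd h.bdd l
  rw [ordProd_smul_right hF, ordProd_smul_left hA, smul_comm _ c, ← smul_sub, h.eq _ _ _ _ hm,
    finsum_smul_eq (hasFiniteSupport_of_ge (N := N) fun i hi => by simp [hN i hi])]
  refine finsum_congr fun i => ?_
  rw [smul_comm]
  rfl

lemma OPE.add_left {j : ℤ} {S T : ℤ → ℤ → End ℂ M}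
    (hA : TruncField A) (hB : TruncField B) (hF : TruncField F) (h : OPE k j A F F₁ S)
    (h' : OPE k j B F F₁ T) : OPE k j (A + B) F F₁ (S + T) := by
  obtain ⟨L, hL⟩ := h.bdd
  obtain ⟨K, hK⟩ := h'.bdd
  refine ⟨⟨max L K, fun l hl => ?_⟩, fun l m n w hm => ?_⟩
  · rw [Pi.add_apply, hL l (by omega), hK l (by omega), add_zero]
  · obtain ⟨N, hN⟩ := exists_nat_of_bdd h.bdd l
    obtain ⟨N', hN'⟩ := exists_nat_of_bdd h'.bdd l
    rw [ordProd_add_right hA hB, ordProd_add_left hF, smul_add, add_sub_add_comm, h.eq _ _ _ _ hm,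
      h'.eq _ _ _ _ hm, ← finsum_add_distrib
        (hasFiniteSupport_of_ge (N := N) fun i hi => by simp [hN i hi])
        (hasFiniteSupport_of_ge (N := N') fun i hi => by simp [hN' i hi])]
    refine finsum_congr fun i => ?_
    rw [← smul_add]
    rfl

lemma OPE.smul_left {j : ℤ} {S : ℤ → ℤ → End ℂ M} (hA : TruncField A) (hF : TruncField F)
    (h : OPE k j A F F₁ S) (c : ℂ) : OPE k j (c • A) F F₁ (c • S) := by
  refine ⟨h.bdd.imp fun L hL l hl => by simp [hL l hl], fun l m n w hm => ?_⟩
  obtain ⟨N, hN⟩ := exists_nat_of_bdd h.bdd l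
  rw [ordProd_smul_right hA, ordProd_smul_left hF, smul_comm _ c, ← smul_sub, h.eq _ _ _ _ hm,
    finsum_smul_eq (hasFiniteSupport_of_ge (N := N) fun i hi => by simp [hN i hi])]
  refine finsum_congr fun i => ?_
  rw [smul_comm]
  rfl

/-- A triangular system in two indices. -/
lemma eq_zero_of_triangular₂ {D : ℤ → ℤ → ℤ → End ℂ M}
    (hD : ∀ m n, Boxed fun q s : ℕ => D (m + q) (n + s)) (x y : ℂ)
    (h : ∀ m n N w, ∑ᶠ q : ℕ, ∑ᶠ s : ℕ, (binom(x, q) * binom(y, s)) •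
      D (m + q) (n + s) (N - k * q - k * s) w = 0) : D = 0 := by
  funext m n
  obtain ⟨N, hN⟩ := hD m n
  suffices H : ∀ t q s : ℕ, 2 * N ≤ q + s + t → D (m + q) (n + s) = 0 by
    simpa using H (2 * N) 0 0 (by omega)
  intro t
  induction t with
  | zero => intro q s hqs; exact hN q s (by omega)
  | succ t ih =>
    intro q s hqs
    have ih' : ∀ i p : ℕ, 1 ≤ i ∨ 1 ≤ p → D (m + q + i) (n + s + p) = 0 := by
      intro i p hip
      have := ih (q + i) (s + p) (by omega)
      push_cast at this
      rwa [← add_assoc, ← add_assoc] at this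
    funext K
    ext w
    have h1 := h (m + q) (n + s) K w
    rw [finsum_finsum_eq_sum_range (N := 1) fun i p hip => by rw [ih' i p hip]; simp] at h1
    simpa using h1

end Conjugation
/-! ### Free fields and their normal ordered products -/

section FreeField

variable {h : Type*} [AddCommGroup h] [Module ℂ h]

/-- Fields `α(x)`, `α ∈ h`, of sign `s`, with modes in `ℤ + j/k` on the space `M`, whose
(super)commutators are scalars: those of free bosons for `s = 0`, of free fermions for `s = 1`.  The
involution `π` gives the sign of the vectors of `M`. -/
structure FreeField {M : Type u} [AddCommGroup M] [Module ℂ M] (B : LinearMap.BilinForm ℂ h)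
    (k : ℕ) (j : ℤ) (s : ℕ) (π : End ℂ M) (mode : h → ℤ → End ℂ M) : Prop where
  map_add : ∀ α β N, mode (α + β) N = mode α N + mode β N
  map_smul : ∀ (c : ℂ) α N, mode (c • α) N = c • mode α N
  trunc : ∀ α, TruncField (mode α)
  support : ∀ α N, ¬ N ≡ j [ZMOD k] → mode α N = 0
  parity_parity : π * π = 1
  parity_mode : ∀ α N w, π (mode α N w) = (-1 : ℂ) ^ s • mode α N (π w)
  commutator : ∀ α β a b w, a ≡ j [ZMOD k] → b ≡ j [ZMOD k] →
    mode α a (mode β b w) - (-1 : ℂ) ^ s • mode β b (mode α a w) =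
      (B α β * binom((a : ℂ) / k, 1 - s)) • vacFamily M k (a + b - k * (1 - s : ℕ)) w
  sign : (s = 0 ∧ π = 1) ∨ s = 1
  dvd : (k : ℤ) ∣ 2 * j

/-- The space generated by the creation modes of free fields, which acts on itself. -/
structure FreeModel {V : Type u} [AddCommGroup V] [Module ℂ V] (B : LinearMap.BilinForm ℂ h)
    (s : ℕ) (vac : V) (π : End ℂ V) (mode : h → ℤ → End ℂ V) : Prop
    extends FreeField B 1 0 s π mode where
  parity_vac : π vac = vac
  annihilation : ∀ α n, 0 ≤ n → mode α n vac = 0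
  span : ∀ p : Submodule ℂ V, vac ∈ p →
    (∀ α n, n < 0 → ∀ u ∈ p, mode α n u ∈ p) → ∀ u, u ∈ p
  /-- the space is freely generated by the (super)commuting creation modes -/
  lift : ∀ (N : Type u) [AddCommGroup N] [Module ℂ N] (T : ℕ → h →ₗ[ℂ] End ℂ N),
    (∀ α β m n, T m α * T n β = (-1 : ℂ) ^ s • (T n β * T m α)) → ∀ x : N,
      ∃ φ : V →ₗ[ℂ] N, φ vac = x ∧ ∀ α (n : ℕ) u, φ (mode α (-n - 1) u) = T n α (φ u)

lemma neg_one_pow_mul_neg_one_pow (s : ℕ) : (-1 : ℂ) ^ s * (-1) ^ s = 1 := by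
  rw [← mul_pow]; norm_num

namespace FreeField

variable {M : Type u} [AddCommGroup M] [Module ℂ M] {B : LinearMap.BilinForm ℂ h}
    {k : ℕ} [NeZero k] {j : ℤ} {s : ℕ} {π : End ℂ M} {mode : h → ℤ → End ℂ M}
    (ff : FreeField B k j s π mode)

lemma conj_mode (ff : FreeField B k j s π mode) (α : h) : conjFamily π (mode α) =
    (-1 : ℂ) ^ s • mode α := by
  funext N
  ext w
  rw [conjFamily_apply, ff.parity_mode]
  have : π (π w) = w := by rw [← Module.End.mul_apply, ff.parity_parity]; rfl
  rw [this]
  rfl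

/-- The fields that are local with respect to the given free fields. -/
def localFields : Submodule ℂ (ℤ → End ℂ M) where
  carrier := {F | TruncField F ∧ ∀ α, ∃ L : ℤ, ∀ l, L ≤ l → ∀ m n w, m ≡ j [ZMOD k] →
    ordProd k (mode α) F l m n w -
      (-1 : ℂ) ^ l • ordProd k (conjFamily π F) (mode α) l n m w = 0}
  zero_mem' := ⟨TruncField.zero, fun α => ⟨0, fun l _ m n w _ => by
    rw [map_zero, ordProd_zero_left, ordProd_zero_right, smul_zero, sub_zero]⟩⟩
  add_mem' := by
    rintro F G ⟨hF, hF'⟩ ⟨hG, hG'⟩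
    refine ⟨hF.add hG, fun α => ?_⟩
    obtain ⟨L, hL⟩ := hF' α
    obtain ⟨K, hK⟩ := hG' α
    refine ⟨max L K, fun l hl m n w hm => ?_⟩
    rw [_root_.map_add, ordProd_add_right hF hG, ordProd_add_left (ff.trunc α), smul_add,
      add_sub_add_comm, hL l (by omega) _ _ _ hm, hK l (by omega) _ _ _ hm, add_zero]
  smul_mem' := by
    rintro c F ⟨hF, hF'⟩
    refine ⟨hF.smul c, fun α => ?_⟩
    obtain ⟨L, hL⟩ := hF' α
    refine ⟨L, fun l hl m n w hm => ?_⟩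
    rw [_root_.map_smul, ordProd_smul_right hF, ordProd_smul_left (ff.trunc α), smul_comm _ c,
      ← smul_sub, hL l hl _ _ _ hm, smul_zero]

lemma exists_ope (α : h) {F : ℤ → End ℂ M} (hF : F ∈ ff.localFields) :
    ∃ T, OPE k j (mode α) F (conjFamily π F) T :=
  OPE.exists_of_local (ff.trunc α) hF.1 (hF.2 α)

lemma conj_mem {F : ℤ → End ℂ M} (hF : F ∈ ff.localFields) :
    conjFamily π F ∈ ff.localFields := by
  refine ⟨hF.1.conj, fun α => ?_⟩
  obtain ⟨T, hT⟩ := ff.exists_ope α hF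
  have h1 := hT.conj ff.parity_parity (neg_one_pow_mul_neg_one_pow s) (ff.trunc α) hF.1
    (ff.conj_mode α)
  obtain ⟨L, hL⟩ := h1.bdd
  refine ⟨L, fun l hl m n w hm => ?_⟩
  rw [h1.eq _ _ _ _ hm]
  refine finsum_eq_zero_of_forall_eq_zero fun i => ?_
  rw [hL (l + i) (by omega)]
  simp

/-- The products of the free field `α(x)` with a local field. -/
def fieldProd (α : h) (F : ff.localFields) : ℤ → ℤ → End ℂ M :=
  (ff.exists_ope α F.2).choose

lemma fieldProd_ope (α : h) (F : ff.localFields) :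
    OPE k j (mode α) F (conjFamily π F) (ff.fieldProd α F) :=
  (ff.exists_ope α F.2).choose_spec

lemma fieldProd_trunc (α : h) (F : ff.localFields) (l : ℤ) : TruncField (ff.fieldProd α F l) :=
  (ff.fieldProd_ope α F).truncField (ff.trunc α) F.2.1 F.2.1.conj l

lemma fieldProd_add (α : h) (F G : ff.localFields) :
    ff.fieldProd α (F + G) = ff.fieldProd α F + ff.fieldProd α G := by
  refine (ff.fieldProd_ope α (F + G)).unique ?_
  have := (ff.fieldProd_ope α F).add (ff.trunc α) F.2.1 G.2.1 (ff.fieldProd_ope α G)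
  rwa [← _root_.map_add] at this

lemma fieldProd_smul (α : h) (c : ℂ) (F : ff.localFields) :
    ff.fieldProd α (c • F) = c • ff.fieldProd α F := by
  refine (ff.fieldProd_ope α (c • F)).unique ?_
  have := (ff.fieldProd_ope α F).smul (ff.trunc α) F.2.1 c
  rwa [← _root_.map_smul] at this

lemma fieldProd_add_left (α β : h) (F : ff.localFields) :
    ff.fieldProd (α + β) F = ff.fieldProd α F + ff.fieldProd β F := by
  refine (ff.fieldProd_ope _ F).unique ?_
  have := (ff.fieldProd_ope α F).add_left (ff.trunc α) (ff.trunc β) F.2.1 (ff.fieldProd_ope β F)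
  rwa [show mode α + mode β = mode (α + β) from funext fun N => (ff.map_add α β N).symm] at this

lemma fieldProd_smul_left (c : ℂ) (α : h) (F : ff.localFields) :
    ff.fieldProd (c • α) F = c • ff.fieldProd α F := by
  refine (ff.fieldProd_ope _ F).unique ?_
  have := (ff.fieldProd_ope α F).smul_left (ff.trunc α) F.2.1 c
  rwa [show c • mode α = mode (c • α) from funext fun N => (ff.map_smul c α N).symm] at this

/-- Conjugation of a local field. -/
def conjLocal (F : ff.localFields) : ff.localFields := ⟨conjFamily π F, ff.conj_mem F.2⟩

lemma fieldProd_conj (α : h) (F : ff.localFields) (l : ℤ) :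
    ff.fieldProd α (ff.conjLocal F) l = (-1 : ℂ) ^ s • conjFamily π (ff.fieldProd α F l) := by
  have h1 := (ff.fieldProd_ope α F).conj ff.parity_parity (neg_one_pow_mul_neg_one_pow s)
    (ff.trunc α) F.2.1 (ff.conj_mode α)
  exact congrFun ((ff.fieldProd_ope α (ff.conjLocal F)).unique h1) l

/-- The Jacobi identity for `α(x)`, `β(x)` and a local field. -/
lemma finsum_fieldProd_sub (α β : h) (F : ff.localFields) (m n a b c : ℤ)
    (ha : a ≡ j [ZMOD k]) (hb : b ≡ j [ZMOD k]) (w : M) :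
    ∑ᶠ q : ℕ, binom((b : ℂ) / k, q) •
        (ordProd k (mode α) (ff.fieldProd β F (n + q)) m a (b + c - k * q) w -
        (-1 : ℂ) ^ m • ordProd k (conjFamily π (ff.fieldProd β F (n + q))) (mode α) m
          (b + c - k * q) a w) -
      (-1 : ℂ) ^ s • ∑ᶠ q : ℕ, binom((a : ℂ) / k, q) •
        (ordProd k (mode β) (ff.fieldProd α F (m + q)) n b (a + c - k * q) w -
          (-1 : ℂ) ^ n • ordProd k (conjFamily π (ff.fieldProd α F (m + q))) (mode β) n
            (a + c - k * q) b w) =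
      B α β • ∑ t ∈ range (1 - s + 1),
        (binom(m, t) * binom((a : ℂ) / k, 1 - s - t)) •
          ∑ᶠ i : ℕ, binom(((a : ℂ) + b) / k - (1 - s : ℕ) + t, i) •
            (if m + n - t + i = -1 then
              F.1 (a + b + c - k * (1 - s : ℕ) + k * t - k * i) w else 0) := by
  have hconj : ∀ γ l, conjFamily π (ff.fieldProd γ F l) =
      (-1 : ℂ) ^ s • ff.fieldProd γ (ff.conjLocal F) l := fun γ l => by
    rw [fieldProd_conj, smul_smul, neg_one_pow_mul_neg_one_pow, one_smul]
  have h1 : ∀ γ, OPE k j (mode γ) (conjFamily π F) F (ff.fieldProd γ (ff.conjLocal F)) :=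
    fun γ => by
    have := ff.fieldProd_ope γ (ff.conjLocal F)
    simp only [conjLocal, conjFamily_conjFamily ff.parity_parity] at this
    exact this
  simp only [hconj]
  exact OPE.finsum_ordProd_sub (neg_one_pow_mul_neg_one_pow s) ff.dvd (ff.trunc α) (ff.trunc β)
    F.2.1 F.2.1.conj (ff.fieldProd_trunc α F) (ff.fieldProd_trunc β F)
    (fun a b w ha hb => ff.commutator α β a b w ha hb)
    (ff.fieldProd_ope α F) (h1 α) (ff.fieldProd_ope β F) (h1 β) m n a b c ha hb w

/-- The products of a free field with a local field are local (Dong's lemma). -/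
lemma fieldProd_mem (β : h) (F : ff.localFields) (l : ℤ) :
    ff.fieldProd β F l ∈ ff.localFields := by
  refine ⟨ff.fieldProd_trunc β F l, fun α => ?_⟩
  obtain ⟨LA, hLA⟩ := (ff.fieldProd_ope α F).bdd
  obtain ⟨LB, hLB⟩ := (ff.fieldProd_ope β F).bdd
  -- descending induction on the order of the product
  suffices H : ∀ t : ℕ, ∃ K : ℤ, ∀ n, LB - t ≤ n → ∀ m, K ≤ m → ∀ a c w, a ≡ j [ZMOD k] →
      ordProd k (mode α) (ff.fieldProd β F n) m a c w -
        (-1 : ℂ) ^ m • ordProd k (conjFamily π (ff.fieldProd β F n)) (mode α) m c a w = 0 by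
    obtain ⟨K, hK⟩ := H (LB - l).toNat
    exact ⟨K, hK l (by omega)⟩
  intro t
  induction t with
  | zero =>
    refine ⟨0, fun n hn m _ a c w _ => ?_⟩
    rw [hLB n (by push_cast at hn; omega), _root_.map_zero, ordProd_zero_left, ordProd_zero_right,
      smul_zero,
      sub_zero]
  | succ t ih =>
    obtain ⟨K, hK⟩ := ih
    refine ⟨max K (max LA (1 - s + t + 1 - LB)), fun n hn m hm a c w ha => ?_⟩
    by_cases hn' : LB - t ≤ n
    · exact hK n hn' m (by omega) a c w ha
    have key := ff.finsum_fieldProd_sub α β F m n a j (c - j) ha rfl w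
    rw [finsum_eq_zero_of_forall_eq_zero (f := fun q : ℕ => binom((a : ℂ) / k, q) • _)
      fun q => ?_, smul_zero, sub_zero, sum_eq_zero fun t' ht' => ?_, smul_zero,
      finsum_eq_sum_range (N := 1) fun q hq => ?_] at key
    · simpa using key
    · rw [hK (n + q) (by push_cast at hn; omega) m (by omega) _ _ _ ha, smul_zero]
    · rw [finsum_eq_zero_of_forall_eq_zero, smul_zero]
      intro i
      rw [if_neg, smul_zero]
      have := Finset.mem_range.mp ht'
      push_cast at hn
      rcases ff.sign with ⟨rfl, _⟩ | rfl <;> omega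
    · rw [hLA (m + q) (by omega), _root_.map_zero, ordProd_zero_left, ordProd_zero_right,
        smul_zero, sub_zero, smul_zero]

/-- The `l`-th product with `α(x)`, as an operator on local fields. -/
def fieldMode (α : h) (l : ℤ) : End ℂ ff.localFields where
  toFun F := ⟨ff.fieldProd α F l, ff.fieldProd_mem α F l⟩
  map_add' F G := Subtype.ext (congrFun (ff.fieldProd_add α F G) l)
  map_smul' c F := Subtype.ext (congrFun (ff.fieldProd_smul α c F) l)

lemma fieldMode_val (α : h) (l : ℤ) (F : ff.localFields) :
    (ff.fieldMode α l F).1 = ff.fieldProd α F l := rfl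

/-- The products with `α(x)` and `β(x)` satisfy the commutation relations of the modes of the
untwisted free fields. -/
lemma fieldMode_commutator (α β : h) (m n : ℤ) (F : ff.localFields) :
    ff.fieldMode α m (ff.fieldMode β n F) - (-1 : ℂ) ^ s • ff.fieldMode β n (ff.fieldMode α m F) =
      (B α β * binom(m, 1 - s)) • if m + n = (1 - s : ℕ) - 1 then F else 0 := by
  set ε : ℂ := (-1 : ℂ) ^ s with hε
  set p : ℕ := 1 - s with hp
  set γ : ℂ := B α β with hγ
  set x : ℂ := (j : ℂ) / k with hx
  set P : ℤ → ℤ → ℤ → End ℂ M := fun m n => ff.fieldProd α (ff.fieldMode β n F) m with hP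
  set Q : ℤ → ℤ → ℤ → End ℂ M := fun m n => ff.fieldProd β (ff.fieldMode α m F) n with hQ
  set R : ℤ → ℤ → ℤ → End ℂ M := fun m n =>
    (γ * binom(m, p)) • if m + n = p - 1 then F.1 else 0 with hR
  suffices h : (fun m n => P m n - ε • Q m n - R m n) = 0 by
    have h1 := congrFun (congrFun h m) n
    apply Subtype.ext
    have h2 : ((((γ * binom(m, p)) • if m + n = p - 1 then F else 0 :
        ff.localFields)) : ℤ → End ℂ M) = R m n := by
      simp only [hR]
      split_ifs <;> rfl
    rw [h2]
    exact sub_eq_zero.mp h1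
  obtain ⟨LA, hLA⟩ := (ff.fieldProd_ope α F).bdd
  obtain ⟨LB, hLB⟩ := (ff.fieldProd_ope β F).bdd
  have hPb : ∀ m n, Boxed fun q t : ℕ => P (m + q) (n + t) := fun m n => by
    refine Boxed.of_right (N := (LB - n).toNat) (fun q t ht => ?_) fun t => ?_
    · have : ff.fieldMode β (n + t) F = 0 := Subtype.ext (hLB (n + t) (by omega))
      simp only [hP, this]
      have := ff.fieldProd_smul α 0 0
      rw [zero_smul, zero_smul] at this
      rw [this]; rfl
    · obtain ⟨K, hK⟩ := (ff.fieldProd_ope α (ff.fieldMode β (n + t) F)).bdd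
      exact ⟨(K - m).toNat, fun q hq => hK _ (by omega)⟩
  have hQb : ∀ m n, Boxed fun q t : ℕ => Q (m + q) (n + t) := fun m n => by
    refine Boxed.of_left (N := (LA - m).toNat) (fun q t ht => ?_) fun q => ?_
    · have : ff.fieldMode α (m + q) F = 0 := Subtype.ext (hLA (m + q) (by omega))
      simp only [hQ, this]
      have := ff.fieldProd_smul β 0 0
      rw [zero_smul, zero_smul] at this
      rw [this]; rfl
    · obtain ⟨K, hK⟩ := (ff.fieldProd_ope β (ff.fieldMode α (m + q) F)).bdd
      exact ⟨(K - n).toNat, fun q hq => hK _ (by omega)⟩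
  have hRb : ∀ m n, Boxed fun q t : ℕ => R (m + q) (n + t) := fun m n =>
    Boxed.of_add (N := (p - m - n).toNat) fun q t h => by
      simp only [hR]
      rw [if_neg (by omega), smul_zero]
  refine eq_zero_of_triangular₂ (k := k) (fun m n => ((hPb m n).sub ((hQb m n).smul
    fun _ _ => ε)).sub (hRb m n)) x x fun m n N w => ?_
  have ev : ∀ {f : ℕ → ℕ → ℤ → End ℂ M}, Boxed f → Boxed fun q t : ℕ =>
      (binom(x, q) * binom(x, t)) • f q t (N - k * q - k * t) w := fun {f} hf =>
    hf.imp fun K hK q t h => by dsimp only; rw [hK q t h]; simp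
  have key := ff.finsum_fieldProd_sub α β F m n j j (N - j - j) rfl rfl w
  -- the three terms of the commutation relation
  have e1 : ∑ᶠ q : ℕ, binom((j : ℂ) / k, q) •
        (ordProd k (mode α) (ff.fieldProd β F (n + q)) m j (j + (N - j - j) - k * q) w -
        (-1 : ℂ) ^ m • ordProd k (conjFamily π (ff.fieldProd β F (n + q))) (mode α) m
          (j + (N - j - j) - k * q) j w) =
      ∑ᶠ q : ℕ, ∑ᶠ t : ℕ, (binom(x, q) * binom(x, t)) •
        P (m + q) (n + t) (N - k * q - k * t) w := by
    rw [(ev (hPb m n)).finsum_comm]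
    refine finsum_congr fun t => ?_
    have h1 := (ff.fieldProd_ope α (ff.fieldMode β (n + t) F)).eq m j
      (j + (N - j - j) - k * t) w rfl
    obtain ⟨K, hK⟩ := (ff.fieldProd_ope α (ff.fieldMode β (n + t) F)).bdd
    rw [fieldMode_val] at h1
    rw [h1, finsum_smul_eq (hasFiniteSupport_of_ge (N := (K - m).toNat) fun i hi => by
      rw [hK _ (by omega)]; simp)]
    refine finsum_congr fun q => ?_
    rw [smul_smul, mul_comm, show j + (j + (N - j - j) - (k : ℤ) * t) - k * q = N - k * q - k * t by
      ring]
  have e2 : ∑ᶠ q : ℕ, binom((j : ℂ) / k, q) •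
        (ordProd k (mode β) (ff.fieldProd α F (m + q)) n j (j + (N - j - j) - k * q) w -
        (-1 : ℂ) ^ n • ordProd k (conjFamily π (ff.fieldProd α F (m + q))) (mode β) n
          (j + (N - j - j) - k * q) j w) =
      ∑ᶠ q : ℕ, ∑ᶠ t : ℕ, (binom(x, q) * binom(x, t)) •
        Q (m + q) (n + t) (N - k * q - k * t) w := by
    refine finsum_congr fun q => ?_
    have h1 := (ff.fieldProd_ope β (ff.fieldMode α (m + q) F)).eq n j
      (j + (N - j - j) - k * q) w rfl
    obtain ⟨K, hK⟩ := (ff.fieldProd_ope β (ff.fieldMode α (m + q) F)).bdd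
    rw [fieldMode_val] at h1
    rw [h1, finsum_smul_eq (hasFiniteSupport_of_ge (N := (K - n).toNat) fun i hi => by
      rw [hK _ (by omega)]; simp)]
    refine finsum_congr fun t => ?_
    rw [smul_smul, show j + (j + (N - j - j) - (k : ℤ) * q) - k * t = N - k * q - k * t by ring]
  have e3 : γ • ∑ t ∈ range (p + 1),
        (binom(m, t) * binom((j : ℂ) / k, p - t)) •
          ∑ᶠ i : ℕ, binom(((j : ℂ) + j) / k - p + t, i) •
            (if m + n - t + i = -1 then
              F.1 (j + j + (N - j - j) - k * p + k * t - k * i) w else 0) =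
      ∑ᶠ q : ℕ, ∑ᶠ t : ℕ, (binom(x, q) * binom(x, t)) •
        R (m + q) (n + t) (N - k * q - k * t) w := by
    have h0 : ∀ q t : ℕ, (binom(x, q) * binom(x, t)) •
        R (m + q) (n + t) (N - k * q - k * t) w =
        if m + n + (q + t : ℕ) = p - 1 then (γ * (binom(x, q) * binom(x, t) *
          binom((m : ℂ) + q, p))) • F.1 (N - k * (q + t : ℕ)) w else 0 := by
      intro q t
      simp only [hR]
      rw [show m + q + (n + t) = m + n + ((q + t : ℕ) : ℤ) by push_cast; ring]
      split_ifs
      · simp only [Pi.smul_apply, smul_apply, smul_smul]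
        rw [show N - (k : ℤ) * q - k * t = N - k * ((q + t : ℕ) : ℤ) by push_cast; ring]
        congr 1
        push_cast
        ring
      · simp
    rw [(ev (hRb m n)).finsum_antidiagonal]
    simp only [h0]
    rcases lt_or_ge ((p : ℤ) - 1 - m - n) 0 with hu | hu
    · rw [finsum_eq_zero_of_forall_eq_zero fun u => sum_eq_zero fun ij _ => if_neg (by omega),
        sum_eq_zero fun t ht => ?_, smul_zero]
      rw [finsum_eq_zero_of_forall_eq_zero, smul_zero]
      intro i
      have := Finset.mem_range.mp ht
      rw [if_neg (by omega), smul_zero]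
    · obtain ⟨u, hu'⟩ := Int.eq_ofNat_of_zero_le hu
      rw [finsum_eq_single _ u]
      · have h2 : ∀ ij ∈ antidiagonal u,
            (if m + n + (ij.1 + ij.2 : ℕ) = (p : ℤ) - 1 then
              (γ * (binom(x, ij.1) * binom(x, ij.2) * binom((m : ℂ) + ij.1, p))) •
              F.1 (N - k * (ij.1 + ij.2 : ℕ)) w else 0) =
            (γ * (binom(x, ij.1) * binom(x, ij.2) * binom((m : ℂ) + ij.1, p))) •
              F.1 (N - k * u) w := by
          intro ij hij
          rw [mem_antidiagonal] at hij
          rw [hij, if_pos (by omega)]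
        rw [sum_congr rfl h2, ← sum_smul, ← mul_sum, sum_choose_choose_add,
          ← Finset.sum_range_reflect, mul_smul, sum_smul]
        congr 1
        refine sum_congr rfl fun t ht => ?_
        have ht : t ≤ p := by simpa [Nat.lt_succ_iff] using ht
        obtain ⟨t', ht'⟩ := Nat.exists_eq_add_of_le ht
        rw [show p + 1 - 1 - t = t' by omega, show p - t' = t by omega,
          show p - t = t' by omega, mul_smul (binom(x, t) * binom(m, t')),
          mul_comm (binom(x, t))]
        congr 1
        split_ifs with htu
        · obtain ⟨i, hi⟩ := Nat.exists_eq_add_of_le htu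
          rw [finsum_eq_single _ i, if_pos (by omega), show u - t = i by omega,
            show x + x - (t : ℂ) = ((j : ℂ) + j) / k - p + t' by
              rw [ht', hx, add_div]; push_cast; ring,
            show j + j + (N - j - j) - (k : ℤ) * p + k * t' - k * i = N - k * u by
              rw [ht', hi]; push_cast; ring]
          intro i' hi'
          rw [if_neg (by omega), smul_zero]
        · rw [zero_smul]
          refine finsum_eq_zero_of_forall_eq_zero fun i => ?_
          rw [if_neg (by omega), smul_zero]
      · intro u' hu''
        refine sum_eq_zero fun ij hij => ?_
        rw [mem_antidiagonal] at hij
        rw [if_neg (by omega)]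
  rw [e1, e2, e3, ← Boxed.finsum_smul (ev (hQb m n)),
    ← Boxed.finsum_sub (ev (hPb m n)) ((ev (hQb m n)).smul fun _ _ => ε), ← sub_eq_zero,
    ← Boxed.finsum_sub ((ev (hPb m n)).sub ((ev (hQb m n)).smul fun _ _ => ε))
      (ev (hRb m n))] at key
  rw [← key]
  refine finsum_congr fun q => finsum_congr fun t => ?_
  simp only [Pi.sub_apply, sub_apply, Pi.smul_apply, smul_apply, smul_sub]
  rw [smul_comm ε]

end FreeField

end FreeField
/-! ### Vertex operators generated by free fields -/

section VertexOperators

variable {M : Type*} [AddCommGroup M] [Module ℂ M] {k : ℕ}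

lemma vmode_trunc (A : VertexOperator ℂ M) : TruncField (vmode k A) := fun w => by
  obtain ⟨K, hK⟩ := A.exists_bound w
  exact ⟨-K - k + 1, fun n hn => hK _ (by omega)⟩

lemma vmode_add (A A' : VertexOperator ℂ M) : vmode k (A + A') = vmode k A + vmode k A' := by
  funext N
  simp [vmode]

lemma vmode_smul (c : ℂ) (A : VertexOperator ℂ M) : vmode k (c • A) = c • vmode k A := by
  funext N
  simp [vmode]

variable (M k) in
/-- The modes of a vertex operator, as a linear map. -/
def vmodeHom : VertexOperator ℂ M →ₗ[ℂ] (ℤ → End ℂ M) where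
  toFun := vmode k
  map_add' := vmode_add
  map_smul' := vmode_smul

lemma vmodeHom_apply (A : VertexOperator ℂ M) : vmodeHom M k A = vmode k A := rfl

lemma vmode_zero (M : Type*) [AddCommGroup M] [Module ℂ M] (k : ℕ) [NeZero k] :
    vmode k (0 : VertexOperator ℂ M) = 0 := (vmodeHom M k).map_zero

lemma vmode_injective : Function.Injective (vmode k : VertexOperator ℂ M → _) := fun A B h => by
  refine VertexOperator.ext_coeff fun e w => ?_
  have := congrFun h (-e - k)
  simp only [vmode] at this
  rw [show -(-e - (k : ℤ)) - k = e by ring] at this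
  rw [this]

/-- The vertex operator with given modes. -/
def ofModes (k : ℕ) (F : ℤ → End ℂ M) (hF : TruncField F) : VertexOperator ℂ M :=
  VertexOperator.of_coeff (fun e => F (-e - k)) fun w => by
    obtain ⟨N, hN⟩ := hF w
    refine ⟨-N - k, fun e he => ?_⟩
    by_contra hlt
    exact he (hN _ (by omega))

lemma vmode_ofModes (F : ℤ → End ℂ M) (hF : TruncField F) :
    vmode k (ofModes k F hF) = F := by
  funext N
  simp only [vmode, ofModes, VertexOperator.of_coeff, HVertexOperator.coeff_of_coeff]
  congr 1
  ring

end VertexOperators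

section Model

variable {h : Type*} [AddCommGroup h] [Module ℂ h] {B : LinearMap.BilinForm ℂ h} {s : ℕ}
  {V : Type u} [AddCommGroup V] [Module ℂ V] {vac : V} {πV : End ℂ V}
  {modeV : h → ℤ → End ℂ V}
  {M : Type u} [AddCommGroup M] [Module ℂ M] {k : ℕ} [NeZero k] {j : ℤ} {π : End ℂ M}
  {mode : h → ℤ → End ℂ M}

namespace FreeField

variable (ff : FreeField B k j s π mode)

/-- The field `1` is local. -/
def vacLocal : ff.localFields := ⟨vacFamily M k, truncField_vacFamily, fun α => by
  have hc : conjFamily π (vacFamily M k) = vacFamily M k := by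
    funext N
    change π * _ * π = _
    unfold vacFamily
    split_ifs
    · rw [mul_one, ff.parity_parity]
    · rw [mul_zero, zero_mul]
  obtain ⟨P, hP, -⟩ := OPE.vac_right (k := k) (ff.trunc α) (ff.support α)
  obtain ⟨L, hL⟩ := hP.bdd
  refine ⟨L, fun l hl m n w hm => ?_⟩
  rw [hc, hP.eq _ _ _ _ hm]
  refine finsum_eq_zero_of_forall_eq_zero fun i => ?_
  rw [hL (l + i) (by omega)]
  simp⟩

lemma conjLocal_vacLocal : ff.conjLocal ff.vacLocal = ff.vacLocal := by
  apply Subtype.ext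
  funext N
  change π * vacFamily M k N * π = vacFamily M k N
  unfold vacFamily
  split_ifs
  · rw [mul_one, ff.parity_parity]
  · rw [mul_zero, zero_mul]

lemma fieldMode_vacLocal (α : h) : ff.fieldProd α ff.vacLocal (-1) = mode α ∧
    ∀ l : ℕ, ff.fieldProd α ff.vacLocal l = 0 := by
  obtain ⟨P, hP, h1, h2⟩ := OPE.vac_right (k := k) (ff.trunc α) (ff.support α)
  have h3 := ff.fieldProd_ope α ff.vacLocal
  rw [show conjFamily π (ff.vacLocal : ℤ → End ℂ M) = vacFamily M k from
    congrArg Subtype.val ff.conjLocal_vacLocal] at h3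
  rw [h3.unique hP]
  exact ⟨h1, h2⟩

lemma fieldMode_conjLocal (α : h) (l : ℤ) (F : ff.localFields) :
    ff.fieldMode α l (ff.conjLocal F) = (-1 : ℂ) ^ s • ff.conjLocal (ff.fieldMode α l F) :=
  Subtype.ext (ff.fieldProd_conj α F l)

/-- The products of negative order, as linear maps in `α`. -/
def creationField (n : ℕ) : h →ₗ[ℂ] End ℂ ff.localFields where
  toFun α := ff.fieldMode α (-n - 1)
  map_add' α β := by
    ext F : 2
    exact congrFun (ff.fieldProd_add_left α β F) _
  map_smul' c α := by
    ext F : 2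
    exact congrFun (ff.fieldProd_smul_left c α F) _

end FreeField

/-- The vertex operators of the vectors of a free model as fields on `M`: the creation modes are
sent to products of negative order. -/
lemma FreeModel.exists_fields (fm : FreeModel B s vac πV modeV) (ff : FreeField B k j s π mode) :
    ∃ φ : V →ₗ[ℂ] ff.localFields, φ vac = ff.vacLocal ∧
      (∀ α n u, φ (modeV α n u) = ff.fieldMode α n (φ u)) ∧
      ∀ u, φ (πV u) = ff.conjLocal (φ u) := by
  -- products of negative order with free fields (super)commute, so the universal property applies
  obtain ⟨φ, h1, h2⟩ := fm.lift ff.localFields ff.creationField (fun α β m n => by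
    refine LinearMap.ext fun F => ?_
    have := ff.fieldMode_commutator α β (-m - 1) (-n - 1) F
    have hs : ¬ ((-(m : ℤ) - 1) + (-n - 1) = ((1 - s : ℕ) : ℤ) - 1) := by
      have : (0 : ℤ) ≤ ((1 - s : ℕ) : ℤ) := Int.natCast_nonneg _
      omega
    rw [if_neg hs, smul_zero, sub_eq_zero] at this
    exact this) ff.vacLocal
  have hneg : ∀ α n, n < 0 → ∀ u, φ (modeV α n u) = ff.fieldMode α n (φ u) := fun α n hn u => by
    obtain ⟨t, ht⟩ := Int.eq_ofNat_of_zero_le (show 0 ≤ -n - 1 by omega)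
    obtain rfl : n = -t - 1 := by omega
    exact h2 α t u
  refine ⟨φ, h1, fun α n u => ?_, fun u => ?_⟩
  · rcases lt_or_ge n 0 with hn | hn
    · exact hneg α n hn u
    obtain ⟨t, rfl⟩ := Int.eq_ofNat_of_zero_le hn
    -- induction on the number of creation modes, using the commutation relations on both sides
    refine fm.span (LinearMap.ker (φ ∘ₗ modeV α t - ff.fieldMode α t ∘ₗ φ)) ?_ ?_ u |> fun h =>
      sub_eq_zero.mp h
    · rw [LinearMap.mem_ker, sub_apply, comp_apply, comp_apply,
        fm.annihilation α t hn, map_zero, h1, zero_sub, neg_eq_zero]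
      exact Subtype.ext ((ff.fieldMode_vacLocal α).2 t)
    · intro β m hm u hu
      rw [LinearMap.mem_ker, sub_apply, comp_apply, comp_apply,
        sub_eq_zero] at hu ⊢
      have c1 := fm.commutator α β t m u (by simpa using Int.modEq_one)
        (by simpa using Int.modEq_one)
      have c2 := ff.fieldMode_commutator α β t m (φ u)
      rw [sub_eq_iff_eq_add] at c1 c2
      rw [c1, hneg β m hm, c2, map_add, map_smul, map_smul, hneg β m hm, hu]
      congr 1
      unfold vacFamily
      have hiff : (t : ℤ) + m - (1 : ℕ) * ((1 - s : ℕ) : ℤ) = -(1 : ℕ) ↔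
          (t : ℤ) + m = ((1 - s : ℕ) : ℤ) - 1 := by push_cast; omega
      simp only [hiff]
      rw [Nat.cast_one, div_one]
      split_ifs <;> simp
  · refine fm.span (LinearMap.ker (ff.localFields.subtype ∘ₗ φ ∘ₗ πV -
      conjFamily π ∘ₗ ff.localFields.subtype ∘ₗ φ)) ?_ ?_ u |> fun h =>
      Subtype.ext (sub_eq_zero.mp h)
    · rw [LinearMap.mem_ker, sub_apply, sub_eq_zero]
      simp only [comp_apply, fm.parity_vac, h1]
      exact (congrArg Subtype.val ff.conjLocal_vacLocal).symm
    · intro β m hm u hu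
      rw [LinearMap.mem_ker, sub_apply, sub_eq_zero] at hu ⊢
      simp only [comp_apply, Submodule.subtype_apply] at hu ⊢
      have hu' : φ (πV u) = ff.conjLocal (φ u) := Subtype.ext hu
      rw [fm.parity_mode, map_smul, hneg β m hm, hneg β m hm, hu', ff.fieldMode_conjLocal,
        smul_smul, neg_one_pow_mul_neg_one_pow, one_smul]
      rfl

/-- The properties of the vertex operators generated by free fields. -/
structure IsFreeY (πV : End ℂ V) (vac : V) (modeV : h → ℤ → End ℂ V) (k : ℕ) (j : ℤ)
    (π : End ℂ M) (mode : h → ℤ → End ℂ M)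
    (Y : V →ₗ[ℂ] VertexOperator ℂ M) : Prop where
  vacuum : vmode k (Y vac) = vacFamily M k
  ope : ∀ α u, OPE k j (mode α) (vmode k (Y u)) (vmode k (Y (πV u)))
    fun n => vmode k (Y (modeV α n u))
  parity : ∀ u, vmode k (Y (πV u)) = conjFamily π (vmode k (Y u))
  gen : ∀ α, vmode k (Y (modeV α (-1) vac)) = mode α

lemma FreeModel.exists_isFreeY (fm : FreeModel B s vac πV modeV)
    (ff : FreeField B k j s π mode) :
    ∃ Y : V →ₗ[ℂ] VertexOperator ℂ M, IsFreeY πV vac modeV k j π mode Y := by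
  obtain ⟨φ, h1, h2, h3⟩ := fm.exists_fields ff
  let Y : V →ₗ[ℂ] VertexOperator ℂ M :=
    { toFun := fun u => ofModes k (φ u).1 (φ u).2.1
      map_add' := fun u v => vmode_injective (k := k) (by
        rw [vmode_add, vmode_ofModes, vmode_ofModes, vmode_ofModes, map_add]; rfl)
      map_smul' := fun c u => vmode_injective (k := k) (by
        rw [vmode_smul, vmode_ofModes, vmode_ofModes, map_smul]; rfl) }
  have hY : ∀ u, vmode k (Y u) = (φ u).1 := fun u => vmode_ofModes _ (φ u).2.1
  refine ⟨Y, ?_, fun α u => ?_, fun u => ?_, fun α => ?_⟩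
  · rw [hY, h1]; rfl
  · simp only [hY, h2, h3]
    exact ff.fieldProd_ope α (φ u)
  · rw [hY, hY, h3]; rfl
  · rw [hY, h2, h1]
    exact (ff.fieldMode_vacLocal α).1

/-- The recursion is the Jacobi identity with one free field, solved for the products. -/
lemma IsFreeY.isIterated (ff : FreeField B k j s π mode)
    (hs : s = 0 → πV = 1) {Y : V →ₗ[ℂ] VertexOperator ℂ M}
    (hY : IsFreeY πV vac modeV k j π mode Y) :
    IsIterated k j s vac πV modeV mode Y := by
  refine ⟨fun N => by rw [hY.vacuum]; rfl, fun α n hn b u hu N w => ?_⟩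
  have hsign : vmode k (Y (πV u)) = ((-1 : ℂ) ^ (s * b)) • vmode k (Y u) := by
    rcases ff.sign with ⟨rfl, _⟩ | rfl
    · rw [hs rfl, zero_mul, pow_zero, one_smul]
      rfl
    · rw [hu, map_smul, vmode_smul, one_mul]
  have h1 := hY.ope α u
  rw [hsign] at h1
  rw [h1.product_eq]
  refine finsum_congr fun i => ?_
  rw [jacobiLHS_eq (ff.trunc α) (vmode_trunc _)]

/-- The recursion determines the vertex operators of all vectors, since the creation modes
generate the space from the vacuum. -/
lemma FreeModel.isIterated_unique (fm : FreeModel B s vac πV modeV)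
    {Y Y' : V →ₗ[ℂ] VertexOperator ℂ M} (hY : IsIterated k j s vac πV modeV mode Y)
    (hY' : IsIterated k j s vac πV modeV mode Y') : Y = Y' := by
  have hπ : ∀ u, πV (πV u) = u := fun u => by
    rw [← Module.End.mul_apply, fm.parity_parity]; rfl
  have hstep : ∀ α n, n < 0 → ∀ u, Y u = Y' u → Y (πV u) = Y' (πV u) →
      Y (modeV α n u) = Y' (modeV α n u) := by
    have hom : ∀ α n, n < 0 → ∀ (b : ℕ) u, πV u = (-1 : ℂ) ^ b • u → Y u = Y' u →
        Y (modeV α n u) = Y' (modeV α n u) := by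
      intro α n hn b u hu h1
      refine vmode_injective (k := k) ?_
      funext N
      ext w
      rw [hY.iterate α n hn b u hu, hY'.iterate α n hn b u hu, h1]
    intro α n hn u h1 h2
    have e : u = (1 / 2 : ℂ) • (u + πV u) + (1 / 2 : ℂ) • (u - πV u) := by module
    rw [e, map_add, map_add, map_add, map_smul, map_smul, map_smul, map_smul, map_smul, map_smul,
      hom α n hn 0 (u + πV u) (by rw [map_add, hπ, pow_zero, one_smul, add_comm])
        (by rw [map_add, map_add, h1, h2]),
      hom α n hn 1 (u - πV u) (by rw [map_sub, hπ, pow_one]; module)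
        (by rw [map_sub, map_sub, h1, h2])]
  refine LinearMap.ext fun u => ?_
  refine (fm.span (LinearMap.ker (Y - Y') ⊓ LinearMap.ker ((Y - Y') ∘ₗ πV)) ?_ ?_ u).1 |> fun h =>
    sub_eq_zero.mp h
  · have : (Y - Y') vac = 0 := by
      rw [sub_apply, sub_eq_zero]
      refine vmode_injective (k := k) ?_
      funext N
      rw [hY.vac, hY'.vac]
    refine ⟨this, ?_⟩
    change (Y - Y') (πV vac) = 0
    rw [fm.parity_vac, this]
  · rintro α n hn u ⟨h1, h2⟩
    have h1 : Y u = Y' u := sub_eq_zero.mp h1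
    have h2 : Y (πV u) = Y' (πV u) := sub_eq_zero.mp h2
    refine ⟨sub_eq_zero.mpr (hstep α n hn u h1 h2), ?_⟩
    change (Y - Y') (πV (modeV α n u)) = 0
    rw [fm.parity_mode, map_smul, sub_apply,
      hstep α n hn (πV u) h2 (by rw [hπ, h1]), sub_self, smul_zero]

lemma FreeModel.existsUnique_isIterated (fm : FreeModel B s vac πV modeV)
    (ff : FreeField B k j s π mode) :
    ∃! Y : V →ₗ[ℂ] VertexOperator ℂ M, IsIterated k j s vac πV modeV mode Y := by
  have hs : s = 0 → πV = 1 := fun h0 => by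
    rcases fm.sign with ⟨_, h1⟩ | h1
    · exact h1
    · omega
  obtain ⟨Y, hY⟩ := fm.exists_isFreeY ff
  exact ⟨Y, hY.isIterated ff hs, fun Y' hY' => fm.isIterated_unique hY' (hY.isIterated ff hs)⟩

lemma FreeModel.isFreeY_of_isIterated (fm : FreeModel B s vac πV modeV)
    (ff : FreeField B k j s π mode) {Y : V →ₗ[ℂ] VertexOperator ℂ M}
    (hY : IsIterated k j s vac πV modeV mode Y) : IsFreeY πV vac modeV k j π mode Y := by
  have hs : s = 0 → πV = 1 := fun h0 => by
    rcases fm.sign with ⟨_, h1⟩ | h1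
    · exact h1
    · omega
  obtain ⟨Y', hY'⟩ := fm.exists_isFreeY ff
  rwa [fm.isIterated_unique hY (hY'.isIterated ff hs)]

end Model
/-! ### Derivations of symmetric and Clifford algebras -/

section SymDeriv

variable {W : Type*} [AddCommGroup W] [Module ℂ W]

/-- The homomorphism `a ↦ a + D(a) ε` to the dual numbers, where the derivation `D` extends `f`. -/
def symDerivLift (f : Dual ℂ W) :
    SymmetricAlgebra ℂ W →ₐ[ℂ] TrivSqZeroExt (SymmetricAlgebra ℂ W) (SymmetricAlgebra ℂ W) :=
  SymmetricAlgebra.lift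
      ((TrivSqZeroExt.inlAlgHom ℂ (SymmetricAlgebra ℂ W) (SymmetricAlgebra ℂ W)).toLinearMap ∘ₗ
          SymmetricAlgebra.ι ℂ W +
        (TrivSqZeroExt.inrHom (SymmetricAlgebra ℂ W) (SymmetricAlgebra ℂ W)).restrictScalars ℂ ∘ₗ
          (Algebra.linearMap ℂ (SymmetricAlgebra ℂ W)) ∘ₗ f)

lemma symDeriv_apply (f : Dual ℂ W) (a : SymmetricAlgebra ℂ W) :
    symDeriv f a = (symDerivLift f a).snd := rfl

lemma symDeriv_lift_fst (f : Dual ℂ W) (a : SymmetricAlgebra ℂ W) :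
    (symDerivLift f a).fst = a := by
  have : (TrivSqZeroExt.fstHom ℂ _ (SymmetricAlgebra ℂ W)).comp (symDerivLift f) =
      AlgHom.id ℂ _ := by
    refine SymmetricAlgebra.algHom_ext (LinearMap.ext fun w => ?_)
    simp [symDerivLift]
  exact DFunLike.congr_fun this a

lemma symDeriv_mul (f : Dual ℂ W) (a b : SymmetricAlgebra ℂ W) :
    symDeriv f (a * b) = a * symDeriv f b + b * symDeriv f a := by
  rw [symDeriv_apply, symDeriv_apply, symDeriv_apply, map_mul, TrivSqZeroExt.snd_mul,
    symDeriv_lift_fst, symDeriv_lift_fst]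
  simp [mul_comm]

lemma symDeriv_ι (f : Dual ℂ W) (w : W) :
    symDeriv f (SymmetricAlgebra.ι ℂ W w) = algebraMap ℂ _ (f w) := by
  rw [symDeriv_apply, symDerivLift, SymmetricAlgebra.lift_ι_apply]
  simp [Algebra.algebraMap_eq_smul_one]

lemma symDeriv_algebraMap (f : Dual ℂ W) (c : ℂ) :
    symDeriv f (algebraMap ℂ _ c) = 0 := by
  rw [symDeriv_apply, AlgHom.commutes]
  rfl

lemma symDeriv_one (f : Dual ℂ W) : symDeriv f 1 = 0 := by
  rw [← map_one (algebraMap ℂ _), symDeriv_algebraMap]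

lemma symDeriv_ι_mul (f : Dual ℂ W) (w : W) (a : SymmetricAlgebra ℂ W) :
    symDeriv f (SymmetricAlgebra.ι ℂ W w * a) =
      SymmetricAlgebra.ι ℂ W w * symDeriv f a + f w • a := by
  rw [symDeriv_mul, symDeriv_ι, Algebra.smul_def, mul_comm a]

/-- Induction on the number of factors. -/
lemma SymmetricAlgebra.left_induction {C : SymmetricAlgebra ℂ W → Prop}
    (one : C 1) (smul : ∀ (c : ℂ) a, C a → C (c • a)) (add : ∀ a b, C a → C b → C (a + b))
    (ι_mul : ∀ w a, C a → C (SymmetricAlgebra.ι ℂ W w * a)) (a : SymmetricAlgebra ℂ W) : C a := by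
  suffices H : ∀ b, C b → C (a * b) by simpa using H 1 one
  induction a using SymmetricAlgebra.induction with
  | algebraMap c => exact fun b hb => by rw [← Algebra.smul_def]; exact smul c b hb
  | ι w => exact fun b hb => ι_mul w b hb
  | mul a a' ha ha' => exact fun b hb => by rw [mul_assoc]; exact ha _ (ha' _ hb)
  | add a a' ha ha' => exact fun b hb => by rw [add_mul]; exact add _ _ (ha b hb) (ha' b hb)

lemma symDeriv_add (f g : Dual ℂ W) : symDeriv (f + g) = symDeriv f + symDeriv g := by
  ext a
  induction a using SymmetricAlgebra.left_induction with
  | one => simp [symDeriv_one]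
  | smul c a ha => rw [map_smul, map_smul, ha]
  | add a b ha hb => rw [map_add, map_add, ha, hb]
  | ι_mul w a ha =>
    rw [add_apply] at ha ⊢
    rw [symDeriv_ι_mul, symDeriv_ι_mul, symDeriv_ι_mul, ha, add_apply, add_smul, mul_add]
    abel

lemma symDeriv_smul (c : ℂ) (f : Dual ℂ W) : symDeriv (c • f) = c • symDeriv f := by
  ext a
  induction a using SymmetricAlgebra.left_induction with
  | one => simp [symDeriv_one]
  | smul c a ha => rw [map_smul, map_smul, ha]
  | add a b ha hb => rw [map_add, map_add, ha, hb]
  | ι_mul w a ha =>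
    rw [smul_apply] at ha ⊢
    rw [symDeriv_ι_mul, symDeriv_ι_mul, ha, smul_apply, smul_add, smul_smul,
      mul_smul_comm, smul_eq_mul]

lemma symDeriv_comm (f g : Dual ℂ W) (a : SymmetricAlgebra ℂ W) :
    symDeriv f (symDeriv g a) = symDeriv g (symDeriv f a) := by
  induction a using SymmetricAlgebra.left_induction with
  | one => simp [symDeriv_one]
  | smul c a ha => simp only [map_smul, ha]
  | add a b ha hb => simp only [map_add, ha, hb]
  | ι_mul w a ha =>
    simp only [symDeriv_ι_mul, map_add, map_smul, ha]
    abel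

/-- The sum of a derivation and a multiplication: an element of the Heisenberg algebra. -/
def symOp (f : Dual ℂ W) (w : W) : End ℂ (SymmetricAlgebra ℂ W) :=
  symDeriv f + LinearMap.mulLeft ℂ (SymmetricAlgebra.ι ℂ W w)

lemma symOp_apply (f : Dual ℂ W) (w : W) (a) :
    symOp f w a = symDeriv f a + SymmetricAlgebra.ι ℂ W w * a := rfl

lemma symOp_add (f g : Dual ℂ W) (v w : W) :
    symOp (f + g) (v + w) = symOp f v + symOp g w := by
  ext a
  simp only [symOp_apply, map_add, symDeriv_add, add_apply, add_mul]
  abel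

lemma symOp_smul (c : ℂ) (f : Dual ℂ W) (w : W) :
    symOp (c • f) (c • w) = c • symOp f w := by
  ext a
  simp only [symOp_apply, map_smul, symDeriv_smul, smul_apply, smul_add, smul_mul_assoc]

lemma symOp_zero_left (w : W) :
    symOp 0 w = LinearMap.mulLeft ℂ (SymmetricAlgebra.ι ℂ W w) := by
  ext a
  rw [symOp_apply, ← zero_smul ℂ (0 : Dual ℂ W), symDeriv_smul, zero_smul]
  simp

lemma symOp_zero_right (f : Dual ℂ W) : symOp f 0 = symDeriv f := by
  ext a
  rw [symOp_apply, map_zero, zero_mul, add_zero]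

lemma symOp_commutator (f g : Dual ℂ W) (v w : W) (a : SymmetricAlgebra ℂ W) :
    symOp f v (symOp g w a) - symOp g w (symOp f v a) = (f w - g v) • a := by
  simp only [symOp_apply, map_add, symDeriv_ι_mul, sub_smul]
  rw [symDeriv_comm f g, mul_left_comm]
  abel

lemma symDeriv_trunc (g : ℕ → Dual ℂ W) (hg : ∀ w, ∃ N, ∀ p, N ≤ p → g p w = 0)
    (a : SymmetricAlgebra ℂ W) : ∃ N, ∀ p, N ≤ p → symDeriv (g p) a = 0 := by
  induction a using SymmetricAlgebra.left_induction with
  | one => exact ⟨0, fun p _ => symDeriv_one _⟩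
  | smul c a ha =>
    obtain ⟨N, hN⟩ := ha
    exact ⟨N, fun p hp => by rw [map_smul, hN p hp, smul_zero]⟩
  | add a b ha hb =>
    obtain ⟨N, hN⟩ := ha
    obtain ⟨K, hK⟩ := hb
    exact ⟨max N K, fun p hp => by rw [map_add, hN p (by omega), hK p (by omega), add_zero]⟩
  | ι_mul w a ha =>
    obtain ⟨N, hN⟩ := ha
    obtain ⟨K, hK⟩ := hg w
    exact ⟨max N K, fun p hp => by
      rw [symDeriv_ι_mul, hN p (by omega), hK p (by omega), zero_smul, mul_zero, add_zero]⟩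

end SymDeriv

section Clifford

variable {W : Type*} [AddCommGroup W] [Module ℂ W] (Q : QuadraticForm ℂ W)

/-- The sum of an odd derivation and a multiplication on a Clifford algebra. -/
def cliffordOp (f : Dual ℂ W) (w : W) : End ℂ (CliffordAlgebra Q) :=
  contractLeft f + LinearMap.mulLeft ℂ (CliffordAlgebra.ι Q w)

lemma cliffordOp_apply (f : Dual ℂ W) (w : W) (a) :
    cliffordOp Q f w a = contractLeft f a + CliffordAlgebra.ι Q w * a := rfl

lemma cliffordOp_zero_left (w : W) :
    cliffordOp Q 0 w = LinearMap.mulLeft ℂ (CliffordAlgebra.ι Q w) := by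
  ext a
  rw [cliffordOp_apply, map_zero, zero_apply, zero_add]
  rfl

lemma cliffordOp_zero_right (f : Dual ℂ W) :
    cliffordOp Q f 0 = contractLeft f := by
  ext a
  rw [cliffordOp_apply, map_zero, zero_mul, add_zero]

lemma cliffordOp_add (f g : Dual ℂ W) (v w : W) :
    cliffordOp Q (f + g) (v + w) = cliffordOp Q f v + cliffordOp Q g w := by
  ext a
  simp only [cliffordOp_apply, map_add, add_apply, add_mul]
  abel

lemma cliffordOp_smul (c : ℂ) (f : Dual ℂ W) (w : W) :
    cliffordOp Q (c • f) (c • w) = c • cliffordOp Q f w := by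
  ext a
  simp only [cliffordOp_apply, map_smul, smul_apply, smul_add, smul_mul_assoc]

lemma cliffordOp_commutator (f g : Dual ℂ W) (v w : W) (a : CliffordAlgebra Q) :
    cliffordOp Q f v (cliffordOp Q g w a) + cliffordOp Q g w (cliffordOp Q f v a) =
      (f w + g v + QuadraticMap.polar Q v w) • a := by
  have h1 := congrArg (· * a) (CliffordAlgebra.ι_mul_ι_add_swap (Q := Q) v w)
  simp only [add_mul, mul_assoc] at h1
  simp only [cliffordOp_apply, map_add, contractLeft_ι_mul, add_smul]
  rw [CliffordAlgebra.contractLeft_comm f g, Algebra.smul_def (QuadraticMap.polar Q v w), ← h1]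
  abel

lemma CliffordAlgebra.left_induction' {C : CliffordAlgebra Q → Prop}
    (one : C 1) (smul : ∀ (c : ℂ) a, C a → C (c • a)) (add : ∀ a b, C a → C b → C (a + b))
    (ι_mul : ∀ w a, C a → C (CliffordAlgebra.ι Q w * a)) (a : CliffordAlgebra Q) : C a := by
  induction a using CliffordAlgebra.left_induction with
  | algebraMap c => rw [Algebra.algebraMap_eq_smul_one]; exact smul c 1 one
  | add a b ha hb => exact add a b ha hb
  | ι_mul a w ha => exact ι_mul w a ha

lemma contractLeft_trunc (g : ℕ → Dual ℂ W) (hg : ∀ w, ∃ N, ∀ p, N ≤ p → g p w = 0)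
    (a : CliffordAlgebra Q) : ∃ N, ∀ p, N ≤ p → contractLeft (g p) a = 0 := by
  induction a using CliffordAlgebra.left_induction' with
  | one => exact ⟨0, fun p _ => contractLeft_one Q _⟩
  | smul c a ha =>
    obtain ⟨N, hN⟩ := ha
    exact ⟨N, fun p hp => by rw [map_smul, hN p hp, smul_zero]⟩
  | add a b ha hb =>
    obtain ⟨N, hN⟩ := ha
    obtain ⟨K, hK⟩ := hb
    exact ⟨max N K, fun p hp => by rw [map_add, hN p (by omega), hK p (by omega), add_zero]⟩
  | ι_mul w a ha =>
    obtain ⟨N, hN⟩ := ha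
    obtain ⟨K, hK⟩ := hg w
    exact ⟨max N K, fun p hp => by
      rw [contractLeft_ι_mul, hN p (by omega), hK p (by omega), zero_smul,
        mul_zero, sub_zero]⟩

lemma involute_contractLeft (f : Dual ℂ W) (a : CliffordAlgebra Q) :
    involute (contractLeft f a) =
      -contractLeft f (involute a) := by
  induction a using CliffordAlgebra.left_induction' with
  | one => simp
  | smul c a ha => simp [ha]
  | add a b ha hb => simp [ha, hb]; abel
  | ι_mul w a ha =>
    simp only [contractLeft_ι_mul, map_sub, map_mul, map_smul,
      involute_ι, ha, neg_mul, map_neg]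
    simp

lemma involute_cliffordOp (f : Dual ℂ W) (w : W) (a : CliffordAlgebra Q) :
    involute (cliffordOp Q f w a) =
      -cliffordOp Q f w (involute a) := by
  rw [cliffordOp_apply, cliffordOp_apply, map_add, involute_contractLeft, map_mul,
    involute_ι, neg_mul, neg_add]

lemma involute_mul_involute :
    (involute (Q := Q)).toLinearMap * CliffordAlgebra.involute.toLinearMap = 1 := by
  ext a
  exact CliffordAlgebra.involute_involute a

end Clifford
/-! ### The free fields on `V_bos`, `V_fer`, `M_κ` and `M_σ` -/

section Concrete

variable {h : Type u} [AddCommGroup h] [Module ℂ h] (B : LinearMap.BilinForm ℂ h)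

lemma modePairing_single (α β : h) (p q : ℕ) :
    modePairing B α p (Finsupp.single q β) = if p = q then B α β else 0 := by
  simp only [modePairing, comp_apply, Finsupp.lapply_apply, Finsupp.single_apply]
  by_cases hpq : p = q
  · simp [hpq]
  · simp [hpq, Ne.symm hpq]

lemma modePairing_add (α β : h) (p : ℕ) :
    modePairing B (α + β) p = modePairing B α p + modePairing B β p := by
  ext; simp [modePairing]

lemma modePairing_smul (c : ℂ) (α : h) (p : ℕ) :
    modePairing B (c • α) p = c • modePairing B α p := by
  ext; simp [modePairing]

lemma modePairing_trunc (α : h) (w : CreationModes h) :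
    ∃ N, ∀ p, N ≤ p → modePairing B α p w = 0 := by
  refine ⟨w.support.sup id + 1, fun p hp => ?_⟩
  have : w p = 0 := by
    by_contra hne
    have := Finset.le_sup (f := id) (Finsupp.mem_support_iff.mpr hne)
    simp only [id] at this
    omega
  simp [modePairing, this]

/-- Truncation for modes that are multiples of operators indexed by natural numbers. -/
lemma trunc_of_nat {M : Type*} [AddCommGroup M] [Module ℂ M] {F : ℤ → End ℂ M}
    {G : ℕ → End ℂ M} (hG : ∀ w, ∃ N, ∀ p, N ≤ p → G p w = 0) (c : ℤ → ℂ) (f : ℤ → ℕ)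
    (hf : ∀ K, ∃ N, ∀ n, N ≤ n → K ≤ f n) (N₀ : ℤ) (hF : ∀ n, N₀ ≤ n → F n = c n • G (f n)) :
    TruncField F := fun w => by
  obtain ⟨K, hK⟩ := hG w
  obtain ⟨N, hN⟩ := hf K
  refine ⟨max N N₀, fun n hn => ?_⟩
  rw [hF n (by omega), smul_apply, hK _ (hN n (by omega)), smul_zero]

lemma vacFamily_apply (M : Type*) [AddCommGroup M] [Module ℂ M] (k : ℕ) (N : ℤ) (w : M) :
    vacFamily M k N w = if N = -k then w else 0 := by
  unfold vacFamily
  split_ifs <;> rfl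

lemma smul_vacFamily (M : Type*) [AddCommGroup M] [Module ℂ M] (k : ℕ) (N : ℤ) (c : ℂ) (w : M) :
    c • vacFamily M k N w = (if N = -k then c else 0) • w := by
  unfold vacFamily
  split_ifs <;> simp

lemma bosMode_eq (α : h) (n : ℤ) : bosMode B α n =
    symOp (if n < 0 then 0 else (n : ℂ) • modePairing B α (n - 1).toNat)
      (if n < 0 then Finsupp.single (-n - 1).toNat α else 0) := by
  unfold bosMode
  split_ifs
  · rw [symOp_zero_left]
  · rw [symOp_zero_right, symDeriv_smul]

lemma ferMode_eq (α : h) (n : ℤ) : ferMode B α n =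
    cliffordOp 0 (if n < 0 then 0 else modePairing B α n.toNat)
      (if n < 0 then Finsupp.single (-n - 1).toNat α else 0) := by
  unfold ferMode
  split_ifs
  · rw [cliffordOp_zero_left]
  · rw [cliffordOp_zero_right]

lemma kappaMode_eq (α : h) (n : ℤ) (hn : ¬ Even n) : kappaMode B α n =
    symOp (if n < 0 then 0 else ((n : ℂ) / 2) • modePairing B α ((n - 1) / 2).toNat)
      (if n < 0 then Finsupp.single ((-n - 1) / 2).toNat α else 0) := by
  unfold kappaMode
  rw [if_neg hn]
  split_ifs
  · rw [symOp_zero_left]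
  · rw [symOp_zero_right, symDeriv_smul]

variable {B}

lemma bosMode_freeField (hsymm : B.IsSymm) :
    FreeField B 1 0 0 (1 : End ℂ (Vbos h)) (bosMode B) where
  map_add α β N := by
    simp only [bosMode_eq]
    rw [← symOp_add]
    split_ifs <;> simp [modePairing_add]
  map_smul c α N := by
    simp only [bosMode_eq]
    rw [← symOp_smul]
    split_ifs <;> simp [modePairing_smul, smul_comm _ c]
  trunc α := trunc_of_nat (symDeriv_trunc (modePairing B α) (modePairing_trunc B α)) (fun n => n)
    (fun n => (n - 1).toNat) (fun K => ⟨K + 1, fun n hn => by omega⟩) 0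
    fun n hn => by unfold bosMode; rw [if_neg (by omega)]
  support α N hN := by simp [Int.modEq_one] at hN
  parity_parity := one_mul 1
  parity_mode α N w := by simp
  commutator α β a b w _ _ := by
    rw [pow_zero, one_smul, bosMode_eq, bosMode_eq, symOp_commutator, smul_vacFamily]
    have hs : B β α = B α β := hsymm.eq β α
    simp only [Nat.cast_one, div_one, Nat.sub_zero, Ring.choose_one_right, one_mul]
    congr 1
    rcases eq_or_ne a (-b) with rfl | hab <;> split_ifs <;>
      simp [modePairing_single, hs, mul_comm] <;> try omega
  sign := Or.inl ⟨rfl, rfl⟩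
  dvd := by simp

lemma ferMode_freeField (hsymm : B.IsSymm) :
    FreeField B 1 0 1 (CliffordAlgebra.involute.toLinearMap : End ℂ (Vfer h))
      (ferMode B) where
  map_add α β N := by
    simp only [ferMode_eq]
    rw [← cliffordOp_add]
    split_ifs <;> simp [modePairing_add]
  map_smul c α N := by
    simp only [ferMode_eq]
    rw [← cliffordOp_smul]
    split_ifs <;> simp [modePairing_smul]
  trunc α := trunc_of_nat (contractLeft_trunc 0 (modePairing B α) (modePairing_trunc B α))
    (fun n => 1) (fun n => n.toNat) (fun K => ⟨K, fun n hn => by omega⟩) 0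
    fun n hn => by unfold ferMode; rw [if_neg (by omega), one_smul]
  support α N hN := by simp [Int.modEq_one] at hN
  parity_parity := involute_mul_involute 0
  parity_mode α N w := by
    rw [ferMode_eq, pow_one, neg_one_smul]
    exact involute_cliffordOp 0 _ _ _
  commutator α β a b w _ _ := by
    rw [pow_one, neg_one_smul, sub_neg_eq_add, ferMode_eq, ferMode_eq, cliffordOp_commutator,
      smul_vacFamily]
    have hs : B β α = B α β := hsymm.eq β α
    have hp : ∀ v w : CreationModes h,
        QuadraticMap.polar (0 : QuadraticForm ℂ (CreationModes h)) v w = 0 := fun v w => by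
      simp [QuadraticMap.polar]
    simp only [Nat.cast_one, Nat.sub_self, Ring.choose_zero_right, mul_one, Nat.cast_zero,
      sub_zero, hp, add_zero, mul_zero]
    congr 1
    split_ifs <;> simp [modePairing_single, hs] <;> omega
  sign := Or.inr rfl
  dvd := by simp

lemma kappaMode_freeField (hsymm : B.IsSymm) :
    FreeField B 2 1 0 (1 : End ℂ (Mkappa h)) (kappaMode B) where
  map_add α β N := by
    by_cases hN : Even N
    · simp [kappaMode, hN]
    simp only [kappaMode_eq _ _ _ hN]
    rw [← symOp_add]
    split_ifs <;> simp [modePairing_add]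
  map_smul c α N := by
    by_cases hN : Even N
    · simp [kappaMode, hN]
    simp only [kappaMode_eq _ _ _ hN]
    rw [← symOp_smul]
    split_ifs <;> simp [modePairing_smul, smul_comm _ c]
  trunc α := trunc_of_nat (symDeriv_trunc (modePairing B α) (modePairing_trunc B α))
    (fun n => if Even n then 0 else n / 2)
    (fun n => ((n - 1) / 2).toNat) (fun K => ⟨2 * K + 1, fun n hn => by omega⟩) 0
    fun n hn => by
      unfold kappaMode
      split_ifs
      · rw [zero_smul]
      · omega
      · rfl
  support α N hN := by
    unfold kappaMode
    rw [if_pos]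
    by_contra hodd
    rw [Int.not_even_iff] at hodd
    exact hN hodd
  parity_parity := one_mul 1
  parity_mode α N w := by simp
  commutator α β a b w ha' hb' := by
    replace ha' : a % 2 = 1 := ha'
    replace hb' : b % 2 = 1 := hb'
    rw [pow_zero, one_smul, kappaMode_eq _ _ _ (Int.not_even_iff.mpr ha'),
      kappaMode_eq _ _ _ (Int.not_even_iff.mpr hb'), symOp_commutator, smul_vacFamily]
    have hs : B β α = B α β := hsymm.eq β α
    simp only [Nat.cast_one, Nat.sub_zero, Ring.choose_one_right, mul_one, Nat.cast_ofNat]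
    congr 1
    rcases eq_or_ne a (-b) with rfl | hab <;> split_ifs <;>
      simp [modePairing_single, hs, mul_comm, neg_div] <;> omega
  sign := Or.inl ⟨rfl, rfl⟩
  dvd := by simp

/-- Operators (super)commuting on generators (super)commute on their span. -/
lemma lsum_mul_lsum {N : Type*} [AddCommGroup N] [Module ℂ N] {T : ℕ → h →ₗ[ℂ] End ℂ N} {ε : ℂ}
    (hT : ∀ α β m n, T m α * T n β = ε • (T n β * T m α)) (v w : CreationModes h) :
    Finsupp.lsum ℂ T v * Finsupp.lsum ℂ T w =
      ε • (Finsupp.lsum ℂ T w * Finsupp.lsum ℂ T v) := by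
  induction v using Finsupp.induction_linear with
  | zero => simp
  | add v v' hv hv' => rw [map_add, add_mul, mul_add, hv, hv', smul_add]
  | single q α =>
    induction w using Finsupp.induction_linear with
    | zero => simp
    | add v v' hv hv' => rw [map_add, add_mul, mul_add, hv, hv', smul_add]
    | single r β => simp only [Finsupp.lsum_single, hT α β]

lemma ι_single_closed {A : Type*} [AddCommGroup A] [Module ℂ A] (p : Submodule ℂ A)
    (m : CreationModes h →ₗ[ℂ] End ℂ A)
    (hm : ∀ α q, ∀ u ∈ p, m (Finsupp.single q α) u ∈ p) (w : CreationModes h) {u : A}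
    (hu : u ∈ p) : m w u ∈ p := by
  induction w using Finsupp.induction_linear with
  | zero => rw [map_zero]; exact p.zero_mem
  | add f g hf hg => rw [map_add]; exact p.add_mem hf hg
  | single q α => exact hm α q u hu

open scoped IsMulCommutative in
lemma bosMode_freeModel (hsymm : B.IsSymm) :
    FreeModel B 0 (1 : Vbos h) 1 (bosMode B) where
  toFreeField := bosMode_freeField hsymm
  parity_vac := rfl
  annihilation α n hn := by
    unfold bosMode
    rw [if_neg (by omega), smul_apply, symDeriv_one, smul_zero]
  span p h1 hp u := by
    induction u using SymmetricAlgebra.left_induction with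
    | one => exact h1
    | smul c a ha => exact p.smul_mem c ha
    | add a b ha hb => exact p.add_mem ha hb
    | ι_mul w a ha =>
      refine ι_single_closed p ((LinearMap.mul ℂ (Vbos h)) ∘ₗ SymmetricAlgebra.ι ℂ _)
        (fun α q u hu => ?_) w ha
      have := hp α (-q - 1) (by omega) u hu
      unfold bosMode at this
      rw [if_pos (by omega), show (-(-(q : ℤ) - 1) - 1).toNat = q by omega] at this
      exact this
  lift N _ _ T hT x := by
    set f : CreationModes h →ₗ[ℂ] End ℂ N := Finsupp.lsum ℂ T with hf
    have hf1 : ∀ q α, f (Finsupp.single q α) = T q α := fun q α => by simp [hf]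
    have hcomm : ∀ v w, f v * f w = f w * f v := fun v w => by
      simpa only [pow_zero, one_smul] using lsum_mul_lsum hT v w
    -- the universal property needs a commutative target: the algebra generated by the operators
    have hadj := Algebra.isMulCommutative_adjoin ℂ (s := Set.range f) (by
      rintro _ ⟨v, rfl⟩ _ ⟨w, rfl⟩; exact hcomm v w)
    let g : CreationModes h →ₗ[ℂ] Algebra.adjoin ℂ (Set.range f) :=
      f.codRestrict (Subalgebra.toSubmodule (Algebra.adjoin ℂ (Set.range f)))
        fun v => Algebra.subset_adjoin ⟨v, rfl⟩
    refine ⟨LinearMap.applyₗ x ∘ₗ (Algebra.adjoin ℂ (Set.range f)).val.toLinearMap ∘ₗ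
      (SymmetricAlgebra.lift g).toLinearMap, ?_, ?_⟩
    · simp
    · intro α n u
      unfold bosMode
      rw [if_pos (by omega), show (-(-(n : ℤ) - 1) - 1).toNat = n by omega]
      simp only [comp_apply, LinearMap.mulLeft_apply, AlgHom.toLinearMap_apply, map_mul,
        SymmetricAlgebra.lift_ι_apply]
      change (f (Finsupp.single n α) * _) x = _
      rw [hf1]
      rfl

lemma ferMode_freeModel (hsymm : B.IsSymm) :
    FreeModel B 1 (1 : Vfer h) CliffordAlgebra.involute.toLinearMap (ferMode B) where
  toFreeField := ferMode_freeField hsymm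
  parity_vac := map_one involute
  annihilation α n hn := by
    unfold ferMode
    rw [if_neg (by omega)]
    exact contractLeft_one 0 _
  span p h1 hp u := by
    induction u using CliffordAlgebra.left_induction' with
    | one => exact h1
    | smul c a ha => exact p.smul_mem c ha
    | add a b ha hb => exact p.add_mem ha hb
    | ι_mul w a ha =>
      refine ι_single_closed p ((LinearMap.mul ℂ (Vfer h)) ∘ₗ ExteriorAlgebra.ι ℂ)
        (fun α q u hu => ?_) w ha
      have := hp α (-q - 1) (by omega) u hu
      unfold ferMode at this
      rw [if_pos (by omega), show (-(-(q : ℤ) - 1) - 1).toNat = q by omega] at this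
      exact this
  lift N _ _ T hT x := by
    set f : CreationModes h →ₗ[ℂ] End ℂ N := Finsupp.lsum ℂ T with hf
    have hf1 : ∀ q α, f (Finsupp.single q α) = T q α := fun q α => by simp [hf]
    have hsq : ∀ v, f v * f v = 0 := fun v => by
      have := lsum_mul_lsum hT v v
      rw [pow_one, neg_one_smul, eq_neg_iff_add_eq_zero, ← two_smul ℂ] at this
      exact (smul_eq_zero.mp this).resolve_left two_ne_zero
    refine ⟨LinearMap.applyₗ x ∘ₗ (ExteriorAlgebra.lift ℂ ⟨f, hsq⟩).toLinearMap, ?_, ?_⟩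
    · simp
    · intro α n u
      unfold ferMode
      rw [if_pos (by omega), show (-(-(n : ℤ) - 1) - 1).toNat = n by omega]
      simp [hf1]

lemma polar_sigmaForm (hsymm : B.IsSymm) {d : ℕ} (P : Polarization B d) (v w : SigmaModes P) :
    QuadraticMap.polar (sigmaForm P) v w = B v.2 w.2 := by
  have hs : B (w.2 : h) v.2 = B (v.2 : h) w.2 := hsymm.eq _ _
  simp only [sigmaForm, QuadraticMap.polar, QuadraticMap.comp_apply, comp_apply,
    LinearMap.BilinMap.toQuadraticMap_apply, smul_apply, map_add,
    add_apply, LinearMap.snd_apply, Submodule.subtype_apply, smul_eq_mul, hs]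
  ring

section Sigma

variable {d : ℕ} (P : Polarization B d)

/-- The derivation part of the mode `α_{N/2}` on `M_σ`. -/
def sigmaDual (α : h) (N : ℤ) : Dual ℂ (SigmaModes P) :=
  if N < -1 then 0
  else if N = -1 then B (P.aminus.projectionOnto _ P.isCompl α : h) ∘ₗ
          (P.aplus ⊔ P.e).subtype ∘ₗ LinearMap.snd ℂ _ _
  else modePairing B α ((N + 1) / 2 - 1).toNat ∘ₗ LinearMap.fst ℂ _ _

/-- The multiplication part of the mode `α_{N/2}` on `M_σ`. -/
def sigmaVec (α : h) (N : ℤ) : SigmaModes P :=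
  if N < -1 then (Finsupp.single (-(N + 1) / 2 - 1).toNat α, 0)
  else if N = -1 then (0, (P.aplus ⊔ P.e).projectionOnto _ P.isCompl.symm α)
  else 0

lemma sigmaMode_eq (α : h) (N : ℤ) (hN : ¬ Even N) :
    sigmaMode P α N = cliffordOp _ (sigmaDual P α N) (sigmaVec P α N) := by
  unfold sigmaMode sigmaDual sigmaVec
  rw [if_neg hN]
  split_ifs
  · rw [cliffordOp_zero_left]
  · rfl
  · rw [cliffordOp_zero_right]

lemma projectionOnto_pairing (hsymm : B.IsSymm) (α β : h) :
    B (P.aminus.projectionOnto _ P.isCompl α : h)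
      ((P.aplus ⊔ P.e).projectionOnto _ P.isCompl.symm β : h) +
    B (P.aminus.projectionOnto _ P.isCompl β : h)
      ((P.aplus ⊔ P.e).projectionOnto _ P.isCompl.symm α : h) +
    B ((P.aplus ⊔ P.e).projectionOnto _ P.isCompl.symm α : h)
      ((P.aplus ⊔ P.e).projectionOnto _ P.isCompl.symm β : h) = B α β := by
  have key : ∀ γ : h, γ = (P.aminus.projectionOnto _ P.isCompl γ : h) +
      ((P.aplus ⊔ P.e).projectionOnto _ P.isCompl.symm γ : h) := fun γ =>
    (Submodule.projection_add_projection_eq_self P.isCompl γ).symm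
  conv_rhs => rw [key α, key β]
  rw [map_add, map_add, add_apply, add_apply,
    P.isotropic_aminus _ (Subtype.property _) _ (Subtype.property _),
    show B ((P.aplus ⊔ P.e).projectionOnto _ P.isCompl.symm α : h)
      (P.aminus.projectionOnto _ P.isCompl β : h) = B (P.aminus.projectionOnto _ P.isCompl β : h)
      ((P.aplus ⊔ P.e).projectionOnto _ P.isCompl.symm α : h) from hsymm.eq _ _]
  ring

/-- The anticommutator of two modes on `M_σ`. For two zero modes it is the sum of the
contributions of `a⁻`, paired with `a⁺ ⊕ e` in both orders, and of the form on `a⁺ ⊕ e`. -/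
lemma sigmaDual_sigmaVec (hsymm : B.IsSymm) (α β : h) (a b : ℤ) (ha : a % 2 = 1)
    (hb : b % 2 = 1) :
    sigmaDual P α a (sigmaVec P β b) + sigmaDual P β b (sigmaVec P α a) +
      QuadraticMap.polar (sigmaForm P) (sigmaVec P α a) (sigmaVec P β b) =
      if a + b = -2 then B α β else 0 := by
  have hs : B β α = B α β := hsymm.eq β α
  rw [polar_sigmaForm hsymm]
  rcases lt_trichotomy a (-1) with ha' | rfl | ha'
  · have e1 : ¬ b < -1 → b ≠ -1 → 0 ≤ b := by omega
    simp only [sigmaDual, sigmaVec, if_pos ha']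
    split_ifs <;> simp [modePairing_single, hs] <;> omega
  · simp only [sigmaDual, sigmaVec]
    have := projectionOnto_pairing P hsymm α β
    simp only [Submodule.coe_projectionOnto_apply] at this
    split_ifs <;> first | omega | simp [this]
  · have e1 : ¬ a < -1 := by omega
    have e2 : a ≠ -1 := by omega
    simp only [sigmaDual, sigmaVec, if_neg e1, if_neg e2]
    split_ifs <;> simp [modePairing_single] <;> omega

lemma sigmaMode_freeField (hsymm : B.IsSymm) :
    FreeField B 2 1 1 (CliffordAlgebra.involute.toLinearMap : End ℂ (Msigma P))
      (sigmaMode P) where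
  map_add α β N := by
    by_cases hN : Even N
    · simp [sigmaMode, hN]
    simp only [sigmaMode_eq _ _ _ hN]
    rw [← cliffordOp_add]
    congr 1 <;> simp only [sigmaDual, sigmaVec] <;> split_ifs <;>
      simp [modePairing_add, LinearMap.add_comp]
  map_smul c α N := by
    by_cases hN : Even N
    · simp [sigmaMode, hN]
    simp only [sigmaMode_eq _ _ _ hN]
    rw [← cliffordOp_smul]
    congr 1 <;> simp only [sigmaDual, sigmaVec] <;> split_ifs <;>
      simp [modePairing_smul, LinearMap.smul_comp]
  trunc α := trunc_of_nat (contractLeft_trunc (sigmaForm P)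
      (fun p => modePairing B α p ∘ₗ LinearMap.fst ℂ _ _) (fun w => modePairing_trunc B α w.1))
    (fun n => if Even n then 0 else 1) (fun n => ((n + 1) / 2 - 1).toNat)
    (fun K => ⟨2 * K + 2, fun n hn => by omega⟩) 0
    fun n hn => by
      unfold sigmaMode
      split_ifs
      · rw [zero_smul]
      · omega
      · omega
      · rw [one_smul]
  support α N hN := by
    unfold sigmaMode
    rw [if_pos]
    by_contra hodd
    rw [Int.not_even_iff] at hodd
    exact hN hodd
  parity_parity := involute_mul_involute _
  parity_mode α N w := by
    by_cases hN : Even N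
    · simp [sigmaMode, hN]
    rw [sigmaMode_eq _ _ _ hN, pow_one, neg_one_smul]
    exact involute_cliffordOp _ _ _ _
  commutator α β a b w ha hb := by
    replace ha : a % 2 = 1 := ha
    replace hb : b % 2 = 1 := hb
    rw [pow_one, neg_one_smul, sub_neg_eq_add, sigmaMode_eq _ _ _ (Int.not_even_iff.mpr ha),
      sigmaMode_eq _ _ _ (Int.not_even_iff.mpr hb), cliffordOp_commutator, smul_vacFamily,
      sigmaDual_sigmaVec P hsymm α β a b ha hb]
    simp only [Nat.sub_self, Ring.choose_zero_right, mul_one, Nat.cast_zero, mul_zero, sub_zero,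
      Nat.cast_ofNat]
  sign := Or.inr rfl
  dvd := by simp

end Sigma

end Concrete
/-! ### Vertex superalgebras and their twisted modules -/

section Generic

lemma map_finsum_ge' {M N : Type*} [AddCommGroup M] [Module ℂ M] [AddCommGroup N] [Module ℂ N]
    (T : M →ₗ[ℂ] N) {f : ℕ → M} {K : ℕ} (h : ∀ i, K ≤ i → f i = 0) :
    T (∑ᶠ i, f i) = ∑ᶠ i, T (f i) :=
  map_finsum T (hasFiniteSupport_of_ge h)

namespace VertexData

variable {V : Type*} [AddCommGroup V] [Module ℂ V] (D : VertexData V)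
  {M : Type*} [AddCommGroup M] [Module ℂ M]

/-- The Jacobi identity for `u`, of sign `a` and with modes in `ℤ + j/k` on `M`, and all `v`. -/
def HasOPE (k : ℕ) (Yg : V →ₗ[ℂ] VertexOperator ℂ M) (a : ℕ) (j : ℤ) (u : V) : Prop :=
  ∀ v, OPE k j (vmode k (Yg u)) (vmode k (Yg v)) (vmode k (Yg ((D.parity ^ a) v)))
    fun l => vmode k (Yg (D.md u l v))

lemma md_trunc (u : V) : TruncField (D.md u) := vmode_trunc _

lemma md_add (u v : V) (n : ℤ) : D.md (u + v) n = D.md u n + D.md v n := by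
  rw [md, map_add, vmode_add]; rfl

lemma md_smul (c : ℂ) (u : V) (n : ℤ) : D.md (c • u) n = c • D.md u n := by
  rw [md, map_smul, vmode_smul]; rfl

lemma md_zero (n : ℤ) : D.md 0 n = 0 := by
  rw [← zero_smul ℂ (0 : V), md_smul, zero_smul]

variable {D} {k : ℕ} [NeZero k] {Yg : V →ₗ[ℂ] VertexOperator ℂ M} {a b : ℕ} {j : ℤ} {u v : V}

lemma HasSign.parity_pow (h : D.HasSign b v) (a : ℕ) : (D.parity ^ a) v = (-1 : ℂ) ^ (a * b) • v :=
    by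
  induction a with
  | zero => simp
  | succ a ih =>
    rw [pow_succ', Module.End.mul_apply, ih, map_smul, h, smul_smul, ← pow_add]
    congr 2; ring

lemma HasSign.congr (h : D.HasSign a u) (hab : a % 2 = b % 2) : D.HasSign b u := by
  rw [HasSign, h, neg_one_pow_eq_pow_mod_two, hab, ← neg_one_pow_eq_pow_mod_two]

lemma parity_pow_congr (hP : ∀ v, D.parity (D.parity v) = v) (hab : a % 2 = b % 2) :
    D.parity ^ a = D.parity ^ b := by
  have h2 : D.parity ^ 2 = 1 := by
    ext v; rw [pow_two]; exact hP v
  rw [← Nat.div_add_mod a 2, ← Nat.div_add_mod b 2, hab, pow_add, pow_add, pow_mul, pow_mul, h2,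
    one_pow, one_pow]

lemma HasOPE.congr (hP : ∀ v, D.parity (D.parity v) = v) (h : D.HasOPE k Yg a j u)
    (hab : a % 2 = b % 2) : D.HasOPE k Yg b j u := fun v => by
  rw [← parity_pow_congr hP hab]; exact h v

/-- The projection to the vectors of sign `a`. -/
def signProj (D : VertexData V) (a : ℕ) : End ℂ V :=
  (1 / 2 : ℂ) • (1 + (-1 : ℂ) ^ a • D.parity)

lemma signProj_apply (a : ℕ) (u : V) :
    D.signProj a u = (1 / 2 : ℂ) • (u + (-1 : ℂ) ^ a • D.parity u) := rfl

lemma HasSign.signProj_eq (h : D.HasSign a u) : D.signProj a u = u := by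
  rw [signProj_apply, h, smul_smul, neg_one_pow_mul_neg_one_pow, one_smul, ← two_smul ℂ u,
    smul_smul]
  norm_num

lemma HasSign.signProj_eq_zero (h : D.HasSign b u) (hab : a % 2 ≠ b % 2) :
    D.signProj a u = 0 := by
  have : (-1 : ℂ) ^ a * (-1) ^ b = -1 := by
    rw [← pow_add, Odd.neg_one_pow (by rw [Nat.odd_iff]; omega)]
  rw [signProj_apply, h, smul_smul, this]
  simp

lemma hasSign_signProj (hP : ∀ v, D.parity (D.parity v) = v) (a : ℕ) (u : V) :
    D.HasSign a (D.signProj a u) := by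
  rw [HasSign, signProj_apply, map_smul, map_add, map_smul, hP, smul_comm ((-1 : ℂ) ^ a),
    smul_add ((-1 : ℂ) ^ a), smul_smul, neg_one_pow_mul_neg_one_pow, one_smul, add_comm]

lemma eq_signProj_add (u : V) : u = D.signProj 0 u + D.signProj 1 u := by
  simp only [signProj_apply]
  module

lemma HasOPE.of_homogeneous (hP : ∀ v, D.parity (D.parity v) = v)
    (h : ∀ b v, D.HasSign b v → OPE k j (vmode k (Yg u)) (vmode k (Yg v))
      (((-1 : ℂ) ^ (a * b)) • vmode k (Yg v)) fun l => vmode k (Yg (D.md u l v))) :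
    D.HasOPE k Yg a j u := fun v => by
  have key : ∀ b v, D.HasSign b v → OPE k j (vmode k (Yg u)) (vmode k (Yg v))
      (vmode k (Yg ((D.parity ^ a) v))) fun l => vmode k (Yg (D.md u l v)) := fun b v hv => by
    rw [hv.parity_pow, map_smul, vmode_smul]
    exact h b v hv
  have := (key 0 _ (hasSign_signProj hP 0 v)).add (vmode_trunc _) (vmode_trunc _) (vmode_trunc _)
    (key 1 _ (hasSign_signProj hP 1 v))
  simp only [← vmode_add, ← map_add, ← eq_signProj_add] at this
  convert this using 1
  funext l
  rw [Pi.add_apply, ← vmode_add, ← map_add, ← map_add, ← eq_signProj_add]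

lemma HasOPE.homogeneous (h : D.HasOPE k Yg a j u) (hv : D.HasSign b v) :
    OPE k j (vmode k (Yg u)) (vmode k (Yg v))
      (((-1 : ℂ) ^ (a * b)) • vmode k (Yg v)) fun l => vmode k (Yg (D.md u l v)) := by
  have := h v
  rwa [hv.parity_pow, map_smul, vmode_smul] at this

lemma HasOPE.add (h : D.HasOPE k Yg a j u) (h' : D.HasOPE k Yg a j v) :
    D.HasOPE k Yg a j (u + v) := fun w => by
  have := (h w).add_left (vmode_trunc _) (vmode_trunc _) (vmode_trunc _) (h' w)
  rw [← vmode_add, ← map_add] at this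
  convert this using 1
  funext l
  rw [Pi.add_apply, ← vmode_add, ← map_add, md_add, add_apply]

lemma HasOPE.smul (h : D.HasOPE k Yg a j u) (c : ℂ) : D.HasOPE k Yg a j (c • u) := fun w => by
  have := (h w).smul_left (vmode_trunc _) (vmode_trunc _) c
  rw [← vmode_smul, ← map_smul] at this
  convert this using 1
  funext l
  rw [Pi.smul_apply, ← vmode_smul, ← map_smul, md_smul, smul_apply]

lemma HasSign.md (hmd : ∀ u v n, D.parity (D.md u n v) = D.md (D.parity u) n (D.parity v))
    (hu : D.HasSign a u) (hv : D.HasSign b v) (n : ℤ) : D.HasSign (a + b) (D.md u n v) := by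
  rw [HasSign, hmd, hu, hv, md_smul, smul_apply, map_smul, smul_smul, pow_add]

/-- The vectors satisfying the Jacobi identity with all vectors are closed under products. -/
lemma HasOPE.mul (hP : ∀ v, D.parity (D.parity v) = v)
    (hmd : ∀ u v n, D.parity (D.md u n v) = D.md (D.parity u) n (D.parity v))
    {j' : ℤ} (su : D.HasSign a u) (sv : D.HasSign b v) (hV : D.HasOPE 1 D.Y a 0 u)
    (hu : D.HasOPE k Yg a j u) (hv : D.HasOPE k Yg b j' v) (r : ℤ) :
    D.HasOPE k Yg (a + b) (j + j') (D.md u r v) := by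
  refine HasOPE.of_homogeneous hP fun c w hw => ?_
  have h0 : vmode k (Yg 0) = 0 := (vmodeHom M k ∘ₗ Yg).map_zero
  have key := OPE.assoc (εAB := (-1 : ℂ) ^ (a * b)) (εBC := (-1 : ℂ) ^ (b * c))
    (εAC := (-1 : ℂ) ^ (a * c)) (AB := fun l => vmode k (Yg (D.md u l v)))
    (BC := fun l => vmode k (Yg (D.md v l w))) (AC := fun l => vmode k (Yg (D.md u l w)))
    (ABC := fun l m => vmode k (Yg (D.md u m (D.md v l w))))
    (BAC := fun l m => vmode k (Yg (D.md v m (D.md u l w))))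
    (X := fun r n => vmode k (Yg (D.md (D.md u r v) n w)))
    (vmode_trunc _) (vmode_trunc _) (vmode_trunc _) (neg_one_pow_mul_neg_one_pow _)
    (fun _ => vmode_trunc _) (fun _ => vmode_trunc _) (fun _ => vmode_trunc _)
    (hu.homogeneous sv) (hv.homogeneous hw) (hu.homogeneous hw)
    (fun l => by
      rw [← pow_add, ← mul_add]
      exact hu.homogeneous (sv.md hmd hw l))
    (fun l => by
      rw [← pow_add, mul_comm a b, ← mul_add]
      exact hv.homogeneous (su.md hmd hw l))
    ?_ ?_ ?_ ?_ ?_ r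
  · rw [add_mul, pow_add]
    exact key
  · obtain ⟨L, hL⟩ := D.md_trunc v w
    exact ⟨L, fun l hl => by funext m; rw [hL l hl, map_zero, h0]; rfl⟩
  · obtain ⟨L, hL⟩ := D.md_trunc u w
    exact ⟨L, fun l hl => by funext m; rw [hL l hl, map_zero, h0]; rfl⟩
  · obtain ⟨L, hL⟩ := D.md_trunc u v
    exact ⟨L, fun l hl => by
      funext m; rw [hL l hl, md_zero, zero_apply, h0]; rfl⟩
  · intro l
    obtain ⟨K, hK⟩ := D.md_trunc (D.md u l v) w
    exact ⟨K, fun n hn => by rw [hK n hn, h0]⟩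
  · intro r q n N x
    let T : V →ₗ[ℂ] M := LinearMap.applyₗ x ∘ₗ LinearMap.proj N ∘ₗ vmodeHom M k ∘ₗ Yg
    have hT : ∀ y, T y = vmode k (Yg y) N x := fun y => rfl
    have h1 := congrArg T ((hV.homogeneous sv).eq r q n w (by simpa using Int.modEq_one))
    obtain ⟨L1, hL1⟩ := D.md_trunc v w
    obtain ⟨L2, hL2⟩ := D.md_trunc u w
    obtain ⟨L3, hL3⟩ := D.md_trunc u v
    rw [map_sub, map_smul, ordProd_smul_left (vmode_trunc _), map_smul, ordProd, ordProd,
      map_finsum_ge' (K := (L1 - n).toNat) T fun i hi => by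
        have : vmode 1 (D.Y v) (n + (1 : ℕ) * i) w = 0 := hL1 _ (by push_cast; omega)
        rw [this, map_zero, smul_zero],
      map_finsum_ge' (K := (L2 - q).toNat) T fun i hi => by
        have : vmode 1 (D.Y u) (q + (1 : ℕ) * i) w = 0 := hL2 _ (by push_cast; omega)
        rw [this, map_zero, smul_zero],
      map_finsum_ge' (K := (L3 - r).toNat) T fun i hi => by
        rw [hL3 _ (by omega), map_zero]
        have := congrFun ((vmodeHom V 1).map_zero) (q + n - (1 : ℕ) * i)
        rw [vmodeHom_apply] at this
        rw [this]; simp] at h1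
    simp only [map_smul, hT] at h1
    rw [smul_smul] at h1
    convert h1 using 1
    · congr 1
      · refine finsum_congr fun i => ?_
        rw [show (q : ℤ) + (1 : ℕ) * (r - i) = q + r - i by push_cast; ring,
          show n + (1 : ℕ) * (i : ℤ) = n + i by push_cast; ring]
        rfl
      · rw [mul_comm]
        congr 1
        refine finsum_congr fun i => ?_
        rw [show n + (1 : ℕ) * (r - i) = n + r - i by push_cast; ring,
          show (q : ℤ) + (1 : ℕ) * (i : ℤ) = q + i by push_cast; ring]
        rfl
    · refine finsum_congr fun i => ?_
      push_cast
      rw [div_one, one_mul]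
      rfl

/-- A vertex superalgebra: the axioms of a vertex operator superalgebra that do not involve `ω`,
with the Jacobi identity for a spanning set of vectors. -/
structure IsVertex (D : VertexData V) : Prop where
  parity_parity : ∀ v, D.parity (D.parity v) = v
  parity_vac : D.parity D.vac = D.vac
  parity_md : ∀ u v n, D.parity (D.md u n v) = D.md (D.parity u) n (D.parity v)
  md_vac : vmode 1 (D.Y D.vac) = vacFamily V 1
  creation : ∀ v, ∀ n : ℤ, 0 ≤ n → D.md v n D.vac = 0
  creation_neg_one : ∀ v, D.md v (-1) D.vac = v
  span : Submodule.span ℂ {u | ∃ a, D.HasSign a u ∧ D.HasOPE 1 D.Y a 0 u} = ⊤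

namespace IsVertex

lemma hasOPE (hD : D.IsVertex) {a : ℕ} {u : V} (hu : D.HasSign a u) : D.HasOPE 1 D.Y a 0 u := by
  rw [← hu.signProj_eq]
  clear hu
  have hmem : u ∈ Submodule.span ℂ {u | ∃ a, D.HasSign a u ∧ D.HasOPE 1 D.Y a 0 u} := by
    rw [hD.span]; trivial
  have h0 : D.HasOPE 1 D.Y a 0 (0 : V) := fun v => by
    simp only [map_zero, md_zero, zero_apply]
    rw [vmode_zero]
    refine ⟨⟨0, fun _ _ => rfl⟩, fun l m n w _ => ?_⟩
    rw [ordProd_zero_left, ordProd_zero_right]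
    simp
  induction hmem using Submodule.span_induction with
  | mem u hu =>
    obtain ⟨b, hb, hope⟩ := hu
    by_cases hab : a % 2 = b % 2
    · rw [(hb.congr hab.symm).signProj_eq]
      exact hope.congr hD.parity_parity hab.symm
    · rw [hb.signProj_eq_zero hab]; exact h0
  | zero => rw [map_zero]; exact h0
  | add u v _ _ hu hv => rw [map_add]; exact hu.add hv
  | smul c u _ hu => rw [map_smul]; exact hu.smul c

/-- The Jacobi identity in terms of modes. -/
lemma jacobi (hD : D.IsVertex) {a b : ℕ} {u v : V} (hu : D.HasSign a u) (hv : D.HasSign b v)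
    (l m n : ℤ) (w : V) :
    jacobiLHS 1 ((-1) ^ (a * b)) (D.md u) (D.md v) l m n w =
      ∑ᶠ i : ℕ, (Ring.choose m i : ℂ) • D.md (D.md u (l + i) v) (m + n - i) w := by
  rw [jacobiLHS_eq (D.md_trunc u) (D.md_trunc v)]
  have := ((hD.hasOPE hu).homogeneous hv).eq l m n w (by simpa using Int.modEq_one)
  refine this.trans (finsum_congr fun i => ?_)
  rw [Nat.cast_one, Nat.cast_one, div_one, one_mul]
  rfl

/-- The commutator formula. -/
lemma commutator (hD : D.IsVertex) {a b : ℕ} {u v : V} (hu : D.HasSign a u)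
    (hv : D.HasSign b v) {K : ℕ}
    (hK : ∀ s : ℕ, K ≤ s → D.md u s v = 0) (m n : ℤ) (w : V) :
    D.md u m (D.md v n w) - (-1 : ℂ) ^ (a * b) • D.md v n (D.md u m w) =
      ∑ s ∈ range K, binom(m, s) • D.md (D.md u s v) (m + n - s) w := by
  have := ((hD.hasOPE hu).homogeneous hv).commutator m n (by simpa using Int.modEq_one) w
  refine this.trans ((finsum_eq_sum_range fun s hs => ?_).trans (sum_congr rfl fun s _ => ?_))
  · change _ • D.md (D.md u s v) _ _ = 0
    rw [hK s hs, md_zero, zero_apply, smul_zero]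
  · rw [Nat.cast_one, Nat.cast_one, div_one, one_mul]
    rfl

/-- The vertex operator of the translate `u_{-2} 1` is the derivative of the vertex operator of
`u`. -/
lemma vmode_neg_two_vac {M : Type*} [AddCommGroup M] [Module ℂ M] {k : ℕ} [NeZero k]
    {Yg : V →ₗ[ℂ] VertexOperator ℂ M} {a : ℕ} {j : ℤ} {u : V} (hD : D.IsVertex)
    (hYg : vmode k (Yg D.vac) = vacFamily M k) (hu : D.HasOPE k Yg a j u) {m : ℤ}
    (hm : m ≡ j [ZMOD k]) (w : M) : vmode k (Yg (D.md u (-2) D.vac)) m w =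
      (-(m : ℂ) / k) • vmode k (Yg u) (m - k) w := by
  have hs : D.HasSign 0 D.vac := by rw [HasSign, hD.parity_vac, pow_zero, one_smul]
  have hk : (0 : ℤ) < k := by exact_mod_cast NeZero.pos k
  have := (hu.homogeneous hs).eq (-2) m 0 w hm
  rw [mul_zero, pow_zero, one_smul, hYg, ordProd_vacFamily_right_zero _ _ _ _ fun q => by nlinarith,
    ordProd_vacFamily_left_zero _ _ _ _ fun q hq => ?_, smul_zero, sub_zero,
    finsum_eq_sum_range (N := 2) fun i hi => ?_, sum_range_succ, sum_range_one] at this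
  · simp only [Nat.cast_zero, Nat.cast_one, add_zero, mul_zero, sub_zero, mul_one,
      Ring.choose_zero_right, Ring.choose_one_right, one_smul,
      show (-2 : ℤ) + 1 = -1 by norm_num, hD.creation_neg_one] at this
    rw [neg_div, neg_smul]
    exact eq_neg_of_add_eq_zero_left this.symm
  · rw [hD.creation u _ (by omega), map_zero]
    rw [vmode_zero]
    simp
  · have : (k : ℤ) * (-2 - q + 1) = 0 := by linear_combination hq
    rcases mul_eq_zero.mp this with h | h <;> omega

lemma md_neg_two_vac (hD : D.IsVertex) (v : V) (n : ℤ) (w : V) :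
    D.md (D.md v (-2) D.vac) n w = (-n : ℂ) • D.md v (n - 1) w := by
  have H : ∀ a v, D.HasSign a v →
      D.md (D.md v (-2) D.vac) n w = (-n : ℂ) • D.md v (n - 1) w := fun a v hv => by
    have := hD.vmode_neg_two_vac hD.md_vac (hD.hasOPE hv) (m := n) (by simpa using Int.modEq_one) w
    rw [Nat.cast_one, Nat.cast_one, div_one] at this
    exact this
  conv_lhs => rw [eq_signProj_add (D := D) v]
  conv_rhs => rw [eq_signProj_add (D := D) v]
  rw [md_add, add_apply, md_add, md_add, add_apply, add_apply,
    H _ _ (hasSign_signProj hD.parity_parity 0 v), H _ _ (hasSign_signProj hD.parity_parity 1 v),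
    smul_add]

/-- The translation `v ↦ v_{-2} 1` is a derivation of all products. -/
lemma md_neg_two_md (hD : D.IsVertex) {a : ℕ} {u : V} (hu : D.HasSign a u) (n : ℤ) (v : V) :
    D.md (D.md u n v) (-2) D.vac =
      (-n : ℂ) • D.md u (n - 1) v + D.md u n (D.md v (-2) D.vac) := by
  have := ((hD.hasOPE hu) v).product_eq n (-2) D.vac
  rw [finsum_eq_single _ 0 fun i hi => by
    simp [Ring.choose_zero_pos ℂ (Nat.pos_of_ne_zero hi)]] at this
  simp only [Nat.cast_zero, Int.cast_zero, mul_zero, sub_zero, add_zero, pow_zero, one_smul,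
    zero_div, Ring.choose_zero_right, one_mul] at this
  refine this.trans ?_
  have h1 : ordProd 1 (vmode 1 (D.Y ((D.parity ^ a) v))) (vmode 1 (D.Y u)) n (-2) 0 D.vac = 0 :=
    finsum_eq_zero_of_forall_eq_zero fun i => by
      have : vmode 1 (D.Y u) (0 + (1 : ℕ) * i) D.vac = 0 := hD.creation u _ (by push_cast; omega)
      rw [this, map_zero, smul_zero]
  rw [h1, smul_zero, sub_zero, ordProd, finsum_eq_sum_range (N := 2) fun i hi => by
      have : vmode 1 (D.Y v) (-2 + (1 : ℕ) * i) D.vac = 0 := hD.creation v _ (by push_cast; omega)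
      rw [this, map_zero, smul_zero], sum_range_succ, sum_range_one, add_comm]
  simp only [Nat.cast_one, Nat.cast_zero, Ring.choose_one_right, Ring.choose_zero_right, pow_zero,
    pow_one, one_mul, one_smul, mul_one, mul_zero, zero_add, add_zero, sub_zero, neg_mul]
  rw [show (-2 : ℤ) + 1 = -1 by norm_num]
  change _ • D.md u _ (D.md v (-1) D.vac) + _ = _
  rw [hD.creation_neg_one]
  rfl

/-- If `ω_0` is the translation and `ω_i ω`, `i ≥ 1`, are as in a vertex operator algebra, then the
modes of `ω` satisfy the Virasoro relations. -/
lemma virasoro (hD : D.IsVertex) {c : ℂ} (hω : D.parity D.omega = D.omega)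
    (h0 : D.L (-1) D.omega = D.md D.omega (-2) D.vac) (h1 : D.L 0 D.omega = (2 : ℂ) • D.omega)
    (h2 : D.L 1 D.omega = 0) (h3 : D.L 2 D.omega = (c / 2) • D.vac)
    (h4 : ∀ n : ℤ, 3 ≤ n → D.L n D.omega = 0) (m n : ℤ) :
    D.L m * D.L n - D.L n * D.L m = ((m : ℂ) - n) • D.L (m + n) +
      (if m + n = 0 then ((m : ℂ) ^ 3 - m) / 12 * c else 0) • (1 : End ℂ V) := by
  have hs : D.HasSign 0 D.omega := by rw [HasSign, hω, pow_zero, one_smul]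
  ext w
  have key := hD.commutator hs hs (K := 4) (fun s hs => by
    have := h4 (s - 1) (by omega)
    rwa [L, sub_add_cancel] at this) (m + 1) (n + 1) w
  rw [mul_zero, pow_zero, one_smul] at key
  rw [sub_apply, Module.End.mul_apply, Module.End.mul_apply]
  refine key.trans ?_
  simp only [sum_range_succ, sum_range_zero, zero_add, Nat.cast_zero, Nat.cast_one,
    Nat.cast_ofNat, Ring.choose_zero_right, Ring.choose_one_right, one_smul]
  rw [L] at h0 h1 h2 h3
  norm_num at h0 h1 h2 h3
  rw [h0, h1, h2, h3, md_zero, zero_apply, smul_zero, add_zero, hD.md_neg_two_vac,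
    md_smul, md_smul, smul_apply, smul_apply]
  have hv : D.md D.vac (m + 1 + (n + 1) - 3) w = if m + n = 0 then w else 0 := by
    rw [md, hD.md_vac, vacFamily_apply]
    have : m + 1 + (n + 1) - 3 = -(1 : ℕ) ↔ m + n = 0 := by push_cast; omega
    simp only [this]
  have h3' : binom((m + 1 : ℤ), 3) = ((m : ℂ) ^ 3 - m) / 6 := by
    have e : ∀ x : ℂ, binom(x, 3) = x * (x - 1) * (x - 2) / 6 := fun x => by
      have := Ring.descPochhammer_eq_factorial_smul_choose x 3
      rw [← Polynomial.aeval_eq_smeval] at this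
      simp [descPochhammer_succ_right, Nat.factorial] at this
      rw [map_ofNat] at this
      linear_combination (-1 / 6 : ℂ) * this
    rw [e]; push_cast; ring
  rw [hv, h3', add_apply, smul_apply, smul_apply, L,
    show m + 1 + (n + 1) - 1 = m + n + 1 by ring,
    show m + 1 + (n + 1) - 0 - 1 = m + n + 1 by ring, Module.End.one_apply]
  split_ifs with h
  · rw [smul_smul, smul_smul, ← add_smul]
    congr 2
    · push_cast; ring
    · ring
  · rw [smul_zero, smul_zero, zero_smul, smul_smul, ← add_smul]
    congr 2
    push_cast; ring

end IsVertex

end VertexData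

end Generic
/-! ### Twisted modules -/

section Twisted

namespace VertexData

variable {V : Type*} [AddCommGroup V] [Module ℂ V] {D : VertexData V}
  {M : Type*} [AddCommGroup M] [Module ℂ M] {g : End ℂ V}
  {Yg : V →ₗ[ℂ] VertexOperator ℂ M} {a b j j' : ℕ} {u v : V}

variable (D g Yg) in
/-- The vector `u` has sign `a`, `g u = (-1)^j u`, its modes on `M` lie in `ℤ + j/2`, and it
satisfies the Jacobi identity with all vectors. -/
structure TwistedGood (a j : ℕ) (u : V) : Prop where
  sign : D.HasSign a u
  grad : g u = (-1 : ℂ) ^ j • u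
  support : ∀ N : ℤ, ¬ N ≡ j [ZMOD (2 : ℕ)] → vmode 2 (Yg u) N = 0
  ope : D.HasOPE 2 Yg a j u

variable (D g Yg) in
/-- The vertex operators `Yg` satisfy `Yg(1, x) = 1` and the twisted Jacobi identity for a spanning
set of homogeneous vectors. -/
structure IsTwistedSystem : Prop where
  vac : vmode 2 (Yg D.vac) = vacFamily M 2
  span : Submodule.span ℂ {u | ∃ a j, TwistedGood D g Yg a j u} = ⊤

lemma TwistedGood.md (hD : D.IsVertex) (hg : ∀ u v n, g (D.md u n v) = D.md (g u) n (g v))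
    (hu : TwistedGood D g Yg a j u) (hv : TwistedGood D g Yg b j' v) (r : ℤ) :
    TwistedGood D g Yg (a + b) (j + j') (D.md u r v) where
  sign := hu.sign.md hD.parity_md hv.sign r
  grad := by
    rw [hg, hu.grad, hv.grad, md_smul, smul_apply, map_smul, smul_smul, pow_add]
  support N hN := by
    ext w
    have := (hu.ope v).product_eq r N w
    refine this.trans (finsum_eq_zero_of_forall_eq_zero fun i => ?_)
    have hb : ∀ t : ℤ, ¬ t ≡ j' [ZMOD (2 : ℕ)] → vmode 2 (Yg ((D.parity ^ a) v)) t = 0 :=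
      fun t ht => by
        rw [hv.sign.parity_pow, map_smul, vmode_smul, Pi.smul_apply, hv.support t ht, smul_zero]
    have key : ∀ q : ℤ, ¬ N - j + (2 : ℕ) * q ≡ j' [ZMOD (2 : ℕ)] := fun q hq => hN (by
      simp only [Int.ModEq] at hq ⊢
      push_cast at hq ⊢
      omega)
    rw [ordProd, ordProd, finsum_eq_zero_of_forall_eq_zero fun i => by
        rw [hv.support _ (key i), zero_apply, map_zero, smul_zero],
      finsum_eq_zero_of_forall_eq_zero fun i => by
        rw [hb _ (key _), zero_apply, smul_zero]]
    simp
  ope := by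
    rw [Nat.cast_add]
    exact HasOPE.mul hD.parity_parity hD.parity_md hu.sign hv.sign (hD.hasOPE hu.sign) hu.ope
      hv.ope r

lemma TwistedGood.jacobi (hu : TwistedGood D g Yg a j u)
    (hv : D.HasSign b v) (l m n : ℤ) (w : M) :
    jacobiLHS 2 ((-1) ^ (a * b)) (vmode 2 (Yg u)) (vmode 2 (Yg v)) l m n w =
      (1 / (2 : ℕ) : ℂ) • ∑ r ∈ range 2, ((-1 : ℂ) ^ (-(r * m) : ℤ)) • ∑ᶠ i : ℕ,
        (binom((m : ℂ) / (2 : ℕ), i)) •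
          vmode 2 (Yg (D.md ((g ^ r) u) (l + i) v)) (m + n - (2 : ℕ) * i) w := by
  rw [sum_range_succ, sum_range_one]
  simp only [Nat.cast_zero, zero_mul, neg_zero, zpow_zero, one_smul, pow_zero, Module.End.one_apply,
    pow_one, Nat.cast_one, one_mul, hu.grad, md_smul, smul_apply, map_smul, vmode_smul,
    Pi.smul_apply]
  have e1 : ∀ i : ℕ, binom((m : ℂ) / (2 : ℕ), i) • (-1 : ℂ) ^ j •
      vmode 2 (Yg (D.md u (l + i) v)) (m + n - (2 : ℕ) * i) w = (-1 : ℂ) ^ j •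
      binom((m : ℂ) / (2 : ℕ), i) • vmode 2 (Yg (D.md u (l + i) v)) (m + n - (2 : ℕ) * i) w :=
    fun i => smul_comm _ _ _
  obtain ⟨L, hL⟩ := D.md_trunc u v
  have h0 : vmode 2 (Yg 0) = 0 := (vmodeHom M 2 ∘ₗ Yg).map_zero
  rw [finsum_congr e1, ← finsum_smul_eq (hasFiniteSupport_of_ge (N := (L - l).toNat)
    fun i hi => by rw [hL _ (by omega), h0]; simp), smul_smul]
  by_cases hm : m ≡ j [ZMOD (2 : ℕ)]
  · have hsign : (-1 : ℂ) ^ (-m) * (-1) ^ j = 1 := by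
      obtain ⟨t, ht⟩ := hm.dvd
      obtain rfl : m = j - (2 : ℕ) * t := by omega
      have : (-1 : ℂ) ^ (-((j : ℤ) - (2 : ℕ) * t)) = (-1 : ℂ) ^ (j : ℤ) := by
        rw [show -((j : ℤ) - (2 : ℕ) * t) = j + 2 * (t - j) by push_cast; ring,
          zpow_add₀ (by norm_num), zpow_mul (-1 : ℂ) 2]
        norm_num
      rw [this, zpow_natCast, neg_one_pow_mul_neg_one_pow]
    rw [hsign, one_smul, ← two_smul ℂ, smul_smul,
      jacobiLHS_eq (vmode_trunc _) (vmode_trunc _)]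
    have := (hu.ope.homogeneous hv).eq l m n w hm
    rw [this]
    norm_num
  · have hsign : (-1 : ℂ) ^ (-m) * (-1) ^ j = -1 := by
      obtain ⟨t, ht⟩ : ∃ t, m = j + 1 + 2 * t := ⟨(m - j - 1) / 2, by
        simp only [Int.ModEq] at hm; push_cast at hm; omega⟩
      rw [ht, ← zpow_natCast, ← zpow_add₀ (by norm_num), show -((j : ℤ) + 1 + 2 * t) + j =
        -1 + 2 * (-t) by ring, zpow_add₀ (by norm_num), zpow_mul]
      norm_num
    rw [hsign, neg_one_smul, add_neg_cancel, smul_zero]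
    refine finsum_eq_zero_of_forall_eq_zero fun i => ?_
    have key : ∀ q : ℤ, ¬ m + (2 : ℕ) * q ≡ j [ZMOD (2 : ℕ)] := fun q hq => hm (by
      simp only [Int.ModEq] at hq ⊢
      push_cast at hq ⊢
      omega)
    rw [hu.support _ (key _), hu.support _ (key _)]
    simp

lemma jacobiLHS_add {k : ℕ} [NeZero k] {A A' B : ℤ → End ℂ M} (hA : TruncField A)
    (hA' : TruncField A') (hB : TruncField B) (ε : ℂ) (l m n : ℤ) (w : M) :
    jacobiLHS k ε (A + A') B l m n w = jacobiLHS k ε A B l m n w + jacobiLHS k ε A' B l m n w := by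
  rw [jacobiLHS_eq (hA.add hA') hB, jacobiLHS_eq hA hB, jacobiLHS_eq hA' hB, ordProd_add_left hB,
    ordProd_add_right hA hA', smul_add]
  abel

lemma jacobiLHS_smul {k : ℕ} [NeZero k] {A B : ℤ → End ℂ M} (hA : TruncField A)
    (hB : TruncField B) (ε c : ℂ) (l m n : ℤ) (w : M) :
    jacobiLHS k ε (c • A) B l m n w = c • jacobiLHS k ε A B l m n w := by
  rw [jacobiLHS_eq (hA.smul c) hB, jacobiLHS_eq hA hB, ordProd_smul_left hB,
    ordProd_smul_right hA, smul_sub, smul_comm c]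

/-- The Jacobi identity for a spanning set of homogeneous vectors gives that for all homogeneous
vectors. -/
lemma IsTwistedSystem.isWeakTwistedModule (h : IsTwistedSystem D g Yg) :
    D.IsWeakTwistedModule g 2 (-1) Yg where
  vac N := by rw [h.vac]; rfl
  support j v hv N hN := by
    -- the projection to an eigenspace of `g` maps every good vector to itself or to zero
    suffices H : ∀ u, vmode 2 (Yg ((1 / 2 : ℂ) • (u + (-1 : ℂ) ^ j • g u))) N = 0 by
      have := H v
      rw [hv, smul_smul, neg_one_pow_mul_neg_one_pow, one_smul, ← two_smul ℂ, smul_smul] at this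
      norm_num at this
      exact this
    intro u
    have hmem : u ∈ Submodule.span ℂ {u | ∃ a j, TwistedGood D g Yg a j u} := by
      rw [h.span]; trivial
    have h0 : vmode 2 (Yg 0) = 0 := (vmodeHom M 2 ∘ₗ Yg).map_zero
    induction hmem using Submodule.span_induction with
    | mem u hu =>
      obtain ⟨b, i, hu⟩ := hu
      by_cases hij : i % 2 = j % 2
      · rw [map_smul, map_add, map_smul, hu.grad, map_smul, vmode_smul, vmode_add, vmode_smul,
          vmode_smul, Pi.smul_apply, Pi.add_apply, Pi.smul_apply, Pi.smul_apply,
          hu.support N fun hN' => hN ?_]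
        · simp
        · simp only [Int.ModEq] at hN' ⊢
          push_cast at hN' ⊢
          omega
      · have : (-1 : ℂ) ^ j * (-1) ^ i = -1 := by
          rw [← pow_add, Odd.neg_one_pow (by rw [Nat.odd_iff]; omega)]
        rw [hu.grad, smul_smul, this, neg_one_smul, add_neg_cancel, smul_zero, h0]
        rfl
    | zero => rw [map_zero, smul_zero, add_zero, smul_zero, h0]; rfl
    | add u v _ _ hu hv =>
      rw [map_add, smul_add ((-1 : ℂ) ^ j), add_add_add_comm, smul_add (1 / 2 : ℂ),
        map_add, vmode_add, Pi.add_apply, hu, hv, add_zero]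
    | smul c u _ hu =>
      rw [map_smul g, smul_comm _ c, ← smul_add, smul_comm _ c, map_smul, vmode_smul, Pi.smul_apply,
        hu, smul_zero]
  jacobi a b u v hu hv l m n w := by
    rw [← hu.signProj_eq]
    clear hu
    have hmem : u ∈ Submodule.span ℂ {u | ∃ a j, TwistedGood D g Yg a j u} := by
      rw [h.span]; trivial
    have h0 : vmode 2 (Yg 0) = 0 := (vmodeHom M 2 ∘ₗ Yg).map_zero
    have h0' : vmode 2 (0 : VertexOperator ℂ M) = 0 := (vmodeHom M 2).map_zero
    have hzero : jacobiLHS 2 ((-1) ^ (a * b)) (vmode 2 (Yg 0)) (vmode 2 (Yg v)) l m n w =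
      (1 / (2 : ℕ) : ℂ) • ∑ r ∈ range 2, ((-1 : ℂ) ^ (-(r * m) : ℤ)) • ∑ᶠ i : ℕ,
        (binom((m : ℂ) / (2 : ℕ), i)) •
          vmode 2 (Yg (D.md ((g ^ r) 0) (l + i) v)) (m + n - (2 : ℕ) * i) w := by
      rw [jacobiLHS_eq (vmode_trunc _) (vmode_trunc _), h0, ordProd_zero_left, ordProd_zero_right,
        smul_zero, sub_zero]
      simp only [map_zero, md_zero, zero_apply, h0', Pi.zero_apply, smul_zero, finsum_zero,
        Finset.sum_const_zero]
    have hfin : ∀ (r : ℕ) (u : V), Function.HasFiniteSupport fun i : ℕ =>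
        (binom((m : ℂ) / (2 : ℕ), i)) •
          vmode 2 (Yg (D.md ((g ^ r) u) (l + i) v)) (m + n - (2 : ℕ) * i) w := fun r u => by
      obtain ⟨L, hL⟩ := D.md_trunc ((g ^ r) u) v
      exact hasFiniteSupport_of_ge (N := (L - l).toNat) fun i hi => by
        rw [hL _ (by omega), h0]; simp
    induction hmem using Submodule.span_induction with
    | mem u hu =>
      obtain ⟨a', i, hu⟩ := hu
      by_cases haa : a' % 2 = a % 2
      · rw [(hu.sign.congr haa).signProj_eq]
        have : (-1 : ℂ) ^ (a * b) = (-1) ^ (a' * b) := by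
          rw [pow_mul, pow_mul, neg_one_pow_eq_pow_mod_two, ← haa, ← neg_one_pow_eq_pow_mod_two]
        rw [this]
        exact hu.jacobi hv l m n w
      · rw [hu.sign.signProj_eq_zero (Ne.symm haa)]
        exact hzero
    | zero => rw [map_zero]; exact hzero
    | add u u' _ _ hu hu' =>
      rw [map_add, map_add, vmode_add,
        jacobiLHS_add (vmode_trunc _) (vmode_trunc _) (vmode_trunc _),
        hu, hu', ← smul_add, ← sum_add_distrib]
      congr 1
      refine sum_congr rfl fun r _ => ?_
      rw [← smul_add, ← finsum_add_distrib (hfin r _) (hfin r _)]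
      congr 1
      refine finsum_congr fun i => ?_
      rw [map_add, md_add, add_apply, map_add, vmode_add, Pi.add_apply,
        add_apply, smul_add]
    | smul c u _ hu =>
      rw [map_smul, map_smul, vmode_smul, jacobiLHS_smul (vmode_trunc _) (vmode_trunc _), hu,
        smul_comm c, smul_sum]
      congr 1
      refine sum_congr rfl fun r _ => ?_
      rw [smul_comm c, finsum_smul_eq (hfin r _)]
      congr 1
      refine finsum_congr fun i => ?_
      rw [map_smul, md_smul, smul_apply, map_smul, vmode_smul, Pi.smul_apply,
        smul_apply, smul_comm c]

lemma vmode_refineVar (A : VertexOperator ℂ M) (k : ℕ) [NeZero k] (N : ℤ) :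
    vmode k (refineVar k A) N = if (k : ℤ) ∣ N then vmode 1 A (N / k) else 0 := by
  have hk : (k : ℤ) ≠ 0 := by exact_mod_cast NeZero.ne k
  simp only [vmode, refineVar, LinearMap.coe_mk, AddHom.coe_mk, VertexOperator.of_coeff,
    HVertexOperator.coeff_of_coeff]
  have h1 : (k : ℤ) ∣ -N - k ↔ (k : ℤ) ∣ N := by
    rw [dvd_sub_self_right, dvd_neg]
  simp only [h1]
  split_ifs with h
  · obtain ⟨t, rfl⟩ := h
    rw [Int.mul_ediv_cancel_left _ hk, show -((k : ℤ) * t) - k = k * (-t - 1) by ring,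
      Int.mul_ediv_cancel_left _ hk]
    rfl
  · rfl

/-- An OPE in the variable `x`, regarded as one in `x^{1/k}`. -/
lemma OPE.refine {k : ℕ} [NeZero k] {A B B' : VertexOperator ℂ M}
    {T : ℤ → VertexOperator ℂ M}
    (h : OPE 1 0 (vmode 1 A) (vmode 1 B) (vmode 1 B') fun l => vmode 1 (T l)) :
    OPE k 0 (vmode k (refineVar k A)) (vmode k (refineVar k B)) (vmode k (refineVar k B'))
      fun l => vmode k (refineVar k (T l)) := by
  have hk : (k : ℤ) ≠ 0 := by exact_mod_cast NeZero.ne k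
  have hk' : (k : ℂ) ≠ 0 := by exact_mod_cast NeZero.ne k
  refine ⟨?_, fun l m n w hm => ?_⟩
  · obtain ⟨L, hL⟩ := h.bdd
    refine ⟨L, fun l hl => ?_⟩
    have : T l = 0 := vmode_injective (k := 1) (by
      rw [hL l hl]; exact (vmodeHom M 1).map_zero.symm)
    rw [this, map_zero]
    exact (vmodeHom M k).map_zero
  obtain ⟨m, rfl⟩ := Int.modEq_zero_iff_dvd.mp hm
  simp only [ordProd, vmode_refineVar]
  by_cases hn : (k : ℤ) ∣ n
  · obtain ⟨n, rfl⟩ := hn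
    have h1 := h.eq l m n w (by simpa using Int.modEq_one)
    simp only [ordProd, Nat.cast_one, one_mul, div_one] at h1
    have e1 : ∀ x y : ℤ, (k : ℤ) * x + k * y = k * (x + y) := fun x y => by ring
    simp only [e1, ← mul_sub, dvd_mul_right, if_true, Int.mul_ediv_cancel_left _ hk]
    rw [h1]
    refine finsum_congr fun i => ?_
    push_cast
    rw [mul_div_cancel_left₀ _ hk']
  · have e1 : ∀ i : ℤ, ¬ (k : ℤ) ∣ n + k * i := fun i hi => hn (by
      simpa using (Int.dvd_add_left (dvd_mul_right _ _)).mp hi)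
    have e2 : ∀ i : ℤ, ¬ (k : ℤ) ∣ k * m + n - k * i := fun i hi => e1 (m - i) (by
      rwa [show (k : ℤ) * m + n - k * i = n + k * (m - i) by ring] at hi)
    simp only [if_neg (e1 _), if_neg (e2 _)]
    simp

/-- The adjoint module, in the variable `x^{1/2}`. -/
lemma IsVertex.refine (hD : D.IsVertex) :
    IsTwistedSystem D LinearMap.id (refineVar 2 ∘ₗ D.Y) where
  vac := by
    funext N
    rw [comp_apply, vmode_refineVar, hD.md_vac]
    unfold vacFamily
    split_ifs with h1 h2 h3 h3 <;> first | rfl | (exfalso; push_cast at *; omega)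
  span := by
    rw [eq_top_iff, ← hD.span]
    refine Submodule.span_mono ?_
    rintro u ⟨a, hs, hu⟩
    refine ⟨a, 0, hs, by simp, fun N hN => ?_, fun v => ?_⟩
    · rw [comp_apply, vmode_refineVar, if_neg]
      intro h
      exact hN (by simpa [Int.modEq_zero_iff_dvd] using h)
    · exact OPE.refine (hu v)

end VertexData

end Twisted
/-! ### Tensor products -/

section TensorProducts

variable {M N : Type*} [AddCommGroup M] [Module ℂ M] [AddCommGroup N] [Module ℂ N] {k : ℕ}
  {M' N' : Type*} [AddCommGroup M'] [Module ℂ M'] [AddCommGroup N'] [Module ℂ N']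

lemma bilin_support_finite {Z : Type*} [AddCommGroup Z] [Module ℂ Z] (Λ : M →ₗ[ℂ] N →ₗ[ℂ] Z)
    {f : ℤ → M} {g : ℤ → N} {L : ℤ} (hf : ∃ K, ∀ p, K ≤ p → f p = 0) (hg : ∀ p, p < L → g p = 0) :
    (Function.support fun p : ℤ => Λ (f p) (g p)).Finite := by
  obtain ⟨K, hf⟩ := hf
  refine (Set.finite_Icc L K).subset fun p hp => ?_
  rw [Function.mem_support] at hp
  constructor
  · by_contra h
    exact hp (by rw [hg _ (by omega), map_zero])
  · by_contra h
    exact hp (by rw [hf _ (by omega), map_zero, zero_apply])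

/-- The modes of `A(x) ⊗ C(x)`, followed by a tensor product of linear maps. -/
lemma map_vmode_fieldTensor (Φ : M →ₗ[ℂ] M') (Ψ : N →ₗ[ℂ] N') (A : VertexOperator ℂ M)
    (C : VertexOperator ℂ N) (n t : ℤ) (x : M) (y : N) :
    map Φ Ψ (vmode k (fieldTensor A C) (n + t) (x ⊗ₜ y)) =
      ∑ᶠ p : ℤ, Φ (vmode k A (p + t) x) ⊗ₜ[ℂ] Ψ (vmode k C (n - p - k) y) := by
  have h1 : vmode k (fieldTensor A C) (n + t) (x ⊗ₜ y) =
      ∑ᶠ p : ℤ, HVertexOperator.coeff A p x ⊗ₜ[ℂ] HVertexOperator.coeff C (-(n + t) - k - p) y :=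
    rfl
  obtain ⟨K, hK⟩ := vmode_trunc (k := k) A x
  obtain ⟨L, hL⟩ := vmode_trunc (k := k) C y
  have h2 : vmode k (fieldTensor A C) (n + t) (x ⊗ₜ y) =
      ∑ᶠ p : ℤ, vmode k A (p + t) x ⊗ₜ[ℂ] vmode k C (n - p - k) y := by
    rw [h1]
    refine (finsum_eq_of_bijective (fun p : ℤ => -p - t - k)
      ⟨fun p q hpq => ?_, fun p => ⟨-p - t - k, ?_⟩⟩ fun p => ?_).symm
    · simp only at hpq; omega
    · simp only; ring
    · unfold vmode
      rw [show -(n + t) - (k : ℤ) - (-p - t - k) = -(n - p - k) - k by ring,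
        show -(p + t) - (k : ℤ) = -p - t - k by ring]
  rw [h2]
  exact map_finsum (map Φ Ψ) (bilin_support_finite (TensorProduct.mk ℂ M N) (L := n - k - L + 1)
    ⟨K - t, fun p hp => hK _ (by omega)⟩ fun p hp => hL _ (by omega))

lemma map_vmode_fieldTensor' (Φ : M →ₗ[ℂ] M') (Ψ : N →ₗ[ℂ] N') (A : VertexOperator ℂ M)
    (C : VertexOperator ℂ N) (n t : ℤ) (x : M) (y : N) :
    map Φ Ψ (vmode k (fieldTensor A C) (n + t) (x ⊗ₜ y)) =
      ∑ᶠ p : ℤ, Φ (vmode k A (n - p - k) x) ⊗ₜ[ℂ] Ψ (vmode k C (p + t) y) := by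
  have h := map_vmode_fieldTensor (k := k) Φ Ψ A C (n + t) 0 x y
  rw [add_zero] at h
  rw [h]
  refine finsum_eq_of_bijective (fun p : ℤ => n - k - p)
    ⟨fun p q hpq => by simpa using hpq, fun p => ⟨n - k - p, by simp⟩⟩ fun p => ?_
  rw [add_zero, show n - (n - k - p) - (k : ℤ) = p by ring,
    show n - k - p + t = n + t - p - (k : ℤ) by ring]

lemma vmode_fieldTensor (A : VertexOperator ℂ M) (C : VertexOperator ℂ N) (n : ℤ)
    (x : M) (y : N) : vmode k (fieldTensor A C) n (x ⊗ₜ y) =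
      ∑ᶠ p : ℤ, vmode k A p x ⊗ₜ[ℂ] vmode k C (n - p - k) y := by
  have := map_vmode_fieldTensor (k := k) LinearMap.id LinearMap.id A C n 0 x y
  simpa using this

lemma finsum_finsum_comm' {X : Type*} [AddCommMonoid X] {f : ℕ → ℤ → X} {I : ℕ}
    (hI : ∀ i, I ≤ i → ∀ p, f i p = 0) (hf : ∀ i, (Function.support (f i)).Finite) :
    ∑ᶠ i, ∑ᶠ p, f i p = ∑ᶠ p, ∑ᶠ i, f i p := by
  have h1 : ∑ᶠ i, ∑ᶠ p, f i p = ∑ i ∈ range I, ∑ᶠ p, f i p :=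
    finsum_eq_sum_of_support_subset _ fun i hi => by
      simp only [Finset.coe_range, Set.mem_Iio]
      by_contra h
      exact hi (finsum_eq_zero_of_forall_eq_zero (hI i (by omega)))
  rw [h1, ← finsum_sum_comm _ _ fun i _ => hf i]
  exact finsum_congr fun p => (finsum_eq_sum_of_support_subset _ fun i hi => by
      simp only [Finset.coe_range, Set.mem_Iio]
      by_contra h
      exact hi (hI i (by omega) p)).symm

section Bilinear

variable {Z : Type*} [AddCommGroup Z] [Module ℂ Z] (Λ : M →ₗ[ℂ] N →ₗ[ℂ] Z) {c : ℤ → N} {L : ℤ}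

lemma finsum_bilin_comm {f : ℕ → ℤ → M} {I : ℕ} (hc : ∀ p, p < L → c p = 0)
    (hf : ∀ i, ∃ R, ∀ p, R ≤ p → f i p = 0) (hI : ∀ i, I ≤ i → ∀ p, L ≤ p → f i p = 0) :
    ∑ᶠ i, ∑ᶠ p, Λ (f i p) (c p) = ∑ᶠ p, Λ (∑ᶠ i, f i p) (c p) := by
  rw [finsum_finsum_comm' (I := I) (fun i hi p => ?_) fun i => bilin_support_finite Λ (hf i) hc]
  · refine finsum_congr fun p => ?_
    by_cases hp : p < L
    · simp [hc p hp]
    · exact (map_finsum_ge' (K := I) (Λ.flip (c p)) fun i hi => hI i hi p (by omega)).symm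
  · by_cases hp : p < L
    · rw [hc p hp, map_zero]
    · rw [hI i hi p (by omega), map_zero, zero_apply]

/-- An operator product expansion is preserved by pairing with a sequence bounded below. -/
lemma OPE.finsum_bilin [NeZero k] {j : ℤ} {A B B' : ℤ → End ℂ M} {T : ℤ → ℤ → End ℂ M}
    (hA : TruncField A) (hB : TruncField B) (hB' : TruncField B') (h : OPE k j A B B' T)
    (hc : ∀ p, p < L → c p = 0) (l m : ℤ) (hm : m ≡ j [ZMOD k]) (x : M) :
    ∑ᶠ i : ℕ, ∑ᶠ p : ℤ,
        Λ (((-1) ^ i * binom(l, i)) • A (m + k * (l - i)) (B (p + k * i) x)) (c p) -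
      (-1 : ℂ) ^ l • ∑ᶠ i : ℕ, ∑ᶠ p : ℤ,
        Λ (((-1) ^ i * binom(l, i)) • B' (p + k * (l - i)) (A (m + k * i) x)) (c p) =
      ∑ᶠ i : ℕ, ∑ᶠ p : ℤ, Λ (binom((m : ℂ) / k, i) • T (l + i) (m + p - k * i) x) (c p) := by
  obtain ⟨KA, hKA⟩ := hA x
  obtain ⟨KB, hKB⟩ := hB x
  obtain ⟨LT, hLT⟩ := exists_nat_of_bdd h.bdd l
  have hk : (0 : ℤ) < k := by exact_mod_cast NeZero.pos k
  have hki : ∀ i : ℕ, (i : ℤ) ≤ k * i := fun i => by nlinarith [Int.natCast_nonneg i]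
  have hR : ∀ i : ℕ, ∃ R : ℤ, ∀ p, R ≤ p →
      ((-1) ^ i * binom(l, i)) • B' (p + k * (l - i)) (A (m + k * i) x) = 0 := fun i => by
    obtain ⟨R, hR⟩ := hB' (A (m + k * i) x)
    exact ⟨R - k * (l - i), fun p hp => by rw [hR _ (by omega), smul_zero]⟩
  have hA0 : ∀ i : ℕ, (KA - m).toNat ≤ i → A (m + k * i) x = 0 := fun i hi =>
    hKA _ (by have := hki i; omega)
  rw [finsum_bilin_comm Λ (I := (KB - L).toNat) hc
      (fun i => ⟨KB - k * i, fun p hp => by rw [hKB _ (by omega), map_zero, smul_zero]⟩)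
      (fun i hi p hp => by
        have := hki i
        rw [hKB _ (by omega), map_zero, smul_zero]),
    finsum_bilin_comm Λ (I := (KA - m).toNat) hc hR
      (fun i hi p hp => by rw [hA0 i hi, map_zero, smul_zero]),
    finsum_bilin_comm Λ (I := LT) hc (fun i => by
        obtain ⟨R, hR⟩ := h.truncField hA hB hB' (l + i) x
        exact ⟨R - m + k * i, fun p hp => by rw [hR _ (by omega), smul_zero]⟩)
      (fun i hi p hp => by rw [hLT i hi]; simp)]
  have hs2 := bilin_support_finite Λ (f := fun p => ordProd k B' A l p m x) (by
    choose R hR using hR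
    refine ⟨∑ i ∈ range (KA - m).toNat, |R i|, fun p hp => ?_⟩
    refine finsum_eq_zero_of_forall_eq_zero fun i => ?_
    by_cases hi : i < (KA - m).toNat
    · have h1 := Finset.single_le_sum (f := fun i => |R i|) (fun i _ => abs_nonneg _)
        (Finset.mem_range.mpr hi)
      exact hR i p (by have := le_abs_self (R i); omega)
    · rw [hA0 i (by omega), map_zero, smul_zero]) hc
  refine Eq.trans (congrArg (_ - ·) (smul_finsum' _ hs2)) ?_
  refine (finsum_sub_distrib (bilin_support_finite Λ ⟨KB, fun p hp =>
    finsum_eq_zero_of_forall_eq_zero fun i => by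
      have := hki i
      rw [hKB _ (by omega), map_zero, smul_zero]⟩ hc) (hs2.subset fun p hp => ?_)).symm.trans ?_
  · contrapose! hp
    rw [Function.notMem_support] at hp ⊢
    exact (congrArg _ hp).trans (smul_zero _)
  · refine finsum_congr fun p => ?_
    rw [← h.eq l m p x hm, map_sub, map_smul]
    rfl

end Bilinear

/-- To check an OPE on a tensor product, it is enough to consider pure tensors. -/
lemma OPE.of_tmul [NeZero k] {j : ℤ} {A B B' : ℤ → End ℂ (M ⊗[ℂ] N)}
    {T : ℤ → ℤ → End ℂ (M ⊗[ℂ] N)} (hA : TruncField A) (hB : TruncField B)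
    (hT : ∃ L : ℤ, ∀ l, L ≤ l → T l = 0)
    (h : ∀ (l m n : ℤ) (x : M) (y : N), m ≡ j [ZMOD k] →
      ordProd k A B l m n (x ⊗ₜ y) - (-1 : ℂ) ^ l • ordProd k B' A l n m (x ⊗ₜ y) =
        ∑ᶠ i : ℕ, binom((m : ℂ) / k, i) • T (l + i) (m + n - k * i) (x ⊗ₜ y)) :
    OPE k j A B B' T := by
  refine ⟨hT, fun l m n w hm => ?_⟩
  obtain ⟨K, hK⟩ := exists_nat_of_bdd hT l
  have hf : ∀ w, Function.HasFiniteSupport fun i : ℕ =>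
      binom((m : ℂ) / k, i) • T (l + i) (m + n - k * i) w := fun w =>
    hasFiniteSupport_of_ge (N := K) fun i hi => by rw [hK i hi]; simp
  induction w with
  | zero => simp [ordProd_map_zero]
  | add x y hx hy =>
    rw [ordProd_map_add hB, ordProd_map_add hA, smul_add, add_sub_add_comm, hx, hy,
      ← finsum_add_distrib (hf x) (hf y)]
    exact finsum_congr fun i => by rw [map_add, smul_add]
  | tmul x y => exact h l m n x y hm

lemma bdd_of_vmode {T : ℤ → VertexOperator ℂ M} (h : ∃ L : ℤ, ∀ l, L ≤ l → vmode k (T l) = 0)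
    {X : Type*} [AddCommGroup X] [Module ℂ X] (f : VertexOperator ℂ M →ₗ[ℂ] VertexOperator ℂ X) :
    ∃ L : ℤ, ∀ l, L ≤ l → vmode k (f (T l)) = 0 := by
  obtain ⟨L, hL⟩ := h
  refine ⟨L, fun l hl => ?_⟩
  have : T l = 0 := vmode_injective (k := k) (by
    rw [hL l hl]; exact (vmodeHom M k).map_zero.symm)
  rw [this, map_zero]
  exact (vmodeHom _ k).map_zero

/-- The OPE of `A(x) ⊗ 1` with `B(x) ⊗ C(x)`. -/
lemma OPE.tensor_left [NeZero k] {j : ℤ} {A B B' : VertexOperator ℂ M}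
    {T : ℤ → VertexOperator ℂ M} (h : OPE k j (vmode k A) (vmode k B) (vmode k B')
      fun l => vmode k (T l)) (C : VertexOperator ℂ N) {A₁ : VertexOperator ℂ (M ⊗[ℂ] N)}
    (hA₁ : ∀ n, vmode k A₁ n = map (vmode k A n) LinearMap.id) :
    OPE k j (vmode k A₁) (vmode k (fieldTensor B C)) (vmode k (fieldTensor B' C))
      fun l => vmode k (fieldTensor (T l) C) := by
  refine OPE.of_tmul (vmode_trunc _) (vmode_trunc _) (bdd_of_vmode h.bdd (fieldTensor.flip C))
    fun l m n x y hm => ?_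
  obtain ⟨K, hK⟩ := vmode_trunc (k := k) C y
  have e := h.finsum_bilin (TensorProduct.mk ℂ M N) (c := fun p => vmode k C (n - p - k) y)
    (L := n - k - K + 1) (vmode_trunc _) (vmode_trunc _) (vmode_trunc _)
    (fun p hp => hK _ (by omega)) l m hm x
  refine Eq.trans (congrArg₂ (fun a b => a - (-1 : ℂ) ^ l • b) (finsum_congr fun i => ?_)
    (finsum_congr fun i => ?_)) (e.trans (finsum_congr fun i => ?_))
  · rw [hA₁, ← smul_apply, ← map_smul_left]
    exact map_vmode_fieldTensor _ _ _ _ _ _ _ _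
  · have := map_vmode_fieldTensor (k := k) (((-1) ^ i * binom(l, i)) • LinearMap.id) LinearMap.id
      B' C n (k * (l - i)) (vmode k A (m + k * i) x) y
    rw [map_smul_left, map_id] at this
    rw [hA₁]
    exact this
  · have := map_vmode_fieldTensor (k := k) (binom((m : ℂ) / k, i) • LinearMap.id) LinearMap.id
      (T (l + i)) C n (m - k * i) x y
    rw [map_smul_left, map_id] at this
    rw [show m + n - (k : ℤ) * i = n + (m - k * i) by ring]
    refine (this.trans (finsum_congr fun p => ?_)).symm
    rw [show p + (m - (k : ℤ) * i) = m + p - k * i by ring]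
    rfl

/-- The OPE of `π ⊗ A(x)` with `B(x) ⊗ C(x)`, where `B₁(x) π = π B(x)`. -/
lemma OPE.tensor_right [NeZero k] {j : ℤ} {A C C' : VertexOperator ℂ N}
    {T : ℤ → VertexOperator ℂ N} (h : OPE k j (vmode k A) (vmode k C) (vmode k C')
      fun l => vmode k (T l)) {B B₁ πB : VertexOperator ℂ M} {π : End ℂ M}
    (hB₁ : ∀ n x, vmode k B₁ n (π x) = π (vmode k B n x))
    (hπB : ∀ n x, vmode k πB n x = π (vmode k B n x)) {A₁ : VertexOperator ℂ (M ⊗[ℂ] N)}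
    (hA₁ : ∀ n, vmode k A₁ n = map π (vmode k A n)) :
    OPE k j (vmode k A₁) (vmode k (fieldTensor B C)) (vmode k (fieldTensor B₁ C'))
      fun l => vmode k (fieldTensor πB (T l)) := by
  refine OPE.of_tmul (vmode_trunc _) (vmode_trunc _) (bdd_of_vmode h.bdd (fieldTensor πB))
    fun l m n x y hm => ?_
  obtain ⟨K, hK⟩ := vmode_trunc (k := k) B x
  have e := h.finsum_bilin (TensorProduct.mk ℂ M N).flip
    (c := fun p => π (vmode k B (n - p - k) x)) (L := n - k - K + 1) (vmode_trunc _)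
    (vmode_trunc _) (vmode_trunc _) (fun p hp => by rw [hK _ (by omega), map_zero]) l m hm y
  refine Eq.trans (congrArg₂ (fun a b => a - (-1 : ℂ) ^ l • b) (finsum_congr fun i => ?_)
    (finsum_congr fun i => ?_)) (e.trans (finsum_congr fun i => ?_))
  · rw [hA₁, ← smul_apply, ← map_smul_right]
    exact map_vmode_fieldTensor' _ _ _ _ _ _ _ _
  · have := map_vmode_fieldTensor' (k := k) LinearMap.id (((-1) ^ i * binom(l, i)) • LinearMap.id)
      B₁ C' n (k * (l - i)) (π x) (vmode k A (m + k * i) y)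
    rw [map_smul_right, map_id] at this
    rw [hA₁]
    refine this.trans (finsum_congr fun p => ?_)
    rw [hB₁]
    rfl
  · have := map_vmode_fieldTensor' (k := k) LinearMap.id
      (binom((m : ℂ) / k, i) • LinearMap.id) πB (T (l + i)) n (m - k * i) x y
    rw [map_smul_right, map_id] at this
    rw [show m + n - (k : ℤ) * i = n + (m - k * i) by ring]
    refine (this.trans (finsum_congr fun p => ?_)).symm
    rw [show p + (m - (k : ℤ) * i) = m + p - k * i by ring, id_apply, hπB]
    rfl

end TensorProducts
/-! ### Tensor products of vertex superalgebras and of twisted modules -/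

section TensorVertex

variable {M N : Type*} [AddCommGroup M] [Module ℂ M] [AddCommGroup N] [Module ℂ N] {k : ℕ}
  {V W : Type*} [AddCommGroup V] [Module ℂ V] [AddCommGroup W] [Module ℂ W]

/-- The vertex operator `A(x) ∘ ρ`. -/
def compRight (ρ : End ℂ M) : VertexOperator ℂ M →ₗ[ℂ] VertexOperator ℂ M :=
  LinearMap.lcomp ℂ _ ρ

lemma vmode_compRight (ρ : End ℂ M) (A : VertexOperator ℂ M) (n : ℤ) (x : M) :
    vmode k (compRight ρ A) n x = vmode k A n (ρ x) := rfl

lemma OPE.comp_right [NeZero k] {j : ℤ} {A B B' : VertexOperator ℂ M} {T : ℤ → VertexOperator ℂ M}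
    (h : OPE k j (vmode k A) (vmode k B) (vmode k B') fun l => vmode k (T l))
    {ρ : End ℂ M} {ε : ℂ} (hε : ε * ε = 1)
    (hρ : ∀ n w, ρ (vmode k A n w) = ε • vmode k A n (ρ w)) :
    OPE k j (vmode k A) (vmode k (compRight ρ B)) (vmode k (ε • compRight ρ B'))
      fun l => vmode k (compRight ρ (T l)) := by
  refine ⟨bdd_of_vmode h.bdd (compRight ρ), fun l m n w hm => ?_⟩
  refine Eq.trans ?_ (h.eq l m n (ρ w) hm)
  refine congrArg₂ (· - ·) rfl (congrArg _ (finsum_congr fun i => ?_))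
  rw [vmode_smul, Pi.smul_apply, smul_apply, vmode_compRight, hρ, map_smul, smul_smul ε ε,
    hε, one_smul]

/-- For homogeneous `v` the sign in the tensor product is a power of the parity on the first
factor. -/
lemma tensorY_tmul {P : End ℂ M} {Q : End ℂ W}
    {Y₁ : V →ₗ[ℂ] VertexOperator ℂ M} {Y₂ : W →ₗ[ℂ] VertexOperator ℂ N} (hP : P * P = 1) {c : ℕ}
    (u : V) {v : W} (hv : Q v = (-1 : ℂ) ^ c • v) :
    tensorY P Q Y₁ Y₂ (u ⊗ₜ v) = fieldTensor (compRight (P ^ c) (Y₁ u)) (Y₂ v) := by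
  have h1 : tensorY P Q Y₁ Y₂ (u ⊗ₜ v) =
      fieldTensor (Y₁ u) (Y₂ ((1 / 2 : ℂ) • (v + Q v))) +
        fieldTensor (compRight P (Y₁ u)) (Y₂ ((1 / 2 : ℂ) • (v - Q v))) := rfl
  have h2 : P ^ c = P ^ (c % 2) := by
    conv_lhs => rw [← Nat.div_add_mod c 2]
    rw [pow_add, pow_mul, pow_two, hP, one_pow, one_mul]
  have h3 : compRight 1 (Y₁ u) = Y₁ u := rfl
  rw [h1, hv, h2, neg_one_pow_eq_pow_mod_two]
  have e1 : (1 / 2 : ℂ) • (v + v) = v := by module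
  rcases Nat.mod_two_eq_zero_or_one c with h | h
  · rw [h, pow_zero, one_smul, sub_self, smul_zero, map_zero, map_zero, add_zero, e1, pow_zero, h3]
  · rw [h, pow_one, neg_one_smul, add_neg_cancel, smul_zero, map_zero, map_zero, zero_add,
      sub_neg_eq_add, e1, pow_one]

lemma vmode_tensorY {P : End ℂ M} {Q : End ℂ W}
    {Y₁ : V →ₗ[ℂ] VertexOperator ℂ M} {Y₂ : W →ₗ[ℂ] VertexOperator ℂ N} (hP : P * P = 1) {c : ℕ}
    (u : V) {v : W} (hv : Q v = (-1 : ℂ) ^ c • v) (n : ℤ) (x : M) (y : N) :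
    vmode k (tensorY P Q Y₁ Y₂ (u ⊗ₜ v)) n (x ⊗ₜ y) =
      ∑ᶠ p : ℤ, vmode k (Y₁ u) p ((P ^ c) x) ⊗ₜ[ℂ] vmode k (Y₂ v) (n - p - k) y := by
  rw [tensorY_tmul hP u hv, vmode_fieldTensor]
  rfl

lemma vmode_tensorY_tmul_vac {P : End ℂ M} {Q : End ℂ W} {vac : W}
    {Y₁ : V →ₗ[ℂ] VertexOperator ℂ M} {Y₂ : W →ₗ[ℂ] VertexOperator ℂ N} (hP : P * P = 1)
    (hv : Q vac = vac) (hY : vmode k (Y₂ vac) = vacFamily N k) (u : V) (n : ℤ) :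
    vmode k (tensorY P Q Y₁ Y₂ (u ⊗ₜ vac)) n =
      map (vmode k (Y₁ u) n) LinearMap.id := by
  ext x y
  have := vmode_tensorY (k := k) (P := P) (Q := Q) (Y₁ := Y₁) (Y₂ := Y₂) hP (c := 0) u (v := vac)
    (by rw [hv, pow_zero, one_smul]) n x y
  refine this.trans ?_
  rw [finsum_eq_single _ n, hY, vacFamily_apply, if_pos (by omega)]
  · rfl
  · intro p hp
    rw [hY, vacFamily_apply, if_neg (by omega), tmul_zero]

lemma vmode_tensorY_vac_tmul {P : End ℂ M} {Q : End ℂ W} {vac : V}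
    {Y₁ : V →ₗ[ℂ] VertexOperator ℂ M} {Y₂ : W →ₗ[ℂ] VertexOperator ℂ N} (hP : P * P = 1) {c : ℕ}
    (hY : vmode k (Y₁ vac) = vacFamily M k) {v : W} (hv : Q v = (-1 : ℂ) ^ c • v) (n : ℤ) :
    vmode k (tensorY P Q Y₁ Y₂ (vac ⊗ₜ v)) n =
      map (P ^ c) (vmode k (Y₂ v) n) := by
  ext x y
  have := vmode_tensorY (k := k) (P := P) (Q := Q) (Y₁ := Y₁) (Y₂ := Y₂) hP vac hv n x y
  refine this.trans ?_
  rw [finsum_eq_single _ (-k : ℤ), hY, vacFamily_apply, if_pos rfl, show n - -(k : ℤ) - k =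
    n by ring]
  · rfl
  · intro p hp
    rw [hY, vacFamily_apply, if_neg hp, zero_tmul]

namespace VertexData

variable {D : VertexData V} {E : VertexData W} {Y₁ : V →ₗ[ℂ] VertexOperator ℂ M}
  {Y₂ : W →ₗ[ℂ] VertexOperator ℂ N} {P : End ℂ M}

lemma IsVertex.parity_mul (hD : D.IsVertex) : D.parity * D.parity = 1 :=
  LinearMap.ext hD.parity_parity

lemma md_tmul_vac (hD : D.IsVertex) (hE : E.IsVertex) (u : V) (n : ℤ) :
    (D.tensor E).md (u ⊗ₜ E.vac) n = map (D.md u n) LinearMap.id :=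
  vmode_tensorY_tmul_vac hD.parity_mul hE.parity_vac hE.md_vac u n

lemma md_vac_tmul (hD : D.IsVertex) {c : ℕ} {v : W} (hv : E.HasSign c v) (n : ℤ) :
    (D.tensor E).md (D.vac ⊗ₜ v) n = map (D.parity ^ c) (E.md v n) :=
  vmode_tensorY_vac_tmul hD.parity_mul hD.md_vac hv n

lemma md_tmul (hD : D.IsVertex) {c : ℕ} (u : V) {v : W} (hv : E.HasSign c v) (n : ℤ) (x : V)
    (y : W) : (D.tensor E).md (u ⊗ₜ v) n (x ⊗ₜ y) =
      ∑ᶠ p : ℤ, D.md u p ((D.parity ^ c) x) ⊗ₜ[ℂ] E.md v (n - p - 1) y :=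
  vmode_tensorY hD.parity_mul u hv n x y

lemma tensor_parity_pow (a : ℕ) :
    (D.tensor E).parity ^ a = map (D.parity ^ a) (E.parity ^ a) :=
  TensorProduct.map_pow D.parity E.parity a

/-- It suffices to check linear identities on tensors `u ⊗ v` with `v` homogeneous. -/
lemma tensor_induction (hE : ∀ v, E.parity (E.parity v) = v) {C : V ⊗[ℂ] W → Prop}
    (zero : C 0) (add : ∀ x y, C x → C y → C (x + y))
    (tmul : ∀ (u : V) (c : ℕ) (v : W), E.HasSign c v → C (u ⊗ₜ v)) (x : V ⊗[ℂ] W) : C x := by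
  induction x with
  | zero => exact zero
  | add x y hx hy => exact add x y hx hy
  | tmul u v =>
    rw [eq_signProj_add (D := E) v, tmul_add]
    exact add _ _ (tmul u 0 _ (hasSign_signProj hE 0 v)) (tmul u 1 _ (hasSign_signProj hE 1 v))

lemma HasOPE.of_tmul [NeZero k] {a : ℕ} {j : ℤ} {U : V ⊗[ℂ] W} {F : Type*} [AddCommGroup F]
    [Module ℂ F] {Y : V ⊗[ℂ] W →ₗ[ℂ] VertexOperator ℂ F} (hE : ∀ v, E.parity (E.parity v) = v)
    (h : ∀ (b : V) (c : ℕ) (v : W), E.HasSign c v →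
      OPE k j (vmode k (Y U)) (vmode k (Y (b ⊗ₜ v)))
        (vmode k (Y (((D.tensor E).parity ^ a) (b ⊗ₜ v))))
        fun l => vmode k (Y ((D.tensor E).md U l (b ⊗ₜ v)))) :
    (D.tensor E).HasOPE k Y a j U := fun x => by
  induction x using tensor_induction hE with
  | zero =>
    rw [map_zero, map_zero, vmode_zero]
    refine ⟨⟨0, fun l _ => ?_⟩, fun l m n w _ => ?_⟩
    · rw [map_zero, map_zero]
      exact vmode_zero F k
    · simp only [map_zero]
      rw [vmode_zero,
        ordProd_zero_left, ordProd_zero_right]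
      simp
  | add x y hx hy =>
    have := hx.add (vmode_trunc _) (vmode_trunc _) (vmode_trunc _) hy
    simp only [← vmode_add, ← map_add] at this
    convert this using 1
    funext l
    rw [Pi.add_apply, ← vmode_add, ← map_add, ← map_add]
  | tmul b c v hv => exact h b c v hv

lemma parity_pow_vmode
    (hPY : ∀ u n x, P (vmode k (Y₁ u) n x) = vmode k (Y₁ (D.parity u)) n (P x)) (t : ℕ) (b : V)
    (n : ℤ) (x : M) : (P ^ t) (vmode k (Y₁ b) n x) =
      vmode k (Y₁ ((D.parity ^ t) b)) n ((P ^ t) x) := by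
  induction t with
  | zero => rfl
  | succ t ih =>
    rw [pow_succ', Module.End.mul_apply, ih, hPY, pow_succ', Module.End.mul_apply,
      Module.End.mul_apply]

/-- The Jacobi identity for `u ⊗ 1`. -/
lemma HasOPE.tmul_vac [NeZero k] {a : ℕ} {j : ℤ} {u : V} (hD : D.IsVertex) (hE : E.IsVertex)
    (hP : P * P = 1) (hPY : ∀ u n x, P (vmode k (Y₁ u) n x) = vmode k (Y₁ (D.parity u)) n (P x))
    (hY₂ : vmode k (Y₂ E.vac) = vacFamily N k) (hu : D.HasSign a u) (h : D.HasOPE k Y₁ a j u) :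
    (D.tensor E).HasOPE k (tensorY P E.parity Y₁ Y₂) a j (u ⊗ₜ E.vac) := by
  refine HasOPE.of_tmul hE.parity_parity fun b c v hv => ?_
  have hPu : ∀ n x, (P ^ c) (vmode k (Y₁ u) n x) =
      (-1 : ℂ) ^ (a * c) • vmode k (Y₁ u) n ((P ^ c) x) := fun n x => by
    rw [parity_pow_vmode hPY, hu.parity_pow, map_smul, vmode_smul, mul_comm]
    rfl
  have key := ((h b).comp_right (neg_one_pow_mul_neg_one_pow (a * c)) hPu).tensor_left (Y₂ v)
    (vmode_tensorY_tmul_vac (P := P) hP hE.parity_vac hY₂ u)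
  rw [tensor_parity_pow, map_tmul, hv.parity_pow, tmul_smul, map_smul,
    tensorY_tmul hP b hv, tensorY_tmul hP _ hv]
  rw [map_smul, smul_apply] at key
  convert key using 1
  funext l
  rw [md_tmul_vac hD hE, map_tmul, id_apply, tensorY_tmul hP _ hv]

/-- The Jacobi identity for `1 ⊗ v`. -/
lemma HasOPE.vac_tmul [NeZero k] {a : ℕ} {j : ℤ} {v : W} (hD : D.IsVertex) (hE : E.IsVertex)
    (hP : P * P = 1) (hPY : ∀ u n x, P (vmode k (Y₁ u) n x) = vmode k (Y₁ (D.parity u)) n (P x))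
    (hY₁ : vmode k (Y₁ D.vac) = vacFamily M k) (hv : E.HasSign a v) (h : E.HasOPE k Y₂ a j v) :
    (D.tensor E).HasOPE k (tensorY P E.parity Y₁ Y₂) a j (D.vac ⊗ₜ v) := by
  refine HasOPE.of_tmul hE.parity_parity fun b c w hw => ?_
  have hww : E.HasSign c ((E.parity ^ a) w) := by
    rw [hw.parity_pow, HasSign, map_smul, hw, smul_comm]
  have hpp : ∀ s t x, (P ^ s) ((P ^ t) x) = (P ^ (s + t)) x := fun s t x => by
    rw [pow_add]
    rfl
  have key := (h w).tensor_right (B := compRight (P ^ c) (Y₁ b))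
    (B₁ := compRight (P ^ c) (Y₁ ((D.parity ^ a) b)))
    (πB := compRight (P ^ (a + c)) (Y₁ ((D.parity ^ a) b))) (π := P ^ a)
    (fun n x => by
      rw [vmode_compRight, vmode_compRight, parity_pow_vmode hPY, hpp, hpp, add_comm])
    (fun n x => by rw [vmode_compRight, vmode_compRight, parity_pow_vmode hPY, hpp])
    (vmode_tensorY_vac_tmul (P := P) hP hY₁ hv)
  rw [tensor_parity_pow, map_tmul, tensorY_tmul hP b hw, tensorY_tmul hP _ hww]
  convert key using 1
  funext l
  rw [md_vac_tmul hD hv, map_tmul, tensorY_tmul hP _ (hv.md hE.parity_md hw l)]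

/-- The tensor product of two maps compatible with all products is compatible with all products.
-/
lemma tensor_map_md (hD : D.IsVertex) (hE : E.IsVertex) {g : End ℂ V}
    {g' : End ℂ W} (hg : ∀ u v n, g (D.md u n v) = D.md (g u) n (g v))
    (hgP : ∀ v, g (D.parity v) = D.parity (g v))
    (hg' : ∀ u v n, g' (E.md u n v) = E.md (g' u) n (g' v))
    (hgQ : ∀ v, g' (E.parity v) = E.parity (g' v)) (U X : V ⊗[ℂ] W) (n : ℤ) :
    map g g' ((D.tensor E).md U n X) =
      (D.tensor E).md (map g g' U) n (map g g' X) := by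
  induction U using tensor_induction hE.parity_parity with
  | zero => simp only [map_zero, md_zero, zero_apply]
  | add U U' hU hU' => simp only [map_add, md_add, add_apply, hU, hU']
  | tmul u c v hv =>
    induction X with
    | zero => simp only [map_zero]
    | add X X' hX hX' => simp only [map_add, hX, hX']
    | tmul x y =>
      have hv' : E.HasSign c (g' v) := by
        rw [HasSign, ← hgQ, hv, map_smul]
      have hgPc : ∀ x, g ((D.parity ^ c) x) = (D.parity ^ c) (g x) := fun x => by
        clear hv hv'
        induction c with
        | zero => rfl
        | succ c ih => rw [pow_succ', Module.End.mul_apply, Module.End.mul_apply, hgP, ih]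
      have h1 := map_vmode_fieldTensor (k := 1) g g' (compRight (D.parity ^ c) (D.Y u)) (E.Y v)
        n 0 x y
      rw [← tensorY_tmul hD.parity_mul u hv, add_zero] at h1
      refine h1.trans ?_
      rw [map_tmul, map_tmul, md_tmul hD _ hv']
      refine finsum_congr fun p => ?_
      rw [add_zero, vmode_compRight, ← hgPc]
      congr 1
      · exact hg _ _ _
      · exact hg' _ _ _

lemma vmode_tensor_vac {Q : End ℂ W} {vac : W} {vac' : V} (hP : P * P = 1)
    (hv : Q vac = vac) (hY₁ : vmode k (Y₁ vac') = vacFamily M k)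
    (hY₂ : vmode k (Y₂ vac) = vacFamily N k) :
    vmode k (tensorY P Q Y₁ Y₂ (vac' ⊗ₜ vac)) = vacFamily (M ⊗[ℂ] N) k := by
  funext n
  rw [vmode_tensorY_tmul_vac hP hv hY₂, hY₁]
  unfold vacFamily
  split_ifs
  · exact map_id
  · exact TensorProduct.map_zero_left _

lemma md_tmul_vac_vac_tmul (hD : D.IsVertex) (hE : E.IsVertex) (u : V) (v : W) :
    (D.tensor E).md (u ⊗ₜ E.vac) (-1) (D.vac ⊗ₜ v) = u ⊗ₜ v := by
  rw [md_tmul_vac hD hE, map_tmul, hD.creation_neg_one]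
  rfl

lemma span_tmul {s : Set V} {t : Set W} (hs : Submodule.span ℂ s = ⊤)
    (ht : Submodule.span ℂ t = ⊤) :
    Submodule.span ℂ (Set.image2 (fun u v => u ⊗ₜ[ℂ] v) s t) = ⊤ := by
  have := Submodule.map₂_span_span ℂ (TensorProduct.mk ℂ V W) s t
  rw [hs, ht, TensorProduct.map₂_mk_top_top_eq_top] at this
  exact this.symm

lemma hasSign_tmul {a b : ℕ} {u : V} {v : W} (hu : D.HasSign a u) (hv : E.HasSign b v) :
    (D.tensor E).HasSign (a + b) (u ⊗ₜ v) := by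
  change map D.parity E.parity (u ⊗ₜ v) = _
  rw [map_tmul, hu, hv, TensorProduct.smul_tmul_smul, pow_add]

lemma IsVertex.hasSign_vac (hD : D.IsVertex) : D.HasSign 0 D.vac := by
  rw [HasSign, hD.parity_vac, pow_zero, one_smul]

/-- The tensor product of two vertex superalgebras is a vertex superalgebra. -/
lemma IsVertex.tensor (hD : D.IsVertex) (hE : E.IsVertex) : (D.tensor E).IsVertex := by
  have hPP : ∀ v, (D.tensor E).parity ((D.tensor E).parity v) = v := fun v => by
    change (map D.parity E.parity * map D.parity E.parity) v = v
    rw [← TensorProduct.map_mul, hD.parity_mul, hE.parity_mul, TensorProduct.map_one]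
    rfl
  have hmd : ∀ u v n, (D.tensor E).parity ((D.tensor E).md u n v) =
      (D.tensor E).md ((D.tensor E).parity u) n ((D.tensor E).parity v) := fun u v n =>
    tensor_map_md hD hE hD.parity_md (fun _ => rfl) hE.parity_md (fun _ => rfl) u v n
  have hcr : ∀ (u : V) (c : ℕ) (v : W), E.HasSign c v → ∀ n : ℤ, (D.tensor E).md (u ⊗ₜ v) n
      (D.vac ⊗ₜ E.vac) = ∑ᶠ p : ℤ, D.md u p D.vac ⊗ₜ[ℂ] E.md v (n - p - 1) E.vac := by
    intro u c v hv n
    rw [md_tmul hD u hv]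
    have : (D.parity ^ c) D.vac = D.vac := by
      rw [hD.hasSign_vac.parity_pow, mul_zero, pow_zero, one_smul]
    rw [this]
  refine ⟨hPP, ?_, hmd, ?_, fun x n hn => ?_, fun x => ?_, ?_⟩
  · change map D.parity E.parity (D.vac ⊗ₜ E.vac) = _
    rw [map_tmul, hD.parity_vac, hE.parity_vac]
    rfl
  · exact vmode_tensor_vac hD.parity_mul hE.parity_vac hD.md_vac hE.md_vac
  · induction x using tensor_induction hE.parity_parity with
    | zero => rw [md_zero, zero_apply]
    | add x y hx hy => rw [md_add, add_apply, hx, hy, add_zero]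
    | tmul u c v hv =>
      refine (hcr u c v hv n).trans (finsum_eq_zero_of_forall_eq_zero fun p => ?_)
      by_cases hp : 0 ≤ p
      · rw [hD.creation u p hp, zero_tmul]
      · rw [hE.creation v _ (by omega), tmul_zero]
  · induction x using tensor_induction hE.parity_parity with
    | zero => rw [md_zero, zero_apply]
    | add x y hx hy => rw [md_add, add_apply, hx, hy]
    | tmul u c v hv =>
      refine (hcr u c v hv (-1)).trans ?_
      rw [finsum_eq_single _ (-1)]
      · rw [hD.creation_neg_one, show (-1 : ℤ) - -1 - 1 = -1 by norm_num, hE.creation_neg_one]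
      · intro p hp
        by_cases hp : 0 ≤ p
        · rw [hD.creation u p hp, zero_tmul]
        · rw [hE.creation v _ (by omega), tmul_zero]
  · rw [eq_top_iff, ← span_tmul hD.span hE.span]
    refine Submodule.span_mono ?_
    rintro _ ⟨u, ⟨a, hu, hu'⟩, v, ⟨b, hv, hv'⟩, rfl⟩
    refine ⟨a + b, hasSign_tmul hu hv, ?_⟩
    have h1 : (D.tensor E).HasOPE 1 (D.tensor E).Y a 0 (u ⊗ₜ E.vac) :=
      hu'.tmul_vac hD hE hD.parity_mul (fun u n x => hD.parity_md u x n) hE.md_vac hu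
    have h2 : (D.tensor E).HasOPE 1 (D.tensor E).Y b 0 (D.vac ⊗ₜ v) :=
      hv'.vac_tmul hD hE hD.parity_mul (fun u n x => hD.parity_md u x n) hD.md_vac hv
    have s1 := hasSign_tmul hu hE.hasSign_vac
    have s2 := hasSign_tmul hD.hasSign_vac hv
    rw [add_zero] at s1
    rw [zero_add] at s2
    have := h1.mul hPP hmd s1 s2 h1 h2 (-1)
    rw [md_tmul_vac_vac_tmul hD hE] at this
    simpa using this

/-- The tensor product of two twisted modules. -/
lemma IsTwistedSystem.tensor (hD : D.IsVertex) (hE : E.IsVertex) {g : End ℂ V}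
    {g' : End ℂ W} (hg : ∀ u v n, g (D.md u n v) = D.md (g u) n (g v))
    (hgP : ∀ v, g (D.parity v) = D.parity (g v)) (hgv : g D.vac = D.vac)
    (hg' : ∀ u v n, g' (E.md u n v) = E.md (g' u) n (g' v))
    (hgQ : ∀ v, g' (E.parity v) = E.parity (g' v)) (hgv' : g' E.vac = E.vac)
    (hP : P * P = 1) (hPY : ∀ u n x, P (vmode 2 (Y₁ u) n x) = vmode 2 (Y₁ (D.parity u)) n (P x))
    (h₁ : IsTwistedSystem D g Y₁) (h₂ : IsTwistedSystem E g' Y₂) :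
    IsTwistedSystem (D.tensor E) (map g g') (tensorY P E.parity Y₁ Y₂) where
  vac := vmode_tensor_vac hP hE.parity_vac h₁.vac h₂.vac
  span := by
    rw [eq_top_iff, ← span_tmul h₁.span h₂.span]
    refine Submodule.span_mono ?_
    rintro _ ⟨u, ⟨a, j, hu⟩, v, ⟨b, j', hv⟩, rfl⟩
    refine ⟨a + b, j + j', ?_⟩
    have s1 := hasSign_tmul hu.sign hE.hasSign_vac
    have s2 := hasSign_tmul hD.hasSign_vac hv.sign
    rw [add_zero] at s1
    rw [zero_add] at s2
    have h1 : TwistedGood (D.tensor E) (map g g') (tensorY P E.parity Y₁ Y₂) a j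
        (u ⊗ₜ E.vac) := ⟨s1, by
          rw [map_tmul, hu.grad, hgv', smul_tmul'],
        fun N hN => by
          rw [vmode_tensorY_tmul_vac hP hE.parity_vac h₂.vac, hu.support N hN,
            TensorProduct.map_zero_left],
        hu.ope.tmul_vac hD hE hP hPY h₂.vac hu.sign⟩
    have h2 : TwistedGood (D.tensor E) (map g g') (tensorY P E.parity Y₁ Y₂) b j'
        (D.vac ⊗ₜ v) := ⟨s2, by
          rw [map_tmul, hv.grad, hgv, tmul_smul],
        fun N hN => by
          rw [vmode_tensorY_vac_tmul hP h₁.vac hv.sign, hv.support N hN,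
            TensorProduct.map_zero_right],
        hv.ope.vac_tmul hD hE hP hPY h₁.vac hv.sign⟩
    have := h1.md (hD.tensor hE) (fun u v n => tensor_map_md hD hE hg hgP hg' hgQ u v n) h2 (-1)
    rwa [md_tmul_vac_vac_tmul hD hE] at this

lemma IsAutomorphism.tensor (hD : D.IsVertex) (hE : E.IsVertex) {g : End ℂ V}
    {g' : End ℂ W} (h : D.IsAutomorphism g) (h' : E.IsAutomorphism g') :
    (D.tensor E).IsAutomorphism (map g g') where
  bijective := (TensorProduct.congr (LinearEquiv.ofBijective g h.bijective)
    (LinearEquiv.ofBijective g' h'.bijective)).bijective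
  map_vac := by
    change map g g' (D.vac ⊗ₜ E.vac) = _
    rw [map_tmul, h.map_vac, h'.map_vac]
    rfl
  map_omega := by
    change map g g' (D.omega ⊗ₜ E.vac + D.vac ⊗ₜ E.omega) = _
    rw [map_add, map_tmul, map_tmul, h.map_vac, h'.map_vac,
      h.map_omega, h'.map_omega]
    rfl
  map_parity v := by
    change (map g g' ∘ₗ map D.parity E.parity) v =
      (map D.parity E.parity ∘ₗ map g g') v
    rw [← TensorProduct.map_comp, ← TensorProduct.map_comp,
      show g ∘ₗ D.parity = D.parity ∘ₗ g from LinearMap.ext h.map_parity,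
      show g' ∘ₗ E.parity = E.parity ∘ₗ g' from LinearMap.ext h'.map_parity]
  map_md := tensor_map_md hD hE h.map_md h.map_parity h'.map_md h'.map_parity

end VertexData

end TensorVertex
/-! ### Vertex superalgebras generated by free fields -/

section FreeVertex

variable {h : Type*} [AddCommGroup h] [Module ℂ h] {B : LinearMap.BilinForm ℂ h} {s : ℕ}
  {V : Type u} [AddCommGroup V] [Module ℂ V] {D : VertexData V} {modeV : h → ℤ → End ℂ V}
  {M : Type u} [AddCommGroup M] [Module ℂ M] {k : ℕ} [NeZero k] {j : ℤ} {π : End ℂ M}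
  {mode : h → ℤ → End ℂ M}

lemma VertexData.hasOPE_vac {Yg : V →ₗ[ℂ] VertexOperator ℂ M}
    (hY : vmode 1 (D.Y D.vac) = vacFamily V 1) (hYg : vmode k (Yg D.vac) = vacFamily M k) :
    D.HasOPE k Yg 0 0 D.vac := fun v => by
  have e : (fun l => vmode k (Yg (D.md D.vac l v))) =
      fun l : ℤ => if l = -1 then vmode k (Yg v) else 0 := by
    funext l
    rw [VertexData.md, hY, vacFamily_apply, Nat.cast_one]
    split_ifs
    · rfl
    · exact (vmodeHom M k ∘ₗ Yg).map_zero
  rw [hYg, e]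
  exact OPE.vac_left (vmode_trunc _)

namespace FreeModel

open VertexData

/-- The iterate formula for free fields with integral modes. -/
lemma iterate_md (hY : IsFreeY D.parity D.vac modeV 1 0 D.parity modeV D.Y) (α : h) (n N : ℤ)
    (u w : V) : D.md (modeV α n u) N w = ordProd 1 (modeV α) (D.md u) n 0 N w -
      (-1 : ℂ) ^ n • ordProd 1 (D.md (D.parity u)) (modeV α) n N 0 w := by
  have := (hY.ope α u).product_eq n N w
  rw [finsum_eq_single _ 0 fun i hi => by
    simp [Ring.choose_zero_pos ℂ (Nat.pos_of_ne_zero hi)]] at this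
  simp only [Nat.cast_zero, Int.cast_zero, mul_zero, sub_zero, add_zero, pow_zero, one_smul,
    zero_div, Ring.choose_zero_right, one_mul] at this
  exact this

lemma md_gen (hY : IsFreeY D.parity D.vac modeV 1 0 D.parity modeV D.Y) (α : h) (n : ℤ) :
    D.md (modeV α (-1) D.vac) n = modeV α n := congrFun (hY.gen α) n

lemma hasSign_gen (fm : FreeModel B s D.vac D.parity modeV) (α : h) (n : ℤ) :
    D.HasSign s (modeV α n D.vac) := by
  rw [HasSign, fm.parity_mode, fm.parity_vac]

lemma parity_parity' (fm : FreeModel B s D.vac D.parity modeV) (v : V) :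
    D.parity (D.parity v) = v := LinearMap.congr_fun fm.parity_parity v

lemma parity_pow_sign (fm : FreeModel B s D.vac D.parity modeV) : D.parity ^ s = D.parity := by
  rcases fm.sign with ⟨h0, h1⟩ | h1
  · rw [h1, one_pow]
  · rw [h1, pow_one]

lemma parity_md (fm : FreeModel B s D.vac D.parity modeV)
    (hY : IsFreeY D.parity D.vac modeV 1 0 D.parity modeV D.Y) (u v : V) (n : ℤ) :
    D.parity (D.md u n v) = D.md (D.parity u) n (D.parity v) := by
  have := LinearMap.congr_fun (congrFun (hY.parity u) n) (D.parity v)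
  rw [conjFamily_apply, parity_parity' fm] at this
  exact this.symm

/-- The creation property of the fields generated by free fields. -/
lemma creation (fm : FreeModel B s D.vac D.parity modeV)
    (hY : IsFreeY D.parity D.vac modeV 1 0 D.parity modeV D.Y) (u : V) :
    (∀ n : ℤ, 0 ≤ n → D.md u n D.vac = 0) ∧ D.md u (-1) D.vac = u := by
  let p : Submodule ℂ V :=
    { carrier := {u | (∀ n : ℤ, 0 ≤ n → D.md u n D.vac = 0) ∧ D.md u (-1) D.vac = u}
      zero_mem' := ⟨fun n _ => by rw [md_zero, zero_apply],
        by rw [md_zero, zero_apply]⟩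
      add_mem' := fun {u v} hu hv => ⟨fun n hn => by
        rw [md_add, add_apply, hu.1 n hn, hv.1 n hn, add_zero],
        by rw [md_add, add_apply, hu.2, hv.2]⟩
      smul_mem' := fun c u hu => ⟨fun n hn => by
        rw [md_smul, smul_apply, hu.1 n hn, smul_zero],
        by rw [md_smul, smul_apply, hu.2]⟩ }
  refine fm.span p ⟨fun n hn => ?_, ?_⟩ (fun α n hn u hu => ?_) u
  · rw [md, hY.vacuum, vacFamily_apply, if_neg (by push_cast; omega)]
  · rw [md, hY.vacuum, vacFamily_apply, if_pos (by norm_num)]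
  · have h1 : ∀ N, ordProd 1 (D.md (D.parity u)) (modeV α) n N 0 D.vac = 0 := fun N =>
      finsum_eq_zero_of_forall_eq_zero fun i => by
        rw [fm.annihilation α _ (by push_cast; omega), map_zero, smul_zero]
    refine ⟨fun N hN => ?_, ?_⟩
    · rw [iterate_md hY, h1, smul_zero, sub_zero]
      refine finsum_eq_zero_of_forall_eq_zero fun i => ?_
      rw [hu.1 _ (by push_cast; omega), map_zero, smul_zero]
    · rw [iterate_md hY, h1, smul_zero, sub_zero]
      refine (finsum_eq_single _ 0 fun i hi => ?_).trans ?_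
      · rw [hu.1 _ (by push_cast; omega), map_zero, smul_zero]
      · simp [hu.2]

lemma hasOPE_gen (fm : FreeModel B s D.vac D.parity modeV)
    (hY : IsFreeY D.parity D.vac modeV 1 0 D.parity modeV D.Y)
    {Yg : V →ₗ[ℂ] VertexOperator ℂ M} (hYg : IsFreeY D.parity D.vac modeV k j π mode Yg) (α : h) :
    D.HasOPE k Yg s j (modeV α (-1) D.vac) := fun v => by
  rw [hYg.gen, parity_pow_sign fm]
  simp only [md_gen hY]
  exact hYg.ope α v

/-- A space generated by free fields is a vertex superalgebra. -/
lemma isVertex (fm : FreeModel B s D.vac D.parity modeV)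
    (hY : IsFreeY D.parity D.vac modeV 1 0 D.parity modeV D.Y) : D.IsVertex where
  parity_parity := parity_parity' fm
  parity_vac := fm.parity_vac
  parity_md := parity_md fm hY
  md_vac := hY.vacuum
  creation u := (creation fm hY u).1
  creation_neg_one u := (creation fm hY u).2
  span := by
    rw [eq_top_iff]
    rintro u -
    refine fm.span _ ?_ (fun α n hn u hu => ?_) u
    · exact Submodule.subset_span ⟨0, by rw [HasSign, fm.parity_vac]; simp,
        hasOPE_vac hY.vacuum hY.vacuum⟩
    · have hgen := hasOPE_gen fm hY hY α
      induction hu using Submodule.span_induction with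
      | mem u hu =>
        obtain ⟨a, hu, hu'⟩ := hu
        refine Submodule.subset_span ⟨s + a, ?_, ?_⟩
        · rw [← md_gen hY]
          exact (hasSign_gen fm α (-1)).md (parity_md fm hY) hu n
        · rw [← md_gen hY]
          have := hgen.mul (parity_parity' fm) (parity_md fm hY) (hasSign_gen fm α (-1)) hu hgen
            hu' n
          rwa [add_zero] at this
      | zero => rw [map_zero]; exact Submodule.zero_mem _
      | add u v _ _ hu hv => rw [map_add]; exact Submodule.add_mem _ hu hv
      | smul c u _ hu => rw [map_smul]; exact Submodule.smul_mem _ c hu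

/-- An injective map that rescales the free fields, fixes the vacuum and commutes with the parity is
compatible with all products. -/
lemma map_md (fm : FreeModel B s D.vac D.parity modeV)
    (hY : IsFreeY D.parity D.vac modeV 1 0 D.parity modeV D.Y) {g : End ℂ V}
    (hg : Function.Injective g) (hgP : ∀ v, g (D.parity v) = D.parity (g v))
    (hgv : g D.vac = D.vac) {c : ℂ} (hgm : ∀ α n u, g (modeV α n u) = c • modeV α n (g u))
    (u v : V) (n : ℤ) : g (D.md u n v) = D.md (g u) n (g v) := by
  let p : Submodule ℂ V :=
    { carrier := {u | ∀ v n, g (D.md u n v) = D.md (g u) n (g v)}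
      zero_mem' := fun v n => by
        rw [md_zero, map_zero, md_zero, zero_apply, zero_apply, map_zero]
      add_mem' := fun {u v} hu hv w n => by
        rw [md_add, _root_.map_add, md_add, add_apply, add_apply,
          _root_.map_add, hu, hv]
      smul_mem' := fun c u hu w n => by
        rw [md_smul, _root_.map_smul, md_smul, smul_apply, smul_apply,
          _root_.map_smul, hu] }
  refine fm.span p (fun v n => ?_) (fun α n hn u hu v N => ?_) u v n
  · rw [hgv, md, hY.vacuum, vacFamily_apply, vacFamily_apply]
    split_ifs
    · rfl
    · exact map_zero g
  · have hu' : ∀ v n, g (D.md (D.parity u) n v) = D.md (D.parity (g u)) n (g v) := fun v n => by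
      have h1 : D.md (D.parity u) n v = D.parity (D.md u n (D.parity v)) := by
        rw [parity_md fm hY, parity_parity' fm]
      rw [h1, hgP, hu, hgP, parity_md fm hY, parity_parity' fm]
    rw [hgm, md_smul, smul_apply, iterate_md hY, iterate_md hY, map_sub, _root_.map_smul,
      smul_sub, smul_comm c, ordProd, ordProd, ordProd, ordProd]
    have hinj : ∀ f : ℕ → V, g (∑ᶠ i, f i) = ∑ᶠ i, g (f i) := fun f =>
      AddMonoidHom.map_finsum_of_injective g.toAddMonoidHom hg f
    have hsm : ∀ f : ℕ → V, c • (∑ᶠ i, f i) = ∑ᶠ i, c • f i := fun f => smul_finsum c f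
    rw [hinj, hinj, hsm, hsm]
    refine congrArg₂ (· - ·) (finsum_congr fun i => ?_)
      (congrArg _ (finsum_congr fun i => ?_))
    · rw [_root_.map_smul, hgm, hu, smul_comm]
    · rw [_root_.map_smul, hu', hgm, smul_comm c, _root_.map_smul]

/-- Free fields with modes in `ℤ + 1/2` generate a twisted module. -/
lemma isTwistedSystem (fm : FreeModel B s D.vac D.parity modeV)
    (hY : IsFreeY D.parity D.vac modeV 1 0 D.parity modeV D.Y) (ff : FreeField B 2 1 s π mode)
    {Yg : V →ₗ[ℂ] VertexOperator ℂ M} (hYg : IsFreeY D.parity D.vac modeV 2 1 π mode Yg)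
    {g : End ℂ V} (hg : ∀ u v n, g (D.md u n v) = D.md (g u) n (g v))
    (hgv : g D.vac = D.vac) (hgm : ∀ α n u, g (modeV α n u) = -modeV α n (g u)) :
    IsTwistedSystem D g Yg where
  vac := hYg.vacuum
  span := by
    have hD := isVertex fm hY
    rw [eq_top_iff]
    rintro u -
    refine fm.span _ ?_ (fun α n hn u hu => ?_) u
    · refine Submodule.subset_span ⟨0, 0, hD.hasSign_vac, by simp [hgv], fun N hN => ?_,
        hasOPE_vac hY.vacuum hYg.vacuum⟩
      ext w
      rw [hYg.vacuum, vacFamily_apply, if_neg, zero_apply]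
      rintro rfl
      exact hN (by decide)
    · have hgen : TwistedGood D g Yg s 1 (modeV α (-1) D.vac) := ⟨hasSign_gen fm α (-1), by
          rw [hgm, hgv, pow_one, neg_one_smul], fun N hN => by
          rw [hYg.gen]; exact ff.support α N hN, hasOPE_gen fm hY hYg α⟩
      induction hu using Submodule.span_induction with
      | mem u hu =>
        obtain ⟨a, j, hu⟩ := hu
        refine Submodule.subset_span ⟨s + a, 1 + j, ?_⟩
        rw [← md_gen hY]
        exact hgen.md hD hg hu n
      | zero => rw [map_zero]; exact Submodule.zero_mem _
      | add u v _ _ hu hv => rw [_root_.map_add]; exact Submodule.add_mem _ hu hv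
      | smul c u _ hu => rw [_root_.map_smul]; exact Submodule.smul_mem _ c hu

/-- If the modes of `ω` act on the free fields as on primary fields of weight `δ + 1`, then `ω_0` is
the translation. -/
lemma omega_zero (fm : FreeModel B s D.vac D.parity modeV)
    (hY : IsFreeY D.parity D.vac modeV 1 0 D.parity modeV D.Y) {δ : ℂ}
    (hω : ∀ α (r m : ℤ) w, D.md D.omega r (modeV α m w) =
      modeV α m (D.md D.omega r w) + (δ * r - m) • modeV α (m + r - 1) w) (u : V) :
    D.md D.omega 0 u = D.md u (-2) D.vac := by
  have hD := isVertex fm hY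
  let p : Submodule ℂ V :=
    { carrier := {u | D.md D.omega 0 u = D.md u (-2) D.vac}
      zero_mem' := by
        rw [Set.mem_ofPred_eq, map_zero, md_zero, zero_apply]
      add_mem' := fun {u v} hu hv => by
        rw [Set.mem_ofPred_eq] at *
        rw [_root_.map_add, hu, hv, md_add, add_apply]
      smul_mem' := fun c u hu => by
        rw [Set.mem_ofPred_eq] at *
        rw [_root_.map_smul, hu, md_smul, smul_apply] }
  refine fm.span p ?_ (fun α n hn u hu => ?_) u
  · change D.md D.omega 0 D.vac = D.md D.vac (-2) D.vac
    rw [hD.creation _ _ le_rfl, md, hD.md_vac, vacFamily_apply, if_neg (by norm_num)]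
  · change D.md D.omega 0 (modeV α n u) = D.md (modeV α n u) (-2) D.vac
    have h1 := hD.md_neg_two_md (hasSign_gen fm α (-1)) n u
    rw [md_gen hY, md_gen hY] at h1
    rw [h1, hω, show D.md D.omega 0 u = D.md u (-2) D.vac from hu, add_comm]
    simp

end FreeModel

end FreeVertex
/-! ### Conformal vectors -/

section Conformal

variable {V W : Type*} [AddCommGroup V] [Module ℂ V] [AddCommGroup W] [Module ℂ W]

namespace VertexData

/-- The vector `ω` of a vertex superalgebra is a conformal vector of central charge `c`: `ω_0` is
the translation, and the singular products `ω_i ω` are as they should be. -/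
structure IsConformal (D : VertexData V) (c : ℂ) : Prop extends D.IsVertex where
  parity_omega : D.parity D.omega = D.omega
  omega_zero : ∀ v, D.md D.omega 0 v = D.md v (-2) D.vac
  omega_one : D.md D.omega 1 D.omega = (2 : ℂ) • D.omega
  omega_two : D.md D.omega 2 D.omega = 0
  omega_three : D.md D.omega 3 D.omega = (c / 2) • D.vac
  omega_of_four_le : ∀ n : ℤ, 4 ≤ n → D.md D.omega n D.omega = 0

variable {D : VertexData V} {E : VertexData W} {c c' : ℂ}

lemma IsConformal.hasSign_omega (hD : D.IsConformal c) : D.HasSign 0 D.omega := by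
  rw [HasSign, hD.parity_omega, pow_zero, one_smul]

/-- A conformal vertex superalgebra with a suitable grading is a vertex operator superalgebra. -/
lemma IsConformal.isVOSA (hD : D.IsConformal c)
    (grading : DirectSum.IsInternal (fun n : ℤ => wtSpace (D.L 0) ((n : ℂ) / 2)))
    (finite_dim : ∀ n : ℤ, FiniteDimensional ℂ (wtSpace (D.L 0) ((n : ℂ) / 2)))
    (lower_bound : ∃ N : ℤ, ∀ n < N, wtSpace (D.L 0) ((n : ℂ) / 2) = ⊥) : D.IsVOSA c where
  parity_parity := hD.parity_parity
  parity_vac := hD.parity_vac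
  parity_omega := hD.parity_omega
  parity_md := hD.parity_md
  grading := grading
  finite_dim := finite_dim
  lower_bound := lower_bound
  vac_mem := by
    rw [Module.End.mem_eigenspace_iff, zero_smul]
    exact hD.creation _ _ (by norm_num)
  omega_mem := Module.End.mem_eigenspace_iff.mpr hD.omega_one
  md_vac n := by
    rw [md, hD.md_vac]
    rfl
  creation := hD.creation
  creation_neg_one := hD.creation_neg_one
  jacobi _ _ _ _ hu hv := hD.jacobi hu hv
  virasoro := hD.virasoro hD.parity_omega (hD.omega_zero _) hD.omega_one hD.omega_two
    hD.omega_three fun n hn => hD.omega_of_four_le _ (by omega)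
  derivative v n := by
    ext w
    rw [show D.L (-1) v = D.md v (-2) D.vac from hD.omega_zero v, hD.md_neg_two_vac]
    rfl

lemma md_tensor_omega (hD : D.IsConformal c) (hE : E.IsConformal c') (n : ℤ) :
    (D.tensor E).md (D.tensor E).omega n =
      map (D.md D.omega n) LinearMap.id +
        map LinearMap.id (E.md E.omega n) := by
  change (D.tensor E).md (D.omega ⊗ₜ E.vac + D.vac ⊗ₜ E.omega) n = _
  rw [md_add, md_tmul_vac hD.toIsVertex hE.toIsVertex, md_vac_tmul hD.toIsVertex hE.hasSign_omega]
  rfl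

lemma md_tensor_omega_tmul (hD : D.IsConformal c) (hE : E.IsConformal c') (n : ℤ) (u : V)
    (v : W) : (D.tensor E).md (D.tensor E).omega n (u ⊗ₜ v) =
      D.md D.omega n u ⊗ₜ v + u ⊗ₜ E.md E.omega n v := by
  rw [md_tensor_omega hD hE]
  rfl

/-- The central charges of a tensor product add. -/
lemma IsConformal.tensor (hD : D.IsConformal c) (hE : E.IsConformal c') :
    (D.tensor E).IsConformal (c + c') := by
  have hT := hD.toIsVertex.tensor hE.toIsVertex
  have key : ∀ n : ℤ, 0 ≤ n → (D.tensor E).md (D.tensor E).omega n (D.tensor E).omega =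
      D.md D.omega n D.omega ⊗ₜ E.vac + D.vac ⊗ₜ E.md E.omega n E.omega := by
    intro n hn
    change (D.tensor E).md (D.tensor E).omega n (D.omega ⊗ₜ E.vac + D.vac ⊗ₜ E.omega) = _
    rw [map_add, md_tensor_omega_tmul hD hE, md_tensor_omega_tmul hD hE, hD.creation _ n hn,
      hE.creation _ n hn, tmul_zero, zero_tmul, add_zero, zero_add]
  refine ⟨hT, ?_, fun x => ?_, ?_, ?_, ?_, fun n hn => ?_⟩
  · change map D.parity E.parity (D.omega ⊗ₜ E.vac + D.vac ⊗ₜ E.omega) = _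
    rw [map_add, map_tmul, map_tmul, hD.parity_omega, hD.parity_vac,
      hE.parity_omega, hE.parity_vac]
    rfl
  · induction x using tensor_induction hE.parity_parity with
    | zero => rw [map_zero, md_zero, zero_apply]
    | add x y hx hy => rw [map_add, hx, hy, md_add, add_apply]
    | tmul u a v hv =>
      have h1 : (D.parity ^ a) D.vac = D.vac := by
        rw [hD.hasSign_vac.parity_pow, mul_zero, pow_zero, one_smul]
      have h2 := md_tmul hD.toIsVertex u hv (-2) D.vac E.vac
      rw [h1, finsum_eq_sum_of_support_subset (s := {-2, -1}), Finset.sum_pair (by norm_num)] at h2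
      · rw [md_tensor_omega_tmul hD hE, hD.omega_zero, hE.omega_zero]
        refine Eq.trans ?_ h2.symm
        rw [hD.creation_neg_one, show (-2 : ℤ) - -2 - 1 = -1 by norm_num, hE.creation_neg_one]
        norm_num
      · intro p hp
        by_contra hp'
        simp only [Finset.coe_insert, Finset.coe_singleton, Set.mem_insert_iff,
          Set.mem_singleton_iff, not_or] at hp'
        refine hp ?_
        dsimp only
        by_cases h0 : 0 ≤ p
        · rw [hD.creation u p h0, zero_tmul]
        · rw [hE.creation v _ (by omega), tmul_zero]
  · rw [key _ (by norm_num), hD.omega_one, hE.omega_one, tmul_smul,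
      ← smul_tmul', ← smul_add]
    rfl
  · rw [key _ (by norm_num), hD.omega_two, hE.omega_two, tmul_zero,
      zero_tmul, add_zero]
  · rw [key _ (by norm_num), hD.omega_three, hE.omega_three, tmul_smul,
      ← smul_tmul', ← add_smul, ← add_div]
    rfl
  · rw [key _ (by omega), hD.omega_of_four_le n hn, hE.omega_of_four_le n hn,
      tmul_zero, zero_tmul, add_zero]

/-- The operator `L(0)` of a tensor product of twisted modules. -/
lemma twistedL0_tensor {M N : Type*} [AddCommGroup M] [Module ℂ M] [AddCommGroup N] [Module ℂ N]
    {P : End ℂ M} {Y₁ : V →ₗ[ℂ] VertexOperator ℂ M} {Y₂ : W →ₗ[ℂ] VertexOperator ℂ N}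
    (hE : E.IsConformal c') {k : ℕ} (hP : P * P = 1)
    (h₁ : vmode k (Y₁ D.vac) = vacFamily M k) (h₂ : vmode k (Y₂ E.vac) = vacFamily N k) :
    (D.tensor E).twistedL0 k (tensorY P E.parity Y₁ Y₂) =
      map (D.twistedL0 k Y₁) LinearMap.id +
        map LinearMap.id (E.twistedL0 k Y₂) := by
  change vmode k (tensorY P E.parity Y₁ Y₂ (D.omega ⊗ₜ E.vac + D.vac ⊗ₜ E.omega)) k = _
  rw [map_add, vmode_add, Pi.add_apply, vmode_tensorY_tmul_vac hP hE.parity_vac h₂,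
    vmode_tensorY_vac_tmul hP h₁ hE.hasSign_omega]
  rfl

end VertexData

end Conformal

section FreeConformal

/-- The family `e` is orthonormal for the bilinear form `B`. -/
abbrev IsOrthonormal {h : Type*} [AddCommGroup h] [Module ℂ h] (B : LinearMap.BilinForm ℂ h)
    {d : ℕ} (e : Fin d → h) : Prop := ∀ i j, B (e i) (e j) = if i = j then 1 else 0

variable {h : Type u} [AddCommGroup h] [Module ℂ h] {B : LinearMap.BilinForm ℂ h} {d : ℕ}
  {e : Basis (Fin d) ℂ h}

lemma sum_pairing_smul (he : IsOrthonormal B e) (α : h) :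
    ∑ j, B α (e j) • e j = α := by
  have : ∀ j, B α (e j) = e.repr α j := fun j => by
    conv_lhs => rw [← e.sum_repr α]
    simp only [map_sum, sum_apply, map_smul, smul_apply, he, smul_eq_mul,
      mul_ite, mul_one, mul_zero, Finset.sum_ite_eq', Finset.mem_univ, if_true]
  simp only [this]
  exact e.sum_repr α

namespace FreeField

variable {M : Type u} [AddCommGroup M] [Module ℂ M] {k : ℕ} [NeZero k] {j : ℤ} {s : ℕ}
  {π : End ℂ M} {mode : h → ℤ → End ℂ M}

lemma sum_pairing_mode (ff : FreeField B k j s π mode)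
    (he : IsOrthonormal B e) (α : h) (N : ℤ) (w : M) :
    ∑ i, B α (e i) • mode (e i) N w = mode α N w := by
  let f : h →ₗ[ℂ] End ℂ M :=
    { toFun := fun α => mode α N, map_add' := fun α β => ff.map_add α β N
      map_smul' := fun c α => ff.map_smul c α N }
  have := congrArg (fun α => f α w) (sum_pairing_smul he α)
  simpa [f, sum_apply] using this

end FreeField

open VertexData

lemma bosVOA_isFreeY (hsymm : B.IsSymm) (f : Fin d → h) :
    IsFreeY (bosVOA B f).parity (bosVOA B f).vac (bosMode B) 1 0 (bosVOA B f).parity (bosMode B)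
      (bosVOA B f).Y :=
  (bosMode_freeModel hsymm).isFreeY_of_isIterated (bosMode_freeField hsymm)
    (Classical.epsilon_spec
      ((bosMode_freeModel hsymm).existsUnique_isIterated (bosMode_freeField hsymm)).exists)

lemma ferVOSA_isFreeY (hsymm : B.IsSymm) (f : Fin d → h) :
    IsFreeY (ferVOSA B f).parity (ferVOSA B f).vac (ferMode B) 1 0 (ferVOSA B f).parity (ferMode B)
      (ferVOSA B f).Y :=
  (ferMode_freeModel hsymm).isFreeY_of_isIterated (ferMode_freeField hsymm)
    (Classical.epsilon_spec
      ((ferMode_freeModel hsymm).existsUnique_isIterated (ferMode_freeField hsymm)).exists)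

lemma kappaY_isFreeY (hsymm : B.IsSymm) (f : Fin d → h) :
    IsFreeY (bosVOA B f).parity (bosVOA B f).vac (bosMode B) 2 1 1 (kappaMode B) (kappaY B) :=
  (bosMode_freeModel hsymm).isFreeY_of_isIterated (kappaMode_freeField hsymm)
    (Classical.epsilon_spec
      ((bosMode_freeModel hsymm).existsUnique_isIterated (kappaMode_freeField hsymm)).exists)

lemma sigmaY_isFreeY (hsymm : B.IsSymm) (P : Polarization B d) (f : Fin d → h) :
    IsFreeY (ferVOSA B f).parity (ferVOSA B f).vac (ferMode B) 2 1
      CliffordAlgebra.involute.toLinearMap (sigmaMode P) (sigmaY P) :=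
  (ferMode_freeModel hsymm).isFreeY_of_isIterated (sigmaMode_freeField P hsymm)
    (Classical.epsilon_spec
      ((ferMode_freeModel hsymm).existsUnique_isIterated (sigmaMode_freeField P hsymm)).exists)

lemma bosVOA_freeModel (hsymm : B.IsSymm) (f : Fin d → h) :
    FreeModel B 0 (bosVOA B f).vac (bosVOA B f).parity (bosMode B) := bosMode_freeModel hsymm

lemma ferVOSA_freeModel (hsymm : B.IsSymm) (f : Fin d → h) :
    FreeModel B 1 (ferVOSA B f).vac (ferVOSA B f).parity (ferMode B) := ferMode_freeModel hsymm

lemma bosVOA_isVertex (hsymm : B.IsSymm) (f : Fin d → h) : (bosVOA B f).IsVertex :=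
  (bosVOA_freeModel hsymm f).isVertex (bosVOA_isFreeY hsymm f)

lemma ferVOSA_isVertex (hsymm : B.IsSymm) (f : Fin d → h) : (ferVOSA B f).IsVertex :=
  (ferVOSA_freeModel hsymm f).isVertex (ferVOSA_isFreeY hsymm f)

lemma bosMode_neg_one_one (α : h) : bosMode B α (-1) 1 = bosGen α := by
  simp [bosMode, bosGen]

lemma ferMode_neg_one_one (α : h) : ferMode B α (-1) 1 = ferGen 0 α := by
  simp [ferMode, ferGen]

lemma bosVOA_omega (f : Fin d → h) : (bosVOA B f).omega =
    (1 / 2 : ℂ) • ∑ i, bosMode B (f i) (-1) (bosMode B (f i) (-1) (bosVOA B f).vac) := by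
  change (1 / 2 : ℂ) • ∑ j, bosGen (f j) * bosGen (f j) = _
  congr 1
  refine sum_congr rfl fun i _ => ?_
  rw [show (bosVOA B f).vac = 1 from rfl, bosMode_neg_one_one]
  simp [bosMode, bosGen]

lemma ferVOSA_omega (f : Fin d → h) : (ferVOSA B f).omega =
    (1 / 2 : ℂ) • ∑ i, ferMode B (f i) (-2) (ferMode B (f i) (-1) (ferVOSA B f).vac) := by
  change (1 / 2 : ℂ) • ∑ j, ferGen 1 (f j) * ferGen 0 (f j) = _
  congr 1
  refine sum_congr rfl fun i _ => ?_
  rw [show (ferVOSA B f).vac = 1 from rfl, ferMode_neg_one_one]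
  simp [ferMode, ferGen]

/-- The commutation relations of free bosons. -/
lemma bosMode_commutator (hsymm : B.IsSymm) (α β : h) (a b : ℤ) (w : Vbos h) :
    bosMode B α a (bosMode B β b w) = bosMode B β b (bosMode B α a w) +
      (if a + b = 0 then a * B α β else 0 : ℂ) • w := by
  have := (bosMode_freeField hsymm).commutator α β a b w (by simp [Int.modEq_one])
    (by simp [Int.modEq_one])
  rw [pow_zero, one_smul, vacFamily_apply, sub_eq_iff_eq_add] at this
  rw [this, add_comm]
  have e : a + b - ((1 : ℕ) : ℤ) * ((1 - 0 : ℕ) : ℤ) = -((1 : ℕ) : ℤ) ↔ a + b = 0 := by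
    push_cast; omega
  by_cases hab : a + b = 0
  · rw [if_pos (e.mpr hab), if_pos hab, Nat.cast_one, div_one, Nat.sub_zero, Ring.choose_one_right,
      mul_comm]
  · rw [if_neg (mt e.mp hab), if_neg hab, smul_zero, zero_smul]

/-- The anticommutation relations of free fermions. -/
lemma ferMode_commutator (hsymm : B.IsSymm) (α β : h) (a b : ℤ) (w : Vfer h) :
    ferMode B α a (ferMode B β b w) = -ferMode B β b (ferMode B α a w) +
      (if a + b = -1 then B α β else 0 : ℂ) • w := by
  have := (ferMode_freeField hsymm).commutator α β a b w (by simp [Int.modEq_one])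
    (by simp [Int.modEq_one])
  rw [pow_one, neg_one_smul, vacFamily_apply, sub_eq_iff_eq_add] at this
  rw [this, add_comm]
  have e : a + b - ((1 : ℕ) : ℤ) * ((1 - 1 : ℕ) : ℤ) = -((1 : ℕ) : ℤ) ↔ a + b = -1 := by
    push_cast; omega
  by_cases hab : a + b = -1
  · rw [if_pos (e.mpr hab), if_pos hab, Nat.sub_self, Ring.choose_zero_right, mul_one]
  · rw [if_neg (mt e.mp hab), if_neg hab, smul_zero, zero_smul]

/-- The products `α_t ω`, `t ≥ 0`, for free bosons. -/
lemma bosMode_omega (hsymm : B.IsSymm) (he : IsOrthonormal B e)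
    (α : h) {t : ℤ} (ht : 0 ≤ t) : bosMode B α t (bosVOA B e).omega =
      if t = 1 then bosMode B α (-1) (bosVOA B e).vac else 0 := by
  have h0 : bosMode B α t (bosVOA B e).vac = 0 :=
    (bosMode_freeModel hsymm).annihilation α t ht
  rw [bosVOA_omega, map_smul, map_sum]
  simp only [bosMode_commutator hsymm α, h0, map_zero, zero_add, map_smul]
  have e1 : t + -1 = 0 ↔ t = 1 := by omega
  simp only [e1]
  split_ifs with h1
  · rw [← (bosMode_freeField hsymm).sum_pairing_mode he α (-1), smul_sum]
    refine sum_congr rfl fun i _ => ?_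
    subst h1
    push_cast
    module
  · simp

/-- The products `α_t ω`, `t ≥ 0`, for free fermions. -/
lemma ferMode_omega (hsymm : B.IsSymm) (he : IsOrthonormal B e)
    (α : h) {t : ℤ} (ht : 0 ≤ t) : ferMode B α t (ferVOSA B e).omega =
      if t = 0 then (-1 / 2 : ℂ) • ferMode B α (-2) (ferVOSA B e).vac else
      if t = 1 then (1 / 2 : ℂ) • ferMode B α (-1) (ferVOSA B e).vac else 0 := by
  have h0 : ferMode B α t (ferVOSA B e).vac = 0 :=
    (ferMode_freeModel hsymm).annihilation α t ht
  rw [ferVOSA_omega, map_smul, map_sum]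
  simp only [ferMode_commutator hsymm α, h0, map_zero, zero_add, map_smul, neg_zero]
  have e1 : t + -1 = -1 ↔ t = 0 := by omega
  have e2 : t + -2 = -1 ↔ t = 1 := by omega
  simp only [e1, e2]
  split_ifs with h1 h2 h2
  · omega
  · rw [← (ferMode_freeField hsymm).sum_pairing_mode he α (-2), smul_sum, smul_sum]
    refine sum_congr rfl fun i _ => ?_
    module
  · rw [← (ferMode_freeField hsymm).sum_pairing_mode he α (-1), smul_sum, smul_sum]
    refine sum_congr rfl fun i _ => ?_
    module
  · simp

end FreeConformal
/-! ### The conformal vectors of free bosons and fermions -/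

section FreeConformal

open VertexData

variable {h : Type u} [AddCommGroup h] [Module ℂ h] {B : LinearMap.BilinForm ℂ h} {d : ℕ}
  {e : Basis (Fin d) ℂ h} {M : Type u} [AddCommGroup M] [Module ℂ M] {k : ℕ} [NeZero k]
  {j : ℤ} {π : End ℂ M} {mode : h → ℤ → End ℂ M}

/-- The commutators of the modes of `ω` with free bosons. -/
lemma bos_omega_commutator (hsymm : B.IsSymm)
    (he : IsOrthonormal B e)
    {Yg : Vbos h →ₗ[ℂ] VertexOperator ℂ M}
    (hYg : IsFreeY (bosVOA B e).parity (bosVOA B e).vac (bosMode B) k j π mode Yg) (α : h)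
    {a : ℤ} (ha : a ≡ j [ZMOD k]) (N : ℤ) (w : M) :
    vmode k (Yg (bosVOA B e).omega) N (mode α a w) =
      mode α a (vmode k (Yg (bosVOA B e).omega) N w) - (a / k : ℂ) • mode α (a + N - k) w := by
  have h1 := (hYg.ope α (bosVOA B e).omega)
  rw [show vmode k (Yg ((bosVOA B e).parity (bosVOA B e).omega)) =
    (1 : ℂ) • vmode k (Yg (bosVOA B e).omega) from (one_smul _ _).symm] at h1
  have := h1.commutator a N ha w
  rw [one_smul, finsum_eq_single _ 1 fun i hi => by
    rw [bosMode_omega hsymm he α (by omega), if_neg (by omega), map_zero,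
      vmode_zero]
    simp, bosMode_omega hsymm he α (by omega), if_pos (by norm_num), hYg.gen,
    Ring.choose_one_right, Nat.cast_one, mul_one] at this
  rw [← this, sub_sub_cancel]

/-- The commutators of the modes of `ω` with free fermions. -/
lemma fer_omega_commutator (hsymm : B.IsSymm)
    (he : IsOrthonormal B e)
    {Yg : Vfer h →ₗ[ℂ] VertexOperator ℂ M}
    (hYg : IsFreeY (ferVOSA B e).parity (ferVOSA B e).vac (ferMode B) k j π mode Yg) (α : h)
    {a N : ℤ} (ha : a ≡ j [ZMOD k]) (hN : (k : ℤ) ∣ N) (w : M) :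
    vmode k (Yg (ferVOSA B e).omega) N (mode α a w) =
      mode α a (vmode k (Yg (ferVOSA B e).omega) N w) -
        ((a + N / 2) / k : ℂ) • mode α (a + N - k) w := by
  have hω : (ferVOSA B e).parity (ferVOSA B e).omega = (ferVOSA B e).omega := by
    rw [ferVOSA_omega, map_smul, map_sum]
    simp only [(ferVOSA_freeModel hsymm e).parity_mode, (ferVOSA_freeModel hsymm e).parity_vac,
      map_smul, smul_smul, neg_one_pow_mul_neg_one_pow, one_smul]
  have h1 := (hYg.ope α (ferVOSA B e).omega)
  rw [show vmode k (Yg ((ferVOSA B e).parity (ferVOSA B e).omega)) =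
    (1 : ℂ) • vmode k (Yg (ferVOSA B e).omega) by rw [hω, one_smul]] at h1
  have := h1.commutator a N ha w
  have h2 := (ferVOSA_isVertex hsymm e).vmode_neg_two_vac hYg.vacuum
    ((ferVOSA_freeModel hsymm e).hasOPE_gen (ferVOSA_isFreeY hsymm e) hYg α) (m := a + N)
    (by simpa using ha.add (Int.modEq_zero_iff_dvd.mpr hN)) w
  rw [FreeModel.md_gen (ferVOSA_isFreeY hsymm e), hYg.gen] at h2
  rw [one_smul, finsum_eq_sum_range (N := 2) fun i hi => by
    rw [ferMode_omega hsymm he α (by omega), if_neg (by omega), if_neg (by omega), map_zero,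
      vmode_zero]
    simp, sum_range_succ, sum_range_one, ferMode_omega hsymm he α (by omega),
    ferMode_omega hsymm he α (by omega), if_pos (by norm_num), if_neg (by norm_num),
    if_pos (by norm_num), map_smul, map_smul, vmode_smul, vmode_smul, hYg.gen,
    Ring.choose_one_right, Ring.choose_zero_right, Nat.cast_one, mul_one, Nat.cast_zero, mul_zero,
    sub_zero, Pi.smul_apply, Pi.smul_apply, smul_apply, smul_apply, h2] at this
  rw [sub_eq_iff_eq_add] at this
  rw [this]
  have hk : (k : ℂ) ≠ 0 := by exact_mod_cast NeZero.ne k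
  push_cast
  match_scalars
  field_simp
  ring

lemma bosVOA_isConformal (hsymm : B.IsSymm)
    (he : IsOrthonormal B e) : (bosVOA B e).IsConformal d := by
  have hD := bosVOA_isVertex hsymm e
  have hY := bosVOA_isFreeY hsymm e
  have hω : ∀ α (r m : ℤ) w, (bosVOA B e).md (bosVOA B e).omega r (bosMode B α m w) =
      bosMode B α m ((bosVOA B e).md (bosVOA B e).omega r w) +
        ((0 : ℂ) * r - m) • bosMode B α (m + r - 1) w := fun α r m w => by
    have := bos_omega_commutator hsymm he hY α (a := m) (by simp [Int.modEq_one]) r w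
    rw [zero_mul, zero_sub, neg_smul, ← sub_eq_add_neg]
    rwa [Nat.cast_one, Nat.cast_one, div_one] at this
  have h0 : ∀ α (n : ℤ), 0 ≤ n → bosMode B α n (bosVOA B e).vac = 0 :=
    (bosMode_freeModel hsymm).annihilation
  have key : ∀ r : ℤ, 0 ≤ r → (bosVOA B e).md (bosVOA B e).omega r (bosVOA B e).omega =
      (1 / 2 : ℂ) • ∑ i, (bosMode B (e i) (-1) (bosMode B (e i) (r - 2) (bosVOA B e).vac) +
        bosMode B (e i) (r - 2) (bosMode B (e i) (-1) (bosVOA B e).vac)) := fun r hr => by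
    conv_lhs => rw [bosVOA_omega]
    rw [map_smul, map_sum, ← bosVOA_omega]
    simp only [hω, hD.creation _ r hr, map_zero, zero_add, zero_mul, zero_sub, Int.cast_neg,
      Int.cast_one, neg_neg, one_smul, show (-1 : ℤ) + r - 1 = r - 2 by ring]
  refine ⟨hD, rfl, FreeModel.omega_zero (bosVOA_freeModel hsymm e) hY hω, ?_, ?_, ?_,
    fun n hn => ?_⟩
  · rw [key 1 (by norm_num), bosVOA_omega, ← Finset.sum_add_distrib.symm, smul_smul]
    norm_num
    rw [← two_smul ℂ, smul_smul]
    norm_num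
  · rw [key 2 (by norm_num)]
    simp [h0, bosMode_commutator hsymm _ _ 0 (-1)]
  · rw [key 3 (by norm_num)]
    simp [h0, bosMode_commutator hsymm _ _ 1 (-1), he, div_eq_inv_mul, mul_smul,
      Nat.cast_smul_eq_nsmul]
  · rw [key n (by omega)]
    have h1 : n - 2 + -1 ≠ 0 := by omega
    simp [h0 _ (n - 2) (by omega), bosMode_commutator hsymm _ _ (n - 2) (-1), h1]

lemma ferVOSA_isConformal (hsymm : B.IsSymm)
    (he : IsOrthonormal B e) : (ferVOSA B e).IsConformal (d / 2) := by
  have hD := ferVOSA_isVertex hsymm e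
  have hY := ferVOSA_isFreeY hsymm e
  have hω : ∀ α (r m : ℤ) w, (ferVOSA B e).md (ferVOSA B e).omega r (ferMode B α m w) =
      ferMode B α m ((ferVOSA B e).md (ferVOSA B e).omega r w) +
        ((-1 / 2 : ℂ) * r - m) • ferMode B α (m + r - 1) w := fun α r m w => by
    have := fer_omega_commutator hsymm he hY α (a := m) (N := r) (by simp [Int.modEq_one])
      (by simp) w
    rw [Nat.cast_one, Nat.cast_one, div_one, sub_eq_add_neg, ← neg_smul] at this
    rw [show (-1 / 2 : ℂ) * r - m = -(m + r / 2) by ring]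
    exact this
  have h0 : ∀ α (n : ℤ), 0 ≤ n → ferMode B α n (ferVOSA B e).vac = 0 :=
    (ferMode_freeModel hsymm).annihilation
  have key : ∀ r : ℤ, 0 ≤ r → (ferVOSA B e).md (ferVOSA B e).omega r (ferVOSA B e).omega =
      (1 / 2 : ℂ) • ∑ i, ((1 - r / 2 : ℂ) •
        ferMode B (e i) (-2) (ferMode B (e i) (r - 2) (ferVOSA B e).vac) +
        (2 - r / 2 : ℂ) • ferMode B (e i) (r - 3) (ferMode B (e i) (-1) (ferVOSA B e).vac)) :=
      fun r hr => by
    conv_lhs => rw [ferVOSA_omega]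
    rw [map_smul, map_sum, ← ferVOSA_omega]
    refine congrArg _ (sum_congr rfl fun i _ => ?_)
    rw [hω, hω, hD.creation _ r hr, map_zero, zero_add, map_smul,
      show (-1 : ℤ) + r - 1 = r - 2 by ring, show (-2 : ℤ) + r - 1 = r - 3 by ring]
    push_cast
    congr 2 <;> ring
  have hsq : ∀ i, ferMode B (e i) (-1) (ferMode B (e i) (-1) (ferVOSA B e).vac) = 0 := fun i => by
    have := ferMode_commutator hsymm (e i) (e i) (-1) (-1) (ferVOSA B e).vac
    rw [if_neg (by norm_num), zero_smul, add_zero, eq_neg_iff_add_eq_zero, ← two_smul ℂ] at this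
    exact (smul_eq_zero.mp this).resolve_left two_ne_zero
  refine ⟨hD, ?_, FreeModel.omega_zero (ferVOSA_freeModel hsymm e) hY hω, ?_, ?_, ?_,
    fun n hn => ?_⟩
  · rw [ferVOSA_omega, map_smul, map_sum]
    simp only [(ferVOSA_freeModel hsymm e).parity_mode, (ferVOSA_freeModel hsymm e).parity_vac,
      map_smul, smul_smul, neg_one_pow_mul_neg_one_pow, one_smul]
  · rw [key 1 (by norm_num), ferVOSA_omega, smul_comm]
    refine congrArg _ ?_
    rw [smul_sum]
    refine sum_congr rfl fun i _ => ?_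
    norm_num
    module
  · rw [key 2 (by norm_num)]
    simp [h0, hsq]
  · rw [key 3 (by norm_num)]
    simp [h0, ferMode_commutator hsymm _ _ 0 (-1), he]
    rw [← nsmul_eq_mul, ← Nat.cast_smul_eq_nsmul ℂ, smul_smul, smul_smul]
    congr 1
    ring
  · rw [key n (by omega)]
    by_cases h4 : n = 4
    · subst h4
      simp [h0]
      norm_num
    · have h1 : n - 3 + -1 ≠ -1 := by omega
      simp [h0 _ (n - 2) (by omega), h0 _ (n - 3) (by omega),
        ferMode_commutator hsymm _ _ (n - 3) (-1), h1]

end FreeConformal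
/-! ### The twisted modules generated by free fields and their lowest weights -/

section TwistedFree

open VertexData

variable {h : Type u} [AddCommGroup h] [Module ℂ h] {B : LinearMap.BilinForm ℂ h} {d : ℕ}
  {e : Basis (Fin d) ℂ h}

lemma kappaBos_ι_mul (w : CreationModes h) (u : Vbos h) :
    kappaBos h (SymmetricAlgebra.ι ℂ _ w * u) = -(SymmetricAlgebra.ι ℂ _ w * kappaBos h u) := by
  simp [kappaBos]

lemma kappaBos_one : kappaBos h 1 = 1 := map_one (SymmetricAlgebra.lift _)

lemma kappaBos_kappaBos (u : Vbos h) : kappaBos h (kappaBos h u) = u := by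
  induction u using SymmetricAlgebra.left_induction with
  | one => rw [kappaBos_one, kappaBos_one]
  | smul c a ha => rw [map_smul, map_smul, ha]
  | add a b ha hb => rw [map_add, map_add, ha, hb]
  | ι_mul w a ha => rw [kappaBos_ι_mul, map_neg, kappaBos_ι_mul, ha, neg_neg]

lemma kappaBos_symDeriv (f : Dual ℂ (CreationModes h)) (u : Vbos h) :
    kappaBos h (symDeriv f u) = -symDeriv f (kappaBos h u) := by
  induction u using SymmetricAlgebra.left_induction with
  | one => rw [kappaBos_one, symDeriv_one, map_zero, neg_zero]
  | smul c a ha => rw [map_smul, map_smul, map_smul, map_smul, ha, smul_neg]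
  | add a b ha hb => rw [map_add, map_add, map_add, map_add, ha, hb, neg_add]
  | ι_mul w a ha =>
    rw [symDeriv_ι_mul, map_add, map_smul, kappaBos_ι_mul, kappaBos_ι_mul, map_neg, symDeriv_ι_mul,
      ha, neg_neg, mul_neg, neg_neg]

lemma kappaBos_bosMode (α : h) (n : ℤ) (u : Vbos h) :
    kappaBos h (bosMode B α n u) = -bosMode B α n (kappaBos h u) := by
  unfold bosMode
  split_ifs
  · exact kappaBos_ι_mul _ u
  · rw [smul_apply, map_smul, kappaBos_symDeriv, smul_neg, smul_apply]

lemma kappaBos_isAutomorphism (hsymm : B.IsSymm) :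
    (bosVOA B e).IsAutomorphism (kappaBos h) where
  bijective := Function.Involutive.bijective kappaBos_kappaBos
  map_vac := kappaBos_one
  map_omega := by
    rw [bosVOA_omega, map_smul, map_sum]
    simp only [kappaBos_bosMode, map_neg, neg_neg, show kappaBos h (bosVOA B e).vac =
      (bosVOA B e).vac from kappaBos_one]
  map_parity _ := rfl
  map_md := (bosVOA_freeModel hsymm e).map_md (bosVOA_isFreeY hsymm e)
    (Function.Involutive.injective kappaBos_kappaBos) (fun _ => rfl) kappaBos_one (c := -1)
    fun α n u => by rw [kappaBos_bosMode, neg_one_smul]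

lemma IsConformal.isAutomorphism_parity {V : Type*} [AddCommGroup V] [Module ℂ V]
    {D : VertexData V} {c : ℂ} (hD : D.IsConformal c) : D.IsAutomorphism D.parity where
  bijective := Function.Involutive.bijective hD.parity_parity
  map_vac := hD.parity_vac
  map_omega := hD.parity_omega
  map_parity _ := rfl
  map_md := hD.parity_md

lemma isAutomorphism_id {V : Type*} [AddCommGroup V] [Module ℂ V] (D : VertexData V) :
    D.IsAutomorphism LinearMap.id where
  bijective := Function.bijective_id
  map_vac := rfl
  map_omega := rfl
  map_parity _ := rfl
  map_md _ _ _ := rfl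

lemma kappaY_isTwistedSystem (hsymm : B.IsSymm) :
    IsTwistedSystem (bosVOA B e) (kappaBos h) (kappaY B) :=
  (bosVOA_freeModel hsymm e).isTwistedSystem (bosVOA_isFreeY hsymm e) (kappaMode_freeField hsymm)
    (kappaY_isFreeY hsymm e) (kappaBos_isAutomorphism hsymm).map_md kappaBos_one kappaBos_bosMode

lemma sigmaY_isTwistedSystem (hsymm : B.IsSymm) (P : Polarization B d) :
    IsTwistedSystem (ferVOSA B e) CliffordAlgebra.involute.toLinearMap (sigmaY P) :=
  (ferVOSA_freeModel hsymm e).isTwistedSystem (ferVOSA_isFreeY hsymm e)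
    (sigmaMode_freeField P hsymm) (sigmaY_isFreeY hsymm P e) (ferVOSA_isVertex hsymm e).parity_md
    (ferVOSA_isVertex hsymm e).parity_vac fun α n u => by
      have := (ferVOSA_freeModel hsymm e).parity_mode α n u
      rwa [pow_one, neg_one_smul] at this

lemma choose_two (x : ℂ) : binom(x, 2) = x * (x - 1) / 2 := by
  have := Ring.descPochhammer_eq_factorial_smul_choose x 2
  rw [← Polynomial.aeval_eq_smeval] at this
  simp [descPochhammer_succ_right, Nat.factorial] at this
  linear_combination (-1 / 2 : ℂ) * this

/-- The lowest weight of `M_κ`. -/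
lemma kappa_twistedL0_one (hsymm : B.IsSymm)
    (he : IsOrthonormal B e) :
    (bosVOA B e).twistedL0 2 (kappaY B) 1 = (d / 16 : ℂ) • (1 : Mkappa h) := by
  have hY := kappaY_isFreeY hsymm e
  have hann : ∀ α (N : ℤ), 0 ≤ N → kappaMode B α N 1 = 0 := fun α N hN => by
    unfold kappaMode
    split_ifs
    · rfl
    · omega
    · rw [smul_apply, symDeriv_one, smul_zero]
  have key : ∀ i, vmode 2 (kappaY B (bosMode B (e i) (-1) (bosMode B (e i) (-1)
      (bosVOA B e).vac))) 2 1 = (1 / 8 : ℂ) • (1 : Mkappa h) := fun i => by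
    have h0 : ∀ n : ℤ, 0 ≤ n → bosMode B (e i) n (bosVOA B e).vac = 0 :=
      (bosMode_freeModel hsymm).annihilation (e i)
    -- on the lowest weight vector the left-hand side vanishes, and on the right-hand side only the
    -- terms with `α_{-1} α` and `α_1 α` remain
    have := (hY.ope (e i) (bosMode B (e i) (-1) (bosVOA B e).vac)).eq (-1) 1 1 1 (by decide)
    rw [show (bosVOA B e).parity (bosMode B (e i) (-1) (bosVOA B e).vac) =
        bosMode B (e i) (-1) (bosVOA B e).vac from rfl, hY.gen, ordProd,
      finsum_eq_zero_of_forall_eq_zero fun p => by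
        rw [hann _ _ (by push_cast; omega), map_zero, smul_zero], smul_zero, sub_zero,
      finsum_eq_sum_range (N := 3) fun t ht => by
        rw [bosMode_commutator hsymm, h0 _ (by omega), map_zero, if_neg (by omega), zero_smul,
          add_zero, map_zero, vmode_zero]
        simp] at this
    simp only [sum_range_succ, sum_range_zero, zero_add] at this
    norm_num at this
    rw [bosMode_commutator hsymm (e i) (e i) 0, bosMode_commutator hsymm (e i) (e i) 1,
      h0 0 le_rfl, h0 1 (by norm_num), if_neg (by norm_num), if_pos (by norm_num), he,
        if_pos rfl] at this
    simp only [map_zero, zero_add, zero_smul, vmode_zero, Int.cast_one, mul_one, one_smul,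
      hY.vacuum, vacFamily_apply] at this
    norm_num [choose_two] at this
    rw [eq_comm, ← sub_eq_add_neg, sub_eq_zero] at this
    rw [this]
  change vmode 2 (kappaY B (bosVOA B e).omega) 2 1 = _
  rw [bosVOA_omega, map_smul, map_sum, vmode_smul, ← vmodeHom_apply, map_sum, Pi.smul_apply,
    Finset.sum_apply, smul_apply, sum_apply]
  simp only [vmodeHom_apply]
  rw [sum_congr rfl fun i _ => key i, Finset.sum_const, Finset.card_univ, Fintype.card_fin,
    ← Nat.cast_smul_eq_nsmul ℂ, smul_smul, smul_smul]
  congr 1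
  ring

/-- The lowest weight of `M_σ`. -/
lemma sigma_twistedL0_one (hsymm : B.IsSymm) (P : Polarization B d)
    (he : IsOrthonormal B e) :
    (ferVOSA B e).twistedL0 2 (sigmaY P) 1 = (d / 16 : ℂ) • (1 : Msigma P) := by
  have hY := sigmaY_isFreeY hsymm P e
  have hann : ∀ α (N : ℤ), 0 ≤ N → sigmaMode P α N 1 = 0 := fun α N hN => by
    unfold sigmaMode
    split_ifs
    · rfl
    · omega
    · omega
    · exact contractLeft_one _ _
  have key : ∀ i, vmode 2 (sigmaY P (ferMode B (e i) (-2) (ferMode B (e i) (-1)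
      (ferVOSA B e).vac))) 2 1 = (1 / 8 : ℂ) • (1 : Msigma P) := fun i => by
    have h0 : ∀ n : ℤ, 0 ≤ n → ferMode B (e i) n (ferVOSA B e).vac = 0 :=
      (ferMode_freeModel hsymm).annihilation (e i)
    have hsq : ferMode B (e i) (-1) (ferMode B (e i) (-1) (ferVOSA B e).vac) = 0 := by
      have := ferMode_commutator hsymm (e i) (e i) (-1) (-1) (ferVOSA B e).vac
      rw [if_neg (by norm_num), zero_smul, add_zero, eq_neg_iff_add_eq_zero, ← two_smul ℂ] at this
      exact (smul_eq_zero.mp this).resolve_left two_ne_zero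
    have := (hY.ope (e i) (ferMode B (e i) (-1) (ferVOSA B e).vac)).eq (-2) 1 1 1 (by decide)
    have hs := (ferVOSA_freeModel hsymm e).hasSign_gen (e i) (-1)
    rw [HasSign, pow_one, neg_one_smul] at hs
    rw [hs, map_neg, hY.gen, ordProd,
      finsum_eq_zero_of_forall_eq_zero fun p => by
        rw [hann _ _ (by push_cast; omega), map_zero, smul_zero], ordProd,
      finsum_eq_zero_of_forall_eq_zero fun p => by
        rw [hann _ _ (by push_cast; omega), map_zero, smul_zero], smul_zero, sub_zero,
      finsum_eq_sum_range (N := 3) fun t ht => by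
        rw [ferMode_commutator hsymm, h0 _ (by omega), map_zero, if_neg (by omega), zero_smul,
          add_zero, neg_zero, map_zero, vmode_zero]
        simp] at this
    simp only [sum_range_succ, sum_range_zero, zero_add] at this
    norm_num at this
    rw [hsq, ferMode_commutator hsymm (e i) (e i) 0, h0 0 le_rfl, if_pos (by norm_num), he,
      if_pos rfl] at this
    simp only [map_zero, neg_zero, zero_add, vmode_zero, one_smul, hY.vacuum,
      vacFamily_apply] at this
    norm_num [choose_two] at this
    rw [eq_comm, ← sub_eq_add_neg, sub_eq_zero] at this
    rw [this]
  change vmode 2 (sigmaY P (ferVOSA B e).omega) 2 1 = _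
  rw [ferVOSA_omega, map_smul, map_sum, vmode_smul, ← vmodeHom_apply, map_sum, Pi.smul_apply,
    Finset.sum_apply, smul_apply, sum_apply]
  simp only [vmodeHom_apply]
  rw [sum_congr rfl fun i _ => key i, Finset.sum_const, Finset.card_univ, Fintype.card_fin,
    ← Nat.cast_smul_eq_nsmul ℂ, smul_smul, smul_smul]
  congr 1
  ring

lemma freeVOSA_isConformal (hsymm : B.IsSymm)
    (he : IsOrthonormal B e) :
    (freeVOSA B e).IsConformal (d + d / 2) :=
  (bosVOA_isConformal hsymm he).tensor (ferVOSA_isConformal hsymm he)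

lemma freeN2VOSA_isConformal (hsymm : B.IsSymm)
    (he : IsOrthonormal B e) :
    (freeN2VOSA B e).IsConformal (3 * d) := by
  have := (freeVOSA_isConformal hsymm he).tensor (freeVOSA_isConformal hsymm he)
  rwa [show (d + d / 2 + (d + d / 2) : ℂ) = 3 * d by ring] at this

/-- The twisted module `M_κ ⊗ M_σ` of `V_bos ⊗ V_fer`. -/
lemma kappaSigma_isTwistedSystem (hsymm : B.IsSymm) (P : Polarization B d) :
    IsTwistedSystem (freeVOSA B e)
      (map (kappaBos h) CliffordAlgebra.involute.toLinearMap)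
      (tensorY 1 (ferVOSA B e).parity (kappaY B) (sigmaY P)) :=
  IsTwistedSystem.tensor (bosVOA_isVertex hsymm e) (ferVOSA_isVertex hsymm e)
    (kappaBos_isAutomorphism hsymm).map_md (fun _ => rfl) kappaBos_one
    (ferVOSA_isVertex hsymm e).parity_md (fun _ => rfl) (ferVOSA_isVertex hsymm e).parity_vac
    (one_mul 1) (fun _ _ _ => rfl) (kappaY_isTwistedSystem hsymm) (sigmaY_isTwistedSystem hsymm P)

lemma kappaSigma_isAutomorphism (hsymm : B.IsSymm)
    (he : IsOrthonormal B e) : (freeVOSA B e).IsAutomorphism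
      (map (kappaBos h) CliffordAlgebra.involute.toLinearMap) :=
  (kappaBos_isAutomorphism hsymm).tensor (bosVOA_isVertex hsymm e) (ferVOSA_isVertex hsymm e)
    (IsConformal.isAutomorphism_parity (ferVOSA_isConformal hsymm he))

lemma mirrorMap_isAutomorphism (hsymm : B.IsSymm)
    (he : IsOrthonormal B e) :
    (freeN2VOSA B e).IsAutomorphism (mirrorMap h) :=
  (isAutomorphism_id (freeVOSA B e)).tensor (freeVOSA_isConformal hsymm he).toIsVertex
    (freeVOSA_isConformal hsymm he).toIsVertex (kappaSigma_isAutomorphism hsymm he)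

lemma mirrorY_isTwistedSystem (hsymm : B.IsSymm) (P : Polarization B d)
    (he : IsOrthonormal B e) :
    IsTwistedSystem (freeN2VOSA B e) (mirrorMap h) (mirrorY P e) := by
  have hV := (freeVOSA_isConformal hsymm he).toIsVertex
  have hg := kappaSigma_isAutomorphism hsymm he
  exact IsTwistedSystem.tensor hV hV (fun _ _ _ => rfl) (fun _ => rfl) rfl hg.map_md hg.map_parity
    hg.map_vac hV.parity_mul (fun u n x => by
      rw [comp_apply, comp_apply, vmode_refineVar, vmode_refineVar]
      split_ifs
      · exact hV.parity_md u x _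
      · rw [zero_apply, zero_apply, map_zero])
    hV.refine (kappaSigma_isTwistedSystem hsymm P)

/-- The operator `L(0)` on `V ⊗ M_κ ⊗ M_σ` is the sum of those of the tensor factors. -/
lemma mirrorY_twistedL0 (hsymm : B.IsSymm) (P : Polarization B d)
    (he : IsOrthonormal B e) :
    (freeN2VOSA B e).twistedL0 2 (mirrorY P e) =
      map ((freeVOSA B e).L 0) LinearMap.id +
        map LinearMap.id
          (map ((bosVOA B e).twistedL0 2 (kappaY B)) LinearMap.id +
            map LinearMap.id ((ferVOSA B e).twistedL0 2 (sigmaY P))) := by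
  have hV := freeVOSA_isConformal hsymm he
  have h1 := twistedL0_tensor (D :=
    freeVOSA B e) hV hV.toIsVertex.parity_mul hV.toIsVertex.refine.vac
    (kappaSigma_isTwistedSystem hsymm P).vac
  have h2 := twistedL0_tensor (D := bosVOA B e) (ferVOSA_isConformal hsymm he) (one_mul 1)
    (kappaY_isTwistedSystem (e := e) hsymm).vac (sigmaY_isTwistedSystem hsymm P).vac
  have h3 : (freeVOSA B e).twistedL0 2 (refineVar 2 ∘ₗ (freeVOSA B e).Y) = (freeVOSA B e).L 0 := by
    rw [twistedL0, comp_apply, vmode_refineVar, if_pos (dvd_refl _)]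
    rfl
  refine h1.trans ?_
  rw [h3]
  congr 2

end TwistedFree
/-! ### The N=2 superconformal algebra -/

section SuperConformal

namespace VertexData

variable {X : Type*} [AddCommGroup X] [Module ℂ X] {D : VertexData X} {d : ℕ}
  {b f : Fin 2 → Fin d → ℤ → End ℂ X}

/-- The commutators of the modes of `ω` with those of a primary vector of weight `Δ`. -/
lemma IsConformal.primary_commutator {c Δ : ℂ} (hD : D.IsConformal c) {a : ℕ} {x : X}
    (hx : D.HasSign a x) (h1 : D.md D.omega 1 x = Δ • x)
    (h2 : ∀ r : ℤ, 2 ≤ r → D.md D.omega r x = 0) (m n : ℤ) :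
    D.L m * D.md x n - D.md x n * D.L m = ((Δ - 1) * (m + 1) - n) • D.md x (m + n) := by
  ext w
  have := hD.commutator hD.hasSign_omega hx (K := 2) (fun s hs => h2 s (by omega)) (m + 1) n w
  rw [zero_mul, pow_zero, one_smul] at this
  refine this.trans ?_
  rw [sum_range_succ, sum_range_one, Nat.cast_zero, Nat.cast_one, h1, hD.omega_zero,
    hD.md_neg_two_vac, Ring.choose_zero_right, Ring.choose_one_right, one_smul, md_smul,
    smul_apply, smul_apply, sub_zero,
    show m + 1 + n - 1 = m + n by ring, smul_smul, ← add_smul]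
  congr 1
  push_cast
  ring

variable (D b f) in
/-- Two families of free bosons and free fermions among the fields of a vertex superalgebra. -/
structure IsFreePair : Prop extends D.IsVertex where
  sign_b : ∀ c i, D.HasSign 0 (b c i (-1) D.vac)
  sign_f : ∀ c i, D.HasSign 1 (f c i (-1) D.vac)
  md_b : ∀ c i, D.md (b c i (-1) D.vac) = b c i
  md_f : ∀ c i, D.md (f c i (-1) D.vac) = f c i
  bb : ∀ c i m c' i' n w, b c i m (b c' i' n w) = b c' i' n (b c i m w) +
    (if c = c' ∧ i = i' ∧ m + n = 0 then (m : ℂ) else 0) • w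
  bf : ∀ c i m c' i' n w, b c i m (f c' i' n w) = f c' i' n (b c i m w)
  ff : ∀ c i m c' i' n w, f c i m (f c' i' n w) = -f c' i' n (f c i m w) +
    (if c = c' ∧ i = i' ∧ m + n = -1 then (1 : ℂ) else 0) • w

variable (D b f) in
/-- The vector `∑_c ∑_j ε_c b^c_j(-1) f^{σ(c)}_j(-1) 1`. -/
def superVec (ε : Fin 2 → ℂ) (σ : Fin 2 → Fin 2) : X :=
  ∑ c, ∑ j, ε c • b c j (-1) (f (σ c) j (-1) D.vac)

variable (D f) in
/-- The vector `i ∑_j f⁰_j(-1) f¹_j(-1) 1`. -/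
def currentVec : X := Complex.I • ∑ j, f 0 j (-1) (f 1 j (-1) D.vac)

namespace IsFreePair

lemma b_vac (hF : IsFreePair D b f) (c : Fin 2) (i : Fin d) {n : ℤ}
    (hn : 0 ≤ n) : b c i n D.vac = 0 := by
  rw [← hF.md_b]; exact hF.creation _ n hn

lemma f_vac (hF : IsFreePair D b f) (c : Fin 2) (i : Fin d) {n : ℤ}
    (hn : 0 ≤ n) : f c i n D.vac = 0 := by
  rw [← hF.md_f]; exact hF.creation _ n hn

/-- An odd mode squares to zero unless it is paired with itself. -/
lemma f_sq (hF : IsFreePair D b f) (c : Fin 2) (i : Fin d) {n : ℤ} (hn : n + n ≠ -1) (w : X) :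
    f c i n (f c i n w) = 0 := by
  have := hF.ff c i n c i n w
  rw [if_neg (fun h => hn h.2.2), zero_smul, add_zero, eq_neg_iff_add_eq_zero, ← two_smul ℂ] at this
  exact (smul_eq_zero.mp this).resolve_left two_ne_zero

lemma hasSign_superVec (hF : IsFreePair D b f) (ε : Fin 2 → ℂ)
    (σ : Fin 2 → Fin 2) : D.HasSign 1 (superVec D b f ε σ) := by
  have : ∀ c j, D.HasSign 1 (b c j (-1) (f (σ c) j (-1) D.vac)) := fun c j => by
    have := (hF.sign_b c j).md hF.parity_md (hF.sign_f (σ c) j) (-1)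
    rwa [hF.md_b] at this
  simp only [HasSign, superVec, map_sum, map_smul] at this ⊢
  simp only [this, smul_sum, smul_comm ((-1 : ℂ) ^ 1)]

lemma hasSign_currentVec (hF : IsFreePair D b f) :
    D.HasSign 0 (currentVec D f) := by
  have : ∀ j, D.HasSign 0 (f 0 j (-1) (f 1 j (-1) D.vac)) := fun j => by
    have := (hF.sign_f 0 j).md hF.parity_md (hF.sign_f 1 j) (-1)
    rw [hF.md_f] at this
    exact this.congr rfl
  simp only [HasSign, currentVec, map_sum, map_smul] at this ⊢
  simp only [this, pow_zero, one_smul]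

lemma b_superVec (hF : IsFreePair D b f) (ε : Fin 2 → ℂ) (σ : Fin 2 → Fin 2)
    (c : Fin 2) (i : Fin d) {t : ℤ} (ht : 0 ≤ t) : b c i t (superVec D b f ε σ) =
      if t = 1 then ε c • f (σ c) i (-1) D.vac else 0 := by
  have h1 : ∀ c' j, b c i t (b c' j (-1) (f (σ c') j (-1) D.vac)) =
      if t = 1 then (if c = c' then if i = j then f (σ c') j (-1) D.vac else 0 else 0) else 0 :=
    fun c' j => by
      rw [hF.bb, hF.bf, b_vac hF c i ht, map_zero, map_zero, zero_add]
      have : t + -1 = 0 ↔ t = 1 := by omega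
      by_cases h1 : c = c' <;> by_cases h2 : i = j <;> by_cases h3 : t = 1 <;>
        simp [h1, h2, h3, this]
  rw [superVec, map_sum]
  simp only [map_sum, map_smul, h1]
  split_ifs
  · simp [smul_ite, Finset.sum_ite_irrel]
  · simp

lemma f_superVec (hF : IsFreePair D b f) (ε : Fin 2 → ℂ) {σ : Fin 2 → Fin 2}
    (hσ : ∀ c, σ (σ c) = c) (c : Fin 2) (i : Fin d) {t : ℤ} (ht : 0 ≤ t) :
    f c i t (superVec D b f ε σ) = if t = 0 then ε (σ c) • b (σ c) i (-1) D.vac else 0 := by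
  have h1 : ∀ c' j, f c i t (b c' j (-1) (f (σ c') j (-1) D.vac)) =
      if t = 0 then (if σ c = c' then if i = j then b c' j (-1) D.vac else 0 else 0) else 0 :=
    fun c' j => by
      rw [← hF.bf, hF.ff, f_vac hF c i ht, map_zero, neg_zero, zero_add, map_smul]
      have h0 : t + -1 = -1 ↔ t = 0 := by omega
      have h0' : c = σ c' ↔ σ c = c' := ⟨fun h => by rw [h, hσ], fun h => by rw [← h, hσ]⟩
      by_cases h1 : σ c = c' <;> by_cases h2 : i = j <;> by_cases h3 : t = 0 <;>
        simp [h1, h2, h3, h0, h0']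
  rw [superVec, map_sum]
  simp only [map_sum, map_smul, h1]
  split_ifs
  · simp [smul_ite, Finset.sum_ite_irrel]
  · simp

lemma superVec_b (hF : IsFreePair D b f) (ε : Fin 2 → ℂ) (σ : Fin 2 → Fin 2)
    (c : Fin 2) (i : Fin d) (r m : ℤ) (w : X) : D.md (superVec D b f ε σ) r (b c i m w) =
      b c i m (D.md (superVec D b f ε σ) r w) - (m * ε c) • f (σ c) i (m + r - 1) w := by
  have := hF.commutator (hF.sign_b c i) (hasSign_superVec hF ε σ) (K := 2) (fun s hs => by
    rw [hF.md_b, b_superVec hF _ _ _ _ (by omega), if_neg (by omega)]) m r w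
  rw [zero_mul, pow_zero, one_smul, sum_range_succ, sum_range_one, Nat.cast_zero,
    Nat.cast_one, hF.md_b, b_superVec hF _ _ _ _ le_rfl, if_neg (by norm_num),
    b_superVec hF _ _ _ _ (by norm_num), if_pos rfl, md_zero, zero_apply, smul_zero,
    zero_add, md_smul, hF.md_f, Ring.choose_one_right, smul_apply, smul_smul] at this
  rw [← this, sub_sub_cancel]

lemma superVec_f (hF : IsFreePair D b f) (ε : Fin 2 → ℂ) {σ : Fin 2 → Fin 2}
    (hσ : ∀ c, σ (σ c) = c) (c : Fin 2) (i : Fin d) (r m : ℤ) (w : X) :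
    D.md (superVec D b f ε σ) r (f c i m w) =
      -f c i m (D.md (superVec D b f ε σ) r w) + ε (σ c) • b (σ c) i (m + r) w := by
  have := hF.commutator (hF.sign_f c i) (hasSign_superVec hF ε σ) (K := 1) (fun s hs => by
    rw [hF.md_f, f_superVec hF _ hσ _ _ (by omega), if_neg (by omega)]) m r w
  rw [mul_one, pow_one, neg_one_smul, sub_neg_eq_add, sum_range_one, Nat.cast_zero,
    hF.md_f, f_superVec hF _ hσ _ _ le_rfl, if_pos rfl, md_smul, hF.md_b,
    Ring.choose_zero_right, one_smul, smul_apply, sub_zero] at this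
  rw [← this]
  abel

lemma b_currentVec (hF : IsFreePair D b f) (c : Fin 2) (i : Fin d) {t : ℤ}
    (ht : 0 ≤ t) : b c i t (currentVec D f) = 0 := by
  simp only [currentVec, map_smul, map_sum, hF.bf, b_vac hF c i ht, map_zero,
    Finset.sum_const_zero, smul_zero]

lemma f_currentVec (hF : IsFreePair D b f) (c : Fin 2) (i : Fin d) {t : ℤ}
    (ht : 0 ≤ t) : f c i t (currentVec D f) =
      if t = 0 then (Complex.I * ![1, -1] c) • f (![1, 0] c) i (-1) D.vac else 0 := by
  have h0 : t + -1 = -1 ↔ t = 0 := by omega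
  have hv : ∀ c, f c i t D.vac = 0 := fun c => f_vac hF c i ht
  have h1 : ∀ j, f c i t (f 0 j (-1) (f 1 j (-1) D.vac)) =
      -f 0 j (-1) ((if c = 1 ∧ i = j ∧ t + -1 = -1 then (1 : ℂ) else 0) • D.vac) +
        (if c = 0 ∧ i = j ∧ t + -1 = -1 then (1 : ℂ) else 0) • f 1 j (-1) D.vac := fun j => by
    rw [hF.ff, hF.ff c i t 1, hv, map_zero, neg_zero, zero_add]
  simp only [currentVec, map_smul, map_sum, h1, h0]
  fin_cases c <;> by_cases h3 : t = 0 <;> simp [h3, ite_smul, Finset.sum_ite_eq]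

lemma currentVec_b (hF : IsFreePair D b f) (c : Fin 2) (i : Fin d) (r m : ℤ)
    (w : X) : D.md (currentVec D f) r (b c i m w) = b c i m (D.md (currentVec D f) r w) := by
  have := hF.commutator (hF.sign_b c i) (hasSign_currentVec hF) (K := 0) (fun s hs => by
    rw [hF.md_b, b_currentVec hF _ _ (by omega)]) m r w
  rw [zero_mul, pow_zero, one_smul, sum_range_zero, hF.md_b, sub_eq_zero] at this
  exact this.symm

lemma currentVec_f (hF : IsFreePair D b f) (c : Fin 2) (i : Fin d) (r m : ℤ)
    (w : X) : D.md (currentVec D f) r (f c i m w) = f c i m (D.md (currentVec D f) r w) -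
      (Complex.I * ![1, -1] c) • f (![1, 0] c) i (m + r) w := by
  have := hF.commutator (hF.sign_f c i) (hasSign_currentVec hF) (K := 1) (fun s hs => by
    rw [hF.md_f, f_currentVec hF _ _ (by omega), if_neg (by omega)]) m r w
  rw [mul_zero, pow_zero, one_smul, sum_range_one, Nat.cast_zero, hF.md_f,
    f_currentVec hF _ _ le_rfl, if_pos rfl, md_smul, hF.md_f,
    Ring.choose_zero_right, one_smul, smul_apply, sub_zero] at this
  rw [← this, sub_sub_cancel]

/-- The products of the odd vectors. -/
lemma superVec_superVec (hF : IsFreePair D b f) (ε ε' : Fin 2 → ℂ)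
    {σ σ' : Fin 2 → Fin 2} (hσ : ∀ c, σ (σ c) = c) {r : ℤ} (hr : 0 ≤ r) :
    D.md (superVec D b f ε σ) r (superVec D b f ε' σ') = ∑ c, ∑ j, ε' c •
      (ε (σ (σ' c)) • b c j (-1) (b (σ (σ' c)) j (r - 1) D.vac) +
        ε c • f (σ c) j (r - 2) (f (σ' c) j (-1) D.vac)) := by
  conv_lhs => rw [superVec.eq_def D b f ε' σ']
  simp only [map_sum, map_smul]
  refine sum_congr rfl fun c _ => sum_congr rfl fun j _ => congrArg _ ?_
  rw [superVec_b hF, superVec_f hF _ hσ, hF.creation _ r hr, map_zero, neg_zero, zero_add,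
    map_smul, show -1 + r = r - 1 by ring, show r - 1 - 1 = r - 2 by ring]
  push_cast
  module

lemma currentVec_superVec (hF : IsFreePair D b f) (ε : Fin 2 → ℂ)
    {σ : Fin 2 → Fin 2} {r : ℤ} (hr : 0 ≤ r) :
    D.md (currentVec D f) r (superVec D b f ε σ) = ∑ c, ∑ j, ε c •
      -(Complex.I * ![1, -1] (σ c)) • b c j (-1) (f (![1, 0] (σ c)) j (r - 1) D.vac) := by
  simp only [superVec, map_sum, map_smul]
  refine sum_congr rfl fun c _ => sum_congr rfl fun j _ => congrArg _ ?_
  rw [currentVec_b hF, currentVec_f hF, hF.creation _ r hr, map_zero, zero_sub, map_neg,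
    map_smul, show -1 + r = r - 1 by ring, neg_smul]

lemma currentVec_currentVec (hF : IsFreePair D b f) {r : ℤ} (hr : 0 ≤ r) :
    D.md (currentVec D f) r (currentVec D f) =
      (if r = 1 then (d : ℂ) else 0) • D.vac := by
  have h0 : r - 1 + -1 = -1 ↔ r = 1 := by omega
  have key : ∀ j, D.md (currentVec D f) r (f 0 j (-1) (f 1 j (-1) D.vac)) =
      (if r = 1 then -Complex.I else 0) • D.vac := fun j => by
    rw [currentVec_f hF, currentVec_f hF, hF.creation _ r hr, map_zero, zero_sub, map_neg,
      map_smul, show -1 + r = r - 1 by ring]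
    rcases hr.eq_or_lt with rfl | hr
    · norm_num
      rw [f_sq hF 0 j (by norm_num), f_sq hF 1 j (by norm_num)]
      simp
    · have := f_vac hF 0 j (show 0 ≤ r - 1 by omega)
      norm_num [this, hF.ff 1 j (r - 1) 1 j (-1), f_vac hF 1 j (show 0 ≤ r - 1 by omega)]
      split_ifs <;> first | omega | simp
  conv_lhs => rw [currentVec.eq_def]
  rw [map_smul, map_sum, ← currentVec.eq_def]
  simp only [key, Finset.sum_const, Finset.card_univ, Fintype.card_fin, ← Nat.cast_smul_eq_nsmul ℂ,
    smul_smul]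
  split_ifs
  · congr 1
    linear_combination (-d : ℂ) * Complex.I_mul_I
  · simp

end IsFreePair

end VertexData

end SuperConformal
/-! ### The N=2 relations -/

section SuperConformal

namespace VertexData

variable {X : Type*} [AddCommGroup X] [Module ℂ X] {D : VertexData X} {d : ℕ}
  {b f : Fin 2 → Fin d → ℤ → End ℂ X}

namespace IsFreePair

lemma superVec_self (hF : IsFreePair D b f) {ε : Fin 2 → ℂ}
    (hε : ∀ c, ε c * ε c = 1) {σ : Fin 2 → Fin 2} (hσ : ∀ c, σ (σ c) = c) {r : ℤ} (hr : 0 ≤ r) :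
    D.md (superVec D b f ε σ) r (superVec D b f ε σ) = ∑ c, ∑ j,
      (b c j (-1) (b c j (r - 1) D.vac) + f c j (r - 2) (f c j (-1) D.vac)) := by
  rw [superVec_superVec hF ε ε hσ hr]
  simp only [hσ, smul_add, smul_smul, hε, one_smul, sum_add_distrib]
  congr 1
  exact Equiv.sum_comp (Function.Involutive.toPerm σ hσ)
    fun c => ∑ j, f c j (r - 2) (f c j (-1) D.vac)

lemma superVec_self_one (hF : IsFreePair D b f) {ε : Fin 2 → ℂ}
    (hε : ∀ c, ε c * ε c = 1) {σ : Fin 2 → Fin 2} (hσ : ∀ c, σ (σ c) = c) :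
    D.md (superVec D b f ε σ) 1 (superVec D b f ε σ) = 0 := by
  rw [superVec_self hF hε hσ zero_le_one]
  refine sum_eq_zero fun c _ => sum_eq_zero fun j _ => ?_
  rw [b_vac hF c j (by norm_num), map_zero, zero_add]
  exact f_sq hF c j (by norm_num) _

lemma superVec_self_two (hF : IsFreePair D b f) {ε : Fin 2 → ℂ}
    (hε : ∀ c, ε c * ε c = 1) {σ : Fin 2 → Fin 2} (hσ : ∀ c, σ (σ c) = c) :
    D.md (superVec D b f ε σ) 2 (superVec D b f ε σ) = (2 * d : ℂ) • D.vac := by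
  rw [superVec_self hF hε hσ zero_le_two]
  have : ∀ c j, b c j (-1) (b c j (2 - 1) D.vac) + f c j (2 - 2) (f c j (-1) D.vac) = D.vac :=
    fun c j => by
      rw [b_vac hF c j (by norm_num), map_zero, zero_add, hF.ff,
        f_vac hF c j (by norm_num), map_zero, neg_zero, zero_add, if_pos (by simp), one_smul]
  simp only [this, Finset.sum_const, Finset.card_univ, Fintype.card_fin,
    ← Nat.cast_smul_eq_nsmul ℂ, smul_smul]
  norm_num

lemma superVec_self_of_three_le (hF : IsFreePair D b f) {ε : Fin 2 → ℂ}
    (hε : ∀ c, ε c * ε c = 1) {σ : Fin 2 → Fin 2} (hσ : ∀ c, σ (σ c) = c) {r : ℤ} (hr : 3 ≤ r) :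
    D.md (superVec D b f ε σ) r (superVec D b f ε σ) = 0 := by
  rw [superVec_self hF hε hσ (by omega)]
  refine sum_eq_zero fun c _ => sum_eq_zero fun j _ => ?_
  rw [b_vac hF c j (by omega), map_zero, zero_add, hF.ff, f_vac hF c j (by omega), map_zero,
    neg_zero, zero_add, if_neg (by omega), zero_smul]

variable (D b f) in
/-- `ω` is the standard conformal vector of the free bosons and fermions. -/
def IsFreeOmega : Prop := D.omega = (1 / 2 : ℂ) • ∑ c, ∑ j,
    (b c j (-1) (b c j (-1) D.vac) + f c j (-2) (f c j (-1) D.vac))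

lemma superVec_self_zero (hF : IsFreePair D b f) (hω : IsFreeOmega D b f)
    {ε : Fin 2 → ℂ} (hε : ∀ c, ε c * ε c = 1) {σ : Fin 2 → Fin 2} (hσ : ∀ c, σ (σ c) = c) :
    D.md (superVec D b f ε σ) 0 (superVec D b f ε σ) = (2 : ℂ) • D.omega := by
  rw [superVec_self hF hε hσ le_rfl, hω, smul_smul]
  norm_num

/-- The anticommutator of the modes of `superVec ε σ` is independent of the signs `ε` and of the
involution `σ`. -/
lemma superVec_anticommutator (hF : IsFreePair D b f)
    (hω : IsFreeOmega D b f) {ε : Fin 2 → ℂ} (hε : ∀ c, ε c * ε c = 1) {σ : Fin 2 → Fin 2}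
    (hσ : ∀ c, σ (σ c) = c) (m n : ℤ) (w : X) :
    D.md (superVec D b f ε σ) m (D.md (superVec D b f ε σ) n w) +
      D.md (superVec D b f ε σ) n (D.md (superVec D b f ε σ) m w) =
      (2 : ℂ) • D.md D.omega (m + n) w + (if m + n = 1 then (m : ℂ) * (m - 1) * d else 0) • w := by
  have hs := hasSign_superVec hF ε σ
  have := hF.commutator hs hs (K := 3) (fun s hs =>
    superVec_self_of_three_le hF hε hσ (by omega)) m n w
  rw [mul_one, pow_one, neg_one_smul, sub_neg_eq_add] at this
  rw [this]
  simp only [sum_range_succ, sum_range_zero, zero_add, Nat.cast_zero, Nat.cast_one,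
    Nat.cast_ofNat, superVec_self_zero hF hω hε hσ, superVec_self_one hF hε hσ,
    superVec_self_two hF hε hσ, md_smul, md_zero, zero_apply, smul_zero, add_zero,
    Ring.choose_zero_right, one_smul, sub_zero, smul_apply]
  congr 1
  have h1 : m + n - 2 = -((1 : ℕ) : ℤ) ↔ m + n = 1 := by push_cast; omega
  rw [VertexData.md, hF.md_vac, vacFamily_apply, choose_two, smul_smul]
  by_cases h : m + n = 1
  · rw [if_pos (h1.mpr h), if_pos h]
    congr 1
    ring
  · rw [if_neg (mt h1.mp h), if_neg h, smul_zero, zero_smul]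

/-- The conformal vector in terms of an odd vector. -/
lemma omega_eq_anticommutator (hF : IsFreePair D b f)
    (hω : IsFreeOmega D b f) (r : ℤ) (w : X) : D.md D.omega r w =
      (1 / 2 : ℂ) • (D.md (superVec D b f 1 id) r (D.md (superVec D b f 1 id) 0 w) +
        D.md (superVec D b f 1 id) 0 (D.md (superVec D b f 1 id) r w)) := by
  rw [superVec_anticommutator hF hω (ε := 1) (σ := id) (fun c => one_mul 1) fun c => rfl,
    add_zero, smul_add, smul_smul]
  split_ifs with h
  · subst h; simp
  · simp

lemma omega_b (hF : IsFreePair D b f) (hω : IsFreeOmega D b f) (c : Fin 2)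
    (j : Fin d) (r m : ℤ) (w : X) : D.md D.omega r (b c j m w) =
      b c j m (D.md D.omega r w) - (m : ℂ) • b c j (m + r - 1) w := by
  rw [omega_eq_anticommutator hF hω, omega_eq_anticommutator hF hω]
  simp only [superVec_b hF, superVec_f hF 1 (σ := id) (fun _ => rfl), map_sub, map_smul,
    id_eq, Pi.one_apply, mul_one, add_zero, map_add]
  rw [show m - 1 + r = m + r - 1 by ring]
  module

lemma omega_f (hF : IsFreePair D b f) (hω : IsFreeOmega D b f) (c : Fin 2)
    (j : Fin d) (r m : ℤ) (w : X) : D.md D.omega r (f c j m w) =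
      f c j m (D.md D.omega r w) - (m + r / 2 : ℂ) • f c j (m + r - 1) w := by
  rw [omega_eq_anticommutator hF hω, omega_eq_anticommutator hF hω]
  simp only [superVec_b hF, superVec_f hF 1 (σ := id) (fun _ => rfl), map_neg, map_smul,
    id_eq, Pi.one_apply, mul_one, add_zero, map_add, one_smul]
  push_cast
  module

lemma omega_superVec (hF : IsFreePair D b f) (hω : IsFreeOmega D b f)
    (ε : Fin 2 → ℂ) (σ : Fin 2 → Fin 2) {r : ℤ} (hr : 0 ≤ r) :
    D.md D.omega r (superVec D b f ε σ) = ∑ c, ∑ j, ε c •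
      (b c j (r - 2) (f (σ c) j (-1) D.vac) +
        (1 - r / 2 : ℂ) • b c j (-1) (f (σ c) j (r - 2) D.vac)) := by
  simp only [superVec, map_sum, map_smul]
  refine sum_congr rfl fun c _ => sum_congr rfl fun j _ => congrArg _ ?_
  rw [omega_b hF hω, omega_f hF hω, hF.creation _ r hr, map_zero, zero_sub, map_neg,
    map_smul, show -1 + r - 1 = r - 2 by ring]
  push_cast
  module

lemma omega_one_superVec (hF : IsFreePair D b f) (hω : IsFreeOmega D b f)
    (ε : Fin 2 → ℂ) (σ : Fin 2 → Fin 2) :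
    D.md D.omega 1 (superVec D b f ε σ) = (3 / 2 : ℂ) • superVec D b f ε σ := by
  rw [omega_superVec hF hω ε σ zero_le_one, superVec, smul_sum]
  refine sum_congr rfl fun c _ => ?_
  rw [smul_sum]
  refine sum_congr rfl fun j _ => ?_
  rw [show (1 : ℤ) - 2 = -1 by norm_num]
  push_cast
  module

lemma omega_superVec_of_two_le (hF : IsFreePair D b f)
    (hω : IsFreeOmega D b f) (ε : Fin 2 → ℂ) (σ : Fin 2 → Fin 2) {r : ℤ} (hr : 2 ≤ r) :
    D.md D.omega r (superVec D b f ε σ) = 0 := by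
  rw [omega_superVec hF hω ε σ (by omega)]
  refine sum_eq_zero fun c _ => sum_eq_zero fun j _ => ?_
  rw [hF.bf, b_vac hF c j (by omega), f_vac hF _ j (by omega)]
  simp

lemma omega_currentVec (hF : IsFreePair D b f) (hω : IsFreeOmega D b f)
    {r : ℤ} (hr : 0 ≤ r) : D.md D.omega r (currentVec D f) =
      (Complex.I * (1 - r / 2)) • ∑ j, (f 0 j (r - 2) (f 1 j (-1) D.vac) +
        f 0 j (-1) (f 1 j (r - 2) D.vac)) := by
  simp only [currentVec, map_sum, map_smul]
  rw [mul_smul, smul_sum (r := (1 - r / 2 : ℂ))]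
  refine congrArg _ (sum_congr rfl fun j _ => ?_)
  rw [omega_f hF hω, omega_f hF hω, hF.creation _ r hr, map_zero, zero_sub, map_neg,
    map_smul, show -1 + r - 1 = r - 2 by ring]
  push_cast
  module

lemma omega_one_currentVec (hF : IsFreePair D b f) (hω : IsFreeOmega D b f) :
    D.md D.omega 1 (currentVec D f) = (1 : ℂ) • currentVec D f := by
  rw [omega_currentVec hF hω zero_le_one, currentVec]
  rw [show (1 : ℤ) - 2 = -1 by norm_num, sum_add_distrib, ← two_smul ℂ, smul_smul, one_smul]
  congr 1
  push_cast
  ring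

lemma omega_currentVec_of_two_le (hF : IsFreePair D b f)
    (hω : IsFreeOmega D b f) {r : ℤ} (hr : 2 ≤ r) : D.md D.omega r (currentVec D f) = 0 := by
  rw [omega_currentVec hF hω (by omega), sum_eq_zero fun j _ => ?_, smul_zero]
  rw [hF.ff, f_vac hF 0 j (by omega), f_vac hF 1 j (by omega)]
  simp

lemma currentVec_superVec_pos (hF : IsFreePair D b f) (ε : Fin 2 → ℂ)
    (σ : Fin 2 → Fin 2) {r : ℤ} (hr : 1 ≤ r) :
    D.md (currentVec D f) r (superVec D b f ε σ) = 0 := by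
  rw [currentVec_superVec hF ε (by omega)]
  refine sum_eq_zero fun c _ => sum_eq_zero fun j _ => ?_
  rw [f_vac hF _ j (by omega), map_zero, smul_zero, smul_zero]

lemma current_commutator (hF : IsFreePair D b f) (ε : Fin 2 → ℂ)
    (σ : Fin 2 → Fin 2) (m n : ℤ) :
    D.md (currentVec D f) m * D.md (superVec D b f ε σ) n -
      D.md (superVec D b f ε σ) n * D.md (currentVec D f) m =
      D.md (D.md (currentVec D f) 0 (superVec D b f ε σ)) (m + n) := by
  ext w
  have := hF.commutator (hasSign_currentVec hF) (hasSign_superVec hF ε σ) (K := 1)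
    (fun s hs => currentVec_superVec_pos hF ε σ (by omega)) m n w
  rw [zero_mul, pow_zero, one_smul, sum_range_one, Nat.cast_zero, Ring.choose_zero_right,
    one_smul, sub_zero] at this
  exact this

lemma super_super_zero (hF : IsFreePair D b f) (hω : IsFreeOmega D b f) :
    D.md (superVec D b f 1 id) 0 (superVec D b f ![1, -1] ![1, 0]) =
      (-Complex.I) • D.md D.omega 0 (currentVec D f) := by
  rw [superVec_superVec hF _ _ (fun _ => rfl) le_rfl, omega_currentVec hF hω le_rfl,
    smul_smul, Fin.sum_univ_two, ← sum_add_distrib, smul_sum]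
  refine sum_congr rfl fun j _ => ?_
  have h1 := hF.bb 0 j (-1) 1 j (-1) D.vac
  have h2 := hF.ff 1 j (-2) 0 j (-1) D.vac
  norm_num at h1 h2
  norm_num [h1, h2]
  abel

lemma super_super_one (hF : IsFreePair D b f) :
    D.md (superVec D b f 1 id) 1 (superVec D b f ![1, -1] ![1, 0]) =
      (-2 * Complex.I) • currentVec D f := by
  rw [superVec_superVec hF _ _ (fun _ => rfl) zero_le_one, currentVec, smul_smul,
    Fin.sum_univ_two, ← sum_add_distrib, smul_sum]
  refine sum_congr rfl fun j _ => ?_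
  have h1 := fun c => b_vac hF c j (le_refl 0)
  have h2 := hF.ff 1 j (-1) 0 j (-1) D.vac
  norm_num at h2
  norm_num [h1, h2]
  rw [mul_assoc, Complex.I_mul_I]
  module

lemma super_super_of_two_le (hF : IsFreePair D b f) {r : ℤ} (hr : 2 ≤ r) :
    D.md (superVec D b f 1 id) r (superVec D b f ![1, -1] ![1, 0]) = 0 := by
  rw [superVec_superVec hF _ _ (fun _ => rfl) (by omega)]
  refine sum_eq_zero fun c _ => sum_eq_zero fun j _ => ?_
  rw [b_vac hF _ j (by omega), hF.ff, f_vac hF _ j (by omega), if_neg]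
  · simp
  · fin_cases c <;> simp

lemma super_commutator (hF : IsFreePair D b f) (hω : IsFreeOmega D b f)
    (ht : ∀ v, D.md D.omega 0 v = D.md v (-2) D.vac) (m n : ℤ) :
    D.md (superVec D b f 1 id) m * D.md (superVec D b f ![1, -1] ![1, 0]) n +
      D.md (superVec D b f ![1, -1] ![1, 0]) n * D.md (superVec D b f 1 id) m =
      (-Complex.I * (m - n)) • D.md (currentVec D f) (m + n - 1) := by
  ext w
  have := hF.commutator (hasSign_superVec hF 1 id) (hasSign_superVec hF ![1, -1] ![1, 0])
    (K := 2) (fun s hs => super_super_of_two_le hF (by omega)) m n w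
  rw [mul_one, pow_one, neg_one_smul, sub_neg_eq_add] at this
  refine this.trans ?_
  rw [sum_range_succ, sum_range_one, Nat.cast_zero, Nat.cast_one,
    super_super_zero hF hω, super_super_one hF, md_smul, md_smul, ht, smul_apply,
    smul_apply, smul_apply, hF.md_neg_two_vac, Ring.choose_zero_right,
    Ring.choose_one_right, one_smul, sub_zero, smul_smul, smul_smul, ← add_smul]
  congr 1
  push_cast
  ring

/-- Two families of `d` free bosons and fermions generate a representation of the N=2
superconformal algebra of central charge `3d`. -/
lemma isN2VOSA (hV : D.IsVOSA (3 * d)) (hC : D.IsConformal (3 * d)) (hF : IsFreePair D b f)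
    (hω : IsFreeOmega D b f) : D.IsN2VOSA (3 * d)
      ![superVec D b f 1 id, superVec D b f ![1, -1] ![1, 0]] (currentVec D f) := by
  set ε : Fin 2 → Fin 2 → ℂ := ![1, ![1, -1]] with hε_def
  set σ : Fin 2 → Fin 2 → Fin 2 := ![id, ![1, 0]] with hσ_def
  have hτ : ∀ i, ![superVec D b f 1 id, superVec D b f ![1, -1] ![1, 0]] i =
      superVec D b f (ε i) (σ i) := fun i => by fin_cases i <;> rfl
  have hε : ∀ i c, ε i c * ε i c = 1 := fun i c => by
    fin_cases i <;> fin_cases c <;> simp [hε_def]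
  have hσ : ∀ i c, σ i (σ i c) = c := fun i c => by
    fin_cases i <;> fin_cases c <;> rfl
  have hc0 : D.md (currentVec D f) 0 (superVec D b f 1 id) =
      (-Complex.I) • superVec D b f ![1, -1] ![1, 0] := by
    rw [currentVec_superVec hF 1 le_rfl, superVec]
    simp [smul_sum, Fin.sum_univ_two, smul_smul, add_comm]
  have hc1 : D.md (currentVec D f) 0 (superVec D b f ![1, -1] ![1, 0]) =
      Complex.I • superVec D b f 1 id := by
    rw [currentVec_superVec hF _ le_rfl, superVec]
    simp [smul_sum, Fin.sum_univ_two, add_comm]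
  refine ⟨hV, ?_, ?_, ?_, ?_, ?_, ?_, ?_, ?_, ?_, ?_, ?_⟩
  · intro i
    rw [hτ, Module.End.mem_eigenspace_iff]
    exact omega_one_superVec hF hω _ _
  · intro i
    rw [hτ]
    exact hasSign_superVec hF _ _
  · intro i
    rw [hτ, superVec_self_zero hF hω (hε i) (hσ i), smul_smul]
    norm_num
  · change _ = (Complex.I / 2) • D.md (superVec D b f 1 id) 1 (superVec D b f ![1, -1] ![1, 0])
    rw [super_super_one hF, smul_smul,
      show Complex.I / 2 * (-2 * Complex.I) = 1 by linear_combination -Complex.I_mul_I, one_smul]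
  · intro i m n
    rw [hτ, hC.primary_commutator (hasSign_superVec hF _ _) (omega_one_superVec hF hω _ _)
      fun r hr => omega_superVec_of_two_le hF hω _ _ hr, ← add_assoc]
    congr 1
    push_cast
    ring
  · intro i m n
    ext w
    rw [hτ]
    refine (superVec_anticommutator hF hω (hε i) (hσ i) (m + 1) (n + 1) w).trans ?_
    rw [add_apply, smul_apply, smul_apply, L,
      show m + 1 + (n + 1) = m + n + 1 + 1 by ring, Module.End.one_apply]
    have : m + n + 1 + 1 = 1 ↔ m + n + 1 = 0 := by omega
    congr 2
    rw [if_congr this rfl rfl]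
    split_ifs
    · push_cast
      ring
    · rfl
  · intro m n
    rw [hC.primary_commutator (hasSign_currentVec hF) (omega_one_currentVec hF hω)
      fun r hr => omega_currentVec_of_two_le hF hω hr]
    congr 1
    ring
  · intro m n
    ext w
    have hs := hasSign_currentVec hF
    have := hF.commutator hs hs (K := 2) (fun s hs => by
      rw [currentVec_currentVec hF (by omega), if_neg (by omega), zero_smul]) m n w
    rw [zero_mul, pow_zero, one_smul] at this
    refine this.trans ?_
    have h1 : m + n - 1 = -((1 : ℕ) : ℤ) ↔ m + n = 0 := by push_cast; omega
    rw [sum_range_succ, sum_range_one, Nat.cast_zero, Nat.cast_one,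
      currentVec_currentVec hF le_rfl, currentVec_currentVec hF zero_le_one,
      if_neg (by norm_num), if_pos rfl, zero_smul, md_zero, zero_apply, smul_zero,
      zero_add, md_smul, smul_apply, VertexData.md, hF.md_vac, vacFamily_apply,
      Ring.choose_one_right, smul_apply, Module.End.one_apply, smul_smul]
    by_cases h : m + n = 0
    · rw [if_pos (h1.mpr h), if_pos h]
      congr 1
      ring
    · rw [if_neg (mt h1.mp h), if_neg h, smul_zero, zero_smul]
  · intro m n
    have := current_commutator hF 1 id m (n + 1)
    rwa [hc0, md_smul, ← add_assoc] at this
  · intro m n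
    have := current_commutator hF ![1, -1] ![1, 0] m (n + 1)
    rwa [hc1, md_smul, ← add_assoc] at this
  · intro m n
    have := super_commutator hF hω hC.omega_zero (m + 1) (n + 1)
    rw [show m + 1 + (n + 1) - 1 = m + n + 1 by ring] at this
    refine this.trans ?_
    congr 1
    push_cast
    ring

end IsFreePair

end VertexData

end SuperConformal
/-! ### The free fields on `V ⊗ V` -/

section FreeN2

open VertexData

variable {h : Type u} [AddCommGroup h] [Module ℂ h] {B : LinearMap.BilinForm ℂ h} {d : ℕ}
  {e : Basis (Fin d) ℂ h}

/-- The modes of `α⁽ⁱ⁾(-1)1` in the two factors `V` of `V ⊗ V`. -/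
def pairB (B : LinearMap.BilinForm ℂ h) (e : Fin d → h) (c : Fin 2) (i : Fin d) (n : ℤ) :
    End ℂ (Vfree h ⊗[ℂ] Vfree h) :=
  ![map (map (bosMode B (e i) n) LinearMap.id) LinearMap.id,
    map LinearMap.id (map (bosMode B (e i) n) LinearMap.id)] c

/-- The modes of `α⁽ⁱ⁾(-1/2)1` in the two factors `V` of `V ⊗ V`. -/
def pairF (B : LinearMap.BilinForm ℂ h) (e : Fin d → h) (c : Fin 2) (i : Fin d) (n : ℤ) :
    End ℂ (Vfree h ⊗[ℂ] Vfree h) :=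
  ![map (map LinearMap.id (ferMode B (e i) n)) LinearMap.id,
    map (map LinearMap.id CliffordAlgebra.involute.toLinearMap)
      (map LinearMap.id (ferMode B (e i) n))] c

lemma pairB_tmul (i : Fin d) (n : ℤ) (w : Vbos h) (x : Vfer h) (y : Vbos h) (z : Vfer h) :
    pairB B e 0 i n ((w ⊗ₜ x) ⊗ₜ (y ⊗ₜ z)) = (bosMode B (e i) n w ⊗ₜ x) ⊗ₜ (y ⊗ₜ z) ∧
    pairB B e 1 i n ((w ⊗ₜ x) ⊗ₜ (y ⊗ₜ z)) = (w ⊗ₜ x) ⊗ₜ (bosMode B (e i) n y ⊗ₜ z) :=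
  ⟨rfl, rfl⟩

lemma pairF_tmul (i : Fin d) (n : ℤ) (w : Vbos h) (x : Vfer h) (y : Vbos h) (z : Vfer h) :
    pairF B e 0 i n ((w ⊗ₜ x) ⊗ₜ (y ⊗ₜ z)) = (w ⊗ₜ ferMode B (e i) n x) ⊗ₜ (y ⊗ₜ z) ∧
    pairF B e 1 i n ((w ⊗ₜ x) ⊗ₜ (y ⊗ₜ z)) =
      (w ⊗ₜ involute x) ⊗ₜ (y ⊗ₜ ferMode B (e i) n z) :=
  ⟨rfl, rfl⟩

lemma involute_ferMode (hsymm : B.IsSymm) (α : h) (n : ℤ) (w : Vfer h) :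
    involute (ferMode B α n w) = -ferMode B α n (involute w) := by
  have := (ferMode_freeField hsymm).parity_mode α n w
  rwa [pow_one, neg_one_smul] at this

lemma pairB_zero_md (hsymm : B.IsSymm)
    (he : IsOrthonormal B e) (i : Fin d) :
    (freeN2VOSA B e).md (bosVec (e i) ⊗ₜ (1 ⊗ₜ 1)) = pairB B e 0 i ∧
    (freeN2VOSA B e).md ((1 ⊗ₜ 1) ⊗ₜ bosVec (e i)) = pairB B e 1 i := by
  have hV := (freeVOSA_isConformal hsymm he).toIsVertex
  have h1 : ∀ n, (freeVOSA B e).md (bosVec (e i)) n =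
      map (bosMode B (e i) n) LinearMap.id := fun n => by
    have := md_tmul_vac (bosVOA_isVertex hsymm e) (ferVOSA_isVertex hsymm e) (bosGen (e i)) n
    rw [← bosMode_neg_one_one (B := B), show (1 : Vbos h) = (bosVOA B e).vac from rfl,
      FreeModel.md_gen (bosVOA_isFreeY hsymm e)] at this
    rw [← this, show (bosVOA B e).vac = 1 from rfl, bosMode_neg_one_one]
    rfl
  have hs : (freeVOSA B e).HasSign 0 (bosVec (e i)) := by
    change map 1 CliffordAlgebra.involute.toLinearMap (bosGen (e i) ⊗ₜ 1) = _
    rw [map_tmul, AlgHom.toLinearMap_apply, map_one, pow_zero, one_smul]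
    rfl
  constructor
  · funext n
    exact (md_tmul_vac hV hV _ n).trans (by rw [h1]; rfl)
  · funext n
    exact (md_vac_tmul hV hs n).trans (by rw [h1, pow_zero]; rfl)

lemma pairF_md (hsymm : B.IsSymm)
    (he : IsOrthonormal B e) (i : Fin d) :
    (freeN2VOSA B e).md (ferVec (e i) ⊗ₜ (1 ⊗ₜ 1)) = pairF B e 0 i ∧
    (freeN2VOSA B e).md ((1 ⊗ₜ 1) ⊗ₜ ferVec (e i)) = pairF B e 1 i := by
  have hV := (freeVOSA_isConformal hsymm he).toIsVertex
  have hg : (ferVOSA B e).HasSign 1 (ferGen 0 (e i)) := by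
    rw [← ferMode_neg_one_one (B := B)]
    exact (ferVOSA_freeModel hsymm e).hasSign_gen (e i) (-1)
  have h1 : ∀ n, (freeVOSA B e).md (ferVec (e i)) n =
      map LinearMap.id (ferMode B (e i) n) := fun n => by
    have := md_vac_tmul (bosVOA_isVertex hsymm e) hg n
    rw [← ferMode_neg_one_one (B := B), show (1 : Vfer h) = (ferVOSA B e).vac from rfl,
      FreeModel.md_gen (ferVOSA_isFreeY hsymm e)] at this
    rw [show (map LinearMap.id (ferMode B (e i) n) : End ℂ (Vfree h)) =
      map ((bosVOA B e).parity ^ 1) (ferMode B (e i) n) from rfl, ← this,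
      show (ferVOSA B e).vac = 1 from rfl, ferMode_neg_one_one]
    rfl
  have hs : (freeVOSA B e).HasSign 1 (ferVec (e i)) := by
    change map 1 (ferVOSA B e).parity (1 ⊗ₜ ferGen 0 (e i)) = _
    rw [map_tmul, hg, tmul_smul]
    rfl
  constructor
  · funext n
    exact (md_tmul_vac hV hV _ n).trans (by rw [h1]; rfl)
  · funext n
    exact (md_vac_tmul hV hs n).trans (by rw [h1, pow_one]; rfl)

lemma pairB_vac (c : Fin 2) (i : Fin d) : pairB B e c i (-1) ((1 ⊗ₜ 1) ⊗ₜ (1 ⊗ₜ 1)) =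
    ![bosVec (e i) ⊗ₜ (1 ⊗ₜ 1), (1 ⊗ₜ 1) ⊗ₜ bosVec (e i)] c := by
  fin_cases c
  · refine (pairB_tmul i _ _ _ _ _).1.trans ?_
    rw [bosMode_neg_one_one]
    rfl
  · refine (pairB_tmul i _ _ _ _ _).2.trans ?_
    rw [bosMode_neg_one_one]
    rfl

lemma pairF_vac (c : Fin 2) (i : Fin d) : pairF B e c i (-1) ((1 ⊗ₜ 1) ⊗ₜ (1 ⊗ₜ 1)) =
    ![ferVec (e i) ⊗ₜ (1 ⊗ₜ 1), (1 ⊗ₜ 1) ⊗ₜ ferVec (e i)] c := by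
  fin_cases c
  · refine (pairF_tmul i _ _ _ _ _).1.trans ?_
    rw [ferMode_neg_one_one]
    rfl
  · refine (pairF_tmul i _ _ _ _ _).2.trans ?_
    rw [ferMode_neg_one_one, map_one]
    rfl

/-- The free bosons and fermions of the free N=2 vertex operator superalgebra. -/
lemma pair_isFreePair (hsymm : B.IsSymm)
    (he : IsOrthonormal B e) :
    IsFreePair (freeN2VOSA B e) (pairB B e) (pairF B e) := by
  have hvac : (freeN2VOSA B e).vac = (1 ⊗ₜ 1) ⊗ₜ (1 ⊗ₜ 1) := rfl
  have hpar : ∀ (w : Vbos h) (x : Vfer h) (y : Vbos h) (z : Vfer h), (freeN2VOSA B e).parity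
      ((w ⊗ₜ x) ⊗ₜ (y ⊗ₜ z)) =
      (w ⊗ₜ involute x) ⊗ₜ (y ⊗ₜ involute z) := fun _ _ _ _ => rfl
  have hb : ∀ α β (m n : ℤ) (w : Vbos h), bosMode B α m (bosMode B β n w) =
      bosMode B β n (bosMode B α m w) + (if m + n = 0 then m * B α β else 0 : ℂ) • w :=
    bosMode_commutator hsymm
  have hf : ∀ α β (m n : ℤ) (w : Vfer h), ferMode B α m (ferMode B β n w) =
      (-1 : ℂ) • ferMode B β n (ferMode B α m w) + (if m + n = -1 then B α β else 0 : ℂ) • w := by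
    simpa only [neg_one_smul] using ferMode_commutator hsymm
  have hfi : ∀ α (n : ℤ) (w : Vfer h), involute (ferMode B α n w) =
      (-1 : ℂ) • ferMode B α n (involute w) := by
    simpa only [neg_one_smul] using involute_ferMode hsymm
  refine ⟨(freeN2VOSA_isConformal hsymm he).toIsVertex, fun c i => ?_, fun c i => ?_,
    fun c i => ?_, fun c i => ?_, ?_, ?_, ?_⟩
  · rw [HasSign, hvac, pairB_vac, pow_zero, one_smul]
    fin_cases c
    · exact (hpar (bosGen (e i)) 1 1 1).trans (by rw [map_one]; rfl)
    · exact (hpar 1 1 (bosGen (e i)) 1).trans (by rw [map_one]; rfl)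
  · have hi : involute (ferGen 0 (e i)) = -ferGen 0 (e i) :=
      involute_ι _
    rw [HasSign, hvac, pairF_vac, pow_one, neg_one_smul]
    fin_cases c
    · refine (hpar 1 (ferGen 0 (e i)) 1 1).trans ?_
      rw [map_one, hi, tmul_neg, neg_tmul]
      rfl
    · refine (hpar 1 1 1 (ferGen 0 (e i))).trans ?_
      rw [map_one, hi, tmul_neg, tmul_neg]
      rfl
  · rw [hvac, pairB_vac]
    fin_cases c
    · exact (pairB_zero_md hsymm he i).1
    · exact (pairB_zero_md hsymm he i).2
  · rw [hvac, pairF_vac]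
    fin_cases c
    · exact (pairF_md hsymm he i).1
    · exact (pairF_md hsymm he i).2
  · intro c i m c' i' n
    suffices pairB B e c i m ∘ₗ pairB B e c' i' n = pairB B e c' i' n ∘ₗ pairB B e c i m +
        (if c = c' ∧ i = i' ∧ m + n = 0 then (m : ℂ) else 0) • LinearMap.id from
      LinearMap.congr_fun this
    refine TensorProduct.ext_fourfold' fun w x y z => ?_
    simp only [comp_apply, LinearMap.add_apply, LinearMap.smul_apply, id_apply]
    fin_cases c <;> fin_cases c' <;>
      simp only [Fin.zero_eta, Fin.mk_one, (pairB_tmul _ _ _ _ _ _).1,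
      (pairB_tmul _ _ _ _ _ _).2, hb (e i), he, add_tmul, tmul_add,
      ← smul_tmul', tmul_smul] <;>
      by_cases h1 : i = i' <;> by_cases h2 : m + n = 0 <;> simp [h1, h2]
  · intro c i m c' i' n
    suffices pairB B e c i m ∘ₗ pairF B e c' i' n = pairF B e c' i' n ∘ₗ pairB B e c i m from
      LinearMap.congr_fun this
    refine TensorProduct.ext_fourfold' fun w x y z => ?_
    fin_cases c <;> fin_cases c' <;> rfl
  · intro c i m c' i' n
    suffices pairF B e c i m ∘ₗ pairF B e c' i' n =
        (-1 : ℂ) • (pairF B e c' i' n ∘ₗ pairF B e c i m) +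
        (if c = c' ∧ i = i' ∧ m + n = -1 then (1 : ℂ) else 0) • LinearMap.id from fun w => by
      rw [← neg_one_smul ℂ]
      exact LinearMap.congr_fun this w
    refine TensorProduct.ext_fourfold' fun w x y z => ?_
    simp only [comp_apply, LinearMap.add_apply, LinearMap.smul_apply, id_apply]
    fin_cases c <;> fin_cases c' <;>
      simp only [Fin.zero_eta, Fin.mk_one, (pairF_tmul _ _ _ _ _ _).1,
      (pairF_tmul _ _ _ _ _ _).2, hf (e i), he, add_tmul, tmul_add,
      ← smul_tmul', tmul_smul, hfi, smul_smul,
      CliffordAlgebra.involute_involute] <;>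
      by_cases h1 : i = i' <;> by_cases h2 : m + n = -1 <;> simp [h1, h2]

lemma tauN2_eq (j : Fin 2) : tauN2 (⇑e) j =
    ![superVec (freeN2VOSA B e) (pairB B e) (pairF B e) 1 id,
    superVec (freeN2VOSA B e) (pairB B e) (pairF B e) ![1, -1] ![1, 0]] j := by
  have hvac : (freeN2VOSA B e).vac = (1 ⊗ₜ 1) ⊗ₜ (1 ⊗ₜ 1) := rfl
  have hb : ∀ α, bosMode B α (-1) 1 = bosGen α := bosMode_neg_one_one
  have hf : ∀ α, ferMode B α (-1) 1 = ferGen 0 α := ferMode_neg_one_one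
  fin_cases j
  · simp only [tauN2, superVec, hvac, Fin.sum_univ_two, id_eq, Pi.one_apply, one_smul]
    simp only [(pairF_tmul _ _ _ _ _ _).1, (pairF_tmul _ _ _ _ _ _).2, (pairB_tmul _ _ _ _ _ _).1,
      (pairB_tmul _ _ _ _ _ _).2, hb, hf, map_one]
    simp [tauN1, TensorProduct.sum_tmul, TensorProduct.tmul_sum]
  · simp only [tauN2, superVec, hvac, Fin.sum_univ_two]
    simp [(pairF_tmul _ _ _ _ _ _).1, (pairF_tmul _ _ _ _ _ _).2, (pairB_tmul _ _ _ _ _ _).1,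
      (pairB_tmul _ _ _ _ _ _).2, hb, hf, map_one, bosVec, ferVec, sub_eq_add_neg,
      sum_add_distrib]
    exact congrArg (_ + ·) (Finset.sum_neg_distrib (G := Vfree h ⊗[ℂ] Vfree h) _)

lemma muN2_eq : muN2 (⇑e) = currentVec (freeN2VOSA B e) (pairF B e) := by
  have hvac : (freeN2VOSA B e).vac = (1 ⊗ₜ 1) ⊗ₜ (1 ⊗ₜ 1) := rfl
  simp only [muN2, currentVec, hvac, (pairF_tmul _ _ _ _ _ _).1, (pairF_tmul _ _ _ _ _ _).2,
    ferMode_neg_one_one, map_one]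
  rfl

lemma freeN2VOSA_omega : IsFreePair.IsFreeOmega (freeN2VOSA B e) (pairB B e) (pairF B e) := by
  have hvac : (freeN2VOSA B e).vac = (1 ⊗ₜ 1) ⊗ₜ (1 ⊗ₜ 1) := rfl
  have h1 : (freeN2VOSA B e).omega =
    ((bosVOA B e).omega ⊗ₜ 1 + 1 ⊗ₜ (ferVOSA B e).omega) ⊗ₜ (1 ⊗ₜ 1) +
      (1 ⊗ₜ 1) ⊗ₜ ((bosVOA B e).omega ⊗ₜ 1 + 1 ⊗ₜ (ferVOSA B e).omega) := rfl
  have hi : ∀ α, involute (ferMode B α (-1) 1) = -ferMode B α (-1) 1 := fun α => by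
    rw [ferMode_neg_one_one]; exact involute_ι _
  rw [IsFreePair.IsFreeOmega, h1, hvac, bosVOA_omega, ferVOSA_omega]
  simp only [(pairF_tmul _ _ _ _ _ _).1, (pairF_tmul _ _ _ _ _ _).2, (pairB_tmul _ _ _ _ _ _).1,
    (pairB_tmul _ _ _ _ _ _).2, map_one, Fin.sum_univ_two, show (bosVOA B e).vac = 1 from rfl,
    show (ferVOSA B e).vac = 1 from rfl, sum_add_distrib, TensorProduct.sum_tmul,
    TensorProduct.tmul_sum, add_tmul, tmul_add, smul_add,
    ← smul_tmul', tmul_smul]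
  abel

lemma mirrorMap_muN2 (f : Fin d → h) : mirrorMap h (muN2 f) = -muN2 f := by
  have hi : ∀ α : h, involute (ferGen 0 α) = -ferGen 0 α := fun α =>
    involute_ι _
  simp [mirrorMap, muN2, ferVec, hi, kappaBos_one, tmul_neg]
  exact (congrArg (Complex.I • ·) (Finset.sum_neg_distrib (G := Vfree h ⊗[ℂ] Vfree h) _)).trans
    (smul_neg (A := Vfree h ⊗[ℂ] Vfree h) _ _)

lemma kappaBos_bosGen (α : h) : kappaBos h (bosGen α) = -bosGen α := by
  simp [kappaBos, bosGen]

lemma mirrorMap_tauN2 (f : Fin d → h) :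
    mirrorMap h (tauN2 f 0) = tauN2 f 0 ∧ mirrorMap h (tauN2 f 1) = -tauN2 f 1 := by
  have hi : ∀ α : h, involute (ferGen 0 α) = -ferGen 0 α := fun α =>
    involute_ι _
  constructor
  · simp [mirrorMap, tauN2, tauN1, ferVec, bosVec, hi, kappaBos_one, kappaBos_bosGen,
      tmul_neg, neg_tmul]
  · simp only [mirrorMap, tauN2, tauN1, ferVec, bosVec, hi, kappaBos_one, kappaBos_bosGen,
      tmul_neg, neg_tmul, Matrix.cons_val_one, Matrix.cons_val_fin_one,
      map_sum, map_sub, map_tmul, id_apply, AlgHom.toLinearMap_apply, map_one]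
    refine Eq.trans (sum_congr rfl fun i _ => ?_)
      (Finset.sum_neg_distrib (G := Vfree h ⊗[ℂ] Vfree h) _)
    abel

lemma mirrorMap_sq : mirrorMap h ^ 2 = 1 := by
  have h1 : kappaBos h * kappaBos h = 1 := LinearMap.ext kappaBos_kappaBos
  have h2 : (CliffordAlgebra.involute.toLinearMap : End ℂ (Vfer h)) *
      CliffordAlgebra.involute.toLinearMap = 1 :=
    LinearMap.ext CliffordAlgebra.involute_involute
  rw [pow_two, mirrorMap, ← TensorProduct.map_mul, ← TensorProduct.map_mul, h1, h2,
    TensorProduct.map_one]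
  exact TensorProduct.map_one

end FreeN2
/-! ### Graded dimensions -/

section Character

variable {M N : Type u} [AddCommGroup M] [Module ℂ M] [AddCommGroup N] [Module ℂ N]

/-- `L` is diagonalizable with eigenvalues in `c + ½ℕ` and finite multiplicities, and
`∑_i p^{n_i} = F p` for `|p| < 1`, where `c + n_i / 2` are the eigenvalues of `L`, listed with
multiplicities.  The variable `p` stands for `q^{1/2}`. -/
def HasCharacter (L : End ℂ M) (c : ℂ) (F : ℂ → ℂ) : Prop :=
  ∃ (I : Type) (b : Basis I ℂ M) (n : I → ℕ), (∀ i, L (b i) = (c + n i / 2) • b i) ∧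
    ∀ p : ℂ, ‖p‖ < 1 → HasSum (fun i => p ^ n i) (F p)

namespace HasCharacter

variable {L : End ℂ M} {c : ℂ} {F : ℂ → ℂ}

lemma eigenspace_eq_span {I : Type} (b : Basis I ℂ M) (l : I → ℂ)
    (hb : ∀ i, L (b i) = l i • b i) (lam : ℂ) :
    wtSpace L lam = Submodule.span ℂ (Set.range fun i : {i // l i = lam} => b i) := by
  refine le_antisymm (fun x hx => ?_) (Submodule.span_le.mpr ?_)
  · have hrepr : ∀ i y, b.repr (L y) i = l i * b.repr y i := fun i => LinearMap.congr_fun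
      (show b.coord i ∘ₗ L = l i • b.coord i from b.ext fun j => by
        by_cases hij : j = i <;> simp [hb, hij])
    rw [Module.End.mem_eigenspace_iff] at hx
    rw [← b.linearCombination_repr x, Finsupp.linearCombination_apply]
    refine Submodule.sum_mem _ fun i hi => Submodule.smul_mem _ _
      (Submodule.subset_span ⟨⟨i, ?_⟩, rfl⟩)
    have h1 := hrepr i x
    rw [hx, map_smul, Finsupp.smul_apply, smul_eq_mul] at h1
    exact (mul_right_cancel₀ (Finsupp.mem_support_iff.mp hi) h1).symm
  · rintro _ ⟨⟨i, rfl⟩, rfl⟩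
    exact Module.End.mem_eigenspace_iff.mpr (hb i)

/-- Summability at one point makes the multiplicities finite. -/
lemma finite_fiber {I : Type} {n : I → ℕ}
    (hF : ∀ p : ℂ, ‖p‖ < 1 → HasSum (fun i => p ^ n i) (F p)) (lam : ℂ) :
    Finite {i // c + n i / 2 = lam} := by
  by_contra h
  rw [not_finite_iff_infinite] at h
  obtain ⟨i₀, hi₀⟩ := h.nonempty
  have h1 : Summable fun i : {i // c + n i / 2 = lam} => (1 / 2 : ℂ) ^ n i.1 :=
    (hF (1 / 2) (by norm_num)).summable.subtype {i | c + n i / 2 = lam}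
  have h2 : ∀ i : {i // c + n i / 2 = lam}, n i.1 = n i₀ := fun i => Nat.cast_injective (R := ℂ)
    (by linear_combination 2 * i.2 - 2 * hi₀)
  simp only [h2] at h1
  exact pow_ne_zero (n i₀) (by norm_num : (1 / 2 : ℂ) ≠ 0) ((summable_const_iff _).mp h1)

lemma finite_dim (hL : HasCharacter L c F) (lam : ℂ) : FiniteDimensional ℂ (wtSpace L lam) := by
  obtain ⟨I, b, n, hb, hF⟩ := hL
  have := finite_fiber (c := c) hF lam
  rw [eigenspace_eq_span b _ hb]
  exact FiniteDimensional.span_of_finite ℂ (Set.finite_range _)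

lemma isInternal (hL : HasCharacter L c F) :
    DirectSum.IsInternal (fun lam : ℂ => wtSpace L lam) := by
  obtain ⟨I, b, n, hb, -⟩ := hL
  rw [DirectSum.isInternal_submodule_iff_iSupIndep_and_iSup_eq_top]
  refine ⟨Module.End.eigenspaces_iSupIndep L, eq_top_iff.mpr ?_⟩
  rw [← b.span_eq, Submodule.span_le]
  rintro _ ⟨i, rfl⟩
  exact Submodule.mem_iSup_of_mem (c + n i / 2) (Module.End.mem_eigenspace_iff.mpr (hb i))

lemma isInternal_half_int (hL : HasCharacter L 0 F) :
    DirectSum.IsInternal (fun m : ℤ => wtSpace L ((m : ℂ) / 2)) := by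
  obtain ⟨I, b, n, hb, -⟩ := hL
  rw [DirectSum.isInternal_submodule_iff_iSupIndep_and_iSup_eq_top]
  refine ⟨(Module.End.eigenspaces_iSupIndep L).comp (f := fun m : ℤ => (m : ℂ) / 2)
    fun m m' h => ?_, eq_top_iff.mpr ?_⟩
  · simpa using h
  rw [← b.span_eq, Submodule.span_le]
  rintro _ ⟨i, rfl⟩
  refine Submodule.mem_iSup_of_mem (n i : ℤ) (Module.End.mem_eigenspace_iff.mpr ?_)
  rw [hb, zero_add, Int.cast_natCast]

lemma lower_bound (hL : HasCharacter L c F) (lam : ℂ) :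
    ∃ N : ℤ, ∀ m < N, wtSpace L ((m : ℂ) / 2 + lam) = ⊥ := by
  obtain ⟨I, b, n, hb, -⟩ := hL
  suffices ∃ N : ℤ, ∀ m < N, ∀ i, c + n i / 2 ≠ (m : ℂ) / 2 + lam by
    obtain ⟨N, hN⟩ := this
    refine ⟨N, fun m hm => ?_⟩
    have : IsEmpty {i // c + n i / 2 = (m : ℂ) / 2 + lam} := ⟨fun i => hN m hm i.1 i.2⟩
    rw [eigenspace_eq_span b _ hb, Set.range_eq_empty, Submodule.span_empty]
  by_cases h : ∃ m₀ : ℤ, lam = c + m₀ / 2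
  · obtain ⟨m₀, rfl⟩ := h
    refine ⟨-m₀, fun m hm i h => ?_⟩
    have : ((n i : ℤ) : ℂ) = ((m + m₀ : ℤ) : ℂ) := by
      push_cast
      linear_combination 2 * h
    have := Int.cast_injective this
    lia
  -- if `lam` is not in `c + ½ℤ`, no eigenvalue is of the form considered
  · refine ⟨0, fun m _ i hi => h ⟨n i - m, ?_⟩⟩
    push_cast
    linear_combination -hi

lemma norm_exp_lt_one {z : ℂ} (hz : 0 < z.im) : ‖Complex.exp (Real.pi * Complex.I * z)‖ < 1 := by
  rw [Complex.norm_exp, Real.exp_lt_one_iff]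
  simpa using mul_pos Real.pi_pos hz

/-- The graded dimension in the variable `q = e^{2πiz}`, shifted by `q^{-a}`. -/
lemma hasSum_finrank (hL : HasCharacter L c F) (a : ℂ) {z : ℂ} (hz : 0 < z.im) :
    HasSum (fun lam : ℂ => (Module.finrank ℂ (wtSpace L lam) : ℂ) *
      Complex.exp (2 * Real.pi * Complex.I * z * (lam - a)))
      (Complex.exp (2 * Real.pi * Complex.I * z * (c - a)) *
        F (Complex.exp (Real.pi * Complex.I * z))) := by
  obtain ⟨I, b, n, hb, hF⟩ := hL
  have h1 := (hF _ (norm_exp_lt_one hz)).mul_left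
    (Complex.exp (2 * Real.pi * Complex.I * z * (c - a)))
  have h2 : ∀ i, Complex.exp (2 * Real.pi * Complex.I * z * (c - a)) *
      Complex.exp (Real.pi * Complex.I * z) ^ n i =
      Complex.exp (2 * Real.pi * Complex.I * z * ((c + n i / 2) - a)) := fun i => by
    rw [← Complex.exp_nat_mul, ← Complex.exp_add]
    congr 1
    ring
  simp only [h2] at h1
  rw [← (Equiv.sigmaFiberEquiv fun i => c + (n i : ℂ) / 2).hasSum_iff] at h1
  refine h1.sigma fun lam => ?_
  have := finite_fiber (c := c) hF lam
  have := Fintype.ofFinite {i // c + n i / 2 = lam}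
  have hcard : Module.finrank ℂ (wtSpace L lam) = Fintype.card {i // c + n i / 2 = lam} := by
    rw [eigenspace_eq_span b _ hb]
    exact finrank_span_eq_card (b.linearIndependent.comp _ Subtype.val_injective)
  have h3 := hasSum_fintype (fun _ : {i // c + n i / 2 = lam} =>
    Complex.exp (2 * Real.pi * Complex.I * z * (lam - a)))
  rw [Finset.sum_const, Finset.card_univ, ← hcard, nsmul_eq_mul] at h3
  have h4 : (fun i : {i // c + n i / 2 = lam} => Complex.exp (2 * Real.pi * Complex.I * z *
      ((c + n i.1 / 2) - a))) = fun _ => Complex.exp (2 * Real.pi * Complex.I * z * (lam - a)) :=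
    funext fun i => by rw [i.2]
  rw [← h4] at h3
  exact h3

lemma hasSum_mul {I I' : Type} (f : I → ℂ) (g : I' → ℂ) {a b : ℂ} (hf : HasSum f a)
    (hg : HasSum g b) : HasSum (fun i : I × I' => f i.1 * g i.2) (a * b) :=
  hf.mul hg (summable_mul_of_summable_norm hf.summable.norm hg.summable.norm)

/-- Graded dimensions are multiplicative. -/
lemma tensor (hL : HasCharacter L c F) {L' : End ℂ N} {c' : ℂ} {F' : ℂ → ℂ}
    (hL' : HasCharacter L' c' F') :
    HasCharacter (map L LinearMap.id + map LinearMap.id L') (c + c')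
      (fun p => F p * F' p) := by
  obtain ⟨I, b, n, hb, hF⟩ := hL
  obtain ⟨I', b', n', hb', hF'⟩ := hL'
  refine ⟨I × I', b.tensorProduct b', fun i => n i.1 + n' i.2, fun ⟨i, i'⟩ => ?_, fun p hp => ?_⟩
  · simp only [Module.Basis.tensorProduct_apply, add_apply, map_tmul,
      id_apply, hb, hb', ← smul_tmul', tmul_smul, ← add_smul]
    congr 1
    push_cast
    ring
  · simp only [pow_add]
    exact hasSum_mul (fun i => p ^ n i) (fun i => p ^ n' i) (hF p hp) (hF' p hp)

lemma isVOSA {D : VertexData M} {c₀ : ℂ} (hL : HasCharacter (D.L 0) 0 F)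
    (hD : D.IsConformal c₀) : D.IsVOSA c₀ :=
  hD.isVOSA hL.isInternal_half_int (fun _ => hL.finite_dim _)
    ((hL.lower_bound 0).imp fun N h m hm => by simpa using h m hm)

lemma isOrdinaryTwistedModule {D : VertexData N} {g : End ℂ N} {η : ℂ}
    {Yg : N →ₗ[ℂ] VertexOperator ℂ M} (hL : HasCharacter (D.twistedL0 2 Yg) c F)
    (hg : D.IsWeakTwistedModule g 2 η Yg) : D.IsOrdinaryTwistedModule g 2 η Yg :=
  { hg with
    grading := hL.isInternal
    finite_dim := hL.finite_dim
    lower_bound := hL.lower_bound }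

end HasCharacter

end Character
/-! ### Products of geometric series -/

section Products

variable {J : Type}

lemma Finsupp.prod_pow_single_add (x : J → ℂ) (a : J) (m : ℕ) (f : J →₀ ℕ) :
    (Finsupp.single a m + f).prod (fun j n => x j ^ n) = x a ^ m * f.prod fun j n => x j ^ n := by
  classical
  rw [Finsupp.prod_add_index' (fun _ => pow_zero _) (fun _ _ _ => pow_add _ _ _),
    Finsupp.prod_single_index (h := fun j n => x j ^ n) (pow_zero _)]

lemma hasSum_prod_geometric_finset (x : J → ℂ) (hx : ∀ j, ‖x j‖ < 1) (S : Finset J) :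
    HasSum (fun f : {f : J →₀ ℕ // f.support ⊆ S} => f.1.prod fun j n => x j ^ n)
      (∏ j ∈ S, (1 - x j)⁻¹) := by
  classical
  induction S using Finset.induction_on with
  | empty =>
    have : Unique {f : J →₀ ℕ // f.support ⊆ ∅} :=
      ⟨⟨⟨0, by simp⟩⟩, fun f => Subtype.ext (by simpa using f.2)⟩
    have h := hasSum_unique (fun f : {f : J →₀ ℕ // f.support ⊆ ∅} => f.1.prod fun j n => x j ^ n)
    have hd : (default : {f : J →₀ ℕ // f.support ⊆ ∅}).1 = 0 := by
      simpa using (default : {f : J →₀ ℕ // f.support ⊆ ∅}).2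
    rwa [hd, Finsupp.prod_zero_index] at h
  | insert a S ha ih =>
    have hfa : ∀ f : {f : J →₀ ℕ // f.support ⊆ S}, f.1 a = 0 := fun f =>
      Finsupp.notMem_support_iff.mp fun h => ha (f.2 h)
    let E : ℕ × {f : J →₀ ℕ // f.support ⊆ S} ≃ {f : J →₀ ℕ // f.support ⊆ insert a S} :=
      { toFun := fun i => ⟨Finsupp.single a i.1 + i.2.1, Finsupp.support_add.trans
          (Finset.union_subset (Finsupp.support_single_subset.trans (by simp))
            (i.2.2.trans (Finset.subset_insert a S)))⟩
        invFun := fun f => ⟨f.1 a, f.1.erase a, by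
          rw [Finsupp.support_erase]
          exact Finset.subset_insert_iff.mp f.2⟩
        left_inv := fun i => Prod.ext (by simp [hfa]) (Subtype.ext (by
          change (Finsupp.single a i.1 + i.2.1).erase a = i.2.1
          rw [Finsupp.erase_add, Finsupp.erase_single, zero_add,
            Finsupp.erase_of_notMem_support fun h => ha (i.2.2 h)]))
        right_inv := fun f => Subtype.ext (Finsupp.single_add_erase a f.1) }
    rw [← E.hasSum_iff, Finset.prod_insert ha]
    have h := HasCharacter.hasSum_mul _ _ (hasSum_geometric_of_norm_lt_one (hx a)) ih
    simp only [← Finsupp.prod_pow_single_add] at h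
    exact h

/-- Expansion of `∏_j (1 - x_j)⁻¹` into monomials. -/
lemma exists_hasSum_prod_geometric (x : J → ℂ) (hx : Summable fun j => ‖x j‖) {r : ℝ} (hr : r < 1)
    (hxr : ∀ j, ‖x j‖ ≤ r) : ∃ a, HasSum (fun f : J →₀ ℕ => f.prod fun j n => x j ^ n) a ∧
      HasProd (fun j => (1 - x j)⁻¹) a := by
  classical
  have hx1 : ∀ j, ‖x j‖ < 1 := fun j => (hxr j).trans_lt hr
  have hnorm : ∀ f : J →₀ ℕ, ((f.prod fun j n => ((‖x j‖ : ℝ) : ℂ) ^ n) : ℂ) =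
      ((‖f.prod fun j n => x j ^ n‖ : ℝ) : ℂ) := fun f => by
    simp [Finsupp.prod, norm_prod]
  have hsum : Summable fun f : J →₀ ℕ => ‖f.prod fun j n => x j ^ n‖ := by
    refine summable_of_sum_le (c := Real.exp (∑' j, ‖x j‖ / (1 - r))) (fun _ => norm_nonneg _)
      fun T => ?_
    set S := T.biUnion Finsupp.support with hS
    have h1 := hasSum_prod_geometric_finset (fun j => ((‖x j‖ : ℝ) : ℂ)) 
      (fun j => by simpa using hx1 j) S
    simp only [hnorm] at h1
    have h2 : (∏ j ∈ S, (1 - ((‖x j‖ : ℝ) : ℂ))⁻¹) = ((∏ j ∈ S, (1 - ‖x j‖)⁻¹ : ℝ) : ℂ) := by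
      push_cast
      rfl
    rw [h2, Complex.hasSum_ofReal] at h1
    have h3 : ∑ f ∈ T, ‖f.prod fun j n => x j ^ n‖ ≤ ∏ j ∈ S, (1 - ‖x j‖)⁻¹ := by
      rw [← Finset.sum_subtype_of_mem (p := fun f : J →₀ ℕ => f.support ⊆ S)
        (f := fun f => ‖f.prod fun j n => x j ^ n‖)
        fun f hf => Finset.subset_biUnion_of_mem _ hf]
      exact sum_le_hasSum _ (fun _ _ => norm_nonneg _) h1
    refine h3.trans ?_
    have h4 : ∏ j ∈ S, (1 - ‖x j‖)⁻¹ ≤ ∏ j ∈ S, Real.exp (‖x j‖ / (1 - r)) := by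
      refine Finset.prod_le_prod (fun j _ => inv_nonneg.mpr (by linarith [hx1 j])) fun j _ => ?_
      have h5 : 0 < 1 - ‖x j‖ := by linarith [hx1 j]
      calc (1 - ‖x j‖)⁻¹ = ‖x j‖ / (1 - ‖x j‖) + 1 := by field_simp; ring
        _ ≤ ‖x j‖ / (1 - r) + 1 := by
          have h6 : 1 - r ≤ 1 - ‖x j‖ := by linarith [hxr j]
          have h7 : 0 < 1 - r := by linarith
          gcongr
        _ ≤ _ := Real.add_one_le_exp _
    refine h4.trans ?_
    rw [← Real.exp_sum]
    exact Real.exp_le_exp.mpr ((hx.div_const _).sum_le_tsum _ fun j _ =>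
      div_nonneg (norm_nonneg _) (by linarith))
  refine ⟨_, hsum.of_norm.hasSum, ?_⟩
  have h1 : ∀ S : Finset J, ∏ j ∈ S, (1 - x j)⁻¹ = ∑' f : J →₀ ℕ,
      Set.indicator {f : J →₀ ℕ | f.support ⊆ S} (fun f => f.prod fun j n => x j ^ n) f :=
        fun S => by
    rw [← (hasSum_prod_geometric_finset x hx1 S).tsum_eq]
    exact tsum_subtype {f : J →₀ ℕ | f.support ⊆ S} (fun f => f.prod fun j n => x j ^ n)
  rw [HasProd]
  simp only [h1]
  refine tendsto_tsum_of_dominated_convergence hsum (fun f => ?_) (Filter.Eventually.of_forall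
    fun S f => norm_indicator_le_norm_self _ _)
  refine tendsto_const_nhds.congr' ((Filter.eventually_ge_atTop f.support).mono fun S hS => ?_)
  exact (Set.indicator_of_mem (s := {f : J →₀ ℕ | f.support ⊆ S}) hS
    (fun f => f.prod fun j n => x j ^ n)).symm

lemma prod_pow_eq_pow_weight (k : J → ℕ) (p : ℂ) (f : J →₀ ℕ) :
    (f.prod fun j n => (p ^ k j) ^ n) = p ^ Finsupp.weight k f := by
  rw [Finsupp.weight_apply, Finsupp.sum, ← Finset.prod_pow_eq_pow_sum]
  exact Finset.prod_congr rfl fun j _ => by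
    rw [smul_eq_mul, mul_comm, pow_mul]

/-- The generating function of the degrees of the monomials in variables of degrees `k j`. -/
lemma hasSum_pow_weight {k : J → ℕ} (hk : ∀ j, 0 < k j) {p : ℂ} (hp : ‖p‖ < 1)
    (hs : Summable fun j => p ^ k j) :
    HasSum (fun f : J →₀ ℕ => p ^ Finsupp.weight k f) (∏' j, (1 - p ^ k j)⁻¹) ∧
      Multipliable fun j => (1 - p ^ k j)⁻¹ := by
  obtain ⟨a, ha, ha'⟩ := exists_hasSum_prod_geometric (fun j => p ^ k j) hs.norm hp fun j => by
    rw [norm_pow]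
    exact pow_le_of_le_one (norm_nonneg _) hp.le (hk j).ne'
  simp only [prod_pow_eq_pow_weight] at ha
  exact ⟨ha'.tprod_eq ▸ ha, ha'.multipliable⟩

/-- The generating function of the degrees of the squarefree monomials in variables of degrees
`k j`. -/
lemma hasSum_pow_sum {k : J → ℕ} {p : ℂ} (hs : Summable fun j => p ^ k j) :
    HasSum (fun s : Finset J => p ^ ∑ j ∈ s, k j) (∏' j, (1 + p ^ k j)) ∧
      Multipliable fun j => 1 + p ^ k j := by
  have h1 := summable_finsetProd_of_summable_norm hs.norm
  rw [tprod_one_add h1]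
  refine ⟨?_, multipliable_one_add_of_summable_prod h1⟩
  simp only [← Finset.prod_pow_eq_pow_sum]
  exact h1.hasSum

lemma summable_pow_prod_fin {k : ℕ → ℕ} (hk : Function.Injective k) (d : ℕ) {p : ℂ}
    (hp : ‖p‖ < 1) : Summable fun j : ℕ × Fin d => p ^ k j.1 := by
  have h1 : Summable fun n : ℕ => p ^ k n :=
    (summable_geometric_of_norm_lt_one hp).comp_injective hk
  have h2 := HasCharacter.hasSum_mul _ (fun _ : Fin d => (1 : ℂ)) h1.hasSum (hasSum_fintype _)
  simpa using h2.summable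

lemma tprod_prod_fin {f : ℕ → ℂ} {d : ℕ} (hd : Multipliable fun j : ℕ × Fin d => f j.1)
    (hf : Multipliable f) : ∏' j : ℕ × Fin d, f j.1 = (∏' n, f n) ^ d := by
  have h1 := hd.hasProd.prod_fiberwise (g := fun n => f n ^ d) fun n => by
    simpa using hasProd_fintype (fun _ : Fin d => f n)
  exact h1.unique (hf.hasProd.pow d)

end Products
/-! ### Eigenbases of symmetric and Clifford algebras -/

section AlgebraCharacters

variable {W : Type u} [AddCommGroup W] [Module ℂ W] {J : Type} {c : ℂ}

/-- The character of a weight operator on a symmetric algebra for which multiplication by the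
basis vector `β j` raises the weight by `k j / 2`. -/
lemma HasCharacter.symmetricAlgebra (β : Basis J ℂ W) (k : J → ℕ) (hk : ∀ j, 0 < k j)
    (hs : ∀ p : ℂ, ‖p‖ < 1 → Summable fun j => p ^ k j) (L : End ℂ (SymmetricAlgebra ℂ W))
    (h1 : L 1 = c • 1) (hL : ∀ j u, L (SymmetricAlgebra.ι ℂ W (β j) * u) =
      (k j / 2 : ℂ) • (SymmetricAlgebra.ι ℂ W (β j) * u) + SymmetricAlgebra.ι ℂ W (β j) * L u) :
    HasCharacter L c fun p => ∏' j, (1 - p ^ k j)⁻¹ := by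
  classical
  refine ⟨J →₀ ℕ, β.symmetricAlgebra, Finsupp.weight k, fun f => ?_, fun p hp =>
    (hasSum_pow_weight hk hp (hs p hp)).1⟩
  have hb : ∀ f, β.symmetricAlgebra f =
      (SymmetricAlgebra.equivMvPolynomial β).symm (MvPolynomial.monomial f 1) := fun f => by
    simp [Module.Basis.symmetricAlgebra]
  have hb0 : β.symmetricAlgebra 0 = 1 := by
    rw [hb]
    exact map_one (SymmetricAlgebra.equivMvPolynomial β).symm
  have hbs : ∀ j f, β.symmetricAlgebra (Finsupp.single j 1 + f) =
      SymmetricAlgebra.ι ℂ W (β j) * β.symmetricAlgebra f := fun j f => by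
    rw [hb, hb, ← SymmetricAlgebra.equivMvPolynomial_symm_X, ← map_mul, MvPolynomial.X,
      MvPolynomial.monomial_mul, one_mul]
  have hstep : ∀ j f, L (β.symmetricAlgebra f) =
    (c + Finsupp.weight k f / 2) • β.symmetricAlgebra f →
      L (β.symmetricAlgebra (Finsupp.single j 1 + f)) =
        (c + (Finsupp.weight k (Finsupp.single j 1 + f) : ℕ) / 2) •
          β.symmetricAlgebra (Finsupp.single j 1 + f) := fun j f ih => by
    rw [hbs, hL, ih, mul_smul_comm, ← add_smul, map_add, Finsupp.weight_single]
    congr 1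
    push_cast
    simp only [one_smul]
    ring
  induction f using Finsupp.induction with
  | zero => simp [hb0, h1]
  | single_add j m f _ _ ih =>
    clear * - ih hstep
    induction m with
    | zero => simpa using ih
    | succ m ihm =>
      rw [add_comm m, Finsupp.single_add, add_assoc]
      exact hstep _ _ ihm

/-- A weight operator commutes with contraction by a functional supported in weight zero. -/
lemma weight_contractLeft {Q : QuadraticForm ℂ W} (β : Basis J ℂ W) (k : J → ℕ)
    (L : End ℂ (CliffordAlgebra Q)) (h1 : L 1 = c • 1)
    (hL : ∀ j u, L (CliffordAlgebra.ι Q (β j) * u) =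
      (k j / 2 : ℂ) • (CliffordAlgebra.ι Q (β j) * u) + CliffordAlgebra.ι Q (β j) * L u)
    (d : Dual ℂ W) (hd : ∀ j, k j ≠ 0 → d (β j) = 0) (x : CliffordAlgebra Q) :
    L (contractLeft d x) = contractLeft d (L x) := by
  induction x using CliffordAlgebra.left_induction with
  | algebraMap r =>
    rw [CliffordAlgebra.contractLeft_algebraMap, Algebra.algebraMap_eq_smul_one, map_smul, h1,
      map_smul, map_smul, contractLeft_one, map_zero, smul_zero, smul_zero]
  | add x y hx hy => simp only [map_add, hx, hy]
  | ι_mul x w hx =>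
    suffices h : L ∘ₗ contractLeft d ∘ₗ LinearMap.mulRight ℂ x ∘ₗ
        CliffordAlgebra.ι Q = contractLeft d ∘ₗ L ∘ₗ LinearMap.mulRight ℂ x ∘ₗ
        CliffordAlgebra.ι Q from LinearMap.congr_fun h w
    refine β.ext fun j => ?_
    simp only [comp_apply, LinearMap.mulRight_apply, contractLeft_ι_mul, hL,
      map_sub, map_add, map_smul, hx]
    by_cases hj : k j = 0
    · simp [hj]
    · rw [hd j hj]
      simp only [zero_smul, zero_sub, smul_neg]
      abel

/-- The character of a weight operator on a Clifford algebra for which multiplication by the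
basis vector `β j` raises the weight by `k j / 2`, where the bilinear form `A` defining the
quadratic form lives on the vectors of weight zero. -/
lemma HasCharacter.cliffordAlgebra {Q : QuadraticForm ℂ W} (A : LinearMap.BilinForm ℂ W)
    (hA : A.toQuadraticMap = Q - 0) (β : Basis J ℂ W) (k : J → ℕ)
    (hAk : ∀ i j, (k i ≠ 0 ∨ k j ≠ 0) → A (β i) (β j) = 0)
    (hs : ∀ p : ℂ, ‖p‖ < 1 → Summable fun j => p ^ k j) (L : End ℂ (CliffordAlgebra Q))
    (h1 : L 1 = c • 1) (hL : ∀ j u, L (CliffordAlgebra.ι Q (β j) * u) =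
      (k j / 2 : ℂ) • (CliffordAlgebra.ι Q (β j) * u) + CliffordAlgebra.ι Q (β j) * L u) :
    HasCharacter L c fun p => ∏' j, (1 + p ^ k j) := by
  classical
  -- an ordering of the basis, in order to write down the monomials of the exterior algebra
  let : LinearOrder J := IsWellOrder.linearOrder WellOrderingRel
  refine ⟨Finset J, β.ExteriorAlgebra.map (CliffordAlgebra.changeFormEquiv hA),
    fun s => ∑ j ∈ s, k j, fun s => ?_, fun p hp => (hasSum_pow_sum (hs p hp)).1⟩
  have hlist : ∀ l : List J,
      L (CliffordAlgebra.changeForm hA (l.map fun j => CliffordAlgebra.ι 0 (β j)).prod) =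
        (c + ((l.map k).sum : ℕ) / 2) •
          CliffordAlgebra.changeForm hA (l.map fun j => CliffordAlgebra.ι 0 (β j)).prod := by
    intro l
    induction l with
    | nil => simp [h1]
    | cons j l ih =>
      rw [List.map_cons, List.prod_cons, CliffordAlgebra.changeForm_ι_mul, map_sub, hL,
        weight_contractLeft β k L h1 hL _ fun i hi => hAk j i (Or.inr hi), ih, List.map_cons,
        List.sum_cons, map_smul, mul_smul_comm]
      by_cases hj : k j = 0
      · rw [hj]
        simp [smul_sub]
      · have h0 : A (β j) = 0 := β.ext fun i => hAk j i (Or.inl hj)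
        rw [h0, map_zero, zero_apply, smul_zero, sub_zero, sub_zero, ← add_smul]
        congr 1
        push_cast
        ring
  have h2 := hlist (List.ofFn (Set.powersetCard.ofFinEmbEquiv.symm
    (Set.powersetCard.prodEquiv.symm s).2))
  have h3 : ((List.ofFn (Set.powersetCard.ofFinEmbEquiv.symm
      (Set.powersetCard.prodEquiv.symm s).2)).map k).sum = ∑ j ∈ s, k j := by
    rw [List.map_ofFn, List.sum_ofFn]
    conv_rhs => rw [← Finset.map_orderEmbOfFin_univ s rfl, Finset.sum_map]
    rfl
  rw [h3, List.map_ofFn] at h2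
  have h4 : β.ExteriorAlgebra s = (List.ofFn ((fun j => CliffordAlgebra.ι 0 (β j)) ∘
      Set.powersetCard.ofFinEmbEquiv.symm (Set.powersetCard.prodEquiv.symm s).2)).prod :=
    (ExteriorAlgebra.basis_apply β s).trans (ExteriorAlgebra.ιMulti_apply _)
  rw [Module.Basis.map_apply, h4]
  exact h2

end AlgebraCharacters
/-! ### The graded dimensions of the spaces of free fields -/

section FreeCharacters

open VertexData

variable {h : Type u} [AddCommGroup h] [Module ℂ h] {B : LinearMap.BilinForm ℂ h} {d : ℕ}

/-- The basis of the space of creation modes given by the modes of a basis of `h`. -/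
def modesBasis (e : Basis (Fin d) ℂ h) : Basis (ℕ × Fin d) ℂ (CreationModes h) :=
  (Finsupp.basis fun _ : ℕ => e).reindex (Equiv.sigmaEquivProd ℕ (Fin d))

lemma modesBasis_apply (e : Basis (Fin d) ℂ h) (j : ℕ × Fin d) :
    modesBasis e j = Finsupp.single j.1 (e j.2) := by
  simp [modesBasis, Equiv.sigmaEquivProd]

lemma summable_pow_even (d : ℕ) {p : ℂ} (hp : ‖p‖ < 1) :
    Summable fun j : ℕ × Fin d => p ^ (2 * j.1 + 2) :=
  summable_pow_prod_fin (k := fun n => 2 * n + 2) (fun _ _ h => by simpa using h) d hp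

lemma summable_pow_odd (d : ℕ) {p : ℂ} (hp : ‖p‖ < 1) :
    Summable fun j : ℕ × Fin d => p ^ (2 * j.1 + 1) :=
  summable_pow_prod_fin (k := fun n => 2 * n + 1) (fun _ _ h => by simpa using h) d hp

lemma bosVOA_hasCharacter (hsymm : B.IsSymm) (e : Basis (Fin d) ℂ h)
    (he : IsOrthonormal B e) :
    HasCharacter ((bosVOA B e).L 0) 0 fun p => ∏' j : ℕ × Fin d, (1 - p ^ (2 * j.1 + 2))⁻¹ := by
  refine HasCharacter.symmetricAlgebra (modesBasis e) (fun j => 2 * j.1 + 2) (fun _ => by omega)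
    (fun p hp => summable_pow_even d hp) _ ?_ fun j u => ?_
  · rw [zero_smul]
    exact (bosVOA_isVertex hsymm e).creation _ _ (by norm_num)
  · have hm : ∀ u, bosMode B (e j.2) (-(j.1 + 1)) u =
        SymmetricAlgebra.ι ℂ _ (modesBasis e j) * u := fun u => by
      rw [bosMode, if_pos (by omega), modesBasis_apply,
        show (-(-((j.1 : ℤ) + 1)) - 1).toNat = j.1 by omega]
      rfl
    have h1 := bos_omega_commutator hsymm he (bosVOA_isFreeY hsymm e) (e j.2)
      (a := -(j.1 + 1)) (Int.modEq_one) 1 u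
    simp only [Nat.cast_one, add_sub_cancel_right, hm] at h1
    refine h1.trans ?_
    rw [sub_eq_neg_add, ← neg_smul]
    congr 2
    push_cast
    ring

lemma kappa_hasCharacter (hsymm : B.IsSymm) (e : Basis (Fin d) ℂ h)
    (he : IsOrthonormal B e) :
    HasCharacter ((bosVOA B e).twistedL0 2 (kappaY B)) (d / 16)
      fun p => ∏' j : ℕ × Fin d, (1 - p ^ (2 * j.1 + 1))⁻¹ := by
  refine HasCharacter.symmetricAlgebra (modesBasis e) (fun j => 2 * j.1 + 1) (fun _ => by omega)
    (fun p hp => summable_pow_odd d hp) _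
    (kappa_twistedL0_one hsymm he) fun j u => ?_
  have hm : ∀ u, kappaMode B (e j.2) (-(2 * j.1 + 1)) u =
      SymmetricAlgebra.ι ℂ _ (modesBasis e j) * u := fun u => by
    rw [kappaMode, if_neg (by rw [Int.not_even_iff]; omega), if_pos (by omega), modesBasis_apply,
      show ((-(-(2 * (j.1 : ℤ) + 1)) - 1) / 2).toNat = j.1 by omega]
    rfl
  have h1 := bos_omega_commutator hsymm he (kappaY_isFreeY hsymm e) (e j.2)
    (a := -(2 * j.1 + 1)) (by simp only [Int.ModEq]; omega) 2 u
  simp only [Nat.cast_two, add_sub_cancel_right, hm] at h1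
  refine h1.trans ?_
  rw [sub_eq_neg_add, ← neg_smul]
  congr 2
  push_cast
  ring

lemma ferVOSA_hasCharacter (hsymm : B.IsSymm) (e : Basis (Fin d) ℂ h)
    (he : IsOrthonormal B e) :
    HasCharacter ((ferVOSA B e).L 0) 0 fun p => ∏' j : ℕ × Fin d, (1 + p ^ (2 * j.1 + 1)) := by
  refine HasCharacter.cliffordAlgebra 0 CliffordAlgebra.changeForm.zero_proof (modesBasis e)
    (fun j => 2 * j.1 + 1) (fun _ _ _ => rfl)
    (fun p hp => summable_pow_odd d hp) _ ?_ fun j u => ?_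
  · rw [zero_smul]
    exact (ferVOSA_isVertex hsymm e).creation _ _ (by norm_num)
  · have hm : ∀ u, ferMode B (e j.2) (-(j.1 + 1)) u =
        CliffordAlgebra.ι _ (modesBasis e j) * u := fun u => by
      rw [ferMode, if_pos (by omega), modesBasis_apply,
        show (-(-((j.1 : ℤ) + 1)) - 1).toNat = j.1 by omega]
      rfl
    have h1 := fer_omega_commutator hsymm he (ferVOSA_isFreeY hsymm e) (e j.2)
      (a := -(j.1 + 1)) (N := 1) Int.modEq_one (by norm_num) u
    simp only [Nat.cast_one, add_sub_cancel_right, hm] at h1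
    refine h1.trans ?_
    rw [sub_eq_neg_add, ← neg_smul]
    congr 2
    push_cast
    ring

/-- The bilinear form on the modes of `M_σ` defining the Clifford relations. -/
def sigmaBilin (P : Polarization B d) : LinearMap.BilinForm ℂ (SigmaModes P) :=
  (1 / 2 : ℂ) • B.compl₁₂ ((P.aplus ⊔ P.e).subtype ∘ₗ LinearMap.snd ℂ _ _)
    ((P.aplus ⊔ P.e).subtype ∘ₗ LinearMap.snd ℂ _ _)

lemma sigmaBilin_toQuadraticMap (P : Polarization B d) :
    (sigmaBilin P).toQuadraticMap = sigmaForm P - 0 := by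
  ext x
  simp [sigmaBilin, sigmaForm]

lemma Polarization.finrank_zeroModes [Module.Finite ℂ h] (P : Polarization B d) :
    Module.finrank ℂ ↥(P.aplus ⊔ P.e) = d / 2 + d % 2 := by
  have h1 := Submodule.finrank_sup_add_finrank_inf_eq P.aplus P.e
  rw [P.disjoint.eq_bot, finrank_bot, add_zero, P.finrank_aplus, P.finrank_e] at h1
  exact h1

/-- The basis of the creation modes of `M_σ`, consisting of nonzero modes and of zero modes. -/
def sigmaBasis (e : Basis (Fin d) ℂ h) (P : Polarization B d) :
    Basis ((ℕ × Fin d) ⊕ Fin (d / 2 + d % 2)) ℂ (SigmaModes P) :=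
  have : Module.Finite ℂ h := Module.Finite.of_basis e
  (modesBasis e).prod (Module.finBasisOfFinrankEq ℂ _ P.finrank_zeroModes)

lemma sigma_hasCharacter (hsymm : B.IsSymm) (e : Basis (Fin d) ℂ h)
    (he : IsOrthonormal B e) (P : Polarization B d) :
    HasCharacter ((ferVOSA B e).twistedL0 2 (sigmaY P)) (d / 16)
      fun p => ∏' j : (ℕ × Fin d) ⊕ Fin (d / 2 + d % 2),
        (1 + p ^ Sum.elim (fun j => 2 * j.1 + 2) (fun _ => 0) j) := by
  refine HasCharacter.cliffordAlgebra (sigmaBilin P) (sigmaBilin_toQuadraticMap P) (sigmaBasis e P)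
    _ ?_ (fun p hp => ?_) _ (sigma_twistedL0_one hsymm P he) ?_
  · rintro (i | i) (j | j) hij
    · simp [sigmaBilin, sigmaBasis]
    · simp [sigmaBilin, sigmaBasis]
    · simp [sigmaBilin, sigmaBasis]
    · simp at hij
  · exact (HasSum.sum (α := ℕ × Fin d)
      (f := fun j => p ^ Sum.elim (fun j => 2 * j.1 + 2) (fun _ => 0) j)
      (summable_pow_even d hp).hasSum (hasSum_fintype _)).summable
  · have h1 := fun α N (hN : ¬ Even N) u =>
      fer_omega_commutator hsymm he (sigmaY_isFreeY hsymm P e) α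
      (a := N) (N := 2) (by rw [Int.not_even_iff] at hN; simpa [Int.ModEq]) (by norm_num) u
    simp only [Nat.cast_two, add_sub_cancel_right] at h1
    rintro (j | j) u
    · have hb : sigmaBasis e P (Sum.inl j) = (Finsupp.single j.1 (e j.2), 0) :=
        Prod.ext ((Module.Basis.prod_apply_inl_fst _ _ _).trans (modesBasis_apply e j))
          (Module.Basis.prod_apply_inl_snd _ _ _)
      have hm : ∀ u, sigmaMode P (e j.2) (-(2 * j.1 + 3)) u =
          CliffordAlgebra.ι _ (sigmaBasis e P (Sum.inl j)) * u := fun u => by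
        rw [sigmaMode, if_neg (by rw [Int.not_even_iff]; omega), if_pos (by omega), hb,
          show (-(-(2 * (j.1 : ℤ) + 3) + 1) / 2 - 1).toNat = j.1 by omega]
        rfl
      have h2 := h1 (e j.2) (-(2 * j.1 + 3)) (by rw [Int.not_even_iff]; omega) u
      simp only [hm] at h2
      refine h2.trans ?_
      rw [sub_eq_neg_add, ← neg_smul]
      congr 2
      push_cast
      simp only [Sum.elim_inl]
      push_cast
      ring
    · obtain ⟨α, hα⟩ : ∃ α : ↥(P.aplus ⊔ P.e), sigmaBasis e P (Sum.inr j) = (0, α) :=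
        ⟨_, Prod.ext (Module.Basis.prod_apply_inr_fst _ _ _) rfl⟩
      have hm : ∀ u, sigmaMode P α (-1) u = CliffordAlgebra.ι _ (sigmaBasis e P (Sum.inr j)) * u :=
        fun u => by
          rw [sigmaMode, if_neg (by decide), if_neg (by norm_num), if_pos rfl, hα,
            Submodule.projectionOnto_apply_left, Submodule.projectionOnto_apply_right]
          simp
      have h2 := h1 α (-1) (by decide) u
      simp only [hm] at h2
      refine h2.trans ?_
      simp
      rfl

end FreeCharacters
/-! ### Euler products and the eta function -/

section EtaQuotients

/-- Euler's product `∏_{n ≥ 1} (1 - p^n)`. -/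
def eulerProd (p : ℂ) : ℂ := ∏' n : ℕ, (1 - p ^ (n + 1))

variable {p : ℂ}

lemma multipliable_pow {k : ℕ → ℕ} (hk : Function.Injective k) (hp : ‖p‖ < 1) :
    Multipliable (fun n => 1 - p ^ k n) ∧ Multipliable (fun n => 1 + p ^ k n) := by
  have h1 : Summable fun n => p ^ k n :=
    (summable_geometric_of_norm_lt_one hp).comp_injective hk
  refine ⟨?_, multipliable_one_add_of_summable h1.norm⟩
  simp only [sub_eq_add_neg]
  exact multipliable_one_add_of_summable (by simpa only [norm_neg] using h1.norm)

lemma tprod_inv_prod_fin {k : ℕ → ℕ} (hk : Function.Injective k) (hk0 : ∀ n, 0 < k n)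
    (hp : ‖p‖ < 1) (d : ℕ) : ∏' n, (1 - p ^ k n) ≠ 0 ∧
      ∏' j : ℕ × Fin d, (1 - p ^ k j.1)⁻¹ = ((∏' n, (1 - p ^ k n))⁻¹) ^ d := by
  have h1 : Summable fun n => p ^ k n :=
    (summable_geometric_of_norm_lt_one hp).comp_injective hk
  have h2 := (hasSum_pow_weight hk0 hp h1).2
  have hne : ∀ n, 1 - p ^ k n ≠ 0 := fun n h => by
    have h3 : ‖p ^ k n‖ = 1 := by rw [← sub_eq_zero.mp h, norm_one]
    rw [norm_pow] at h3
    exact (pow_lt_one₀ (norm_nonneg _) hp (hk0 n).ne').ne h3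
  have h3 : (∏' n, (1 - p ^ k n)⁻¹) * ∏' n, (1 - p ^ k n) = 1 := by
    rw [← h2.tprod_mul (multipliable_pow hk hp).1]
    simp [hne]
  refine ⟨right_ne_zero_of_mul_eq_one h3, ?_⟩
  rw [tprod_prod_fin (f := fun n => (1 - p ^ k n)⁻¹)
    (hasSum_pow_weight (k := fun j : ℕ × Fin d => k j.1) (fun j => hk0 j.1) hp
      (summable_pow_prod_fin hk d hp)).2 h2, eq_inv_of_mul_eq_one_left h3]

lemma tprod_one_add_prod_fin {k : ℕ → ℕ} (hk : Function.Injective k) (hp : ‖p‖ < 1) (d : ℕ) :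
    ∏' j : ℕ × Fin d, (1 + p ^ k j.1) = (∏' n, (1 + p ^ k n)) ^ d :=
  tprod_prod_fin (f := fun n => 1 + p ^ k n)
    (hasSum_pow_sum (k := fun j : ℕ × Fin d => k j.1) (summable_pow_prod_fin hk d hp)).2
    (multipliable_pow hk hp).2

lemma injective_odd : Function.Injective fun n : ℕ => 2 * n + 1 := fun _ _ h => by simpa using h

lemma injective_even : Function.Injective fun n : ℕ => 2 * n + 2 := fun _ _ h => by simpa using h

lemma injective_succ : Function.Injective fun n : ℕ => n + 1 := fun _ _ h => by simpa using h

lemma eulerProd_ne_zero (hp : ‖p‖ < 1) : eulerProd p ≠ 0 :=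
  (tprod_inv_prod_fin injective_succ (fun _ => Nat.succ_pos _) hp 0).1

lemma tprod_one_sub_even : ∏' n : ℕ, (1 - p ^ (2 * n + 2)) = eulerProd (p ^ 2) := by
  simp only [eulerProd, ← pow_mul, mul_add, mul_one]

lemma eulerProd_sq_ne_zero (hp : ‖p‖ < 1) : eulerProd (p ^ 2) ≠ 0 := by
  refine eulerProd_ne_zero ?_
  rw [norm_pow]
  exact pow_lt_one₀ (norm_nonneg _) hp two_ne_zero

lemma tprod_one_sub_odd (hp : ‖p‖ < 1) :
    (∏' n : ℕ, (1 - p ^ (2 * n + 1))) * eulerProd (p ^ 2) = eulerProd p := by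
  rw [← tprod_one_sub_even, eulerProd]
  exact tprod_even_mul_odd (f := fun n => 1 - p ^ (n + 1)) (multipliable_pow injective_odd hp).1
    (multipliable_pow injective_even hp).1

lemma tprod_one_add_odd_mul_even (hp : ‖p‖ < 1) :
    (∏' n : ℕ, (1 + p ^ (2 * n + 1))) * (∏' n : ℕ, (1 + p ^ (2 * n + 2))) =
      eulerProd (p ^ 2) / eulerProd p := by
  rw [eq_div_iff (eulerProd_ne_zero hp)]
  have h1 : (∏' n : ℕ, (1 + p ^ (2 * n + 1))) * (∏' n : ℕ, (1 + p ^ (2 * n + 2))) =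
      ∏' n : ℕ, (1 + p ^ (n + 1)) :=
    tprod_even_mul_odd (f := fun n => 1 + p ^ (n + 1)) (multipliable_pow injective_odd hp).2
      (multipliable_pow injective_even hp).2
  rw [h1, eulerProd, eulerProd, ← (multipliable_pow injective_succ hp).2.tprod_mul
    (multipliable_pow injective_succ hp).1]
  refine tprod_congr fun n => ?_
  ring

lemma tprod_sum_prod_fin (hp : ‖p‖ < 1) (d r : ℕ) :
    ∏' j : (ℕ × Fin d) ⊕ Fin r, (1 + p ^ Sum.elim (fun j => 2 * j.1 + 2) (fun _ => 0) j) =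
      (∏' n : ℕ, (1 + p ^ (2 * n + 2))) ^ d * 2 ^ r := by
  have h1 : Multipliable fun j : ℕ × Fin d => 1 + p ^ (2 * j.1 + 2) :=
    (hasSum_pow_sum (summable_pow_even d hp)).2
  rw [← tprod_one_add_prod_fin injective_even hp d]
  refine (h1.tprod_sum (f := fun j :
    (ℕ × Fin d) ⊕ Fin r => 1 + p ^ Sum.elim (fun j => 2 * j.1 + 2) (fun _ => 0) j)
    (hasProd_fintype _).multipliable).trans ?_
  congr 1
  simp
  norm_num

lemma eta_eq_eulerProd (z : ℂ) : ModularForm.eta z =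
    Complex.exp (2 * Real.pi * Complex.I * z / 24) *
    eulerProd (Complex.exp (Real.pi * Complex.I * z) ^ 2) := by
  rw [ModularForm.eta, eulerProd, Function.Periodic.qParam]
  simp only [ModularForm.eta_q_eq_pow]
  rw [← Complex.exp_nat_mul]
  push_cast
  congr 7
  ring_nf

lemma eta_half_eq_eulerProd (z : ℂ) : ModularForm.eta (z / 2) =
    Complex.exp (2 * Real.pi * Complex.I * z / 48) * eulerProd
      (Complex.exp (Real.pi * Complex.I * z)) := by
  have h1 : Complex.exp (Real.pi * Complex.I * (z / 2)) ^ 2 =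
      Complex.exp (Real.pi * Complex.I * z) := by
    rw [← Complex.exp_nat_mul]
    congr 1
    push_cast
    ring
  rw [eta_eq_eulerProd, h1]
  congr 2
  ring

lemma Cd_mul_sqrt_two_pow (d : ℕ) : Cd d * (Real.sqrt 2 : ℂ) ^ d = 2 ^ (d / 2 + d % 2) := by
  have h2 : ((Real.sqrt 2 : ℝ) : ℂ) ^ 2 = 2 := by
    rw [← Complex.ofReal_pow, Real.sq_sqrt (by norm_num)]
    norm_num
  rw [Cd]
  split_ifs with hd
  · obtain ⟨m, rfl⟩ := hd
    rw [show (m + m) / 2 + (m + m) % 2 = m by omega, ← two_mul, pow_mul, h2, one_mul]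
  · obtain ⟨m, rfl⟩ := Nat.not_even_iff_odd.mp hd
    rw [show (2 * m + 1) / 2 + (2 * m + 1) % 2 = m + 1 by omega, ← pow_succ', add_assoc,
      show 1 + 1 = 2 from rfl, show 2 * m + 2 = 2 * (m + 1) by ring, pow_mul, h2]

end EtaQuotients
/-! ### The vertex operator superalgebras and twisted modules of the theorem -/

section QDimensions

open VertexData

variable {h : Type u} [AddCommGroup h] [Module ℂ h] {B : LinearMap.BilinForm ℂ h} {d : ℕ}

lemma kappa_hasQDim (hsymm : B.IsSymm) (e : Basis (Fin d) ℂ h)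
    (he : IsOrthonormal B e) :
    (bosVOA B e).HasQDim d 2 (kappaY B)
      (fun z => (ModularForm.eta z / ModularForm.eta (z / 2)) ^ d) := by
  intro z hz
  have h1 := (kappa_hasCharacter hsymm e he).hasSum_finrank (d / 24) hz
  convert h1 using 1
  beta_reduce
  set p := Complex.exp (Real.pi * Complex.I * z) with hp_def
  have hp : ‖p‖ < 1 := HasCharacter.norm_exp_lt_one hz
  have h2 := tprod_one_sub_odd hp
  have h3 := eulerProd_ne_zero hp
  have h4 : ∏' n : ℕ, (1 - p ^ (2 * n + 1)) ≠ 0 := fun h0 => h3 (by rw [← h2, h0, zero_mul])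
  rw [(tprod_inv_prod_fin injective_odd (fun _ => Nat.succ_pos _) hp d).2, eta_eq_eulerProd,
    eta_half_eq_eulerProd, ← hp_def, ← h2]
  have h5 : Complex.exp (2 * Real.pi * Complex.I * z * (d / 16 - d / 24)) =
      Complex.exp (2 * Real.pi * Complex.I * z / 48) ^ d := by
    rw [← Complex.exp_nat_mul]
    congr 1
    ring
  have h6 : Complex.exp (2 * Real.pi * Complex.I * z / 24) =
      Complex.exp (2 * Real.pi * Complex.I * z / 48) ^ 2 := by
    rw [← Complex.exp_nat_mul]
    congr 1
    push_cast
    ring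
  have h7 := eulerProd_sq_ne_zero hp
  have h8 := Complex.exp_ne_zero (2 * Real.pi * Complex.I * z / 48)
  rw [h5, h6, ← mul_pow]
  congr 1
  field_simp

lemma freeVOSA_hasCharacter (hsymm : B.IsSymm) (e : Basis (Fin d) ℂ h)
    (he : IsOrthonormal B e) :
    HasCharacter ((freeVOSA B e).L 0) (0 + 0) fun p =>
      (∏' j : ℕ × Fin d, (1 - p ^ (2 * j.1 + 2))⁻¹) * ∏' j : ℕ × Fin d, (1 + p ^ (2 * j.1 + 1)) :=
        by
  rw [show (freeVOSA B e).L 0 = _ from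
    md_tensor_omega (bosVOA_isConformal hsymm he) (ferVOSA_isConformal hsymm he) _]
  exact (bosVOA_hasCharacter hsymm e he).tensor (ferVOSA_hasCharacter hsymm e he)

lemma freeN2VOSA_isVOSA (hsymm : B.IsSymm) (e : Basis (Fin d) ℂ h)
    (he : IsOrthonormal B e) : (freeN2VOSA B e).IsVOSA (3 * d) := by
  have h1 := (freeVOSA_hasCharacter hsymm e he).tensor (freeVOSA_hasCharacter hsymm e he)
  have h2 : (freeN2VOSA B e).L 0 = _ :=
    md_tensor_omega (freeVOSA_isConformal hsymm he) (freeVOSA_isConformal hsymm he) _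
  rw [show (0 + 0 + (0 + 0) : ℂ) = 0 by norm_num] at h1
  have h3 := h2 ▸ h1
  exact h3.isVOSA (freeN2VOSA_isConformal hsymm he)

lemma mirror_hasCharacter (hsymm : B.IsSymm) (e : Basis (Fin d) ℂ h)
    (he : IsOrthonormal B e) (P : Polarization B d) :
    ∃ F, HasCharacter ((freeN2VOSA B e).twistedL0 2 (mirrorY P e)) (d / 8) F ∧
      ∀ p, ‖p‖ < 1 → F p = 2 ^ (d / 2 + d % 2) * (eulerProd (p ^ 2) / eulerProd p ^ 2) ^ d := by
  have h1 := (freeVOSA_hasCharacter hsymm e he).tensor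
    ((kappa_hasCharacter hsymm e he).tensor (sigma_hasCharacter hsymm e he P))
  rw [← mirrorY_twistedL0 hsymm P he, show (0 + 0 + (d / 16 + d / 16) : ℂ) = d / 8 by ring] at h1
  refine ⟨_, h1, fun p hp => ?_⟩
  have h2 := tprod_one_sub_odd hp
  have h3 := eulerProd_ne_zero hp
  have h4 : ∏' n : ℕ, (1 - p ^ (2 * n + 1)) ≠ 0 := fun h0 => h3 (by rw [← h2, h0, zero_mul])
  have h5 := eulerProd_sq_ne_zero hp
  have h6 := tprod_one_add_odd_mul_even hp
  rw [tprod_sum_prod_fin hp, tprod_one_add_prod_fin injective_odd hp,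
    (tprod_inv_prod_fin injective_odd (fun _ => Nat.succ_pos _) hp d).2,
    (tprod_inv_prod_fin injective_even (fun _ => Nat.succ_pos _) hp d).2, tprod_one_sub_even]
  have h7 : eulerProd (p ^ 2) / eulerProd p ^ 2 = (eulerProd (p ^ 2))⁻¹ *
      (∏' n : ℕ, (1 + p ^ (2 * n + 1))) * (∏' n : ℕ, (1 - p ^ (2 * n + 1)))⁻¹ *
      ∏' n : ℕ, (1 + p ^ (2 * n + 2)) := by
    calc _ = (eulerProd p)⁻¹ * (eulerProd (p ^ 2) / eulerProd p) := by field_simp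
      _ = _ := by
        rw [← h6, ← h2, mul_inv]
        ring
  rw [h7]
  simp only [mul_pow]
  ring

lemma mirror_hasQDim (hsymm : B.IsSymm) (e : Basis (Fin d) ℂ h)
    (he : IsOrthonormal B e) (P : Polarization B d) :
    (freeN2VOSA B e).HasQDim (3 * d) 2 (mirrorY P e)
      (fun z => Cd d * (Real.sqrt 2 : ℂ) ^ d *
        (ModularForm.eta z / ModularForm.eta (z / 2) ^ 2) ^ d) := by
  intro z hz
  obtain ⟨F, hF, hF'⟩ := mirror_hasCharacter hsymm e he P
  convert hF.hasSum_finrank (3 * d / 24) hz using 1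
  beta_reduce
  have hp := HasCharacter.norm_exp_lt_one hz
  rw [hF' _ hp, show (d / 8 - 3 * d / 24 : ℂ) = 0 by ring, mul_zero, Complex.exp_zero, one_mul,
    Cd_mul_sqrt_two_pow, eta_eq_eulerProd, eta_half_eq_eulerProd]
  have h6 : Complex.exp (2 * Real.pi * Complex.I * z / 24) =
      Complex.exp (2 * Real.pi * Complex.I * z / 48) ^ 2 := by
    rw [← Complex.exp_nat_mul]
    congr 1
    push_cast
    ring
  have h8 := Complex.exp_ne_zero (2 * Real.pi * Complex.I * z / 48)
  have h3 := eulerProd_ne_zero hp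
  rw [h6, mul_pow (Complex.exp (2 * Real.pi * Complex.I * z / 48)),
    mul_div_mul_left _ _ (pow_ne_zero 2 h8)]

end QDimensions

theorem mainTheorem4 {h : Type*} [AddCommGroup h] [Module ℂ h] (B : LinearMap.BilinForm ℂ h)
    (hsymm : B.IsSymm) (hnondeg : B.Nondegenerate) {d : ℕ} (e : Basis (Fin d) ℂ h)
    (he : ∀ i j, B (e i) (e j) = if i = j then 1 else 0) (P : Polarization B d) :
    -- the recursions defining the four families of vertex operators have unique solutions
    (∃! Y, IsBosY B Y) ∧ (∃! Y, IsFerY B Y) ∧ (∃! Y, IsKappaY B Y) ∧ (∃! Y, IsSigmaY P Y) ∧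
    -- `M_κ` is an ordinary `κ`-twisted module for `V_bos`
    (bosVOA B e).IsVOSA d ∧
    (bosVOA B e).IsAutomorphism (kappaBos h) ∧ kappaBos h ^ 2 = 1 ∧
    (bosVOA B e).IsOrdinaryTwistedModule (kappaBos h) 2 (-1) (kappaY B) ∧
    (bosVOA B e).HasQDim d 2 (kappaY B)
      (fun z => (ModularForm.eta z / ModularForm.eta (z / 2)) ^ d) ∧
    -- `V ⊗ V` is an N=2 VOSA with mirror map `κ`
    (freeN2VOSA B e).IsN2VOSA (3 * d) (tauN2 e) (muN2 e) ∧
    (freeN2VOSA B e).IsAutomorphism (mirrorMap h) ∧ mirrorMap h ^ 2 = 1 ∧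
    mirrorMap h (muN2 e) = -muN2 e ∧
    mirrorMap h (tauN2 e 0) = tauN2 e 0 ∧ mirrorMap h (tauN2 e 1) = -tauN2 e 1 ∧
    -- `V ⊗ M_κ ⊗ M_σ` is an ordinary `κ`-twisted module for `V ⊗ V`
    (freeN2VOSA B e).IsOrdinaryTwistedModule (mirrorMap h) 2 (-1) (mirrorY P e) ∧
    (freeN2VOSA B e).HasQDim (3 * d) 2 (mirrorY P e)
      (fun z => Cd d * (Real.sqrt 2 : ℂ) ^ d *
        (ModularForm.eta z / ModularForm.eta (z / 2) ^ 2) ^ d) := by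
  obtain ⟨F, hF, -⟩ := mirror_hasCharacter hsymm e he P
  refine ⟨(bosMode_freeModel hsymm).existsUnique_isIterated (bosMode_freeField hsymm),
    (ferMode_freeModel hsymm).existsUnique_isIterated (ferMode_freeField hsymm),
    (bosMode_freeModel hsymm).existsUnique_isIterated (kappaMode_freeField hsymm),
    (ferMode_freeModel hsymm).existsUnique_isIterated (sigmaMode_freeField P hsymm),
    (bosVOA_hasCharacter hsymm e he).isVOSA (bosVOA_isConformal hsymm he),
    kappaBos_isAutomorphism hsymm, LinearMap.ext kappaBos_kappaBos,
    (kappa_hasCharacter hsymm e he).isOrdinaryTwistedModule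
      (kappaY_isTwistedSystem hsymm).isWeakTwistedModule,
    kappa_hasQDim hsymm e he, ?_, mirrorMap_isAutomorphism hsymm he, mirrorMap_sq,
    mirrorMap_muN2 e, (mirrorMap_tauN2 e).1, (mirrorMap_tauN2 e).2,
    hF.isOrdinaryTwistedModule (mirrorY_isTwistedSystem hsymm P he).isWeakTwistedModule,
    mirror_hasQDim hsymm e he P⟩
  rw [funext (tauN2_eq (B := B) (e := e)), muN2_eq (B := B)]
  exact VertexData.IsFreePair.isN2VOSA (freeN2VOSA_isVOSA hsymm e he)
    (freeN2VOSA_isConformal hsymm he)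
    (pair_isFreePair hsymm he) freeN2VOSA_omega

end
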